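/- Let $N\ge 2$, let all subscripts be taken modulo $N$, and let $h\in\mathbb R$. Let $\mathcal E=\lambda\sum_{k=1}^N E_{k+1,k}$, and let $g$ be the twisted loop algebra of all formal series $L=\sum_{p\le P}\ell^{(p)}\mathcal E^{p}$ ($P\in\mathbb Z$, $\ell^{(p)}$ real diagonal $N\times N$ matrices), i.e. matrices of formal Laurent series in $\lambda^{-1}$ with $\Omega L(\lambda)\Omega^{-1}=L(\omega\lambda)$, $\omega=e^{2\pi i/N}$, $\Omega=\mathrm{diag}(1,\omega,\dots,\omega^{N-1})$, with the scalar product $\langle L,M\rangle=(\mathrm{tr}\,LM)_0$ (free term in $\lambda$). Let $\pi_\pm$ be the projections onto $\{p\ge 0\}$ and $\{p<0\}$, $P_0$ the free term, $R=\pi_+-\pi_-$, $R_0=R-P_0$ (the skew part of $R$), $W(E_{jj})=\sum_{k<j}E_{kk}-\sum_{k>j}E_{kk}$, $W=W\circ P_0$, and $$A_1=R_0+W,\quad A_2=R_0-W,\quad S=P_0-W,\quad S^*=P_0+W .$$ A function $\varphi$ on $g^m=g\otimes\dots\otimes g$ (direct product of $m$ copies, with the sum scalar product) is smooth with gradient $\nabla\varphi\in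 g^m$ if for each family $\gamma$ in $g^m$ over a finite-dimensional space with smooth coefficients and locally bounded degree, $\varphi\circ\gamma$ is smooth, $\nabla\varphi\circ\gamma$ is again such a family, and $\partial_w(\varphi\circ\gamma)=\langle\nabla\varphi\circ\gamma,\partial_w\gamma\rangle$. For operators on $g^m$ the bracket $PB_2(A_1,A_2,S)$ is, with $d\varphi=L\nabla\varphi$ and $d'\varphi=\nabla\varphi\,L$, $$\{\varphi,\psi\}_2=\tfrac12\langle A_1 d'\varphi,d'\psi\rangle-\tfrac12\langle A_2 d\varphi,d\psi\rangle+\tfrac12\langle S\,d\varphi,d'\psi\rangle-\tfrac12\langle S^*d'\varphi,d\psi\rangle .$$ Let ${\bf A}_1,{\bf A}_2,{\bf S}$ be the operators on $g\otimes g\otimes g$ $$\begin{pmatrix}A_1&-S&-S\\S^*&A_1&S^*\\S^*&-S&A_1\end{pmatrix},\quad\begin{pmatrix}A_2&-S^*&-S^*\\S&A_2&-S^*\\S&S&A_2\end{pmatrix},\quad\begin{pmatrix}S&S&S\\S&-S^*&-S^*\\S&S&-S^*\end{pmatrix}.$$ On $\mathcal V=\mathbb R^{2N}(u_1,v_1,\dots,u_N,v_N)$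 consider the bracket whose nonvanishing brackets of coordinates are $\{u_k,v_k\}=-u_kv_k$, $\{v_k,u_{k+1}\}=-v_ku_{k+1}$, and put $U=\mathcal E+\mathrm{diag}(u_k)$, $V=I+\mathrm{diag}(v_k)\mathcal E^{-1}$, $C=I-h\,\mathrm{diag}(u_kv_k)\mathcal E^{-1}$ (invertible in $g$). 1. The bracket on $\mathcal V$, $PB_2({\bf A}_1,{\bf A}_2,{\bf S})$ on $g\otimes g\otimes g$ and $PB_2(A_1,A_2,S)$ on $g$ are Poisson brackets on smooth functions. The map $(U,C^{-1},V):\mathcal V\to g\otimes g\otimes g$ is Poisson for the first two, and the maps $L_-=UVC^{-1}$, $VC^{-1}U$, $C^{-1}UV:\mathcal V\to g$ are Poisson for the first and the third. 2. For every conjugation-covariant $f:g\to g$ the Lax triads $$\dot U=\pm U\pi_\pm(f(VC^{-1}U))\mp\pi_\pm(f(UVC^{-1}))U,$$ $$\dot C=\pm C\pi_\pm(f(C^{-1}UV))\mp\pi_\pm(f(UVC^{-1}))C,$$ $$\dot V=\pm V\pi_\pm(f(C^{-1}UV))\mp\pi_\pm(f(VC^{-1}U))V$$ with the upper signs and with the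 lower signs are each equivalent to the equations of motion of one and the same vector field on $\mathcal V$, and they imply $\dot L_-=[L_-,\pm\pi_\pm(f(L_-))]$. If $\varphi$ is a smooth conjugation-invariant function on $g$, then $f=d\varphi$ is conjugation-covariant and the triads with this $f$ are equivalent to the Hamiltonian equations $\dot x=\{H,x\}$ on $\mathcal V$ with $H=\varphi(UVC^{-1})$. 3. For $f(L)=L$ the flow is the relativistic Volterra lattice $$\dot u_k=u_k(v_k-v_{k-1}+hu_kv_k-hu_{k-1}v_{k-1}),\qquad\dot v_k=v_k(u_{k+1}-u_k+hu_{k+1}v_{k+1}-hu_kv_k),$$ and $\pi_+(UVC^{-1})$, $\pi_+(C^{-1}UV)$, $\pi_+(VC^{-1}U)$ are equal to $\mathcal E+\mathrm{diag}(\cdot)$ with diagonal entries $u_k+v_{k-1}+hu_{k-1}v_{k-1}$, $u_k+v_{k-1}+hu_kv_k$, $u_k+v_k+hu_kv_k$, respectively. 4. The equations $\tilde u_k(1+hv_{k-1})=u_k(1+hv_k)$, $\tilde v_k(1+h\tilde u_k)=v_k(1+h\tilde u_{k+1})$ define a smooth map $(u,v)\mapsto(\tilde u,\tilde v)$ on the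 open set where all $1+hv_k\neq0$ and all $1+h\tilde u_k\ne0$, and this map is Poisson for the bracket on $\mathcal V$. It belongs to the hierarchy with $f(L)=h^{-1}\log(I+hL)$: for every $r>0$ there is $h_0>0$ such that for $0<|h|<h_0$ the power series $\log(I+hL)=\sum_{n\ge0}\frac{(-1)^n}{n+1}(hL)^{n+1}$ converges coefficientwise (absolutely) at $L=UVC^{-1},C^{-1}UV,VC^{-1}U$ whenever all $|u_k|,|v_k|\le 2r$, and for every $(u,v)$ with all $|u_k|,|v_k|\le r$ the above map is defined at $(u,v)$, and the Lax triads with this $f$ (both choices of signs, coefficientwise, as identities between doubly infinite series in $\lambda$) have a solution on the time interval between $0$ and $h$ that starts at $(u,v)$ at time $0$ and stays in $\{|u_k|,|v_k|\le2r\}$; every such solution has the value $(\tilde u,\tilde v)$ at time $h$. -/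

import Mathlib

open scoped ContDiff Topology

noncomputable section

/-! ## The twisted loop algebra

Elements are `N × N` matrices whose entries are formal Laurent series in `λ⁻¹` (finitely many
positive powers of `λ`).  The Hahn series variable of `HahnSeries ℤ ℝ` is `λ⁻¹`, so the coefficient of `λ ^ p`
is the Laurent coefficient with index `-p`.  The indices `1, …, N` are the elements of `Fin N`,
and index arithmetic is modulo `N`. -/

/-- Only the entries `(j, k)` with `j - k ≡ p (mod N)` may carry the power `λ ^ p`; this is the
condition `Ω L(λ) Ω⁻¹ = L(ω λ)`, `Ω = diag(1, ω, …, ω ^ (N-1))`, `ω = exp (2 π i / N)`. -/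
def IsTwisted {N : ℕ} (M : Matrix (Fin N) (Fin N) (HahnSeries ℤ ℝ)) : Prop :=
  ∀ (j k : Fin N) (p : ℤ), (M j k).coeff (-p) ≠ 0 →
    ((j : ℕ) : ℤ) - ((k : ℕ) : ℤ) ≡ p [ZMOD (N : ℤ)]

/-- The twisted loop algebra, as a subring of the matrix ring. -/
def twistedLoop (N : ℕ) : Subring (Matrix (Fin N) (Fin N) (HahnSeries ℤ ℝ)) where
  carrier := {M | IsTwisted M}
  mul_mem' := by
    intro A B hA hB j k p hp
    rw [Matrix.mul_apply, HahnSeries.coeff_sum] at hp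
    obtain ⟨i, -, hi⟩ := Finset.exists_ne_zero_of_sum_ne_zero hp
    rw [HahnSeries.coeff_mul] at hi
    obtain ⟨ab, hab, hne⟩ := Finset.exists_ne_zero_of_sum_ne_zero hi
    have hsum : ab.1 + ab.2 = -p := (Finset.mem_antidiagonal.1 hab).2.2
    have h1 := hA j i (-ab.1) (by rw [neg_neg]; exact left_ne_zero_of_mul hne)
    have h2 := hB i k (-ab.2) (by rw [neg_neg]; exact right_ne_zero_of_mul hne)
    have h3 := h1.add h2
    have e1 : ((j : ℕ) : ℤ) - ((i : ℕ) : ℤ) + (((i : ℕ) : ℤ) - ((k : ℕ) : ℤ))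
        = ((j : ℕ) : ℤ) - ((k : ℕ) : ℤ) := by ring
    have e2 : -ab.1 + -ab.2 = p := by linarith
    rwa [e1, e2] at h3
  one_mem' := by
    intro j k p hp
    by_cases hjk : j = k
    · subst hjk
      rw [Matrix.one_apply_eq] at hp
      have hp0 : -p = 0 := by
        by_contra h
        exact hp (HahnSeries.coeff_single_of_ne h)
      have : p = 0 := by linarith
      subst this
      simp [Int.ModEq]
    · rw [Matrix.one_apply_ne hjk] at hp
      exact absurd HahnSeries.coeff_zero hp
  add_mem' := by
    intro A B hA hB j k p hp
    rw [Matrix.add_apply, HahnSeries.coeff_add] at hp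
    by_cases h : (A j k).coeff (-p) = 0
    · exact hB j k p (fun h' => hp (by rw [h, h', add_zero]))
    · exact hA j k p h
  zero_mem' := by
    intro j k p hp
    exact absurd HahnSeries.coeff_zero hp
  neg_mem' := by
    intro A hA j k p hp
    rw [Matrix.neg_apply, HahnSeries.coeff_neg] at hp
    exact hA j k p (fun h => hp (by rw [h, neg_zero]))

/-- The algebra `g`. -/
def Loop (N : ℕ) : Type := twistedLoop N

instance (N : ℕ) : Ring (Loop N) := inferInstanceAs (Ring (twistedLoop N))

/-- The matrix of Laurent series underlying an element of `g`. -/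
def Loop.mat {N : ℕ} (L : Loop N) : Matrix (Fin N) (Fin N) (HahnSeries ℤ ℝ) :=
  Subtype.val (p := fun M => M ∈ twistedLoop N) L

/-- Build an element of `g` from a twisted matrix. -/
def Loop.mk {N : ℕ} (M : Matrix (Fin N) (Fin N) (HahnSeries ℤ ℝ)) (hM : IsTwisted M) : Loop N :=
  Subtype.mk (p := fun M => M ∈ twistedLoop N) M hM

theorem Loop.ext_coeff {N : ℕ} {L M : Loop N}
    (H : ∀ j k p, (L.mat j k).coeff p = (M.mat j k).coeff p) : L = M := by
  apply Subtype.ext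
  funext j k
  ext p
  exact H j k p

theorem Loop.isTwisted {N : ℕ} (L : Loop N) : IsTwisted L.mat :=
  Subtype.property (p := fun M => M ∈ twistedLoop N) L

theorem Loop.coeff_add {N : ℕ} (L M : Loop N) (j k : Fin N) (p : ℤ) :
    ((L + M).mat j k).coeff p = (L.mat j k).coeff p + (M.mat j k).coeff p := rfl

/-- Multiplication of an element of `g` by a real number. -/
instance (N : ℕ) : SMul ℝ (Loop N) where
  smul r L := Loop.mk (fun j k => r • L.mat j k) (by
    intro j k p hp
    rw [HahnSeries.coeff_smul] at hp
    exact L.isTwisted j k p (fun h => hp (by rw [h, smul_zero])))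

theorem Loop.coeff_smul {N : ℕ} (r : ℝ) (L : Loop N) (j k : Fin N) (p : ℤ) :
    ((r • L).mat j k).coeff p = r * (L.mat j k).coeff p := rfl

instance (N : ℕ) : Module ℝ (Loop N) where
  one_smul L := Loop.ext_coeff fun j k p => by rw [Loop.coeff_smul, one_mul]
  mul_smul r s L := Loop.ext_coeff fun j k p => by simp only [Loop.coeff_smul, mul_assoc]
  smul_zero r := Loop.ext_coeff fun j k p => mul_zero r
  smul_add r L M := Loop.ext_coeff fun j k p => by
    simp only [Loop.coeff_smul, Loop.coeff_add, mul_add]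
  add_smul r s L := Loop.ext_coeff fun j k p => by
    simp only [Loop.coeff_smul, Loop.coeff_add, add_mul]
  zero_smul L := Loop.ext_coeff fun j k p => zero_mul _

/-- `coefMat p L` is the matrix coefficient of `λ ^ p` in `L`. -/
def coefMat {N : ℕ} (p : ℤ) (L : Loop N) : Matrix (Fin N) (Fin N) ℝ :=
  fun j k => (L.mat j k).coeff (-p)

/-- `diagShift p d = diag(d) ℰ ^ p`, where `ℰ = λ ∑ E_{k+1,k}`: the entry `(j, k)` is `d_j λ ^ p`
if `j - k ≡ p (mod N)` and `0` otherwise. -/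
def diagShift {N : ℕ} (p : ℤ) (d : Fin N → ℝ) : Loop N :=
  Loop.mk (fun j k => HahnSeries.single (-p)
    (if ((j : ℕ) : ℤ) - ((k : ℕ) : ℤ) ≡ p [ZMOD (N : ℤ)] then d j else 0)) (by
    intro j k q hq
    have hqp : -q = -p := by
      by_contra h
      exact hq (HahnSeries.coeff_single_of_ne h)
    have hq' : q = p := by linarith
    subst hq'
    rw [HahnSeries.coeff_single_same] at hq
    by_contra h
    exact hq (if_neg h))

theorem coeff_diagShift {N : ℕ} (p : ℤ) (d : Fin N → ℝ) (j k : Fin N) (q : ℤ) :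
    ((diagShift p d).mat j k).coeff q = if q = -p then
      (if ((j : ℕ) : ℤ) - ((k : ℕ) : ℤ) ≡ p [ZMOD (N : ℤ)] then d j else 0) else 0 := by
  change (HahnSeries.single (-p) _).coeff q = _
  by_cases h : q = -p
  · rw [if_pos h, h, HahnSeries.coeff_single_same]
  · rw [if_neg h, HahnSeries.coeff_single_of_ne h]

/-- The scalar product `⟨L, M⟩ = tr (L M)_0` on `g`. -/
def loopPair {N : ℕ} (L M : Loop N) : ℝ := (Matrix.trace (L * M).mat).coeff 0

/-- The scalar product on the direct product `g ^ m`. -/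
def bigPair {N m : ℕ} (L M : Fin m → Loop N) : ℝ := ∑ i, loopPair (L i) (M i)

/-- Keep only the nonnegative powers of `λ`. -/
def truncPlus {N : ℕ} (L : Loop N) : Loop N :=
  Loop.mk (fun j k => HahnSeries.truncLT 1 (L.mat j k)) (by
    intro j k p hp
    rw [HahnSeries.coeff_truncLT] at hp
    exact L.isTwisted j k p (fun h => hp (by rw [h, ite_self])))

theorem coeff_truncPlus {N : ℕ} (L : Loop N) (j k : Fin N) (p : ℤ) :
    ((truncPlus L).mat j k).coeff p = if p < 1 then (L.mat j k).coeff p else 0 := rfl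

/-- The projection `π₊` onto nonnegative powers of `ℰ` (equivalently of `λ`). -/
def piPlus (N : ℕ) : Module.End ℝ (Loop N) where
  toFun L := truncPlus L
  map_add' L M := Loop.ext_coeff fun j k p => by
    rw [Loop.coeff_add, coeff_truncPlus, coeff_truncPlus, coeff_truncPlus, Loop.coeff_add]
    split_ifs <;> simp
  map_smul' r L := Loop.ext_coeff fun j k p => by
    rw [RingHom.id_apply, Loop.coeff_smul, coeff_truncPlus, coeff_truncPlus, Loop.coeff_smul]
    split_ifs <;> simp

/-- The projection `π₋` onto negative powers of `ℰ`. -/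
def piMinus (N : ℕ) : Module.End ℝ (Loop N) := 1 - piPlus N

/-- `diag(d) ↦ diag(d) ℰ ^ 0` as a linear map. -/
def diagLin (N : ℕ) : (Fin N → ℝ) →ₗ[ℝ] Loop N where
  toFun d := diagShift 0 d
  map_add' d e := Loop.ext_coeff fun j k p => by
    rw [Loop.coeff_add]
    rw [coeff_diagShift, coeff_diagShift, coeff_diagShift, Pi.add_apply]
    split_ifs <;> simp
  map_smul' r d := Loop.ext_coeff fun j k p => by
    rw [RingHom.id_apply, Loop.coeff_smul]
    rw [coeff_diagShift, coeff_diagShift, Pi.smul_apply, smul_eq_mul]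
    split_ifs <;> simp

/-- The diagonal of the free term. -/
def freeDiag (N : ℕ) : Loop N →ₗ[ℝ] (Fin N → ℝ) where
  toFun L := fun k => coefMat 0 L k k
  map_add' _ _ := rfl
  map_smul' _ _ := rfl

/-- `P₀`: the free term (an element of `g` has diagonal free term). -/
def opP0 (N : ℕ) : Module.End ℝ (Loop N) := diagLin N ∘ₗ freeDiag N

/-- `R = π₊ - π₋`. -/
def opR (N : ℕ) : Module.End ℝ (Loop N) := piPlus N - piMinus N

/-- `R₀`, the skew-symmetric part of `R` (the symmetric part is `P₀`). -/
def opR0 (N : ℕ) : Module.End ℝ (Loop N) := opR N - opP0 N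

/-- `diag(d) ↦ ∑_j d_j (∑_{k<j} E_kk - ∑_{k>j} E_kk)` on diagonals. -/
def diagW (N : ℕ) : (Fin N → ℝ) →ₗ[ℝ] (Fin N → ℝ) where
  toFun d := fun k => ∑ j, d j * ((if k < j then 1 else 0) - (if j < k then 1 else 0))
  map_add' d e := by
    funext k
    simp [add_mul, Finset.sum_add_distrib]
  map_smul' r d := by
    funext k
    simp [mul_assoc, Finset.mul_sum]

/-- `W`, with `W (E_jj) = ∑_{k<j} E_kk - ∑_{k>j} E_kk` and `W = W ∘ P₀`. -/
def opW (N : ℕ) : Module.End ℝ (Loop N) := diagLin N ∘ₗ diagW N ∘ₗ freeDiag N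

def opA1 (N : ℕ) : Module.End ℝ (Loop N) := opR0 N + opW N
def opA2 (N : ℕ) : Module.End ℝ (Loop N) := opR0 N - opW N
def opS (N : ℕ) : Module.End ℝ (Loop N) := opP0 N - opW N
/-- The adjoint of `opS`. -/
def opSadj (N : ℕ) : Module.End ℝ (Loop N) := opP0 N + opW N

/-- A block operator on `g ^ m`: `(A L)_i = ∑_j A_ij (L_j)`. -/
def blockOp {N m : ℕ} (A : Matrix (Fin m) (Fin m) (Module.End ℝ (Loop N))) :
    Module.End ℝ (Fin m → Loop N) :=
  LinearMap.pi fun i => ∑ j, (A i j) ∘ₗ LinearMap.proj j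

/-- The `3 × 3` block operators on `g ⊗ g ⊗ g` (direct product of three copies of `g`). -/
def bigA1 (N : ℕ) : Module.End ℝ (Fin 3 → Loop N) :=
  blockOp !![opA1 N, -opS N, -opS N;
             opSadj N, opA1 N, opSadj N;
             opSadj N, -opS N, opA1 N]

def bigA2 (N : ℕ) : Module.End ℝ (Fin 3 → Loop N) :=
  blockOp !![opA2 N, -opSadj N, -opSadj N;
             opS N, opA2 N, -opSadj N;
             opS N, opS N, opA2 N]

def bigS (N : ℕ) : Module.End ℝ (Fin 3 → Loop N) :=
  blockOp !![opS N, opS N, opS N;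
             opS N, -opSadj N, -opSadj N;
             opS N, opS N, -opSadj N]

/-! ## Smooth functions on `g ^ m`, gradients, and Poisson brackets -/

/-- A smooth family in `g ^ m` over a finite-dimensional space: the degrees in `λ` are locally
bounded above and every coefficient is a smooth function. -/
def IsSmoothFamily {N m : ℕ} {E : Type} [NormedAddCommGroup E] [NormedSpace ℝ E]
    (γ : E → Fin m → Loop N) : Prop :=
  (∀ x, ∃ P : ℤ, ∀ᶠ y in 𝓝 x, ∀ i, ∀ p > P, coefMat p (γ y i) = 0) ∧
  ∀ (i : Fin m) (p : ℤ) (j k : Fin N), ContDiff ℝ ∞ fun y => coefMat p (γ y i) j k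

/-- `G` is the gradient of the smooth function `φ` on `g ^ m`: along every smooth family `γ` the
function `φ ∘ γ` is smooth, `G ∘ γ` is a smooth family, and the chain rule
`∂_w (φ ∘ γ) = ⟨G ∘ γ, ∂_w γ⟩` holds. -/
def HasSmoothGradient {N m : ℕ} (φ : (Fin m → Loop N) → ℝ)
    (G : (Fin m → Loop N) → (Fin m → Loop N)) : Prop :=
  ∀ (E : Type) [NormedAddCommGroup E] [NormedSpace ℝ E] [FiniteDimensional ℝ E]
    (γ : E → Fin m → Loop N), IsSmoothFamily γ →
    ContDiff ℝ ∞ (fun y => φ (γ y)) ∧ IsSmoothFamily (fun y => G (γ y)) ∧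
    ∀ (x w : E) (δ : Fin m → Loop N),
      (∀ i p j k, coefMat p (δ i) j k = fderiv ℝ (fun y => coefMat p (γ y i) j k) x w) →
      fderiv ℝ (fun y => φ (γ y)) x w = bigPair (G (γ x)) δ

/-- Smooth functions on `g ^ m`. -/
def IsSmoothFun {N m : ℕ} (φ : (Fin m → Loop N) → ℝ) : Prop := ∃ G, HasSmoothGradient φ G

open Classical in
/-- The gradient of a smooth function on `g ^ m`. -/
def grad {N m : ℕ} (φ : (Fin m → Loop N) → ℝ) : (Fin m → Loop N) → (Fin m → Loop N) :=
  if h : IsSmoothFun φ then h.choose else 0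

/-- The quadratic r-matrix bracket `PB₂(A₁, A₂, S)` on `g ^ m`, with `dφ = L ∇φ`, `d'φ = ∇φ L`
(componentwise products).  The term with the adjoint `S*` is written as
`⟨S*(d'φ), dψ⟩ = ⟨d'φ, S(dψ)⟩`. -/
def PB2 {N m : ℕ} (A1 A2 S : Module.End ℝ (Fin m → Loop N))
    (φ ψ : (Fin m → Loop N) → ℝ) (L : Fin m → Loop N) : ℝ :=
  (1 / 2) * bigPair (A1 (grad φ L * L)) (grad ψ L * L)
    - (1 / 2) * bigPair (A2 (L * grad φ L)) (L * grad ψ L)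
    + (1 / 2) * bigPair (S (L * grad φ L)) (grad ψ L * L)
    - (1 / 2) * bigPair (grad φ L * L) (S (L * grad ψ L))

/-- `br` is a Poisson bracket on the algebra of smooth functions singled out by `Sm`. -/
structure IsPoissonBracket {X : Type} (Sm : (X → ℝ) → Prop)
    (br : (X → ℝ) → (X → ℝ) → X → ℝ) : Prop where
  closed : ∀ φ ψ, Sm φ → Sm ψ → Sm (br φ ψ)
  add_left : ∀ φ ψ χ, Sm φ → Sm ψ → Sm χ → br (φ + ψ) χ = br φ χ + br ψ χ
  smul_left : ∀ (r : ℝ) (φ ψ), Sm φ → Sm ψ → br (r • φ) ψ = r • br φ ψ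
  skew : ∀ φ ψ, Sm φ → Sm ψ → br φ ψ = -br ψ φ
  leibniz : ∀ φ ψ χ, Sm φ → Sm ψ → Sm χ → br (φ * ψ) χ = φ * br ψ χ + ψ * br φ χ
  jacobi : ∀ φ ψ χ, Sm φ → Sm ψ → Sm χ →
    br φ (br ψ χ) + br ψ (br χ φ) + br χ (br φ ψ) = 0

/-- `F` is a Poisson map: it pulls smooth functions back to smooth functions and
preserves the brackets. -/
def IsPoissonMap {X Y : Type} (SmX : (X → ℝ) → Prop) (brX : (X → ℝ) → (X → ℝ) → X → ℝ)
    (SmY : (Y → ℝ) → Prop) (brY : (Y → ℝ) → (Y → ℝ) → Y → ℝ) (F : X → Y) : Prop :=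
  ∀ φ ψ, SmY φ → SmY ψ →
    SmX (φ ∘ F) ∧ SmX (ψ ∘ F) ∧ brX (φ ∘ F) (ψ ∘ F) = brY φ ψ ∘ F

/-! ## The phase space -/

/-- The phase space `ℝ ^ (2N)` with coordinates `(u, v)`. -/
abbrev Phase (N : ℕ) : Type := (Fin N → ℝ) × (Fin N → ℝ)

def SmoothPhase {N : ℕ} (φ : Phase N → ℝ) : Prop := ContDiff ℝ ∞ φ

def dU {N : ℕ} (k : Fin N) (φ : Phase N → ℝ) (x : Phase N) : ℝ :=
  fderiv ℝ φ x (Pi.single k 1, 0)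

def dV {N : ℕ} (k : Fin N) (φ : Phase N → ℝ) (x : Phase N) : ℝ :=
  fderiv ℝ φ x (0, Pi.single k 1)

/-- The quadratic bracket `{u_k, v_k} = -u_k v_k`, `{v_k, u_{k+1}} = -v_k u_{k+1}`. -/
def quadBr {N : ℕ} [NeZero N] (φ ψ : Phase N → ℝ) (x : Phase N) : ℝ :=
  ∑ k, (-(x.1 k * x.2 k) * (dU k φ x * dV k ψ x - dV k φ x * dU k ψ x)
    - (x.2 k * x.1 (k + 1)) * (dV k φ x * dU (k + 1) ψ x - dU (k + 1) φ x * dV k ψ x))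

/-- The Hamiltonian vector field of `H`, for the convention `ẋ = {H, x}`. -/
def hamField {N : ℕ} [NeZero N] (H : Phase N → ℝ) (x : Phase N) : Phase N :=
  (fun k => quadBr H (fun y => y.1 k) x, fun k => quadBr H (fun y => y.2 k) x)

/-! ## The Lax matrices -/

/-- `U = ℰ + u`. -/
def matU {N : ℕ} (x : Phase N) : Loop N := diagShift 1 (fun _ => 1) + diagShift 0 x.1

/-- `V = I + v ℰ⁻¹`. -/
def matV {N : ℕ} (x : Phase N) : Loop N := 1 + diagShift (-1) x.2

/-- `C = I - h u v ℰ⁻¹`. -/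
def matC {N : ℕ} (h : ℝ) (x : Phase N) : Loop N :=
  1 - h • diagShift (-1) (fun k => x.1 k * x.2 k)

/-- `C⁻¹`, the inverse in the ring `g`. -/
def matCinv {N : ℕ} (h : ℝ) (x : Phase N) : Loop N := Ring.inverse (matC h x)

/-- The Lax matrix map `(U, C⁻¹, V)`. -/
def laxTriple {N : ℕ} (h : ℝ) (x : Phase N) : Fin 3 → Loop N := ![matU x, matCinv h x, matV x]

/-- `L₋ = U V C⁻¹`. -/
def monUVC {N : ℕ} (h : ℝ) (x : Phase N) : Loop N := matU x * matV x * matCinv h x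

/-- `V C⁻¹ U`. -/
def monVCU {N : ℕ} (h : ℝ) (x : Phase N) : Loop N := matV x * matCinv h x * matU x

/-- `C⁻¹ U V`. -/
def monCUV {N : ℕ} (h : ℝ) (x : Phase N) : Loop N := matCinv h x * matU x * matV x

/-! ## Lax triads

The auxiliary matrices are allowed to be doubly infinite formal series in `λ`; these can be
multiplied by Laurent polynomials such as `U`, `C`, `V`. -/

/-- Doubly infinite formal series `∑_p X_p λ ^ p`. -/
abbrev BiSeries (N : ℕ) : Type := ℤ → Matrix (Fin N) (Fin N) ℝ

/-- An element of `g` as a doubly infinite series. -/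
def toBi {N : ℕ} (L : Loop N) : BiSeries N := fun p => coefMat p L

def biPlus {N : ℕ} (X : BiSeries N) : BiSeries N := fun p => if 0 ≤ p then X p else 0

def biMinus {N : ℕ} (X : BiSeries N) : BiSeries N := fun p => if p < 0 then X p else 0

/-- Product of a Laurent polynomial and a doubly infinite series (the sum is finite). -/
def lmulBi {N : ℕ} (A : Loop N) (X : BiSeries N) : BiSeries N :=
  fun p => ∑ᶠ q : ℤ, coefMat q A * X (p - q)

def rmulBi {N : ℕ} (X : BiSeries N) (A : Loop N) : BiSeries N :=
  fun p => ∑ᶠ q : ℤ, X (p - q) * coefMat q A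

/-- The curve `M` in `g` has at time `t` the (coefficientwise) derivative `D`. -/
def HasCoefDeriv {N : ℕ} (M : ℝ → Loop N) (D : BiSeries N) (t : ℝ) : Prop :=
  ∀ (p : ℤ) (i j : Fin N), HasDerivAt (fun s => coefMat p (M s) i j) (D p i j) t

/-- The Lax triads at time `t` along the curve `c`, where `F1`, `F2`, `F3` stand for
`f(U V C⁻¹)`, `f(C⁻¹ U V)`, `f(V C⁻¹ U)` and `P` for `π₊` or `-π₋`:
`U̇ = U P(F3) - P(F1) U`, `Ċ = C P(F2) - P(F1) C`, `V̇ = V P(F2) - P(F3) V`. -/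
structure LaxTriads {N : ℕ} (P : BiSeries N → BiSeries N) (h : ℝ)
    (F1 F2 F3 : Phase N → BiSeries N) (c : ℝ → Phase N) (t : ℝ) : Prop where
  eqU : HasCoefDeriv (fun s => matU (c s))
    (lmulBi (matU (c t)) (P (F3 (c t))) - rmulBi (P (F1 (c t))) (matU (c t))) t
  eqC : HasCoefDeriv (fun s => matC h (c s))
    (lmulBi (matC h (c t)) (P (F2 (c t))) - rmulBi (P (F1 (c t))) (matC h (c t))) t
  eqV : HasCoefDeriv (fun s => matV (c s))
    (lmulBi (matV (c t)) (P (F2 (c t))) - rmulBi (P (F3 (c t))) (matV (c t))) t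

/-- The Lax triads with upper signs, for `f : g → g`. -/
def LaxTriadsPlus {N : ℕ} (h : ℝ) (f : Loop N → Loop N) (c : ℝ → Phase N) (t : ℝ) : Prop :=
  LaxTriads biPlus h (fun x => toBi (f (monUVC h x))) (fun x => toBi (f (monCUV h x)))
    (fun x => toBi (f (monVCU h x))) c t

/-- The Lax triads with lower signs, for `f : g → g`. -/
def LaxTriadsMinus {N : ℕ} (h : ℝ) (f : Loop N → Loop N) (c : ℝ → Phase N) (t : ℝ) : Prop :=
  LaxTriads (fun X => -biMinus X) h (fun x => toBi (f (monUVC h x)))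
    (fun x => toBi (f (monCUV h x))) (fun x => toBi (f (monVCU h x))) c t

/-- `f : g → g` is covariant with respect to conjugation. -/
def ConjCovariant {N : ℕ} (f : Loop N → Loop N) : Prop :=
  ∀ (a : (Loop N)ˣ) (L : Loop N), f (a * L * ↑a⁻¹) = a * f L * ↑a⁻¹

/-- `φ : g → ℝ` is invariant with respect to conjugation; here and below `g` is identified with
`g ^ 1`. -/
def ConjInvariant {N : ℕ} (φ : (Fin 1 → Loop N) → ℝ) : Prop :=
  ∀ (a : (Loop N)ˣ) (L : Loop N), φ (fun _ => a * L * ↑a⁻¹) = φ (fun _ => L)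

/-- `dφ(L) = L ∇φ(L)` for a function `φ` on `g`. -/
def dLeft {N : ℕ} (φ : (Fin 1 → Loop N) → ℝ) (L : Loop N) : Loop N :=
  L * grad φ (fun _ => L) 0

/-! ## The flow with `f(L) = h⁻¹ log (I + h L)` -/

/-- The `n`-th term of the entry `(i, j)` of the coefficient of `λ ^ p` in the power series
`log (I + h L) = ∑_n (-1) ^ n (h L) ^ (n + 1) / (n + 1)`. -/
def logTerm {N : ℕ} (h : ℝ) (L : Loop N) (p : ℤ) (i j : Fin N) (n : ℕ) : ℝ :=
  (-1) ^ n / (n + 1) * coefMat p ((h • L) ^ (n + 1)) i j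

/-- `h⁻¹ log (I + h L)`, a doubly infinite series computed coefficientwise. -/
def logFun {N : ℕ} (h : ℝ) (L : Loop N) : BiSeries N :=
  fun p => Matrix.of fun i j => h⁻¹ * ∑' n, logTerm h L p i j n

/-- The power series for `log (I + h L)` converges coefficientwise (absolutely). -/
def LogConverges {N : ℕ} (h : ℝ) (L : Loop N) : Prop :=
  ∀ p i j, Summable (logTerm h L p i j)

/-- `c` is on the time interval between `0` and `h` a trajectory, inside the ball of radius `r`,
of the flow with `f(L) = h⁻¹ log (I + h L)` starting at `x`. -/
structure IsLogTrajectory {N : ℕ} (h r : ℝ) (x : Phase N) (c : ℝ → Phase N) : Prop where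
  init : c 0 = x
  bdd : ∀ t ∈ Set.uIcc 0 h, ‖c t‖ ≤ r
  plus : ∀ t ∈ Set.uIcc 0 h, LaxTriads biPlus h (fun y => logFun h (monUVC h y))
    (fun y => logFun h (monCUV h y)) (fun y => logFun h (monVCU h y)) c t
  minus : ∀ t ∈ Set.uIcc 0 h, LaxTriads (fun X => -biMinus X) h (fun y => logFun h (monUVC h y))
    (fun y => logFun h (monCUV h y)) (fun y => logFun h (monVCU h y)) c t

/-! ## The relativistic Volterra lattice and the explicit discretization -/

/-- The vector field of the relativistic Volterra lattice. -/
def rvlField {N : ℕ} [NeZero N] (h : ℝ) (x : Phase N) : Phase N :=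
  (fun k => x.1 k * (x.2 k - x.2 (k - 1) + h * x.1 k * x.2 k - h * x.1 (k - 1) * x.2 (k - 1)),
   fun k => x.2 k * (x.1 (k + 1) - x.1 k + h * x.1 (k + 1) * x.2 (k + 1) - h * x.1 k * x.2 k))

/-- The difference equations relating `x = (u, v)` and `y = (ũ, ṽ)`. -/
def IsDiscreteStep {N : ℕ} [NeZero N] (h : ℝ) (x y : Phase N) : Prop :=
  (∀ k, y.1 k * (1 + h * x.2 (k - 1)) = x.1 k * (1 + h * x.2 k)) ∧
  ∀ k, y.2 k * (1 + h * y.1 k) = x.2 k * (1 + h * y.1 (k + 1))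

/-- `ũ` as a function of `(u, v)`. -/
def stepU {N : ℕ} [NeZero N] (h : ℝ) (x : Phase N) (k : Fin N) : ℝ :=
  x.1 k * (1 + h * x.2 k) / (1 + h * x.2 (k - 1))

/-- The explicit map `(u, v) ↦ (ũ, ṽ)`. -/
def stepMap {N : ℕ} [NeZero N] (h : ℝ) (x : Phase N) : Phase N :=
  (stepU h x, fun k => x.2 k * (1 + h * stepU h x (k + 1)) / (1 + h * stepU h x k))

/-- The open set on which the explicit map is defined. -/
def stepDomain (N : ℕ) [NeZero N] (h : ℝ) : Set (Phase N) :=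
  {x | (∀ k, 1 + h * x.2 k ≠ 0) ∧ ∀ k, 1 + h * stepU h x k ≠ 0}

end

noncomputable section

set_option linter.unusedSectionVars false

/-! ## Coefficients of elements of the loop algebra -/

namespace Loop

variable {N : ℕ}

/-! The Jacobi identity for `PB2` is an r-matrix computation. Half the pairing of ∇ψ with the vector
L X − Y L gives the bracket, where X = A₁(∇φ L) + S(L ∇φ) and Y = A₂(L ∇φ) + S*(∇φ L). The Jacobi
sum splits into Hessian terms, which cancel because second derivatives are symmetric, and cyclic
sums of commutators of the X and of the Y. Each X or Y is R₀ of its main argument plus a diagonal of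
degree zero. Such diagonals commute, so the modified Yang–Baxter equation for R₀ evaluates the
cyclic sums whatever the diagonals are (`opR0_yang_baxter`, `loopPair_bracket_sum`,
`isPoissonBracket_PB2`). Only skewness, adjointness and the diagonal type of the corrections enter,
so one proof serves g and g ⊗ g ⊗ g. The bracket on the phase space has constant coefficients in the
commuting derivations u∂_u, v∂_v.

For the Lax triads, suppose U F₃ = F₁ U. Then U π₊(F₃) − π₊(F₁) U is minus the same expression with
π₋. One form bounds the degree from below and the other from above, so a single diagonal survives;
the same happens for C and V (`triad_rhs_matU`, `triad_rhs_onePlus`). Hence both signs describe the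
same vector field, and the equation for C follows from those for U and V. For covariant f the
intertwining relations hold since the three monodromy matrices are conjugate through U, C and V.

The same degree argument computes the Hamiltonian vectors on g ⊗ g ⊗ g at (U, C⁻¹, V): U R₀(G) −
R₀(F) U is a triad term plus explicit diagonals. The blocks built from P₀ and W make the result
tangent to the image of the phase space and equal there to the image of the Hamiltonian field
(`hamVec_laxTriple`). The monodromy maps follow because triple products are Poisson from g ⊗ g ⊗ g
to g (`PB2_comp_tripleProd`). The gradient of an invariant function commutes with its argument
(`grad_commute`), which turns the Hamiltonian field of φ(UVC⁻¹) into the triad field of dφ.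

For the discretization, I + hUVC⁻¹ = (C + hUV) C⁻¹, and in C + hUV the terms with ℰ⁻¹ cancel. So I +
hUVC⁻¹ comes already factored into a nonnegative part and I plus a negative part. The flow of h⁻¹
log(I + hL) over the time h is given by exactly this factorization (`Wiener.exists_factorization`),
which is unique (`Wiener.eq_stepSeries`). Comparing coefficients yields the explicit equations
(`Wiener.stepU_relation`, `Wiener.stepV_relation`). The analysis takes place in a Banach algebra of
absolutely summable series in λ, after the rescaling λ ↦ ρλ. The explicit map is Poisson because it
is a composition of two shears, each of which preserves the bracket. -/

theorem coefMat_ext {L M : Loop N} (H : ∀ p, coefMat p L = coefMat p M) : L = M :=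
  Loop.ext_coeff fun j k p => by
    have := congrFun (congrFun (H (-p)) j) k
    simpa [coefMat] using this

/-- Taking a coefficient is linear. -/
def coefLin (N : ℕ) (p : ℤ) : Loop N →ₗ[ℝ] Matrix (Fin N) (Fin N) ℝ where
  toFun L := coefMat p L
  map_add' _ _ := rfl
  map_smul' _ _ := rfl

theorem coefMat_add (p : ℤ) (L M : Loop N) : coefMat p (L + M) = coefMat p L + coefMat p M := rfl
theorem coefMat_zero (p : ℤ) : coefMat p (0 : Loop N) = 0 := rfl
theorem coefMat_smul (p : ℤ) (r : ℝ) (L : Loop N) : coefMat p (r • L) = r • coefMat p L := rfl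
theorem coefMat_neg (p : ℤ) (L : Loop N) : coefMat p (-L) = -coefMat p L := rfl
theorem coefMat_sub (p : ℤ) (L M : Loop N) : coefMat p (L - M) = coefMat p L - coefMat p M :=
  map_sub (coefLin N p) L M
theorem coefMat_sum {ι : Type*} (p : ℤ) (s : Finset ι) (f : ι → Loop N) :
    coefMat p (∑ i ∈ s, f i) = ∑ i ∈ s, coefMat p (f i) := map_sum (coefLin N p) f s

theorem coefMat_one (p : ℤ) : coefMat p (1 : Loop N) = if p = 0 then 1 else 0 := by
  ext i j
  change ((1 : Matrix (Fin N) (Fin N) (HahnSeries ℤ ℝ)) i j).coeff (-p) = _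
  by_cases hp : p = 0
  · subst hp
    by_cases h : i = j
    · subst h; simp
    · simp [Matrix.one_apply_ne h]
  · by_cases h : i = j
    · subst h; simp [hp, HahnSeries.coeff_one]
    · simp [Matrix.one_apply_ne h, hp]

theorem coefMat_twisted (L : Loop N) (p : ℤ) (i j : Fin N)
    (h : ¬ ((i : ℕ) : ℤ) - ((j : ℕ) : ℤ) ≡ p [ZMOD (N : ℤ)]) : coefMat p L i j = 0 := by
  by_contra h'
  exact h (L.isTwisted i j p h')

/-- The degree in `λ` is at most `P`. -/
def DegLE (P : ℤ) (L : Loop N) : Prop := ∀ p, P < p → coefMat p L = 0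

theorem exists_degLE (L : Loop N) : ∃ P, DegLE P L := by
  classical
  have h : ∀ i j, ∃ P : ℤ, ∀ p, P < p → (L.mat i j).coeff (-p) = 0 := by
    intro i j
    refine ⟨-(L.mat i j).order, fun p hp => HahnSeries.coeff_eq_zero_of_lt_order (by linarith)⟩
  choose P hP using h
  -- A sum of absolute values serves as a common bound and needs no maximum over a possibly empty
  -- index set.
  refine ⟨∑ i, ∑ j, |P i j|, fun p hp => ?_⟩
  ext i j
  apply hP i j p
  have h1 : |P i j| ≤ ∑ j, |P i j| :=
    Finset.single_le_sum (f := fun j => |P i j|) (fun _ _ => abs_nonneg _) (Finset.mem_univ j)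
  have h2 : ∑ j, |P i j| ≤ ∑ i, ∑ j, |P i j| :=
    Finset.single_le_sum (f := fun i => ∑ j, |P i j|)
      (fun _ _ => Finset.sum_nonneg fun _ _ => abs_nonneg _) (Finset.mem_univ i)
  linarith [le_abs_self (P i j)]

theorem DegLE.mono {P Q : ℤ} {L : Loop N} (h : DegLE P L) (hPQ : P ≤ Q) : DegLE Q L :=
  fun p hp => h p (lt_of_le_of_lt hPQ hp)

/-- The product of Hahn series sums over the antidiagonal of the supports, a set that varies with
the factors. Degree bounds replace it by a fixed interval, and the additional terms vanish. With a
fixed index set, products of families can be differentiated term by term. -/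
theorem coeff_mul_eq_sum_Icc (x y : HahnSeries ℤ ℝ) (P Q p : ℤ)
    (hx : ∀ q, P < q → x.coeff (-q) = 0) (hy : ∀ q, Q < q → y.coeff (-q) = 0) :
    (x * y).coeff (-p) = ∑ q ∈ Finset.Icc (p - Q) P, x.coeff (-q) * y.coeff (-(p - q)) := by
  rw [HahnSeries.coeff_mul]
  refine Finset.sum_of_injOn (fun ab => -ab.1) ?_ ?_ ?_ ?_
  · intro a ha b hb hab
    have ha' := (Finset.mem_antidiagonal.1 ha).2.2
    have hb' := (Finset.mem_antidiagonal.1 hb).2.2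
    have : a.1 = b.1 := by simpa using hab
    ext
    · exact this
    · linarith
  · intro ab hab
    obtain ⟨h1, h2, h3⟩ := Finset.mem_antidiagonal.1 hab
    have h1' : x.coeff ab.1 ≠ 0 := h1
    have h2' : y.coeff ab.2 ≠ 0 := h2
    simp only [Finset.coe_Icc, Set.mem_Icc]
    constructor
    · by_contra hlt
      exact h2' (by have := hy (-ab.2) (by linarith); rwa [neg_neg] at this)
    · by_contra hlt
      exact h1' (by have := hx (-ab.1) (by linarith); rwa [neg_neg] at this)
  · intro q hq hq'
    by_contra hne
    apply hq'
    refine ⟨(-q, -(p - q)), ?_, by simp⟩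
    refine Finset.mem_coe.2 (Finset.mem_antidiagonal.2 ⟨left_ne_zero_of_mul hne,
      right_ne_zero_of_mul hne, by lia⟩)
  · intro ab hab
    have h3 := (Finset.mem_antidiagonal.1 hab).2.2
    have : -(p - -ab.1) = ab.2 := by linarith
    rw [neg_neg, this]

theorem coefMat_mul {P Q : ℤ} {L M : Loop N} (hL : DegLE P L) (hM : DegLE Q M) (p : ℤ) :
    coefMat p (L * M) = ∑ q ∈ Finset.Icc (p - Q) P, coefMat q L * coefMat (p - q) M := by
  ext i j
  change ((L.mat * M.mat) i j).coeff (-p) = _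
  rw [Matrix.mul_apply, HahnSeries.coeff_sum, Matrix.sum_apply]
  simp only [Matrix.mul_apply]
  rw [Finset.sum_comm]
  refine Finset.sum_congr rfl fun k _ => ?_
  exact coeff_mul_eq_sum_Icc _ _ P Q p (fun q hq => congrFun (congrFun (hL q hq) i) k)
    (fun q hq => congrFun (congrFun (hM q hq) k) j)

/-- This form needs no degree bounds and matches the definition of `lmulBi`. -/
theorem coefMat_mul_eq_finsum (L M : Loop N) (p : ℤ) :
    coefMat p (L * M) = ∑ᶠ q : ℤ, coefMat q L * coefMat (p - q) M := by
  obtain ⟨P, hP⟩ := exists_degLE L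
  obtain ⟨Q, hQ⟩ := exists_degLE M
  rw [coefMat_mul hP hQ]
  symm
  apply finsum_eq_sum_of_support_subset
  intro q hq
  simp only [Finset.coe_Icc, Set.mem_Icc]
  by_contra h
  apply hq
  by_cases h1 : P < q
  · simp [hP q h1]
  · have : Q < p - q := by
      by_contra h2
      exact h ⟨by linarith, by linarith⟩
    simp [hQ _ this]

theorem DegLE.mul {P Q : ℤ} {L M : Loop N} (hL : DegLE P L) (hM : DegLE Q M) :
    DegLE (P + Q) (L * M) := by
  intro p hp
  rw [coefMat_mul hL hM, Finset.Icc_eq_empty (by linarith), Finset.sum_empty]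

theorem DegLE.add {P : ℤ} {L M : Loop N} (hL : DegLE P L) (hM : DegLE P M) : DegLE P (L + M) :=
  fun p hp => by rw [coefMat_add, hL p hp, hM p hp, add_zero]

theorem DegLE.sub {P : ℤ} {L M : Loop N} (hL : DegLE P L) (hM : DegLE P M) : DegLE P (L - M) :=
  fun p hp => by rw [coefMat_sub, hL p hp, hM p hp, sub_zero]

theorem DegLE.smul {P : ℤ} {L : Loop N} (r : ℝ) (hL : DegLE P L) : DegLE P (r • L) :=
  fun p hp => by rw [coefMat_smul, hL p hp, smul_zero]

theorem degLE_one : DegLE 0 (1 : Loop N) := fun p hp => by rw [coefMat_one, if_neg (by lia)]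

/-- The element of `g` with prescribed coefficients. -/
def ofCoef (P : ℤ) (X : ℤ → Matrix (Fin N) (Fin N) ℝ) (hP : ∀ p, P < p → X p = 0)
    (hX : ∀ (i j : Fin N) (p : ℤ), X p i j ≠ 0 →
      ((i : ℕ) : ℤ) - ((j : ℕ) : ℤ) ≡ p [ZMOD (N : ℤ)]) : Loop N :=
  Loop.mk (fun i j => HahnSeries.ofSuppBddBelow (fun q => X (-q) i j) ⟨-P, fun q hq => by
    by_contra h
    exact hq (by simp [hP (-q) (by linarith)])⟩) (by
    intro i j p hp
    have hp' : X (- -p) i j ≠ 0 := hp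
    exact hX i j p (by rwa [neg_neg] at hp'))

theorem coefMat_ofCoef (P : ℤ) (X : ℤ → Matrix (Fin N) (Fin N) ℝ) (hP hX) (p : ℤ) :
    coefMat p (ofCoef P X hP hX : Loop N) = X p := by
  ext i j
  change X (- -p) i j = _
  rw [neg_neg]

theorem smul_mul' (r : ℝ) (L M : Loop N) : (r • L) * M = r • (L * M) := by
  refine coefMat_ext fun p => ?_
  obtain ⟨P, hP⟩ := exists_degLE L
  obtain ⟨Q, hQ⟩ := exists_degLE M
  rw [coefMat_mul (hP.smul r) hQ, coefMat_smul, coefMat_mul hP hQ, Finset.smul_sum]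
  exact Finset.sum_congr rfl fun q _ => by rw [coefMat_smul, Matrix.smul_mul]

theorem mul_smul' (r : ℝ) (L M : Loop N) : L * (r • M) = r • (L * M) := by
  refine coefMat_ext fun p => ?_
  obtain ⟨P, hP⟩ := exists_degLE L
  obtain ⟨Q, hQ⟩ := exists_degLE M
  rw [coefMat_mul hP (hQ.smul r), coefMat_smul, coefMat_mul hP hQ, Finset.smul_sum]
  exact Finset.sum_congr rfl fun q _ => by rw [coefMat_smul, Matrix.mul_smul]

instance : Algebra ℝ (Loop N) := Algebra.ofModule smul_mul' mul_smul'

/-! ### The scalar product -/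

theorem loopPair_eq_trace (L M : Loop N) : loopPair L M = (coefMat 0 (L * M)).trace := by
  simp only [loopPair, Matrix.trace, HahnSeries.coeff_sum, Matrix.diag, coefMat, neg_zero]

theorem loopPair_comm (L M : Loop N) : loopPair L M = loopPair M L := by
  change (Matrix.trace (L.mat * M.mat)).coeff 0 = (Matrix.trace (M.mat * L.mat)).coeff 0
  rw [Matrix.trace_mul_comm]

theorem loopPair_mul_left (L M K : Loop N) : loopPair (L * M) K = loopPair L (M * K) := by
  rw [loopPair_eq_trace, loopPair_eq_trace, mul_assoc]

theorem loopPair_mul_right (L M K : Loop N) : loopPair L (M * K) = loopPair (K * L) M := by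
  rw [← loopPair_mul_left, loopPair_comm, ← loopPair_mul_left]

/-- The scalar product as a bilinear map. -/
def pairLin (N : ℕ) : Loop N →ₗ[ℝ] Loop N →ₗ[ℝ] ℝ :=
  LinearMap.mk₂ ℝ loopPair
    (fun a b c => by simp only [loopPair_eq_trace, add_mul, coefMat_add, Matrix.trace_add])
    (fun r a b => by simp only [loopPair_eq_trace, smul_mul', coefMat_smul, Matrix.trace_smul])
    (fun a b c => by simp only [loopPair_eq_trace, mul_add, coefMat_add, Matrix.trace_add])
    (fun r a b => by simp only [loopPair_eq_trace, mul_smul', coefMat_smul, Matrix.trace_smul])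

theorem pairLin_apply (L M : Loop N) : pairLin N L M = loopPair L M := rfl

theorem loopPair_add_left (a b c : Loop N) :
    loopPair (a + b) c = loopPair a c + loopPair b c := (pairLin N).map_add₂ a b c
theorem loopPair_add_right (a b c : Loop N) :
    loopPair a (b + c) = loopPair a b + loopPair a c := (pairLin N a).map_add b c
theorem loopPair_sub_left (a b c : Loop N) :
    loopPair (a - b) c = loopPair a c - loopPair b c := (pairLin N).map_sub₂ a b c
theorem loopPair_sub_right (a b c : Loop N) :
    loopPair a (b - c) = loopPair a b - loopPair a c := (pairLin N a).map_sub b c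
theorem loopPair_neg_left (a b : Loop N) : loopPair (-a) b = -loopPair a b :=
  (pairLin N).map_neg₂ a b
theorem loopPair_neg_right (a b : Loop N) : loopPair a (-b) = -loopPair a b :=
  (pairLin N a).map_neg b
theorem loopPair_smul_left (r : ℝ) (a b : Loop N) : loopPair (r • a) b = r * loopPair a b :=
  (pairLin N).map_smul₂ r a b
theorem loopPair_smul_right (r : ℝ) (a b : Loop N) : loopPair a (r • b) = r * loopPair a b :=
  (pairLin N a).map_smul r b
theorem loopPair_zero_right (a : Loop N) : loopPair a 0 = 0 := (pairLin N a).map_zero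

theorem loopPair_eq_sum {P Q : ℤ} {L M : Loop N} (hL : DegLE P L) (hM : DegLE Q M) :
    loopPair L M = ∑ q ∈ Finset.Icc (-Q) P, (coefMat q L * coefMat (-q) M).trace := by
  rw [loopPair_eq_trace, coefMat_mul hL hM, Matrix.trace_sum, zero_sub]
  simp only [zero_sub]

/-- The matrix unit `r λ ^ p E_{jk}`. -/
def matUnit (p : ℤ) (j k : Fin N) (h : ((j : ℕ) : ℤ) - ((k : ℕ) : ℤ) ≡ p [ZMOD (N : ℤ)]) :
    Loop N :=
  ofCoef p (fun q => if q = p then Matrix.single j k 1 else 0)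
    (fun q hq => if_neg (by lia)) (by
      intro i l q hq
      by_cases hqp : q = p
      · subst hqp
        rw [if_pos rfl] at hq
        by_cases hi : j = i ∧ k = l
        · obtain ⟨rfl, rfl⟩ := hi; exact h
        · exact absurd (Matrix.single_apply_of_ne _ _ _ _ _ hi) hq
      · simp [hqp] at hq)

theorem coefMat_matUnit (p : ℤ) (j k : Fin N) (h) (q : ℤ) :
    coefMat q (matUnit p j k h) = if q = p then Matrix.single j k 1 else 0 :=
  coefMat_ofCoef _ _ _ _ _

theorem loopPair_matUnit (L : Loop N) (p : ℤ) (j k : Fin N) (h) :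
    loopPair L (matUnit p j k h) = coefMat (-p) L k j := by
  obtain ⟨P, hP⟩ := exists_degLE L
  have hQ : DegLE p (matUnit p j k h) := fun q hq => by
    rw [coefMat_matUnit, if_neg (by lia)]
  rw [loopPair_eq_sum hP hQ]
  by_cases hp : -p ≤ P
  · rw [Finset.sum_eq_single (-p)]
    · rw [coefMat_matUnit, if_pos (by ring), Matrix.trace_mul_single]
      simp
    · intro q _ hq
      rw [coefMat_matUnit, if_neg (by lia), mul_zero, Matrix.trace_zero]
    · intro hq; exact absurd (Finset.mem_Icc.2 ⟨le_rfl, hp⟩) hq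
  · rw [Finset.Icc_eq_empty hp, Finset.sum_empty, hP _ (by lia)]; rfl

/-- Pairing with the unit λ⁻ᵖ E_{ji} reads off the entry (i, j) of the coefficient of λᵖ. Where the
twist admits no such unit, the entry vanishes anyway. -/
theorem eq_zero_of_loopPair {L : Loop N} (H : ∀ M, loopPair L M = 0) : L = 0 := by
  refine coefMat_ext fun p => ?_
  ext i j
  rw [coefMat_zero, Matrix.zero_apply]
  by_cases h : ((i : ℕ) : ℤ) - ((j : ℕ) : ℤ) ≡ p [ZMOD (N : ℤ)]
  · have h' : ((j : ℕ) : ℤ) - ((i : ℕ) : ℤ) ≡ -p [ZMOD (N : ℤ)] := by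
      have := h.neg; rwa [neg_sub] at this
    have := loopPair_matUnit L (-p) j i h'
    rw [H, neg_neg] at this
    exact this.symm
  · exact coefMat_twisted L p i j h

theorem eq_of_loopPair {L K : Loop N} (H : ∀ M, loopPair L M = loopPair K M) : L = K := by
  rw [← sub_eq_zero]
  exact eq_zero_of_loopPair fun M => by rw [loopPair_sub_left, H, sub_self]

/-! ### The sum scalar product -/

variable {m : ℕ}

theorem bigPair_comm (L M : Fin m → Loop N) : bigPair L M = bigPair M L :=
  Finset.sum_congr rfl fun _ _ => loopPair_comm _ _

theorem bigPair_mul_left (L M K : Fin m → Loop N) : bigPair (L * M) K = bigPair L (M * K) :=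
  Finset.sum_congr rfl fun _ _ => loopPair_mul_left _ _ _

/-- The sum scalar product as a bilinear map. -/
def bigPairLin (N m : ℕ) : (Fin m → Loop N) →ₗ[ℝ] (Fin m → Loop N) →ₗ[ℝ] ℝ :=
  LinearMap.mk₂ ℝ bigPair
    (fun a b c => by simp only [bigPair, Pi.add_apply, loopPair_add_left, Finset.sum_add_distrib])
    (fun r a b => by simp only [bigPair, Pi.smul_apply, loopPair_smul_left, Finset.mul_sum, smul_eq_mul])
    (fun a b c => by simp only [bigPair, Pi.add_apply, loopPair_add_right, Finset.sum_add_distrib])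
    (fun r a b => by simp only [bigPair, Pi.smul_apply, loopPair_smul_right, Finset.mul_sum, smul_eq_mul])

theorem eq_of_bigPair {L K : Fin m → Loop N} (H : ∀ M, bigPair L M = bigPair K M) : L = K := by
  classical
  funext i
  refine eq_of_loopPair fun M => ?_
  have h : ∀ L : Fin m → Loop N, bigPair L (Pi.single i M) = loopPair (L i) M := by
    intro L
    rw [bigPair, Finset.sum_eq_single i]
    · rw [Pi.single_eq_same]
    · intro j _ hj; rw [Pi.single_eq_of_ne hj, loopPair_zero_right]
    · simp
  rw [← h L, ← h K, H]

/-! ### Units -/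

theorem DegLE.pow {A : Loop N} (hA : DegLE (-1) A) : ∀ n : ℕ, DegLE (-(n : ℤ)) (A ^ n)
  | 0 => by simpa using degLE_one
  | n + 1 => by
    have := (hA.pow n).mul hA
    rw [pow_succ]
    exact this.mono (by push_cast; linarith)

/-- The geometric series `∑ A ^ n` for `A` of negative degree. -/
def geom (A : Loop N) (hA : DegLE (-1) A) : Loop N :=
  -- Since A ^ n has degree at most −n, only n ≤ −p can contribute to the coefficient of λᵖ.
  ofCoef 0 (fun p => ∑ n ∈ Finset.range ((-p).toNat + 1), coefMat p (A ^ n))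
    (fun p hp => Finset.sum_eq_zero fun n _ => hA.pow n p (by lia)) (by
      intro i j p hp
      rw [Matrix.sum_apply] at hp
      obtain ⟨n, -, hn⟩ := Finset.exists_ne_zero_of_sum_ne_zero hp
      exact (A ^ n).isTwisted i j p hn)

theorem coefMat_geom (A : Loop N) (hA : DegLE (-1) A) (p : ℤ) :
    coefMat p (geom A hA) = ∑ n ∈ Finset.range ((-p).toNat + 1), coefMat p (A ^ n) :=
  coefMat_ofCoef _ _ _ _ _

theorem coefMat_geom_eq (A : Loop N) (hA : DegLE (-1) A) (p : ℤ) (M : ℕ) (hM : -p < M) :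
    coefMat p (geom A hA) = coefMat p (∑ n ∈ Finset.range M, A ^ n) := by
  rw [coefMat_geom, coefMat_sum]
  by_cases hp : 0 < p
  · rw [Finset.sum_eq_zero fun n _ => hA.pow n p (by lia),
      Finset.sum_eq_zero fun n _ => hA.pow n p (by lia)]
  · apply Finset.sum_subset
    · intro n hn
      simp only [Finset.mem_range] at hn ⊢
      lia
    · intro n _ hn
      simp only [Finset.mem_range] at hn
      exact hA.pow n p (by lia)

theorem degLE_geom_sub (A : Loop N) (hA : DegLE (-1) A) (M : ℕ) :
    DegLE (-(M : ℤ)) (geom A hA - ∑ n ∈ Finset.range M, A ^ n) := fun p hp => by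
  rw [coefMat_sub, coefMat_geom_eq A hA p M (by lia), sub_self]

/-- For a fixed p, replace the series by a partial sum of M > −p terms. The finite telescoping
identity leaves 1 and errors of degree at most −M, which do not reach the coefficient of λᵖ. -/
theorem one_sub_mul_geom (A : Loop N) (hA : DegLE (-1) A) : (1 - A) * geom A hA = 1 := by
  refine coefMat_ext fun p => ?_
  obtain ⟨M, hM⟩ : ∃ M : ℕ, -p < M := ⟨(-p).toNat + 1, by lia⟩
  have h1 : (1 - A) * geom A hA
      = (1 - A) * (geom A hA - ∑ n ∈ Finset.range M, A ^ n) + (1 - A ^ M) := by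
    rw [mul_sub, ← mul_neg_geom_sum A M]; abel
  have hd : DegLE 0 (1 - A) := degLE_one.sub (hA.mono (by lia))
  rw [h1, coefMat_add, coefMat_sub, hA.pow M p (by lia),
    (hd.mul (degLE_geom_sub A hA M)) p (by lia), zero_add, sub_zero]

theorem geom_mul_one_sub (A : Loop N) (hA : DegLE (-1) A) : geom A hA * (1 - A) = 1 := by
  refine coefMat_ext fun p => ?_
  obtain ⟨M, hM⟩ : ∃ M : ℕ, -p < M := ⟨(-p).toNat + 1, by lia⟩
  have h1 : geom A hA * (1 - A)
      = (geom A hA - ∑ n ∈ Finset.range M, A ^ n) * (1 - A) + (1 - A ^ M) := by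
    rw [sub_mul, ← geom_sum_mul_neg A M]; abel
  have hd : DegLE 0 (1 - A) := degLE_one.sub (hA.mono (by lia))
  rw [h1, coefMat_add, coefMat_sub, hA.pow M p (by lia),
    ((degLE_geom_sub A hA M).mul hd) p (by lia), zero_add, sub_zero]

/-- `1 - A` as a unit, for `A` of negative degree. -/
def oneSubUnit (A : Loop N) (hA : DegLE (-1) A) : (Loop N)ˣ :=
  ⟨1 - A, geom A hA, one_sub_mul_geom A hA, geom_mul_one_sub A hA⟩

/-! ### The powers of `ℰ` -/

theorem coefMat_diagShift (p : ℤ) (d : Fin N → ℝ) (q : ℤ) (i j : Fin N) :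
    coefMat q (diagShift p d) i j = if q = p then
      (if ((i : ℕ) : ℤ) - ((j : ℕ) : ℤ) ≡ p [ZMOD (N : ℤ)] then d i else 0) else 0 := by
  rw [coefMat, coeff_diagShift]
  simp only [neg_inj]

theorem degLE_diagShift (p : ℤ) (d : Fin N → ℝ) : DegLE p (diagShift p d) := by
  intro q hq
  ext i j
  rw [coefMat_diagShift, if_neg (by lia)]; rfl

theorem coefMat_diagShift_of_ne {p q : ℤ} (h : q ≠ p) (d : Fin N → ℝ) :
    coefMat q (diagShift p d) = 0 := by
  ext i j
  rw [coefMat_diagShift, if_neg h]; rfl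

theorem sub_modEq_zero_iff (i j : Fin N) :
    ((i : ℕ) : ℤ) - ((j : ℕ) : ℤ) ≡ 0 [ZMOD (N : ℤ)] ↔ i = j := by
  rw [Int.modEq_zero_iff_dvd]
  constructor
  · intro h
    have h1 : ((i : ℕ) : ℤ) < N := by exact_mod_cast i.isLt
    have h2 : ((j : ℕ) : ℤ) < N := by exact_mod_cast j.isLt
    have h3 : ((i : ℕ) : ℤ) - ((j : ℕ) : ℤ) = 0 := Int.eq_zero_of_abs_lt_dvd h (by
      rw [abs_lt]; constructor <;> linarith [Int.natCast_nonneg (i : ℕ), Int.natCast_nonneg (j : ℕ)])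
    exact Fin.ext (by lia)
  · rintro rfl; simp

theorem fin_val_add_one_modEq [NeZero N] (j : Fin N) :
    (((j + 1 : Fin N) : ℕ) : ℤ) ≡ ((j : ℕ) : ℤ) + 1 [ZMOD (N : ℤ)] := by
  have h : ((j + 1 : Fin N) : ℕ) = ((j : ℕ) + 1) % N := by
    rw [Fin.val_add, Fin.val_one', Nat.add_mod_mod]
  rw [h]
  have := Nat.mod_modEq ((j : ℕ) + 1) N
  exact_mod_cast (Int.natCast_modEq_iff.2 this)

theorem sub_modEq_one_iff [NeZero N] (i j : Fin N) :
    ((i : ℕ) : ℤ) - ((j : ℕ) : ℤ) ≡ 1 [ZMOD (N : ℤ)] ↔ i = j + 1 := by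
  rw [← sub_modEq_zero_iff i (j + 1)]
  have h := fin_val_add_one_modEq j
  simp only [Int.modEq_iff_dvd] at h ⊢
  constructor
  · intro h'
    have := (dvd_sub h' h)
    ring_nf at this ⊢
    simpa using this
  · intro h'
    have := (dvd_add h' h)
    ring_nf at this ⊢
    simpa using this

theorem sub_modEq_neg_one_iff [NeZero N] (i j : Fin N) :
    ((i : ℕ) : ℤ) - ((j : ℕ) : ℤ) ≡ -1 [ZMOD (N : ℤ)] ↔ i + 1 = j := by
  rw [eq_comm, ← sub_modEq_one_iff j i]
  constructor
  · intro h; have := h.neg; rwa [neg_sub, neg_neg] at this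
  · intro h; have := h.neg; rwa [neg_sub] at this

theorem coefMat_diagShift_zero (d : Fin N → ℝ) :
    coefMat 0 (diagShift 0 d) = Matrix.diagonal d := by
  ext i j
  rw [coefMat_diagShift, if_pos rfl, Matrix.diagonal_apply]
  simp only [sub_modEq_zero_iff]

end Loop

/-! ## Smooth families and gradients -/

namespace Loop

variable {N m : ℕ} {E F : Type} [NormedAddCommGroup E] [NormedSpace ℝ E]
  [NormedAddCommGroup F] [NormedSpace ℝ F]

/-- A smooth family in `g`. -/
def SmoothLoop (γ : E → Loop N) : Prop :=
  (∀ x, ∃ P : ℤ, ∀ᶠ y in 𝓝 x, DegLE P (γ y)) ∧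
  ∀ (p : ℤ) (j k : Fin N), ContDiff ℝ ∞ fun y => coefMat p (γ y) j k

theorem isSmoothFamily_iff {γ : E → Fin m → Loop N} :
    IsSmoothFamily γ ↔ ∀ i, SmoothLoop fun y => γ y i := by
  constructor
  · rintro ⟨h1, h2⟩ i
    refine ⟨fun x => ?_, h2 i⟩
    obtain ⟨P, hP⟩ := h1 x
    exact ⟨P, hP.mono fun y hy => hy i⟩
  · intro h
    refine ⟨fun x => ?_, fun i => (h i).2⟩
    choose P hP using fun i => (h i).1 x
    refine ⟨∑ i, |P i|, ?_⟩
    filter_upwards [Filter.eventually_all.2 hP] with y hy i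
    exact (hy i).mono ((le_abs_self _).trans
      (Finset.single_le_sum (f := fun i => |P i|) (fun _ _ => abs_nonneg _) (Finset.mem_univ i)))

theorem SmoothLoop.const (L : Loop N) : SmoothLoop (fun _ : E => L) := by
  obtain ⟨P, hP⟩ := exists_degLE L
  exact ⟨fun _ => ⟨P, Filter.Eventually.of_forall fun _ => hP⟩, fun _ _ _ => contDiff_const⟩

theorem SmoothLoop.add {γ η : E → Loop N} (hγ : SmoothLoop γ) (hη : SmoothLoop η) :
    SmoothLoop fun y => γ y + η y := by
  refine ⟨fun x => ?_, fun p j k => (hγ.2 p j k).add (hη.2 p j k)⟩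
  obtain ⟨P, hP⟩ := hγ.1 x
  obtain ⟨Q, hQ⟩ := hη.1 x
  refine ⟨max P Q, ?_⟩
  filter_upwards [hP, hQ] with y h1 h2
  exact (h1.mono (le_max_left _ _)).add (h2.mono (le_max_right _ _))

theorem SmoothLoop.smul {γ : E → Loop N} {f : E → ℝ} (hf : ContDiff ℝ ∞ f) (hγ : SmoothLoop γ) :
    SmoothLoop fun y => f y • γ y := by
  refine ⟨fun x => ?_, fun p j k => hf.mul (hγ.2 p j k)⟩
  obtain ⟨P, hP⟩ := hγ.1 x
  exact ⟨P, hP.mono fun y hy => hy.smul _⟩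

theorem SmoothLoop.const_smul {γ : E → Loop N} (r : ℝ) (hγ : SmoothLoop γ) :
    SmoothLoop fun y => r • γ y := SmoothLoop.smul contDiff_const hγ

theorem SmoothLoop.neg {γ : E → Loop N} (hγ : SmoothLoop γ) : SmoothLoop fun y => -γ y := by
  simpa using hγ.const_smul (-1)

theorem SmoothLoop.sub {γ η : E → Loop N} (hγ : SmoothLoop γ) (hη : SmoothLoop η) :
    SmoothLoop fun y => γ y - η y := by
  simpa [sub_eq_add_neg] using hγ.add hη.neg

theorem SmoothLoop.sum {ι : Type*} (s : Finset ι) {γ : ι → E → Loop N}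
    (h : ∀ i, SmoothLoop (γ i)) : SmoothLoop fun y => ∑ i ∈ s, γ i y := by
  classical
  induction s using Finset.induction_on with
  | empty => simpa using SmoothLoop.const 0
  | insert a s ha ih => simpa [Finset.sum_insert ha] using (h a).add ih

theorem SmoothLoop.comp {γ : F → Loop N} (hγ : SmoothLoop γ) {f : E → F} (hf : ContDiff ℝ ∞ f) :
    SmoothLoop fun y => γ (f y) := by
  refine ⟨fun x => ?_, fun p j k => (hγ.2 p j k).comp hf⟩
  obtain ⟨P, hP⟩ := hγ.1 (f x)
  exact ⟨P, hf.continuous.continuousAt.eventually hP⟩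

/-- Locally constant degree bounds fix the range of summation near x. There a coefficient of a
product is a finite sum of products of smooth functions, so smoothness and the Leibniz rule reduce
to scalars. -/
theorem eventually_coefMat_mul {γ η : E → Loop N} {x : E} {P Q : ℤ}
    (hP : ∀ᶠ y in 𝓝 x, DegLE P (γ y)) (hQ : ∀ᶠ y in 𝓝 x, DegLE Q (η y)) (p : ℤ) (j k : Fin N) :
    (fun y => coefMat p (γ y * η y) j k) =ᶠ[𝓝 x] fun y => ∑ q ∈ Finset.Icc (p - Q) P,
      ∑ i, coefMat q (γ y) j i * coefMat (p - q) (η y) i k := by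
  filter_upwards [hP, hQ] with y h1 h2
  rw [coefMat_mul h1 h2, Matrix.sum_apply]
  simp only [Matrix.mul_apply]

theorem SmoothLoop.mul {γ η : E → Loop N} (hγ : SmoothLoop γ) (hη : SmoothLoop η) :
    SmoothLoop fun y => γ y * η y := by
  refine ⟨fun x => ?_, fun p j k => contDiff_iff_contDiffAt.2 fun x => ?_⟩
  · obtain ⟨P, hP⟩ := hγ.1 x
    obtain ⟨Q, hQ⟩ := hη.1 x
    refine ⟨P + Q, ?_⟩
    filter_upwards [hP, hQ] with y h1 h2
    exact h1.mul h2
  · obtain ⟨P, hP⟩ := hγ.1 x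
    obtain ⟨Q, hQ⟩ := hη.1 x
    refine ContDiffAt.congr_of_eventuallyEq ?_ (eventually_coefMat_mul hP hQ p j k)
    exact ContDiffAt.sum fun q _ => ContDiffAt.sum fun i _ =>
      (hγ.2 q j i).contDiffAt.mul (hη.2 (p - q) i k).contDiffAt

theorem SmoothLoop.pow {γ : E → Loop N} (hγ : SmoothLoop γ) :
    ∀ n : ℕ, SmoothLoop fun y => γ y ^ n
  | 0 => by simpa using SmoothLoop.const 1
  | n + 1 => by simpa [pow_succ] using (hγ.pow n).mul hγ

theorem SmoothLoop.geom {γ : E → Loop N} (hγ : SmoothLoop γ) (h : ∀ y, DegLE (-1) (γ y)) :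
    SmoothLoop fun y => geom (γ y) (h y) := by
  refine ⟨fun x => ⟨0, Filter.Eventually.of_forall fun y p hp => ?_⟩, fun p j k => ?_⟩
  · rw [coefMat_geom]
    exact Finset.sum_eq_zero fun n _ => (h y).pow n p (by lia)
  · simp only [coefMat_geom, Matrix.sum_apply]
    exact ContDiff.sum fun n _ => (hγ.pow n).2 p j k

theorem SmoothLoop.contDiff_pair {γ η : E → Loop N} (hγ : SmoothLoop γ) (hη : SmoothLoop η) :
    ContDiff ℝ ∞ fun y => loopPair (γ y) (η y) := by
  simp only [loopPair_eq_trace, Matrix.trace, Matrix.diag]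
  exact ContDiff.sum fun i _ => (hγ.mul hη).2 0 i i

theorem smoothLoop_diagShift (p : ℤ) {d : E → Fin N → ℝ} (hd : ∀ i, ContDiff ℝ ∞ fun y => d y i) :
    SmoothLoop fun y => diagShift p (d y) := by
  refine ⟨fun x => ⟨p, Filter.Eventually.of_forall fun y => degLE_diagShift p _⟩, fun q j k => ?_⟩
  simp only [coefMat_diagShift]
  split_ifs
  · exact hd j
  · exact contDiff_const
  · exact contDiff_const

/-! ### Derivatives of families -/

/-- `δ` is the derivative of the family `γ` at `x` in the direction `w`. -/
def HasLoopDeriv (γ : E → Loop N) (x w : E) (δ : Loop N) : Prop :=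
  ∀ p j k, coefMat p δ j k = fderiv ℝ (fun y => coefMat p (γ y) j k) x w

theorem HasLoopDeriv.unique {γ : E → Loop N} {x w : E} {δ ε : Loop N}
    (h1 : HasLoopDeriv γ x w δ) (h2 : HasLoopDeriv γ x w ε) : δ = ε :=
  coefMat_ext fun p => by ext j k; rw [h1, h2]

theorem HasLoopDeriv.degLE {γ : E → Loop N} {x w : E} {δ : Loop N} (h : HasLoopDeriv γ x w δ)
    {P : ℤ} (hP : ∀ᶠ y in 𝓝 x, DegLE P (γ y)) : DegLE P δ := by
  intro p hp
  ext j k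
  have : (fun y => coefMat p (γ y) j k) =ᶠ[𝓝 x] fun _ => 0 := by
    filter_upwards [hP] with y hy
    rw [hy p hp]; rfl
  rw [h, this.fderiv_eq]
  simp

theorem SmoothLoop.exists_deriv {γ : E → Loop N} (hγ : SmoothLoop γ) (w : E) :
    ∃ δ : E → Loop N, SmoothLoop δ ∧ ∀ x, HasLoopDeriv γ x w (δ x) := by
  choose P hP using hγ.1
  -- A degree bound valid near x is also valid near each nearby y, so the derivatives of the high
  -- coefficients vanish at y too. This keeps the degree of the derivative family locally bounded.
  have key : ∀ x, ∃ P, ∀ᶠ y in 𝓝 x, ∀ p, P < p → ∀ j k,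
      fderiv ℝ (fun y => coefMat p (γ y) j k) y w = 0 := by
    intro x
    refine ⟨P x, ?_⟩
    filter_upwards [(hP x).eventually_nhds] with y hy p hp j k
    have : (fun y => coefMat p (γ y) j k) =ᶠ[𝓝 y] fun _ => 0 := by
      filter_upwards [hy] with z hz
      rw [hz p hp]; rfl
    rw [this.fderiv_eq]
    simp
  choose Q hQ using key
  refine ⟨fun x => ofCoef (Q x)
    (fun p => Matrix.of fun j k => fderiv ℝ (fun y => coefMat p (γ y) j k) x w)
    (fun p hp => ?_) ?_, ⟨?_, ?_⟩, ?_⟩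
  · ext j k
    exact (hQ x).self_of_nhds p hp j k
  · intro j k p hp
    by_contra h
    apply hp
    have : (fun y => coefMat p (γ y) j k) = fun _ => 0 := by
      funext y
      exact coefMat_twisted _ _ _ _ h
    rw [Matrix.of_apply, this]
    simp
  · intro x
    refine ⟨Q x, ?_⟩
    filter_upwards [hQ x] with y hy p hp
    rw [coefMat_ofCoef]
    ext j k
    exact hy p hp j k
  · intro p j k
    simp only [coefMat_ofCoef, Matrix.of_apply]
    exact ((hγ.2 p j k).fderiv_right (m := ∞) (by simp)).clm_apply contDiff_const
  · intro x p j k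
    simp only [coefMat_ofCoef, Matrix.of_apply]

theorem SmoothLoop.differentiable {γ : E → Loop N} (hγ : SmoothLoop γ) (p : ℤ) (j k : Fin N) :
    Differentiable ℝ fun y => coefMat p (γ y) j k := (hγ.2 p j k).differentiable (by simp)

theorem hasLoopDeriv_const (L : Loop N) (x w : E) : HasLoopDeriv (fun _ => L) x w 0 := by
  intro p j k
  simp [coefMat_zero]

theorem HasLoopDeriv.add {γ η : E → Loop N} {x w : E} {δ ε : Loop N} (hγ : SmoothLoop γ)
    (hη : SmoothLoop η) (h1 : HasLoopDeriv γ x w δ) (h2 : HasLoopDeriv η x w ε) :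
    HasLoopDeriv (fun y => γ y + η y) x w (δ + ε) := by
  intro p j k
  simp only [coefMat_add, Matrix.add_apply]
  rw [fderiv_fun_add (hγ.differentiable p j k x) (hη.differentiable p j k x), h1, h2]
  rfl

theorem HasLoopDeriv.smul {γ : E → Loop N} {f : E → ℝ} {x w : E} {δ : Loop N}
    (hf : ContDiff ℝ ∞ f) (hγ : SmoothLoop γ) (h1 : HasLoopDeriv γ x w δ) :
    HasLoopDeriv (fun y => f y • γ y) x w (f x • δ + fderiv ℝ f x w • γ x) := by
  intro p j k
  simp only [coefMat_add, Matrix.add_apply, coefMat_smul, Matrix.smul_apply, smul_eq_mul]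
  rw [fderiv_fun_mul (hf.differentiable (by simp) x) (hγ.differentiable p j k x), h1]
  simp [mul_comm]

theorem HasLoopDeriv.const_smul {γ : E → Loop N} (r : ℝ) {x w : E} {δ : Loop N}
    (hγ : SmoothLoop γ) (h1 : HasLoopDeriv γ x w δ) :
    HasLoopDeriv (fun y => r • γ y) x w (r • δ) := by
  simpa using HasLoopDeriv.smul contDiff_const hγ h1

theorem HasLoopDeriv.sub {γ η : E → Loop N} {x w : E} {δ ε : Loop N} (hγ : SmoothLoop γ)
    (hη : SmoothLoop η) (h1 : HasLoopDeriv γ x w δ) (h2 : HasLoopDeriv η x w ε) :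
    HasLoopDeriv (fun y => γ y - η y) x w (δ - ε) := by
  have := h1.add hγ (hη.const_smul (-1)) (h2.const_smul (-1) hη)
  simpa [sub_eq_add_neg] using this

theorem HasLoopDeriv.sum {ι : Type*} (s : Finset ι) {γ : ι → E → Loop N} {δ : ι → Loop N}
    {x w : E} (h : ∀ i, SmoothLoop (γ i)) (h1 : ∀ i, HasLoopDeriv (γ i) x w (δ i)) :
    HasLoopDeriv (fun y => ∑ i ∈ s, γ i y) x w (∑ i ∈ s, δ i) := by
  classical
  induction s using Finset.induction_on with
  | empty => simpa using hasLoopDeriv_const 0 x w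
  | insert a s ha ih =>
    simpa [Finset.sum_insert ha] using (h1 a).add (h a) (SmoothLoop.sum s h) ih

theorem HasLoopDeriv.comp {γ : F → Loop N} {f : E → F} {x w : E} {δ : Loop N}
    (hγ : SmoothLoop γ) (hf : DifferentiableAt ℝ f x)
    (h : HasLoopDeriv γ (f x) (fderiv ℝ f x w) δ) : HasLoopDeriv (fun y => γ (f y)) x w δ := by
  intro p j k
  rw [h p j k]
  have := fderiv_comp (𝕜 := ℝ) x (hγ.differentiable p j k (f x)) hf
  exact (congrArg (fun A => A w) this).symm

theorem HasLoopDeriv.mul {γ η : E → Loop N} {x w : E} {δ ε : Loop N} (hγ : SmoothLoop γ)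
    (hη : SmoothLoop η) (h1 : HasLoopDeriv γ x w δ) (h2 : HasLoopDeriv η x w ε) :
    HasLoopDeriv (fun y => γ y * η y) x w (δ * η x + γ x * ε) := by
  obtain ⟨P, hP⟩ := hγ.1 x
  obtain ⟨Q, hQ⟩ := hη.1 x
  intro p j k
  rw [(eventually_coefMat_mul hP hQ p j k).fderiv_eq, fderiv_fun_sum fun q _ =>
    DifferentiableAt.fun_sum fun i _ => (hγ.differentiable q j i x).fun_mul
      (hη.differentiable (p - q) i k x)]
  rw [coefMat_add, coefMat_mul (h1.degLE hP) hQ.self_of_nhds,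
    coefMat_mul hP.self_of_nhds (h2.degLE hQ), ← Finset.sum_add_distrib, Matrix.sum_apply,
    _root_.sum_apply]
  refine Finset.sum_congr rfl fun q _ => ?_
  rw [fderiv_fun_sum fun i _ => (hγ.differentiable q j i x).fun_mul (hη.differentiable (p - q) i k x),
    _root_.sum_apply, Matrix.add_apply, Matrix.mul_apply, Matrix.mul_apply,
    ← Finset.sum_add_distrib]
  refine Finset.sum_congr rfl fun i _ => ?_
  rw [fderiv_fun_mul (hγ.differentiable q j i x) (hη.differentiable (p - q) i k x), h1, h2]
  simp
  ring

theorem fderiv_loopPair {γ η : E → Loop N} {x w : E} {δ ε : Loop N} (hγ : SmoothLoop γ)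
    (hη : SmoothLoop η) (h1 : HasLoopDeriv γ x w δ) (h2 : HasLoopDeriv η x w ε) :
    fderiv ℝ (fun y => loopPair (γ y) (η y)) x w = loopPair δ (η x) + loopPair (γ x) ε := by
  have h := h1.mul hγ hη h2
  simp only [loopPair_eq_trace, Matrix.trace, Matrix.diag]
  rw [fderiv_fun_sum fun i _ => (hγ.mul hη).differentiable 0 i i x,
    _root_.sum_apply, ← Finset.sum_add_distrib]
  refine Finset.sum_congr rfl fun i _ => ?_
  rw [← h 0 i i]; rfl

end Loop

open Loop

/-! ### Families in `g ^ m` -/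

section Families

variable {N m : ℕ} {E F : Type} [NormedAddCommGroup E] [NormedSpace ℝ E]
  [NormedAddCommGroup F] [NormedSpace ℝ F]

/-- `δ` is the derivative of the family `γ` in `g ^ m` at `x` in the direction `w`. -/
def HasFamDeriv (γ : E → Fin m → Loop N) (x w : E) (δ : Fin m → Loop N) : Prop :=
  ∀ i, HasLoopDeriv (fun y => γ y i) x w (δ i)

theorem IsSmoothFamily.exists_deriv {γ : E → Fin m → Loop N} (hγ : IsSmoothFamily γ) (w : E) :
    ∃ δ : E → Fin m → Loop N, IsSmoothFamily δ ∧ ∀ x, HasFamDeriv γ x w (δ x) := by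
  choose δ h1 h2 using fun i => SmoothLoop.exists_deriv (isSmoothFamily_iff.1 hγ i) w
  exact ⟨fun x i => δ i x, isSmoothFamily_iff.2 h1, fun x i => h2 i x⟩

theorem HasFamDeriv.unique {γ : E → Fin m → Loop N} {x w : E} {δ ε : Fin m → Loop N}
    (h1 : HasFamDeriv γ x w δ) (h2 : HasFamDeriv γ x w ε) : δ = ε :=
  funext fun i => (h1 i).unique (h2 i)

section
variable {γ η : E → Fin m → Loop N} {x w : E} {δ ε : Fin m → Loop N}

theorem IsSmoothFamily.const (L : Fin m → Loop N) : IsSmoothFamily (fun _ : E => L) :=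
  isSmoothFamily_iff.2 fun _ => SmoothLoop.const _
theorem IsSmoothFamily.add (hγ : IsSmoothFamily γ) (hη : IsSmoothFamily η) :
    IsSmoothFamily fun y => γ y + η y := isSmoothFamily_iff.2 fun i =>
  SmoothLoop.add (isSmoothFamily_iff.1 hγ i) (isSmoothFamily_iff.1 hη i)
theorem IsSmoothFamily.sub (hγ : IsSmoothFamily γ) (hη : IsSmoothFamily η) :
    IsSmoothFamily fun y => γ y - η y := isSmoothFamily_iff.2 fun i =>
  SmoothLoop.sub (isSmoothFamily_iff.1 hγ i) (isSmoothFamily_iff.1 hη i)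
theorem IsSmoothFamily.mul (hγ : IsSmoothFamily γ) (hη : IsSmoothFamily η) :
    IsSmoothFamily fun y => γ y * η y := isSmoothFamily_iff.2 fun i =>
  SmoothLoop.mul (isSmoothFamily_iff.1 hγ i) (isSmoothFamily_iff.1 hη i)
theorem IsSmoothFamily.smul {f : E → ℝ} (hf : ContDiff ℝ ∞ f) (hγ : IsSmoothFamily γ) :
    IsSmoothFamily fun y => f y • γ y := isSmoothFamily_iff.2 fun i =>
  SmoothLoop.smul hf (isSmoothFamily_iff.1 hγ i)
theorem IsSmoothFamily.const_smul (r : ℝ) (hγ : IsSmoothFamily γ) :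
    IsSmoothFamily fun y => r • γ y := IsSmoothFamily.smul contDiff_const hγ
theorem IsSmoothFamily.comp {γ : F → Fin m → Loop N} (hγ : IsSmoothFamily γ) {f : E → F}
    (hf : ContDiff ℝ ∞ f) : IsSmoothFamily fun y => γ (f y) := isSmoothFamily_iff.2 fun i =>
  SmoothLoop.comp (isSmoothFamily_iff.1 hγ i) hf

theorem IsSmoothFamily.contDiff_pair (hγ : IsSmoothFamily γ) (hη : IsSmoothFamily η) :
    ContDiff ℝ ∞ fun y => bigPair (γ y) (η y) :=
  ContDiff.sum fun i _ => SmoothLoop.contDiff_pair (isSmoothFamily_iff.1 hγ i)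
    (isSmoothFamily_iff.1 hη i)

theorem HasFamDeriv.add (hγ : IsSmoothFamily γ) (hη : IsSmoothFamily η)
    (h1 : HasFamDeriv γ x w δ) (h2 : HasFamDeriv η x w ε) :
    HasFamDeriv (fun y => γ y + η y) x w (δ + ε) := fun i =>
  (h1 i).add (isSmoothFamily_iff.1 hγ i) (isSmoothFamily_iff.1 hη i) (h2 i)
theorem HasFamDeriv.mul (hγ : IsSmoothFamily γ) (hη : IsSmoothFamily η)
    (h1 : HasFamDeriv γ x w δ) (h2 : HasFamDeriv η x w ε) :
    HasFamDeriv (fun y => γ y * η y) x w (δ * η x + γ x * ε) := fun i =>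
  (h1 i).mul (isSmoothFamily_iff.1 hγ i) (isSmoothFamily_iff.1 hη i) (h2 i)
theorem HasFamDeriv.smul {f : E → ℝ} (hf : ContDiff ℝ ∞ f) (hγ : IsSmoothFamily γ)
    (h1 : HasFamDeriv γ x w δ) :
    HasFamDeriv (fun y => f y • γ y) x w (f x • δ + fderiv ℝ f x w • γ x) := fun i =>
  (h1 i).smul hf (isSmoothFamily_iff.1 hγ i)
theorem HasFamDeriv.comp {γ : F → Fin m → Loop N} {f : E → F} (hγ : IsSmoothFamily γ)
    (hf : DifferentiableAt ℝ f x) (h : HasFamDeriv γ (f x) (fderiv ℝ f x w) δ) :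
    HasFamDeriv (fun y => γ (f y)) x w δ := fun i =>
  (h i).comp (isSmoothFamily_iff.1 hγ i) hf

theorem hasFamDeriv_const (L : Fin m → Loop N) (x w : E) : HasFamDeriv (fun _ => L) x w 0 :=
  fun _ => hasLoopDeriv_const _ _ _

theorem fderiv_bigPair (hγ : IsSmoothFamily γ) (hη : IsSmoothFamily η)
    (h1 : HasFamDeriv γ x w δ) (h2 : HasFamDeriv η x w ε) :
    fderiv ℝ (fun y => bigPair (γ y) (η y)) x w = bigPair δ (η x) + bigPair (γ x) ε := by
  simp only [bigPair]
  rw [fderiv_fun_sum fun i _ => (SmoothLoop.contDiff_pair (isSmoothFamily_iff.1 hγ i)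
    (isSmoothFamily_iff.1 hη i)).differentiable (by simp) x,
    _root_.sum_apply, ← Finset.sum_add_distrib]
  exact Finset.sum_congr rfl fun i _ => fderiv_loopPair (isSmoothFamily_iff.1 hγ i)
    (isSmoothFamily_iff.1 hη i) (h1 i) (h2 i)
end

/-! ### Gradients -/

theorem HasSmoothGradient.fderiv_eq [FiniteDimensional ℝ E] {φ : (Fin m → Loop N) → ℝ}
    {G : (Fin m → Loop N) → Fin m → Loop N} (h : HasSmoothGradient φ G)
    {γ : E → Fin m → Loop N} (hγ : IsSmoothFamily γ) {x w : E} {δ : Fin m → Loop N}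
    (hδ : HasFamDeriv γ x w δ) :
    fderiv ℝ (fun y => φ (γ y)) x w = bigPair (G (γ x)) δ := (h E γ hγ).2.2 x w δ hδ

/-- The family `L + s ε` over the line. -/
theorem isSmoothFamily_line {γ ε : E → Fin m → Loop N} (hγ : IsSmoothFamily γ)
    (hε : IsSmoothFamily ε) : IsSmoothFamily fun z : E × ℝ => γ z.1 + z.2 • ε z.1 :=
  (hγ.comp contDiff_fst).add ((hε.comp contDiff_fst).smul contDiff_snd)

theorem hasFamDeriv_line {γ ε : E → Fin m → Loop N} (hγ : IsSmoothFamily γ)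
    (hε : IsSmoothFamily ε) (z : E × ℝ) {w : E} {δ κ : Fin m → Loop N}
    (h1 : HasFamDeriv γ z.1 w δ) (h2 : HasFamDeriv ε z.1 w κ) (r : ℝ) :
    HasFamDeriv (fun z : E × ℝ => γ z.1 + z.2 • ε z.1) z (w, r) (δ + (z.2 • κ + r • ε z.1)) := by
  have e1 : HasFamDeriv (fun z : E × ℝ => γ z.1) z (w, r) δ :=
    HasFamDeriv.comp hγ differentiableAt_fst (by simpa [fderiv_fst] using h1)
  have e2 : HasFamDeriv (fun z : E × ℝ => ε z.1) z (w, r) κ :=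
    HasFamDeriv.comp hε differentiableAt_fst (by simpa [fderiv_fst] using h2)
  refine e1.add (hγ.comp contDiff_fst) ((hε.comp contDiff_fst).smul contDiff_snd) ?_
  have := e2.smul (contDiff_snd (E := E) (F := ℝ) (𝕜 := ℝ) (n := ∞)) (hε.comp contDiff_fst)
  simpa [fderiv_snd] using this

theorem isSmoothFamily_segment (L ε : Fin m → Loop N) :
    IsSmoothFamily fun s : ℝ => L + s • ε :=
  (IsSmoothFamily.const L).add ((IsSmoothFamily.const ε).smul contDiff_id)

theorem hasFamDeriv_segment (L ε : Fin m → Loop N) (s : ℝ) :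
    HasFamDeriv (fun s : ℝ => L + s • ε) s 1 ε := by
  have := (hasFamDeriv_const L s (1 : ℝ)).add (IsSmoothFamily.const L)
    ((IsSmoothFamily.const ε).smul contDiff_id)
    ((hasFamDeriv_const ε s (1 : ℝ)).smul contDiff_id (IsSmoothFamily.const ε))
  simpa using this

/-- The segments L + sε test the gradient against every ε, and the pairing is nondegenerate. Hence
the choice made in `grad` is immaterial. -/
theorem HasSmoothGradient.unique {φ : (Fin m → Loop N) → ℝ}
    {G G' : (Fin m → Loop N) → Fin m → Loop N} (h : HasSmoothGradient φ G)
    (h' : HasSmoothGradient φ G') : G = G' := by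
  funext L
  refine eq_of_bigPair fun ε => ?_
  have e1 := h.fderiv_eq (isSmoothFamily_segment L ε) (hasFamDeriv_segment L ε 0)
  have e2 := h'.fderiv_eq (isSmoothFamily_segment L ε) (hasFamDeriv_segment L ε 0)
  simp only [zero_smul, add_zero] at e1 e2
  rw [← e1, e2]

theorem IsSmoothFun.hasSmoothGradient {φ : (Fin m → Loop N) → ℝ} (h : IsSmoothFun φ) :
    HasSmoothGradient φ (grad φ) := by
  rw [grad, dif_pos h]
  exact h.choose_spec

theorem HasSmoothGradient.grad_eq {φ : (Fin m → Loop N) → ℝ}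
    {G : (Fin m → Loop N) → Fin m → Loop N} (h : HasSmoothGradient φ G) : grad φ = G :=
  (IsSmoothFun.hasSmoothGradient ⟨G, h⟩).unique h

/-- The derivative of the gradient of `φ` at `L` in the direction `ε`. -/
theorem IsSmoothFun.exists_hess {φ : (Fin m → Loop N) → ℝ} (h : IsSmoothFun φ)
    (L ε : Fin m → Loop N) : ∃ κ, HasFamDeriv (fun s : ℝ => grad φ (L + s • ε)) 0 1 κ := by
  obtain ⟨δ, -, hδ⟩ := IsSmoothFamily.exists_deriv
    (h.hasSmoothGradient ℝ _ (isSmoothFamily_segment L ε)).2.1 1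
  exact ⟨δ 0, hδ 0⟩

open Classical in
/-- The Hessian of a smooth function. -/
def hess (φ : (Fin m → Loop N) → ℝ) (L ε : Fin m → Loop N) : Fin m → Loop N :=
  if h : IsSmoothFun φ then (IsSmoothFun.exists_hess h L ε).choose else 0

theorem IsSmoothFun.hess_spec {φ : (Fin m → Loop N) → ℝ} (h : IsSmoothFun φ)
    (L ε : Fin m → Loop N) :
    HasFamDeriv (fun s : ℝ => grad φ (L + s • ε)) 0 1 (hess φ L ε) := by
  rw [hess, dif_pos h]
  exact (IsSmoothFun.exists_hess h L ε).choose_spec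

/-- The Hessian along a family becomes the derivative in an additional real parameter s of one
smooth family over E × ℝ. This is how its smooth dependence on the point and on the direction is
obtained. -/
theorem hess_eq_of_hasFamDeriv [FiniteDimensional ℝ E] {φ : (Fin m → Loop N) → ℝ}
    (h : IsSmoothFun φ) {γ ε : E → Fin m → Loop N} (hγ : IsSmoothFamily γ)
    (hε : IsSmoothFamily ε) (x : E) {κ : Fin m → Loop N}
    (hκ : HasFamDeriv (fun z : E × ℝ => grad φ (γ z.1 + z.2 • ε z.1)) (x, 0) (0, 1) κ) :
    hess φ (γ x) (ε x) = κ := by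
  refine (h.hess_spec (γ x) (ε x)).unique ?_
  have hs := (h.hasSmoothGradient (E × ℝ) _ (isSmoothFamily_line hγ hε)).2.1
  have hf : HasFDerivAt (fun s : ℝ => ((x, s) : E × ℝ)) (ContinuousLinearMap.inr ℝ E ℝ) 0 :=
    hasFDerivAt_prodMk_right x 0
  refine HasFamDeriv.comp (γ := fun z : E × ℝ => grad φ (γ z.1 + z.2 • ε z.1))
    (f := fun s : ℝ => ((x, s) : E × ℝ)) hs hf.differentiableAt ?_
  rw [hf.fderiv]
  simpa using hκ

theorem isSmoothFamily_hess [FiniteDimensional ℝ E] {φ : (Fin m → Loop N) → ℝ}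
    (h : IsSmoothFun φ) {γ ε : E → Fin m → Loop N} (hγ : IsSmoothFamily γ)
    (hε : IsSmoothFamily ε) : IsSmoothFamily fun y => hess φ (γ y) (ε y) := by
  have hs := (h.hasSmoothGradient (E × ℝ) _ (isSmoothFamily_line hγ hε)).2.1
  obtain ⟨κ, h1, h2⟩ := IsSmoothFamily.exists_deriv hs (0, 1)
  have : (fun y => hess φ (γ y) (ε y)) = fun y => κ (y, 0) := by
    funext y
    exact hess_eq_of_hasFamDeriv h hγ hε y (h2 (y, 0))
  rw [this]
  exact h1.comp (contDiff_id.prodMk contDiff_const)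

/-- The derivative of a gradient along a family, paired with a constant vector. -/
theorem bigPair_deriv_grad [FiniteDimensional ℝ E] {φ : (Fin m → Loop N) → ℝ}
    (h : IsSmoothFun φ) {γ : E → Fin m → Loop N} (hγ : IsSmoothFamily γ) {x w : E}
    {δ κ : Fin m → Loop N} (hδ : HasFamDeriv γ x w δ)
    (hκ : HasFamDeriv (fun y => grad φ (γ y)) x w κ) (ε : Fin m → Loop N) :
    bigPair κ ε = bigPair (hess φ (γ x) ε) δ := by
  have hε : IsSmoothFamily fun _ : E => ε := IsSmoothFamily.const ε
  have hΓ := isSmoothFamily_line hγ hε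
  obtain ⟨δ', hδ's, hδ'⟩ := IsSmoothFamily.exists_deriv hγ w
  have hG := (h.hasSmoothGradient (E × ℝ) _ hΓ).2.1
  have hΦ := (h.hasSmoothGradient (E × ℝ) _ hΓ).1
  set Γ : E × ℝ → Fin m → Loop N := fun z => γ z.1 + z.2 • ε with hΓdef
  set Φ : E × ℝ → ℝ := fun z => φ (Γ z)
  obtain ⟨κ1, -, hκ1⟩ := IsSmoothFamily.exists_deriv hG (w, 0)
  obtain ⟨κ2, -, hκ2⟩ := IsSmoothFamily.exists_deriv hG (0, 1)
  have hA : (fun z => fderiv ℝ Φ z (0, 1)) = fun z => bigPair (grad φ (Γ z)) ε := by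
    funext z
    refine h.hasSmoothGradient.fderiv_eq hΓ ?_
    have h0 : HasFamDeriv γ z.1 0 0 := by intro i p j k; simp [coefMat_zero]
    simpa using hasFamDeriv_line hγ hε z h0 (hasFamDeriv_const ε z.1 0) 1
  have hB : (fun z => fderiv ℝ Φ z (w, 0)) = fun z => bigPair (grad φ (Γ z)) (δ' z.1) := by
    funext z
    refine h.hasSmoothGradient.fderiv_eq hΓ ?_
    simpa using hasFamDeriv_line hγ hε z (hδ' z.1) (hasFamDeriv_const ε z.1 w) 0
  -- The mixed second derivatives of φ(γ(y) + sε) agree. Differentiating first in s produces the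
  -- derivative of the gradient along γ paired with ε; differentiating first along w produces the
  -- Hessian in the direction ε paired with δ.
  have hsym : fderiv ℝ (fun z => fderiv ℝ Φ z (0, 1)) (x, 0) (w, 0)
      = fderiv ℝ (fun z => fderiv ℝ Φ z (w, 0)) (x, 0) (0, 1) := by
    have hd : DifferentiableAt ℝ (fderiv ℝ Φ) (x, (0 : ℝ)) :=
      (hΦ.fderiv_right (m := ∞) (by simp)).differentiable (by simp) _
    have hs : IsSymmSndFDerivAt ℝ Φ (x, (0 : ℝ)) :=
      hΦ.contDiffAt.isSymmSndFDerivAt (by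
        rw [minSmoothness_of_isRCLikeNormedField]; exact WithTop.coe_le_coe.2 (le_top : (2 : ℕ∞) ≤ ⊤))
    rw [fderiv_clm_apply hd (differentiableAt_const _),
      fderiv_clm_apply hd (differentiableAt_const _)]
    simpa using hs.eq (w, 0) (0, 1)
  have hδ'0 : HasFamDeriv (fun z : E × ℝ => δ' z.1) (x, 0) (0, 1) 0 := by
    refine HasFamDeriv.comp hδ's differentiableAt_fst ?_
    intro i p j k
    simp [fderiv_fst, coefMat_zero]
  rw [hA, hB, fderiv_bigPair hG (IsSmoothFamily.const ε) (hκ1 _) (hasFamDeriv_const _ _ _),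
    fderiv_bigPair hG (hδ's.comp contDiff_fst) (hκ2 _) hδ'0] at hsym
  have e1 : κ1 (x, 0) = κ := by
    have hs : IsSmoothFamily fun y => grad φ (γ y) := (h.hasSmoothGradient E γ hγ).2.1
    have hf : HasFDerivAt (fun y : E => ((y, 0) : E × ℝ)) (ContinuousLinearMap.inl ℝ E ℝ) x :=
      hasFDerivAt_prodMk_left x 0
    have := HasFamDeriv.comp (γ := fun z => grad φ (Γ z)) (f := fun y : E => ((y, 0) : E × ℝ))
      (x := x) (w := w) (δ := κ1 (x, 0)) hG hf.differentiableAt (by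
        rw [hf.fderiv]; simpa using hκ1 (x, 0))
    simp only [hΓdef, zero_smul, add_zero] at this
    exact this.unique hκ
  have e2 : hess φ (γ x) ε = κ2 (x, 0) := hess_eq_of_hasFamDeriv h hγ hε x (hκ2 (x, 0))
  have e3 : δ' x = δ := (hδ' x).unique hδ
  have z1 : ∀ a : Fin m → Loop N, bigPair a 0 = 0 := fun a => (bigPairLin N m a).map_zero
  rw [e1] at hsym
  rw [z1, add_zero, add_zero] at hsym
  rw [e2, hsym, ← e3]

theorem bigPair_hess_symm {φ : (Fin m → Loop N) → ℝ} (h : IsSmoothFun φ)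
    (L δ ε : Fin m → Loop N) : bigPair (hess φ L δ) ε = bigPair (hess φ L ε) δ := by
  have := bigPair_deriv_grad h (isSmoothFamily_segment L δ) (hasFamDeriv_segment L δ 0)
    (h.hess_spec L δ) ε
  simpa using this

end Families

/-! ## The quadratic r-matrix bracket -/

namespace Loop

variable {N : ℕ}

theorem coefMat_piPlus (L : Loop N) (p : ℤ) :
    coefMat p (piPlus N L) = if 0 ≤ p then coefMat p L else 0 := by
  ext i j
  change ((truncPlus L).mat i j).coeff (-p) = _
  rw [coeff_truncPlus]
  by_cases h : 0 ≤ p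
  · rw [if_pos h, if_pos (by lia)]; rfl
  · rw [if_neg h, if_neg (by lia)]; rfl

theorem coefMat_piMinus (L : Loop N) (p : ℤ) :
    coefMat p (piMinus N L) = if p < 0 then coefMat p L else 0 := by
  change coefMat p (L - piPlus N L) = _
  rw [coefMat_sub, coefMat_piPlus]
  by_cases h : 0 ≤ p
  · rw [if_pos h, if_neg (by lia), sub_self]
  · rw [if_neg h, if_pos (by lia), sub_zero]

theorem coefMat_zero_eq_diagonal (L : Loop N) :
    coefMat 0 L = Matrix.diagonal (freeDiag N L) := by
  ext i j
  rw [Matrix.diagonal_apply]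
  by_cases h : i = j
  · subst h; rw [if_pos rfl]; rfl
  · rw [if_neg h]
    exact coefMat_twisted L 0 i j (by rwa [sub_modEq_zero_iff])

theorem coefMat_diagLin (d : Fin N → ℝ) (p : ℤ) :
    coefMat p (diagLin N d) = if p = 0 then Matrix.diagonal d else 0 := by
  change coefMat p (diagShift 0 d) = _
  by_cases h : p = 0
  · subst h; rw [if_pos rfl, coefMat_diagShift_zero]
  · rw [if_neg h, coefMat_diagShift_of_ne h]

theorem coefMat_opP0 (L : Loop N) (p : ℤ) :
    coefMat p (opP0 N L) = if p = 0 then coefMat 0 L else 0 := by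
  change coefMat p (diagLin N (freeDiag N L)) = _
  rw [coefMat_diagLin, coefMat_zero_eq_diagonal]

theorem coefMat_opR0 (L : Loop N) (p : ℤ) :
    coefMat p (opR0 N L) = (SignType.sign p : ℝ) • coefMat p L := by
  change coefMat p (piPlus N L - (piMinus N L) - opP0 N L) = _
  rw [coefMat_sub, coefMat_sub, coefMat_piPlus, coefMat_piMinus, coefMat_opP0]
  rcases lt_trichotomy p 0 with h | h | h
  · rw [if_neg (by lia), if_pos h, if_neg (by lia), sign_neg h]; simp
  · subst h; simp
  · rw [if_pos h.le, if_neg (by lia), if_neg (by lia), sign_pos h]; simp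

theorem loopPair_opR0 (a b : Loop N) : loopPair (opR0 N a) b = -loopPair a (opR0 N b) := by
  obtain ⟨P, hP⟩ := exists_degLE a
  obtain ⟨Q, hQ⟩ := exists_degLE b
  have hP' : DegLE P (opR0 N a) := fun p hp => by rw [coefMat_opR0, hP p hp, smul_zero]
  have hQ' : DegLE Q (opR0 N b) := fun p hp => by rw [coefMat_opR0, hQ p hp, smul_zero]
  rw [loopPair_eq_sum hP' hQ, loopPair_eq_sum hP hQ', ← Finset.sum_neg_distrib]
  refine Finset.sum_congr rfl fun q _ => ?_
  rw [coefMat_opR0, coefMat_opR0, Left.sign_neg, Matrix.smul_mul, Matrix.mul_smul,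
    Matrix.trace_smul, Matrix.trace_smul]
  simp

/-- Concentrated in degree zero. -/
def DegZero (d : Loop N) : Prop := ∀ p, p ≠ 0 → coefMat p d = 0

theorem coefMat_mul_of_nonneg {a b : Loop N} (ha : ∀ p < 0, coefMat p a = 0)
    (hb : ∀ p < 0, coefMat p b = 0) (p : ℤ) (hp : p ≤ 0) :
    coefMat p (a * b) = if p = 0 then coefMat 0 a * coefMat 0 b else 0 := by
  rw [coefMat_mul_eq_finsum]
  split_ifs with h
  · subst h
    rw [finsum_eq_single _ 0, zero_sub, neg_zero]
    intro q hq
    rcases lt_or_gt_of_ne hq with h | h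
    · rw [ha q h, zero_mul]
    · rw [hb _ (by lia), mul_zero]
  · refine finsum_eq_zero_of_forall_eq_zero fun q => ?_
    by_cases hq : q < 0
    · rw [ha q hq, zero_mul]
    · rw [hb _ (by lia), mul_zero]

theorem coefMat_mul_of_nonpos {a b : Loop N} (ha : ∀ p > 0, coefMat p a = 0)
    (hb : ∀ p > 0, coefMat p b = 0) (p : ℤ) (hp : 0 ≤ p) :
    coefMat p (a * b) = if p = 0 then coefMat 0 a * coefMat 0 b else 0 := by
  rw [coefMat_mul_eq_finsum]
  split_ifs with h
  · subst h
    rw [finsum_eq_single _ 0, zero_sub, neg_zero]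
    intro q hq
    rcases lt_or_gt_of_ne hq with h | h
    · rw [hb _ (by lia), mul_zero]
    · rw [ha q h, zero_mul]
  · refine finsum_eq_zero_of_forall_eq_zero fun q => ?_
    by_cases hq : 0 < q
    · rw [ha q hq, zero_mul]
    · rw [hb _ (by lia), mul_zero]

theorem coefMat_zero_commute (a b : Loop N) :
    coefMat 0 a * coefMat 0 b = coefMat 0 b * coefMat 0 a := by
  rw [coefMat_zero_eq_diagonal, coefMat_zero_eq_diagonal, Matrix.diagonal_mul_diagonal,
    Matrix.diagonal_mul_diagonal]
  congr 1
  funext i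
  ring

/-- In degree zero only the two free terms meet. They are diagonal matrices and commute, so the
commutator starts strictly above degree zero. This makes the diagonal corrections to R₀ harmless. -/
theorem coefMat_bracket_of_nonneg {a b : Loop N} (ha : ∀ p < 0, coefMat p a = 0)
    (hb : ∀ p < 0, coefMat p b = 0) (p : ℤ) (hp : p ≤ 0) : coefMat p (a * b - b * a) = 0 := by
  rw [coefMat_sub, coefMat_mul_of_nonneg ha hb p hp, coefMat_mul_of_nonneg hb ha p hp,
    coefMat_zero_commute, sub_self]

theorem coefMat_bracket_of_nonpos {a b : Loop N} (ha : ∀ p > 0, coefMat p a = 0)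
    (hb : ∀ p > 0, coefMat p b = 0) (p : ℤ) (hp : 0 ≤ p) : coefMat p (a * b - b * a) = 0 := by
  rw [coefMat_sub, coefMat_mul_of_nonpos ha hb p hp, coefMat_mul_of_nonpos hb ha p hp,
    coefMat_zero_commute, sub_self]

theorem opR0_of_pos {c : Loop N} (h : ∀ p ≤ 0, coefMat p c = 0) : opR0 N c = c := by
  refine coefMat_ext fun p => ?_
  rw [coefMat_opR0]
  by_cases hp : p ≤ 0
  · rw [h p hp, smul_zero]
  · rw [sign_pos (by lia)]; simp

theorem opR0_of_neg {c : Loop N} (h : ∀ p, 0 ≤ p → coefMat p c = 0) : opR0 N c = -c := by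
  refine coefMat_ext fun p => ?_
  rw [coefMat_opR0, coefMat_neg]
  by_cases hp : 0 ≤ p
  · rw [h p hp, smul_zero, neg_zero]
  · rw [sign_neg (by lia)]; simp

/-- The modified Yang–Baxter equation, up to terms of degree zero. -/
theorem opR0_yang_baxter {a a' d d' x x' : Loop N} (hd : DegZero d) (hd' : DegZero d')
    (hx : x = opR0 N a + d) (hx' : x' = opR0 N a' + d') :
    (x * x' - x' * x) + (a * a' - a' * a)
      = opR0 N ((x * a' - a' * x) + (a * x' - x' * a)) ∧
    coefMat 0 ((x * a' - a' * x) + (a * x' - x' * a)) = 0 := by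
  -- R₀ multiplies the coefficient of λᵖ by the sign of p. Hence x + a has no negative powers and x
  -- − a no positive ones, whatever the diagonal d is.
  have hpos : ∀ {a d x : Loop N}, DegZero d → x = opR0 N a + d →
      ∀ p < 0, coefMat p (x + a) = 0 := by
    intro a d x hd hx p hp
    rw [hx, coefMat_add, coefMat_add, coefMat_opR0, hd p hp.ne, sign_neg hp]
    simp
  have hneg : ∀ {a d x : Loop N}, DegZero d → x = opR0 N a + d →
      ∀ p > 0, coefMat p (x - a) = 0 := by
    intro a d x hd hx p hp
    rw [hx, coefMat_sub, coefMat_add, coefMat_opR0, hd p hp.ne', sign_pos hp]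
    simp
  have h1 := coefMat_bracket_of_nonneg (hpos hd hx) (hpos hd' hx')
  have h2 := coefMat_bracket_of_nonpos (hneg hd hx) (hneg hd' hx')
  set c1 := (x + a) * (x' + a') - (x' + a') * (x + a) with hc1
  set c2 := (x - a) * (x' - a') - (x' - a') * (x - a) with hc2
  -- The commutators c1 of the sums and c2 of the differences are strictly positive and strictly
  -- negative in degree. R₀ therefore fixes c1 and negates c2, which turns c1 − c2 into c1 + c2.
  have e1 : (2 : ℝ) • ((x * x' - x' * x) + (a * a' - a' * a)) = c1 + c2 := by
    rw [hc1, hc2, two_smul]; noncomm_ring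
  have e2 : (2 : ℝ) • ((x * a' - a' * x) + (a * x' - x' * a)) = c1 - c2 := by
    rw [hc1, hc2, two_smul]; noncomm_ring
  have h20 : (2 : ℝ) ≠ 0 := two_ne_zero
  constructor
  · refine smul_right_injective (Loop N) h20 ?_
    simp only
    rw [e1, ← map_smul, e2, map_sub, opR0_of_pos h1, opR0_of_neg h2, sub_neg_eq_add]
  · refine smul_right_injective _ h20 ?_
    simp only
    rw [← coefMat_smul, e2, coefMat_sub, h1 0 le_rfl, h2 0 le_rfl, sub_zero, smul_zero]

theorem loopPair_degZero {c d : Loop N} (hc : coefMat 0 c = 0) (hd : DegZero d) :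
    loopPair c d = 0 := by
  obtain ⟨P, hP⟩ := exists_degLE c
  obtain ⟨Q, hQ⟩ := exists_degLE d
  rw [loopPair_eq_sum hP hQ]
  refine Finset.sum_eq_zero fun q _ => ?_
  by_cases hq : q = 0
  · subst hq; rw [hc]; simp
  · rw [hd (-q) (by lia)]; simp

theorem loopPair_mul_cycle (a b c : Loop N) : loopPair (a * b) c = loopPair (b * c) a := by
  rw [loopPair_mul_left, loopPair_comm]

theorem loopPair_bracket_cycle (a b c : Loop N) :
    loopPair (a * b - b * a) c = loopPair (b * c - c * b) a := by
  rw [loopPair_sub_left, loopPair_sub_left, loopPair_mul_cycle a b c, loopPair_mul_cycle c b a,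
    loopPair_mul_cycle b a c, loopPair_mul_cycle a c b]

/-- This is the form of the Yang–Baxter equation that the Jacobi identity uses. The diagonal terms
disappear since the mixed bracket has no free term. The right-hand side depends only on the
arguments of R₀. -/
theorem loopPair_bracket_sum {a₁ a₂ a₃ d₁ d₂ d₃ x₁ x₂ x₃ : Loop N} (hd₁ : DegZero d₁)
    (hd₂ : DegZero d₂) (hd₃ : DegZero d₃) (hx₁ : x₁ = opR0 N a₁ + d₁)
    (hx₂ : x₂ = opR0 N a₂ + d₂) (hx₃ : x₃ = opR0 N a₃ + d₃) :
    loopPair (x₁ * x₂ - x₂ * x₁) a₃ + loopPair (x₂ * x₃ - x₃ * x₂) a₁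
      + loopPair (x₃ * x₁ - x₁ * x₃) a₂ = -loopPair (a₁ * a₂ - a₂ * a₁) a₃ := by
  have key : ∀ {a₁ a₂ a₃ d₁ d₂ d₃ x₁ x₂ x₃ : Loop N}, DegZero d₁ → DegZero d₂ → DegZero d₃ →
      x₁ = opR0 N a₁ + d₁ → x₂ = opR0 N a₂ + d₂ → x₃ = opR0 N a₃ + d₃ →
      loopPair (x₁ * x₂ - x₂ * x₁) a₃ = -loopPair (x₂ * x₃ - x₃ * x₂) a₁
        - loopPair (x₃ * x₁ - x₁ * x₃) a₂ - loopPair (a₁ * a₂ - a₂ * a₁) a₃ := by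
    intro a₁ a₂ a₃ d₁ d₂ d₃ x₁ x₂ x₃ hd₁ hd₂ hd₃ hx₁ hx₂ hx₃
    obtain ⟨h1, h2⟩ := opR0_yang_baxter hd₁ hd₂ hx₁ hx₂
    set c := (x₁ * a₂ - a₂ * x₁) + (a₁ * x₂ - x₂ * a₁) with hc
    -- By skewness R₀ moves to a₃, and there it may be replaced by x₃, because c is orthogonal to
    -- degree zero.
    have e1 : loopPair (opR0 N c) a₃ = -loopPair c x₃ := by
      rw [loopPair_opR0, hx₃, loopPair_add_right, loopPair_degZero h2 hd₃, add_zero]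
    have e2 : loopPair c x₃ = loopPair (x₂ * x₃ - x₃ * x₂) a₁
        + loopPair (x₃ * x₁ - x₁ * x₃) a₂ := by
      rw [hc, loopPair_add_left, loopPair_bracket_cycle a₁ x₂ x₃,
        loopPair_bracket_cycle x₁ a₂ x₃, loopPair_bracket_cycle a₂ x₃ x₁, add_comm]
    have e3 : loopPair (x₁ * x₂ - x₂ * x₁) a₃ + loopPair (a₁ * a₂ - a₂ * a₁) a₃
        = loopPair (opR0 N c) a₃ := by rw [← loopPair_add_left, h1]
    rw [e1, e2] at e3
    linarith
  have k1 := key hd₁ hd₂ hd₃ hx₁ hx₂ hx₃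
  linarith

end Loop

/-! ### The Poisson property of `PB2` for general operators -/

section Bracket

variable {N m : ℕ}

/-- The operator `T` in every component. -/
def compOp (m : ℕ) (T : Module.End ℝ (Loop N)) : Module.End ℝ (Fin m → Loop N) :=
  LinearMap.pi fun i => T ∘ₗ LinearMap.proj i

theorem compOp_apply (T : Module.End ℝ (Loop N)) (x : Fin m → Loop N) (i : Fin m) :
    compOp m T x i = T (x i) := rfl

/-- Operators with values in degree zero which depend on the free terms only. -/
structure IsDiagOp (K : Module.End ℝ (Fin m → Loop N)) : Prop where
  degZero : ∀ x i, DegZero (K x i)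
  eq_zero : ∀ x, (∀ i, coefMat 0 (x i) = 0) → K x = 0

/-- Such an operator has finite rank: it is determined by finitely many diagonal entries of the free
terms. On a family it is thus a finite combination of fixed vectors with smooth coefficients, which
can be differentiated. -/
theorem IsDiagOp.eq_sum {K : Module.End ℝ (Fin m → Loop N)} (hK : IsDiagOp K)
    (x : Fin m → Loop N) : K x = ∑ j, ∑ k, coefMat 0 (x j) k k •
      K (Pi.single j (diagShift 0 (Pi.single k 1))) := by
  have h1 : K (x - compOp m (opP0 N) x) = 0 := hK.eq_zero _ fun i => by
    rw [Pi.sub_apply, coefMat_sub, compOp_apply, coefMat_opP0, if_pos rfl, sub_self]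
  rw [map_sub, sub_eq_zero] at h1
  rw [h1]
  simp only [← map_smul, ← map_sum]
  congr 1
  funext i
  rw [Finset.sum_apply, Finset.sum_eq_single i]
  · rw [Finset.sum_apply, compOp_apply]
    change diagLin N (freeDiag N (x i)) = _
    conv_lhs => rw [← Finset.univ_sum_single (freeDiag N (x i)), map_sum]
    refine Finset.sum_congr rfl fun k _ => ?_
    rw [Pi.smul_apply, Pi.single_eq_same]
    change _ = _ • diagLin N (Pi.single k 1)
    rw [← map_smul]
    congr 1
    funext l
    by_cases h : l = k
    · subst h; simp [freeDiag]; rfl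
    · simp [h]
  · intro j _ hj
    rw [Finset.sum_apply]
    exact Finset.sum_eq_zero fun k _ => by
      rw [Pi.smul_apply, Pi.single_eq_of_ne hj.symm, smul_zero]
  · simp

/-- Operators which respect smooth families and their derivatives. -/
def IsSmoothOp (A : Module.End ℝ (Fin m → Loop N)) : Prop :=
  ∀ (E : Type) [NormedAddCommGroup E] [NormedSpace ℝ E] (γ : E → Fin m → Loop N),
    IsSmoothFamily γ → IsSmoothFamily (fun y => A (γ y)) ∧
      ∀ x w δ, HasFamDeriv γ x w δ → HasFamDeriv (fun y => A (γ y)) x w (A δ)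

theorem isSmoothOp_compOp_opR0 : IsSmoothOp (compOp m (opR0 N)) := by
  intro E _ _ γ hγ
  rw [isSmoothFamily_iff] at hγ
  refine ⟨isSmoothFamily_iff.2 fun i => ⟨fun x => ?_, fun p j k => ?_⟩, fun x w δ hδ i p j k => ?_⟩
  · obtain ⟨P, hP⟩ := (hγ i).1 x
    refine ⟨P, hP.mono fun y hy p hp => ?_⟩
    change coefMat p (opR0 N (γ y i)) = 0
    rw [coefMat_opR0, show coefMat p (γ y i) = 0 from hy p hp, smul_zero]
  · simp only [compOp_apply, coefMat_opR0, Matrix.smul_apply, smul_eq_mul]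
    exact contDiff_const.mul ((hγ i).2 p j k)
  · simp only [compOp_apply, coefMat_opR0, Matrix.smul_apply, smul_eq_mul]
    rw [fderiv_const_mul ((hγ i).differentiable p j k x), hδ i p j k]
    rfl

theorem IsSmoothOp.add {A B : Module.End ℝ (Fin m → Loop N)} (hA : IsSmoothOp A)
    (hB : IsSmoothOp B) : IsSmoothOp (A + B) := by
  intro E _ _ γ hγ
  exact ⟨(hA E γ hγ).1.add (hB E γ hγ).1, fun x w δ hδ => ((hA E γ hγ).2 x w δ hδ).add
    (hA E γ hγ).1 (hB E γ hγ).1 ((hB E γ hγ).2 x w δ hδ)⟩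

theorem IsDiagOp.isSmoothOp {K : Module.End ℝ (Fin m → Loop N)} (hK : IsDiagOp K) :
    IsSmoothOp K := by
  intro E _ _ γ hγ
  rw [isSmoothFamily_iff] at hγ
  have hs : ∀ i, ∀ j k, SmoothLoop fun y => coefMat 0 (γ y j) k k •
      K (Pi.single j (diagShift 0 (Pi.single k 1))) i :=
    fun i j k => SmoothLoop.smul ((hγ j).2 0 k k) (SmoothLoop.const _)
  constructor
  · rw [isSmoothFamily_iff]
    intro i
    have : (fun y => K (γ y) i) = fun y => ∑ j, ∑ k, coefMat 0 (γ y j) k k •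
        K (Pi.single j (diagShift 0 (Pi.single k 1))) i := by
      funext y
      conv_lhs => rw [hK.eq_sum]
      simp only [Finset.sum_apply, Pi.smul_apply]
    rw [this]
    exact SmoothLoop.sum _ fun j => SmoothLoop.sum _ fun k => hs i j k
  · intro x w δ hδ i
    have : (fun y => K (γ y) i) = fun y => ∑ j, ∑ k, coefMat 0 (γ y j) k k •
        K (Pi.single j (diagShift 0 (Pi.single k 1))) i := by
      funext y
      conv_lhs => rw [hK.eq_sum]
      simp only [Finset.sum_apply, Pi.smul_apply]
    rw [this, hK.eq_sum]
    simp only [Finset.sum_apply, Pi.smul_apply]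
    refine HasLoopDeriv.sum _ (fun j => SmoothLoop.sum _ fun k => hs i j k) fun j =>
      HasLoopDeriv.sum _ (fun k => hs i j k) fun k => ?_
    have := HasLoopDeriv.smul ((hγ j).2 0 k k) (SmoothLoop.const
      (K (Pi.single j (diagShift 0 (Pi.single k 1))) i)) (hasLoopDeriv_const _ x w)
    rw [smul_zero, zero_add, ← hδ j 0 k k] at this
    exact this

/-- The operators `A₁`, `A₂`, `S` and the adjoint `T` of `S` which define a Poisson bracket. -/
structure IsRMatrix (A1 A2 S T : Module.End ℝ (Fin m → Loop N)) : Prop where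
  diag1 : IsDiagOp (A1 - compOp m (opR0 N))
  diag2 : IsDiagOp (A2 - compOp m (opR0 N))
  diagS : IsDiagOp S
  diagT : IsDiagOp T
  skew1 : ∀ a b, bigPair (A1 a) b = -bigPair a (A1 b)
  skew2 : ∀ a b, bigPair (A2 a) b = -bigPair a (A2 b)
  adj : ∀ a b, bigPair (S a) b = bigPair a (T b)

section
variable {a b c : Fin m → Loop N}
theorem bigPair_add_left : bigPair (a + b) c = bigPair a c + bigPair b c :=
  (bigPairLin N m).map_add₂ a b c
theorem bigPair_add_right : bigPair a (b + c) = bigPair a b + bigPair a c :=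
  (bigPairLin N m a).map_add b c
theorem bigPair_sub_left : bigPair (a - b) c = bigPair a c - bigPair b c :=
  (bigPairLin N m).map_sub₂ a b c
theorem bigPair_sub_right : bigPair a (b - c) = bigPair a b - bigPair a c :=
  (bigPairLin N m a).map_sub b c
theorem bigPair_smul_left (r : ℝ) : bigPair (r • a) b = r * bigPair a b :=
  (bigPairLin N m).map_smul₂ r a b
theorem bigPair_smul_right (r : ℝ) : bigPair a (r • b) = r * bigPair a b :=
  (bigPairLin N m a).map_smul r b
end

theorem bigPair_mul_cycle (a b c : Fin m → Loop N) : bigPair (a * b) c = bigPair (b * c) a := by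
  rw [bigPair_mul_left, bigPair_comm]

variable {A1 A2 S T : Module.End ℝ (Fin m → Loop N)}

/-- The first component of `(A₁, S; S*, A₂)` applied to `(g L, L g)`. -/
def hamX (A1 S : Module.End ℝ (Fin m → Loop N)) (L g : Fin m → Loop N) : Fin m → Loop N :=
  A1 (g * L) + S (L * g)

/-- The second component of `(A₁, S; S*, A₂)` applied to `(g L, L g)`. -/
def hamY (A2 T : Module.End ℝ (Fin m → Loop N)) (L g : Fin m → Loop N) : Fin m → Loop N :=
  A2 (L * g) + T (g * L)

/-- Twice the Hamiltonian vector field of a function with gradient `g`. -/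
def hamVec (A1 A2 S T : Module.End ℝ (Fin m → Loop N)) (L g : Fin m → Loop N) :
    Fin m → Loop N := L * hamX A1 S L g - hamY A2 T L g * L

theorem PB2_eq_hamX (h : IsRMatrix A1 A2 S T) (φ ψ : (Fin m → Loop N) → ℝ) (L : Fin m → Loop N) :
    PB2 A1 A2 S φ ψ L = (1 / 2) * (bigPair (hamX A1 S L (grad φ L)) (grad ψ L * L)
      - bigPair (hamY A2 T L (grad φ L)) (L * grad ψ L)) := by
  rw [PB2, hamX, hamY, bigPair_add_left, bigPair_add_left,
    bigPair_comm (grad φ L * L) (S _), h.adj (L * grad ψ L), bigPair_comm _ (T _)]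
  ring

/-- Cyclicity of the pairing isolates ∇ψ. The bracket becomes the derivative of ψ along a vector
that depends on φ only. -/
theorem PB2_eq_hamVec (h : IsRMatrix A1 A2 S T) (φ ψ : (Fin m → Loop N) → ℝ)
    (L : Fin m → Loop N) :
    PB2 A1 A2 S φ ψ L = (1 / 2) * bigPair (hamVec A1 A2 S T L (grad φ L)) (grad ψ L) := by
  rw [PB2_eq_hamX h, hamVec, bigPair_sub_left, bigPair_mul_cycle L, bigPair_mul_left _ (grad ψ L) L,
    bigPair_mul_left (hamY _ _ _ _)]

/-- The operator with blocks A₁, S, S*, A₂ is skew for the indefinite form ⟨a, a'⟩ − ⟨b, b'⟩. Here a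
and b are arbitrary, so the identity also applies to derivatives of (∇φ L, L ∇φ), which need not
have that shape. -/
theorem bigPair_hamX_skew (h : IsRMatrix A1 A2 S T) (L f : Fin m → Loop N)
    (a b : Fin m → Loop N) :
    bigPair (A1 a + S b) (f * L) - bigPair (A2 b + T a) (L * f)
      = -(bigPair a (hamX A1 S L f) - bigPair b (hamY A2 T L f)) := by
  rw [hamX, hamY, bigPair_add_left, bigPair_add_left, bigPair_add_right, bigPair_add_right,
    h.skew1, h.skew2, h.adj b, bigPair_comm (T a), ← h.adj (L * f) a, bigPair_comm (S _) a]
  ring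

theorem PB2_skew (h : IsRMatrix A1 A2 S T) (φ ψ : (Fin m → Loop N) → ℝ) :
    PB2 A1 A2 S φ ψ = -PB2 A1 A2 S ψ φ := by
  funext L
  have := bigPair_hamX_skew h L (grad ψ L) (grad φ L * L) (L * grad φ L)
  rw [Pi.neg_apply, PB2_eq_hamX h φ, PB2_eq_hamX h ψ]
  rw [hamX, hamY, this, bigPair_comm _ (grad φ L * L), bigPair_comm _ (L * grad φ L)]
  ring

/-- One half of the gradient of a bracket. -/
def bracketGrad (A1 A2 S T : Module.End ℝ (Fin m → Loop N)) (φ ψ : (Fin m → Loop N) → ℝ)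
    (L : Fin m → Loop N) : Fin m → Loop N :=
  hess ψ L (hamVec A1 A2 S T L (grad φ L))
    + (hamX A1 S L (grad φ L) * grad ψ L - grad ψ L * hamY A2 T L (grad φ L))

theorem IsRMatrix.isSmoothOp1 (h : IsRMatrix A1 A2 S T) : IsSmoothOp A1 := by
  simpa using h.diag1.isSmoothOp.add isSmoothOp_compOp_opR0

theorem IsRMatrix.isSmoothOp2 (h : IsRMatrix A1 A2 S T) : IsSmoothOp A2 := by
  simpa using h.diag2.isSmoothOp.add isSmoothOp_compOp_opR0

section Family

variable {E : Type} [NormedAddCommGroup E] [NormedSpace ℝ E]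

theorem IsSmoothFamily.hamX (h : IsRMatrix A1 A2 S T) {γ η : E → Fin m → Loop N}
    (hγ : IsSmoothFamily γ) (hη : IsSmoothFamily η) :
    IsSmoothFamily fun y => hamX A1 S (γ y) (η y) :=
  (h.isSmoothOp1 E _ (hη.mul hγ)).1.add (h.diagS.isSmoothOp E _ (hγ.mul hη)).1

theorem IsSmoothFamily.hamY (h : IsRMatrix A1 A2 S T) {γ η : E → Fin m → Loop N}
    (hγ : IsSmoothFamily γ) (hη : IsSmoothFamily η) :
    IsSmoothFamily fun y => hamY A2 T (γ y) (η y) :=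
  (h.isSmoothOp2 E _ (hγ.mul hη)).1.add (h.diagT.isSmoothOp E _ (hη.mul hγ)).1

theorem IsSmoothFamily.bracketGrad [FiniteDimensional ℝ E] (h : IsRMatrix A1 A2 S T)
    {φ ψ : (Fin m → Loop N) → ℝ} (hφ : IsSmoothFun φ) (hψ : IsSmoothFun ψ)
    {γ : E → Fin m → Loop N} (hγ : IsSmoothFamily γ) :
    IsSmoothFamily fun y => bracketGrad A1 A2 S T φ ψ (γ y) := by
  have h1 := (hφ.hasSmoothGradient E γ hγ).2.1
  have h2 := (hψ.hasSmoothGradient E γ hγ).2.1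
  have hX := IsSmoothFamily.hamX h hγ h1
  have hY := IsSmoothFamily.hamY h hγ h1
  exact (isSmoothFamily_hess hψ hγ ((hγ.mul hX).sub (hY.mul hγ))).add
    ((hX.mul h2).sub (h2.mul hY))

/-- When the bracket is varied, this separates the change κ of the gradient from the change δ of the
point. The former turns into a Hessian, the latter into the part X g − g Y of `bracketGrad`. -/
theorem bigPair_bracketGrad {x y g L δ κ : Fin m → Loop N} :
    bigPair (κ * L + g * δ) x - bigPair (δ * g + L * κ) y
      = bigPair κ (L * x - y * L) + bigPair (x * g - g * y) δ := by
  rw [bigPair_add_left, bigPair_add_left, bigPair_sub_right, bigPair_sub_left,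
    bigPair_mul_left κ, bigPair_mul_cycle g δ, bigPair_mul_cycle δ g, bigPair_mul_cycle L κ,
    bigPair_mul_left κ, bigPair_mul_left δ, bigPair_comm δ (x * g)]
  ring

end Family

/-- The Leibniz rule gives the variation of the bracket. Symmetry of second derivatives
(`bigPair_deriv_grad`) rewrites the variations of ∇φ and ∇ψ as Hessians paired with δ, and skewness
gives both functions the same form up to sign. So the bracket again has a gradient, and brackets can
be iterated. -/
theorem hasSmoothGradient_PB2 (h : IsRMatrix A1 A2 S T) {φ ψ : (Fin m → Loop N) → ℝ}
    (hφ : IsSmoothFun φ) (hψ : IsSmoothFun ψ) :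
    HasSmoothGradient (PB2 A1 A2 S φ ψ) fun L => (1 / 2 : ℝ) •
      (bracketGrad A1 A2 S T φ ψ L - bracketGrad A1 A2 S T ψ φ L) := by
  intro E _ _ _ γ hγ
  have h1 := (hφ.hasSmoothGradient E γ hγ).2.1
  have h2 := (hψ.hasSmoothGradient E γ hγ).2.1
  have hX := IsSmoothFamily.hamX h hγ h1
  have hY := IsSmoothFamily.hamY h hγ h1
  have c1 := hX.contDiff_pair (h2.mul hγ)
  have c2 := hY.contDiff_pair (hγ.mul h2)
  simp only [PB2_eq_hamX h]
  refine ⟨contDiff_const.mul (c1.sub c2), (((IsSmoothFamily.bracketGrad h hφ hψ hγ).sub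
    (IsSmoothFamily.bracketGrad h hψ hφ hγ)).const_smul _), fun x w δ hδ => ?_⟩
  have hδ : HasFamDeriv γ x w δ := hδ
  obtain ⟨κ1', -, hκ1'⟩ := IsSmoothFamily.exists_deriv h1 w
  obtain ⟨κ2', -, hκ2'⟩ := IsSmoothFamily.exists_deriv h2 w
  have hκ1 := hκ1' x
  have hκ2 := hκ2' x
  set κ1 := κ1' x
  set κ2 := κ2' x
  have da1 := hκ1.mul h1 hγ hδ
  have db1 := hδ.mul hγ h1 hκ1
  have da2 := hκ2.mul h2 hγ hδ
  have db2 := hδ.mul hγ h2 hκ2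
  have dX := ((h.isSmoothOp1 E _ (h1.mul hγ)).2 _ _ _ da1).add (h.isSmoothOp1 E _ (h1.mul hγ)).1
    (h.diagS.isSmoothOp E _ (hγ.mul h1)).1 ((h.diagS.isSmoothOp E _ (hγ.mul h1)).2 _ _ _ db1)
  have dY := ((h.isSmoothOp2 E _ (hγ.mul h1)).2 _ _ _ db1).add (h.isSmoothOp2 E _ (hγ.mul h1)).1
    (h.diagT.isSmoothOp E _ (h1.mul hγ)).1 ((h.diagT.isSmoothOp E _ (h1.mul hγ)).2 _ _ _ da1)
  rw [fderiv_const_mul ((c1.sub c2).differentiable (by simp) x), fderiv_fun_sub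
    (c1.differentiable (by simp) x) (c2.differentiable (by simp) x)]
  have e1 := fderiv_bigPair hX (h2.mul hγ) dX da2
  have e2 := fderiv_bigPair hY (hγ.mul h2) dY db2
  simp only [smul_apply, sub_apply, e1, e2, smul_eq_mul]
  have e3 := bigPair_hamX_skew h (γ x) (grad ψ (γ x)) (κ1 * γ x + grad φ (γ x) * δ)
    (δ * grad φ (γ x) + γ x * κ1)
  have e4 := bigPair_bracketGrad (x := hamX A1 S (γ x) (grad ψ (γ x)))
    (y := hamY A2 T (γ x) (grad ψ (γ x))) (g := grad φ (γ x)) (L := γ x) (δ := δ) (κ := κ1)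
  have e5 := bigPair_bracketGrad (x := hamX A1 S (γ x) (grad φ (γ x)))
    (y := hamY A2 T (γ x) (grad φ (γ x))) (g := grad ψ (γ x)) (L := γ x) (δ := δ) (κ := κ2)
  have e6 := bigPair_deriv_grad hφ hγ hδ hκ1 (hamVec A1 A2 S T (γ x) (grad ψ (γ x)))
  have e7 := bigPair_deriv_grad hψ hγ hδ hκ2 (hamVec A1 A2 S T (γ x) (grad φ (γ x)))
  rw [bigPair_smul_left, bigPair_sub_left, bracketGrad, bracketGrad,
    bigPair_add_left (a := hess φ _ _), bigPair_add_left (a := hess ψ _ _), ← e6, ← e7, hamVec,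
    hamVec]
  rw [bigPair_comm _ (hamX A1 S (γ x) (grad φ (γ x))),
    bigPair_comm _ (hamY A2 T (γ x) (grad φ (γ x)))] at e5
  linear_combination (1 / 2) * e3 - (1 / 2) * e4 + (1 / 2) * e5

theorem grad_PB2 (h : IsRMatrix A1 A2 S T) {φ ψ : (Fin m → Loop N) → ℝ}
    (hφ : IsSmoothFun φ) (hψ : IsSmoothFun ψ) (L : Fin m → Loop N) :
    grad (PB2 A1 A2 S φ ψ) L = (1 / 2 : ℝ) •
      (bracketGrad A1 A2 S T φ ψ L - bracketGrad A1 A2 S T ψ φ L) := by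
  rw [(hasSmoothGradient_PB2 h hφ hψ).grad_eq]

/-- In the part of the Jacobi sum without Hessians the mixed terms cancel, and only commutators of
the X among themselves and of the Y among themselves remain. -/
theorem bigPair_bracketGrad_sub {x y u v h L : Fin m → Loop N} :
    bigPair (x * h - h * y) (L * u - v * L) - bigPair (u * h - h * v) (L * x - y * L)
      = bigPair (u * x - x * u) (h * L) - bigPair (v * y - y * v) (L * h) := by
  have key : ∀ x y u v : Fin m → Loop N, bigPair (x * h - h * y) (L * u - v * L)
      = bigPair h (L * u * x) - bigPair h (v * L * x) - bigPair h (y * L * u)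
        + bigPair h (y * v * L) := by
    intro x y u v
    simp only [bigPair_sub_left, bigPair_sub_right]
    rw [bigPair_mul_cycle x h (L * u), bigPair_mul_cycle x h (v * L), bigPair_mul_left h,
      bigPair_mul_left h, bigPair_mul_left h, bigPair_mul_left h]
    simp only [mul_assoc]
    ring
  rw [key, key, bigPair_comm _ (h * L), bigPair_comm _ (L * h), bigPair_mul_left, bigPair_mul_cycle,
    bigPair_mul_left, mul_sub, sub_mul]
  simp only [bigPair_sub_right, mul_assoc]
  ring

/-- The cyclic identity holds componentwise, since b enters only through a diagonal of degree zero.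
It serves both for A₁ with S and for A₂ with the adjoint of S. -/
theorem bigPair_hamX_sum {A S : Module.End ℝ (Fin m → Loop N)}
    (hA : IsDiagOp (A - compOp m (opR0 N))) (hS : IsDiagOp S) (a b : Fin 3 → Fin m → Loop N) :
    bigPair ((A (a 0) + S (b 0)) * (A (a 1) + S (b 1)) - (A (a 1) + S (b 1)) * (A (a 0) + S (b 0))) (a 2)
    + bigPair ((A (a 1) + S (b 1)) * (A (a 2) + S (b 2)) - (A (a 2) + S (b 2)) * (A (a 1) + S (b 1))) (a 0)
    + bigPair ((A (a 2) + S (b 2)) * (A (a 0) + S (b 0)) - (A (a 0) + S (b 0)) * (A (a 2) + S (b 2))) (a 1)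
    = -bigPair (a 0 * a 1 - a 1 * a 0) (a 2) := by
  simp only [bigPair, ← Finset.sum_add_distrib, ← Finset.sum_neg_distrib]
  refine Finset.sum_congr rfl fun i _ => ?_
  have hd : ∀ s, DegZero (((A - compOp m (opR0 N)) (a s) + S (b s)) i) := fun s p hp => by
    rw [Pi.add_apply, coefMat_add, hA.degZero _ i p hp, hS.degZero _ i p hp, add_zero]
  have hx : ∀ s, (A (a s) + S (b s)) i
      = opR0 N (a s i) + ((A - compOp m (opR0 N)) (a s) + S (b s)) i := fun s => by
    rw [← compOp_apply (opR0 N) (a s) i]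
    simp only [LinearMap.sub_apply, Pi.add_apply, Pi.sub_apply]
    abel
  exact loopPair_bracket_sum (hd 0) (hd 1) (hd 2) (hx 0) (hx 1) (hx 2)

/-- The Jacobi sum loses its Hessian terms by symmetry. Yang–Baxter turns the X-commutators and the
Y-commutators into ⟨[fL, gL], kL⟩ and ⟨[Lf, Lg], Lk⟩ with opposite signs, and these two numbers are
equal. -/
theorem isPoissonBracket_PB2 (h : IsRMatrix A1 A2 S T) :
    IsPoissonBracket IsSmoothFun (PB2 A1 A2 S) where
  closed φ ψ hφ hψ := ⟨_, hasSmoothGradient_PB2 h hφ hψ⟩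
  add_left φ ψ χ hφ hψ hχ := by
    have hg : HasSmoothGradient (φ + ψ) (grad φ + grad ψ) := by
      intro E _ _ _ γ hγ
      obtain ⟨a1, a2, a3⟩ := hφ.hasSmoothGradient E γ hγ
      obtain ⟨b1, b2, b3⟩ := hψ.hasSmoothGradient E γ hγ
      refine ⟨a1.add b1, a2.add b2, fun x w δ hδ => ?_⟩
      simp only [Pi.add_apply]
      rw [fderiv_fun_add (a1.differentiable (by simp) x) (b1.differentiable (by simp) x),
        add_apply, a3 x w δ hδ, b3 x w δ hδ, bigPair_add_left]
    funext L
    -- The formula through `hamVec` is visibly linear in the gradient of the second argument, so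
    -- skewness first moves the sum there. The scalar and Leibniz rules below proceed alike.
    rw [PB2_skew h φ χ, PB2_skew h ψ χ, PB2_skew h (φ + ψ) χ]
    simp only [Pi.add_apply, Pi.neg_apply, PB2_eq_hamVec h, hg.grad_eq, bigPair_add_right]
    ring
  smul_left r φ ψ hφ hψ := by
    have hg : HasSmoothGradient (r • φ) (r • grad φ) := by
      intro E _ _ _ γ hγ
      obtain ⟨a1, a2, a3⟩ := hφ.hasSmoothGradient E γ hγ
      refine ⟨contDiff_const.mul a1, a2.const_smul r, fun x w δ hδ => ?_⟩
      simp only [Pi.smul_apply, smul_eq_mul]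
      rw [fderiv_const_mul (a1.differentiable (by simp) x), smul_apply, a3 x w δ hδ,
        bigPair_smul_left, smul_eq_mul]
    funext L
    rw [PB2_skew h φ ψ, PB2_skew h (r • φ) ψ]
    simp only [Pi.smul_apply, Pi.neg_apply, PB2_eq_hamVec h, hg.grad_eq, bigPair_smul_right,
      smul_eq_mul]
    ring
  skew φ ψ _ _ := PB2_skew h φ ψ
  leibniz φ ψ χ hφ hψ hχ := by
    have hg : HasSmoothGradient (φ * ψ) (fun L => φ L • grad ψ L + ψ L • grad φ L) := by
      intro E _ _ _ γ hγ
      obtain ⟨a1, a2, a3⟩ := hφ.hasSmoothGradient E γ hγ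
      obtain ⟨b1, b2, b3⟩ := hψ.hasSmoothGradient E γ hγ
      refine ⟨a1.mul b1, (b2.smul a1).add (a2.smul b1), fun x w δ hδ => ?_⟩
      simp only [Pi.mul_apply]
      rw [fderiv_fun_mul (a1.differentiable (by simp) x) (b1.differentiable (by simp) x),
        add_apply, smul_apply, smul_apply, a3 x w δ hδ, b3 x w δ hδ, bigPair_add_left,
        bigPair_smul_left, bigPair_smul_left, smul_eq_mul, smul_eq_mul]
    funext L
    rw [PB2_skew h φ χ, PB2_skew h ψ χ, PB2_skew h (φ * ψ) χ]
    simp only [Pi.add_apply, Pi.mul_apply, Pi.neg_apply, PB2_eq_hamVec h, hg.grad_eq,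
      bigPair_add_right, bigPair_smul_right]
    ring
  jacobi φ ψ χ hφ hψ hχ := by
    funext L
    simp only [Pi.add_apply, Pi.zero_apply]
    rw [PB2_eq_hamVec h, PB2_eq_hamVec h, PB2_eq_hamVec h, grad_PB2 h hψ hχ, grad_PB2 h hχ hφ,
      grad_PB2 h hφ hψ]
    simp only [bigPair_smul_right, bigPair_sub_right]
    simp only [bracketGrad, bigPair_add_right]
    simp only [bigPair_comm (hamVec A1 A2 S T L _) _]
    set f := grad φ L
    set g := grad ψ L
    set k := grad χ L
    have s1 := bigPair_hess_symm hφ L (hamVec A1 A2 S T L g) (hamVec A1 A2 S T L k)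
    have s2 := bigPair_hess_symm hψ L (hamVec A1 A2 S T L f) (hamVec A1 A2 S T L k)
    have s3 := bigPair_hess_symm hχ L (hamVec A1 A2 S T L f) (hamVec A1 A2 S T L g)
    have t1 : bigPair (hamX A1 S L g * k - k * hamY A2 T L g) (hamVec A1 A2 S T L f)
        - bigPair (hamX A1 S L f * k - k * hamY A2 T L f) (hamVec A1 A2 S T L g) = _ :=
      bigPair_bracketGrad_sub (x := hamX A1 S L g) (y := hamY A2 T L g)
      (u := hamX A1 S L f) (v := hamY A2 T L f) (h := k) (L := L)
    have t2 : bigPair (hamX A1 S L k * f - f * hamY A2 T L k) (hamVec A1 A2 S T L g)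
        - bigPair (hamX A1 S L g * f - f * hamY A2 T L g) (hamVec A1 A2 S T L k) = _ :=
      bigPair_bracketGrad_sub (x := hamX A1 S L k) (y := hamY A2 T L k)
      (u := hamX A1 S L g) (v := hamY A2 T L g) (h := f) (L := L)
    have t3 : bigPair (hamX A1 S L f * g - g * hamY A2 T L f) (hamVec A1 A2 S T L k)
        - bigPair (hamX A1 S L k * g - g * hamY A2 T L k) (hamVec A1 A2 S T L f) = _ :=
      bigPair_bracketGrad_sub (x := hamX A1 S L f) (y := hamY A2 T L f)
      (u := hamX A1 S L k) (v := hamY A2 T L k) (h := g) (L := L)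
    have r1 : bigPair (hamX A1 S L f * hamX A1 S L g - hamX A1 S L g * hamX A1 S L f) (k * L)
        + bigPair (hamX A1 S L g * hamX A1 S L k - hamX A1 S L k * hamX A1 S L g) (f * L)
        + bigPair (hamX A1 S L k * hamX A1 S L f - hamX A1 S L f * hamX A1 S L k) (g * L)
        = -bigPair (f * L * (g * L) - g * L * (f * L)) (k * L) := bigPair_hamX_sum h.diag1 h.diagS ![f * L, g * L, k * L] ![L * f, L * g, L * k]
    have r2 : bigPair (hamY A2 T L f * hamY A2 T L g - hamY A2 T L g * hamY A2 T L f) (L * k)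
        + bigPair (hamY A2 T L g * hamY A2 T L k - hamY A2 T L k * hamY A2 T L g) (L * f)
        + bigPair (hamY A2 T L k * hamY A2 T L f - hamY A2 T L f * hamY A2 T L k) (L * g)
        = -bigPair (L * f * (L * g) - L * g * (L * f)) (L * k) := bigPair_hamX_sum h.diag2 h.diagT ![L * f, L * g, L * k] ![f * L, g * L, k * L]
    -- Moving one factor L around the trace changes a right translate into a left one.
    have r3 : bigPair (f * L * (g * L) - g * L * (f * L)) (k * L)
        = bigPair (L * f * (L * g) - L * g * (L * f)) (L * k) := by
      have aux : ∀ a b c : Fin m → Loop N, bigPair (a * L * (b * L)) (c * L)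
          = bigPair (L * a * (L * b)) (L * c) := by
        intro a b c
        rw [← bigPair_mul_left _ c L, mul_assoc L a, bigPair_mul_cycle L]
        simp only [mul_assoc]
      rw [bigPair_sub_left, bigPair_sub_left, aux, aux]
    linear_combination (1 / 4) * (t1 + t2 + t3) + (1 / 4) * (r1 - r2) - (1 / 4) * r3
      - (1 / 4) * (s1 - s2 + s3)

end Bracket

/-! ## The operators on `g` and on `g ⊗ g ⊗ g` -/

section Operators

variable {N m : ℕ}

theorem loopPair_diagLin_left (d : Fin N → ℝ) (b : Loop N) :
    loopPair (diagLin N d) b = ∑ k, d k * freeDiag N b k := by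
  obtain ⟨Q, hQ⟩ := exists_degLE b
  rw [loopPair_eq_trace, coefMat_mul_eq_finsum, finsum_eq_single _ 0]
  · rw [coefMat_diagLin, if_pos rfl, sub_zero, coefMat_zero_eq_diagonal b,
      Matrix.diagonal_mul_diagonal, Matrix.trace_diagonal]
  · intro q hq
    rw [coefMat_diagLin, if_neg hq, zero_mul]

theorem loopPair_opP0 (a b : Loop N) : loopPair (opP0 N a) b = loopPair a (opP0 N b) := by
  rw [loopPair_comm a]
  change loopPair (diagLin N (freeDiag N a)) b = loopPair (diagLin N (freeDiag N b)) a
  rw [loopPair_diagLin_left, loopPair_diagLin_left]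
  exact Finset.sum_congr rfl fun k _ => mul_comm _ _

theorem sum_diagW_mul (d e : Fin N → ℝ) :
    ∑ k, diagW N d k * e k = -∑ k, diagW N e k * d k := by
  simp only [diagW, LinearMap.coe_mk, AddHom.coe_mk, Finset.sum_mul, ← Finset.sum_neg_distrib]
  rw [Finset.sum_comm]
  refine Finset.sum_congr rfl fun j _ => Finset.sum_congr rfl fun k _ => ?_
  ring

theorem loopPair_opW (a b : Loop N) : loopPair (opW N a) b = -loopPair a (opW N b) := by
  rw [loopPair_comm a]
  change loopPair (diagLin N (diagW N (freeDiag N a))) b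
    = -loopPair (diagLin N (diagW N (freeDiag N b))) a
  rw [loopPair_diagLin_left, loopPair_diagLin_left, sum_diagW_mul]

theorem loopPair_opS (a b : Loop N) : loopPair (opS N a) b = loopPair a (opSadj N b) := by
  change loopPair (opP0 N a - opW N a) b = loopPair a (opP0 N b + opW N b)
  rw [loopPair_sub_left, loopPair_add_right, loopPair_opP0, loopPair_opW, sub_neg_eq_add]

theorem loopPair_opSadj (a b : Loop N) : loopPair (opSadj N a) b = loopPair a (opS N b) := by
  rw [loopPair_comm, ← loopPair_opS, loopPair_comm]

theorem loopPair_opA1 (a b : Loop N) : loopPair (opA1 N a) b = -loopPair a (opA1 N b) := by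
  change loopPair (opR0 N a + opW N a) b = -loopPair a (opR0 N b + opW N b)
  rw [loopPair_add_left, loopPair_add_right, loopPair_opR0, loopPair_opW]; ring

theorem loopPair_opA2 (a b : Loop N) : loopPair (opA2 N a) b = -loopPair a (opA2 N b) := by
  change loopPair (opR0 N a - opW N a) b = -loopPair a (opR0 N b - opW N b)
  rw [loopPair_sub_left, loopPair_sub_right, loopPair_opR0, loopPair_opW]; ring

theorem blockOp_apply (A : Matrix (Fin m) (Fin m) (Module.End ℝ (Loop N))) (x : Fin m → Loop N)
    (i : Fin m) : blockOp A x i = ∑ j, A i j (x j) := by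
  simp [blockOp]

theorem bigPair_blockOp {A B : Matrix (Fin m) (Fin m) (Module.End ℝ (Loop N))}
    (h : ∀ i j a b, loopPair (A i j a) b = loopPair a (B j i b)) (a b : Fin m → Loop N) :
    bigPair (blockOp A a) b = bigPair a (blockOp B b) := by
  have h1 : ∀ (s : Fin m → Loop N) (c : Loop N), loopPair (∑ j, s j) c = ∑ j, loopPair (s j) c :=
    fun s c => by
      rw [← pairLin_apply, map_sum, LinearMap.sum_apply]; rfl
  have h2 : ∀ (s : Fin m → Loop N) (c : Loop N), loopPair c (∑ j, s j) = ∑ j, loopPair c (s j) :=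
    fun s c => by
      rw [← pairLin_apply, map_sum]; rfl
  simp only [bigPair, blockOp_apply, h1, h2, h]
  exact Finset.sum_comm

/-- Operators on `g` with values in degree zero which depend on the free term only. -/
def IsDiagOp₁ (T : Module.End ℝ (Loop N)) : Prop :=
  (∀ x, DegZero (T x)) ∧ ∀ x, coefMat 0 x = 0 → T x = 0

theorem isDiagOp₁_of (T : (Fin N → ℝ) →ₗ[ℝ] Fin N → ℝ) :
    IsDiagOp₁ (diagLin N ∘ₗ T ∘ₗ freeDiag N) := by
  refine ⟨fun x p hp => ?_, fun x hx => ?_⟩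
  · exact (coefMat_diagLin _ p).trans (if_neg hp)
  · have : freeDiag N x = 0 := by
      funext k
      exact congrFun (congrFun hx k) k
    rw [LinearMap.comp_apply, LinearMap.comp_apply, this, map_zero, map_zero]

theorem isDiagOp₁_opW : IsDiagOp₁ (opW N) := isDiagOp₁_of _
theorem isDiagOp₁_opP0 : IsDiagOp₁ (opP0 N) := isDiagOp₁_of LinearMap.id

theorem IsDiagOp₁.add {T T' : Module.End ℝ (Loop N)} (h : IsDiagOp₁ T) (h' : IsDiagOp₁ T') :
    IsDiagOp₁ (T + T') :=
  ⟨fun x p hp => by rw [LinearMap.add_apply, coefMat_add, h.1 x p hp, h'.1 x p hp, add_zero],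
    fun x hx => by rw [LinearMap.add_apply, h.2 x hx, h'.2 x hx, add_zero]⟩

theorem IsDiagOp₁.neg {T : Module.End ℝ (Loop N)} (h : IsDiagOp₁ T) : IsDiagOp₁ (-T) :=
  ⟨fun x p hp => by rw [LinearMap.neg_apply, coefMat_neg, h.1 x p hp, neg_zero],
    fun x hx => by rw [LinearMap.neg_apply, h.2 x hx, neg_zero]⟩

theorem isDiagOp₁_opS : IsDiagOp₁ (opS N) := by
  rw [opS, sub_eq_add_neg]; exact isDiagOp₁_opP0.add isDiagOp₁_opW.neg

theorem isDiagOp₁_opSadj : IsDiagOp₁ (opSadj N) := isDiagOp₁_opP0.add isDiagOp₁_opW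

theorem isDiagOp_blockOp {A : Matrix (Fin m) (Fin m) (Module.End ℝ (Loop N))}
    (h : ∀ i j, IsDiagOp₁ (A i j)) : IsDiagOp (blockOp A) := by
  refine ⟨fun x i p hp => ?_, fun x hx => ?_⟩
  · rw [blockOp_apply, coefMat_sum]
    exact Finset.sum_eq_zero fun j _ => (h i j).1 _ p hp
  · funext i
    rw [blockOp_apply]
    exact Finset.sum_eq_zero fun j _ => (h i j).2 _ (hx j)

theorem isRMatrix_small : IsRMatrix (blockOp !![opA1 N]) (blockOp !![opA2 N])
    (blockOp !![opS N]) (blockOp !![opSadj N]) where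
  diag1 := by
    have : blockOp !![opA1 N] - compOp 1 (opR0 N) = blockOp !![opW N] := by
      refine LinearMap.ext fun x => funext fun i => ?_
      fin_cases i
      simp [blockOp_apply, compOp_apply, opA1]
    rw [this]
    exact isDiagOp_blockOp fun i j => by fin_cases i; fin_cases j; exact isDiagOp₁_opW
  diag2 := by
    have : blockOp !![opA2 N] - compOp 1 (opR0 N) = blockOp !![-opW N] := by
      refine LinearMap.ext fun x => funext fun i => ?_
      fin_cases i
      simp [blockOp_apply, compOp_apply, opA2]
    rw [this]
    exact isDiagOp_blockOp fun i j => by fin_cases i; fin_cases j; exact isDiagOp₁_opW.neg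
  diagS := isDiagOp_blockOp fun i j => by fin_cases i; fin_cases j; exact isDiagOp₁_opS
  diagT := isDiagOp_blockOp fun i j => by fin_cases i; fin_cases j; exact isDiagOp₁_opSadj
  skew1 a b := by
    simp [bigPair, blockOp_apply, loopPair_opA1]
  skew2 a b := by
    simp [bigPair, blockOp_apply, loopPair_opA2]
  adj := bigPair_blockOp fun i j a b => by
    fin_cases i; fin_cases j; exact loopPair_opS a b

/-- The adjoint of `bigS`. -/
def bigSadj (N : ℕ) : Module.End ℝ (Fin 3 → Loop N) :=
  blockOp !![opSadj N, opSadj N, opSadj N;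
             opSadj N, -opS N, opSadj N;
             opSadj N, -opS N, -opS N]

/-- Opposite off-diagonal blocks of A₁ and A₂ are negative adjoints of each other, and all these
blocks are of diagonal type. Nothing more is needed for a Poisson bracket; the particular blocks
matter only for the Lax maps. -/
theorem isRMatrix_big : IsRMatrix (bigA1 N) (bigA2 N) (bigS N) (bigSadj N) where
  diag1 := by
    have : bigA1 N - compOp 3 (opR0 N) = blockOp !![opW N, -opS N, -opS N;
             opSadj N, opW N, opSadj N;
             opSadj N, -opS N, opW N] := by
      refine LinearMap.ext fun x => funext fun i => ?_
      fin_cases i <;> simp [bigA1, blockOp_apply, compOp_apply, opA1, Fin.sum_univ_three] <;> abel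
    rw [this]
    refine isDiagOp_blockOp fun i j => ?_
    fin_cases i <;> fin_cases j <;> first | exact isDiagOp₁_opW | exact isDiagOp₁_opS.neg |
      exact isDiagOp₁_opSadj
  diag2 := by
    have : bigA2 N - compOp 3 (opR0 N) = blockOp !![-opW N, -opSadj N, -opSadj N;
             opS N, -opW N, -opSadj N;
             opS N, opS N, -opW N] := by
      refine LinearMap.ext fun x => funext fun i => ?_
      fin_cases i <;> simp [bigA2, blockOp_apply, compOp_apply, opA2, Fin.sum_univ_three] <;> abel
    rw [this]
    refine isDiagOp_blockOp fun i j => ?_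
    fin_cases i <;> fin_cases j <;> first | exact isDiagOp₁_opW.neg | exact isDiagOp₁_opSadj.neg |
      exact isDiagOp₁_opS
  diagS := by
    refine isDiagOp_blockOp fun i j => ?_
    fin_cases i <;> fin_cases j <;> first | exact isDiagOp₁_opSadj.neg | exact isDiagOp₁_opS
  diagT := by
    refine isDiagOp_blockOp fun i j => ?_
    fin_cases i <;> fin_cases j <;> first | exact isDiagOp₁_opSadj | exact isDiagOp₁_opS.neg
  skew1 a b := by
    simp [bigPair, bigA1, blockOp_apply, Fin.sum_univ_three, loopPair_add_left,
      loopPair_add_right, loopPair_neg_left, loopPair_neg_right, loopPair_opA1, loopPair_opS,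
      loopPair_opSadj]
    ring
  skew2 a b := by
    simp [bigPair, bigA2, blockOp_apply, Fin.sum_univ_three, loopPair_add_left,
      loopPair_add_right, loopPair_neg_left, loopPair_neg_right, loopPair_opA2, loopPair_opS,
      loopPair_opSadj]
    ring
  adj := bigPair_blockOp fun i j a b => by
    fin_cases i <;> fin_cases j <;> simp [loopPair_neg_left, loopPair_neg_right, loopPair_opS,
      loopPair_opSadj]

end Operators

/-! ## The quadratic bracket on the phase space -/

/-- Brackets with constant skew coefficients in commuting derivations are Poisson brackets. -/
theorem isPoissonBracket_of_commuting {X ι : Type} [Fintype ι] (Sm : (X → ℝ) → Prop)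
    (D : ι → (X → ℝ) → X → ℝ) (c : ι → ι → ℝ) (hc : ∀ i j, c i j = -c j i)
    (hmul : ∀ φ ψ, Sm φ → Sm ψ → Sm (φ * ψ)) (hadd : ∀ φ ψ, Sm φ → Sm ψ → Sm (φ + ψ))
    (hsmul : ∀ (r : ℝ) φ, Sm φ → Sm (r • φ)) (hD : ∀ i φ, Sm φ → Sm (D i φ))
    (Dadd : ∀ i φ ψ, Sm φ → Sm ψ → D i (φ + ψ) = D i φ + D i ψ)
    (Dsmul : ∀ i (r : ℝ) φ, Sm φ → D i (r • φ) = r • D i φ)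
    (Dmul : ∀ i φ ψ, Sm φ → Sm ψ → D i (φ * ψ) = φ * D i ψ + ψ * D i φ)
    (Dcomm : ∀ i j φ, Sm φ → D i (D j φ) = D j (D i φ)) (h0 : Sm 0) :
    IsPoissonBracket Sm fun φ ψ => ∑ i, ∑ j, c i j • (D i φ * D j ψ) := by
  have hsum : ∀ {κ : Type} (s : Finset κ) (f : κ → X → ℝ), (∀ k, Sm (f k)) →
      Sm (∑ k ∈ s, f k) := fun s f hf => by
    classical
    induction s using Finset.induction_on with
    | empty => simpa using h0
    | insert a s ha ih => rw [Finset.sum_insert ha]; exact hadd _ _ (hf a) ih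
  have Dzero : ∀ i, D i 0 = 0 := fun i => by simpa using Dsmul i 0 0 h0
  have Dsum : ∀ {κ : Type} (i : ι) (s : Finset κ) (f : κ → X → ℝ), (∀ k, Sm (f k)) →
      D i (∑ k ∈ s, f k) = ∑ k ∈ s, D i (f k) := fun i s f hf => by
    classical
    induction s using Finset.induction_on with
    | empty => simpa using Dzero i
    | insert a s ha ih => rw [Finset.sum_insert ha, Finset.sum_insert ha, Dadd _ _ _ (hf a)
        (hsum s f hf), ih]
  have hterm : ∀ φ ψ, Sm φ → Sm ψ → ∀ i j, Sm (c i j • (D i φ * D j ψ)) :=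
    fun φ ψ hφ hψ i j => hsmul _ _ (hmul _ _ (hD _ _ hφ) (hD _ _ hψ))
  have hcl : ∀ φ ψ, Sm φ → Sm ψ → Sm (∑ i, ∑ j, c i j • (D i φ * D j ψ)) :=
    fun φ ψ hφ hψ => hsum _ _ fun i => hsum _ _ fun j => hterm φ ψ hφ hψ i j
  -- Q φ ψ χ collects the terms with second derivatives of χ. Commuting derivations make it
  -- symmetric in φ and ψ, and each double bracket is a difference of two Q's, so the cyclic sum
  -- telescopes.
  let Q : (X → ℝ) → (X → ℝ) → (X → ℝ) → X → ℝ := fun φ ψ χ =>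
    ∑ i, ∑ j, ∑ k, ∑ l, (c i j * c k l) • (D i φ * D k ψ * D j (D l χ))
  have hQ : ∀ φ ψ χ, Sm χ → Q φ ψ χ = Q ψ φ χ := fun φ ψ χ hχ => by
    have e1 : Q φ ψ χ = ∑ k, ∑ l, ∑ i, ∑ j, (c i j * c k l) • (D i φ * D k ψ * D j (D l χ)) := by
      calc Q φ ψ χ = ∑ p : ι × ι, ∑ q : ι × ι,
            (c p.1 p.2 * c q.1 q.2) • (D p.1 φ * D q.1 ψ * D p.2 (D q.2 χ)) := by
            simp only [Q, Fintype.sum_prod_type]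
        _ = ∑ q : ι × ι, ∑ p : ι × ι,
            (c p.1 p.2 * c q.1 q.2) • (D p.1 φ * D q.1 ψ * D p.2 (D q.2 χ)) := Finset.sum_comm
        _ = _ := by simp only [Fintype.sum_prod_type]
    rw [e1]
    refine Finset.sum_congr rfl fun i _ => Finset.sum_congr rfl fun j _ =>
      Finset.sum_congr rfl fun k _ => Finset.sum_congr rfl fun l _ => ?_
    rw [Dcomm _ _ _ hχ, mul_comm (c k l), mul_comm (D k φ)]
  have hbr : ∀ φ ψ χ, Sm φ → Sm ψ → Sm χ →
      ∑ i, ∑ j, c i j • (D i φ * D j (∑ k, ∑ l, c k l • (D k ψ * D l χ)))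
        = Q φ ψ χ - Q φ χ ψ := fun φ ψ χ hφ hψ hχ => by
    simp only [Q, ← Finset.sum_sub_distrib]
    refine Finset.sum_congr rfl fun i _ => Finset.sum_congr rfl fun j _ => ?_
    rw [Dsum j _ _ fun k => hsum _ _ fun l => hterm ψ χ hψ hχ k l]
    have : ∀ k, D j (∑ l, c k l • (D k ψ * D l χ))
        = ∑ l, c k l • (D k ψ * D j (D l χ) + D l χ * D j (D k ψ)) := fun k => by
      rw [Dsum j _ _ fun l => hterm ψ χ hψ hχ k l]
      exact Finset.sum_congr rfl fun l _ => by
        rw [Dsmul _ _ _ (hmul _ _ (hD _ _ hψ) (hD _ _ hχ)), Dmul _ _ _ (hD _ _ hψ) (hD _ _ hχ)]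
    simp only [this, smul_add, Finset.sum_add_distrib, mul_add, Finset.sum_sub_distrib]
    rw [Finset.sum_comm (f := fun k l => c k l • (D l χ * D j (D k ψ))), sub_eq_add_neg]
    simp only [Finset.mul_sum, Finset.smul_sum, ← Finset.sum_neg_distrib]
    congr 1
    · refine Finset.sum_congr rfl fun k _ => Finset.sum_congr rfl fun l _ => ?_
      funext x
      simp only [Pi.smul_apply, Pi.mul_apply, smul_eq_mul]
      ring
    · refine Finset.sum_congr rfl fun k _ => Finset.sum_congr rfl fun l _ => ?_
      funext x
      simp only [Pi.smul_apply, Pi.mul_apply, smul_eq_mul, Pi.neg_apply]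
      rw [hc l k]
      ring
  exact
  { closed := hcl
    add_left := fun φ ψ χ hφ hψ hχ => by
      simp only [← Finset.sum_add_distrib]
      refine Finset.sum_congr rfl fun i _ => Finset.sum_congr rfl fun j _ => ?_
      rw [Dadd _ _ _ hφ hψ, add_mul, smul_add]
    smul_left := fun r φ ψ hφ hψ => by
      simp only [Finset.smul_sum]
      refine Finset.sum_congr rfl fun i _ => Finset.sum_congr rfl fun j _ => ?_
      rw [Dsmul _ _ _ hφ, smul_mul_assoc, smul_comm]
    skew := fun φ ψ hφ hψ => by
      simp only [← Finset.sum_neg_distrib]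
      rw [Finset.sum_comm]
      refine Finset.sum_congr rfl fun i _ => Finset.sum_congr rfl fun j _ => ?_
      rw [hc j i, neg_smul, mul_comm]
    leibniz := fun φ ψ χ hφ hψ hχ => by
      simp only [Finset.mul_sum, ← Finset.sum_add_distrib]
      refine Finset.sum_congr rfl fun i _ => Finset.sum_congr rfl fun j _ => ?_
      rw [Dmul _ _ _ hφ hψ]
      funext x
      simp only [Pi.smul_apply, Pi.mul_apply, Pi.add_apply, smul_eq_mul]
      ring
    jacobi := fun φ ψ χ hφ hψ hχ => by
      rw [hbr φ ψ χ hφ hψ hχ, hbr ψ χ φ hψ hχ hφ, hbr χ φ ψ hχ hφ hψ, hQ φ ψ χ hχ,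
        hQ φ χ ψ hψ, hQ ψ χ φ hφ]
      abel }

section Phase

variable {N : ℕ}

/-- The coordinate directions of the phase space. -/
def phaseDir : Fin N ⊕ Fin N → Phase N
  | Sum.inl k => (Pi.single k 1, 0)
  | Sum.inr k => (0, Pi.single k 1)

/-- The coordinates of the phase space. -/
def phaseCoord : Fin N ⊕ Fin N → Phase N →L[ℝ] ℝ
  | Sum.inl k => (ContinuousLinearMap.proj k).comp (ContinuousLinearMap.fst ℝ _ _)
  | Sum.inr k => (ContinuousLinearMap.proj k).comp (ContinuousLinearMap.snd ℝ _ _)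

theorem phaseCoord_phaseDir (i j : Fin N ⊕ Fin N) :
    phaseCoord i (phaseDir j) = if i = j then 1 else 0 := by
  rcases i with i | i <;> rcases j with j | j <;>
    simp [phaseCoord, phaseDir, Pi.single_apply]

/-- The logarithmic derivatives `u_k ∂ / ∂u_k` and `v_k ∂ / ∂v_k`. -/
def eulerDeriv (i : Fin N ⊕ Fin N) (φ : Phase N → ℝ) (x : Phase N) : ℝ :=
  phaseCoord i x * fderiv ℝ φ x (phaseDir i)

theorem contDiff_eulerDeriv {i : Fin N ⊕ Fin N} {φ : Phase N → ℝ} (hφ : ContDiff ℝ ∞ φ) :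
    ContDiff ℝ ∞ (eulerDeriv i φ) :=
  (phaseCoord i).contDiff.mul ((hφ.fderiv_right (m := ∞) (by simp)).clm_apply contDiff_const)

/-- The fields u∂_u and v∂_v commute on all of the phase space. This avoids logarithmic coordinates,
which break down where a coordinate vanishes. -/
theorem eulerDeriv_comm (i j : Fin N ⊕ Fin N) {φ : Phase N → ℝ} (hφ : ContDiff ℝ ∞ φ) :
    eulerDeriv i (eulerDeriv j φ) = eulerDeriv j (eulerDeriv i φ) := by
  funext x
  have hs : IsSymmSndFDerivAt ℝ φ x := hφ.contDiffAt.isSymmSndFDerivAt (by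
    rw [minSmoothness_of_isRCLikeNormedField]; exact WithTop.coe_le_coe.2 (le_top : (2 : ℕ∞) ≤ ⊤))
  have hd : DifferentiableAt ℝ (fderiv ℝ φ) x :=
    (hφ.fderiv_right (m := ∞) (by simp)).differentiable (by simp) x
  have key : ∀ i j : Fin N ⊕ Fin N, eulerDeriv i (eulerDeriv j φ) x = phaseCoord i x *
      (phaseCoord j x * fderiv ℝ (fderiv ℝ φ) x (phaseDir i) (phaseDir j)
        + phaseCoord j (phaseDir i) * fderiv ℝ φ x (phaseDir j)) := by
    intro i j
    have e : HasFDerivAt (eulerDeriv j φ) (phaseCoord j x •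
        ((ContinuousLinearMap.apply ℝ ℝ (phaseDir j)).comp (fderiv ℝ (fderiv ℝ φ) x))
        + fderiv ℝ φ x (phaseDir j) • (phaseCoord j : Phase N →L[ℝ] ℝ)) x :=
      (phaseCoord j).hasFDerivAt.mul
        ((ContinuousLinearMap.apply ℝ ℝ (phaseDir j)).hasFDerivAt.comp x hd.hasFDerivAt)
    rw [eulerDeriv, e.fderiv]
    simp [mul_comm]
  rw [key, key, hs.eq (phaseDir i) (phaseDir j), phaseCoord_phaseDir, phaseCoord_phaseDir]
  by_cases h : i = j
  · subst h; rfl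
  · rw [if_neg h, if_neg (Ne.symm h)]; ring

variable [NeZero N]

/-- The coefficients of the quadratic bracket in logarithmic coordinates. -/
def quadCoeff : Fin N ⊕ Fin N → Fin N ⊕ Fin N → ℝ
  | Sum.inl k, Sum.inr l => (if k = l + 1 then 1 else 0) - (if k = l then 1 else 0)
  | Sum.inr l, Sum.inl k => (if k = l then 1 else 0) - (if k = l + 1 then 1 else 0)
  | _, _ => 0

theorem phaseCoord_inl (k : Fin N) (x : Phase N) : phaseCoord (Sum.inl k) x = x.1 k := rfl
theorem phaseCoord_inr (k : Fin N) (x : Phase N) : phaseCoord (Sum.inr k) x = x.2 k := rfl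

theorem quadBr_eq_euler (φ ψ : Phase N → ℝ) (x : Phase N) :
    quadBr φ ψ x = ∑ k, ((eulerDeriv (Sum.inl (k + 1)) φ x - eulerDeriv (Sum.inl k) φ x)
        * eulerDeriv (Sum.inr k) ψ x - eulerDeriv (Sum.inr k) φ x *
        (eulerDeriv (Sum.inl (k + 1)) ψ x - eulerDeriv (Sum.inl k) ψ x)) := by
  refine Finset.sum_congr rfl fun k _ => ?_
  simp only [eulerDeriv, phaseCoord_inl, phaseCoord_inr, phaseDir, dU, dV]
  ring

theorem quadBr_eq_sum (φ ψ : Phase N → ℝ) :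
    quadBr φ ψ = ∑ i, ∑ j, quadCoeff i j • (eulerDeriv i φ * eulerDeriv j ψ) := by
  funext x
  have e1 : ∑ k : Fin N, ∑ l, quadCoeff (Sum.inl k) (Sum.inr l) *
      (eulerDeriv (Sum.inl k) φ x * eulerDeriv (Sum.inr l) ψ x) = ∑ l, (eulerDeriv (Sum.inl (l + 1)) φ x
        - eulerDeriv (Sum.inl l) φ x) * eulerDeriv (Sum.inr l) ψ x := by
    rw [Finset.sum_comm]
    refine Finset.sum_congr rfl fun l _ => ?_
    simp [quadCoeff, sub_mul, Finset.sum_sub_distrib]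
  have e2 : ∑ k : Fin N, ∑ l, quadCoeff (Sum.inr k) (Sum.inl l) *
      (eulerDeriv (Sum.inr k) φ x * eulerDeriv (Sum.inl l) ψ x) = ∑ l, eulerDeriv (Sum.inr l) φ x *
        (eulerDeriv (Sum.inl l) ψ x - eulerDeriv (Sum.inl (l + 1)) ψ x) := by
    refine Finset.sum_congr rfl fun l _ => ?_
    simp [quadCoeff, sub_mul, mul_sub, Finset.sum_sub_distrib]
  simp only [Finset.sum_apply, Fintype.sum_sum_type, Pi.add_apply, Pi.smul_apply, Pi.mul_apply,
    smul_eq_mul, Finset.sum_add_distrib] at e1 e2 ⊢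
  rw [e1, e2]
  simp only [quadCoeff, zero_mul, Finset.sum_const_zero, zero_add, add_zero,
    ← Finset.sum_add_distrib, quadBr_eq_euler]
  refine Finset.sum_congr rfl fun k _ => ?_
  ring

theorem isPoissonBracket_quadBr : IsPoissonBracket (SmoothPhase (N := N)) quadBr := by
  have : (quadBr : (Phase N → ℝ) → _) = fun φ ψ =>
      ∑ i, ∑ j, quadCoeff i j • (eulerDeriv i φ * eulerDeriv j ψ) := by
    funext φ ψ; exact quadBr_eq_sum φ ψ
  rw [this]
  refine isPoissonBracket_of_commuting _ eulerDeriv quadCoeff ?_ (fun _ _ h h' => ContDiff.mul h h')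
    (fun _ _ h h' => ContDiff.add h h') (fun r _ h => contDiff_const.mul h)
    (fun _ _ h => contDiff_eulerDeriv h) ?_ ?_ ?_ (fun i j _ h => eulerDeriv_comm i j h)
    contDiff_const
  · intro i j
    rcases i with i | i <;> rcases j with j | j <;> simp [quadCoeff]
  · intro i φ ψ hφ hψ
    funext x
    simp only [eulerDeriv, Pi.add_apply]
    rw [fderiv_add (ContDiff.differentiable hφ (by simp) x)
      (ContDiff.differentiable hψ (by simp) x), add_apply, mul_add]
  · intro i r φ hφ
    funext x
    simp only [eulerDeriv, Pi.smul_apply, smul_eq_mul]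
    rw [fderiv_const_smul (ContDiff.differentiable hφ (by simp) x), smul_apply, smul_eq_mul]
    ring
  · intro i φ ψ hφ hψ
    funext x
    simp only [eulerDeriv, Pi.add_apply, Pi.mul_apply]
    rw [fderiv_mul (ContDiff.differentiable hφ (by simp) x)
      (ContDiff.differentiable hψ (by simp) x), add_apply, smul_apply, smul_apply, smul_eq_mul,
      smul_eq_mul]
    ring

end Phase

/-! ## The explicit discretization -/

section Step

variable {N : ℕ} [NeZero N]

theorem eulerDeriv_comp {S : Phase N → Phase N} {x : Phase N} (hS : DifferentiableAt ℝ S x)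
    {φ : Phase N → ℝ} (hφ : DifferentiableAt ℝ φ (S x)) (i : Fin N ⊕ Fin N) :
    eulerDeriv i (φ ∘ S) x = fderiv ℝ φ (S x) (phaseCoord i x • fderiv ℝ S x (phaseDir i)) := by
  rw [eulerDeriv, fderiv_comp x hφ hS, map_smul]
  rfl

/-- The first factor of the discretization. -/
def shearU (h : ℝ) (x : Phase N) : Phase N := (stepU h x, x.2)

/-- The second factor of the discretization. -/
def shearV (h : ℝ) (x : Phase N) : Phase N :=
  (x.1, fun k => x.2 k * (1 + h * x.1 (k + 1)) / (1 + h * x.1 k))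

/-- The first factor alters only u, with v as a parameter; the second alters only v, with the new u
as a parameter. Each can be checked separately to preserve the bracket. -/
theorem stepMap_eq_comp (h : ℝ) : stepMap (N := N) h = shearV h ∘ shearU h := rfl

theorem contDiffAt_shearU {h : ℝ} {x : Phase N} (hx : ∀ k, 1 + h * x.2 k ≠ 0) :
    ContDiffAt ℝ ∞ (shearU h) x := by
  refine ContDiffAt.prodMk (contDiffAt_pi.2 fun k => ?_) contDiffAt_snd
  have h1 : ∀ k, ContDiffAt ℝ ∞ (fun y : Phase N => y.1 k) x := fun k =>
    (phaseCoord (Sum.inl k)).contDiff.contDiffAt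
  have h2 : ∀ k, ContDiffAt ℝ ∞ (fun y : Phase N => y.2 k) x := fun k =>
    (phaseCoord (Sum.inr k)).contDiff.contDiffAt
  exact ((h1 k).mul (contDiffAt_const.add (contDiffAt_const.mul (h2 k)))).div
    (contDiffAt_const.add (contDiffAt_const.mul (h2 (k - 1)))) (hx _)

theorem contDiffAt_shearV {h : ℝ} {x : Phase N} (hx : ∀ k, 1 + h * x.1 k ≠ 0) :
    ContDiffAt ℝ ∞ (shearV h) x := by
  refine ContDiffAt.prodMk contDiffAt_fst (contDiffAt_pi.2 fun k => ?_)
  have h1 : ∀ k, ContDiffAt ℝ ∞ (fun y : Phase N => y.1 k) x := fun k =>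
    (phaseCoord (Sum.inl k)).contDiff.contDiffAt
  have h2 : ∀ k, ContDiffAt ℝ ∞ (fun y : Phase N => y.2 k) x := fun k =>
    (phaseCoord (Sum.inr k)).contDiff.contDiffAt
  exact ((h2 k).mul (contDiffAt_const.add (contDiffAt_const.mul (h1 (k + 1))))).div
    (contDiffAt_const.add (contDiffAt_const.mul (h1 k))) (hx _)

theorem fderiv_apply_eq_of_line {S : Phase N → Phase N} {x w : Phase N} {d : Phase N}
    (hS : DifferentiableAt ℝ S x)
    (h1 : ∀ k, HasDerivAt (fun t : ℝ => (S (x + t • w)).1 k) (d.1 k) 0)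
    (h2 : ∀ k, HasDerivAt (fun t : ℝ => (S (x + t • w)).2 k) (d.2 k) 0) :
    fderiv ℝ S x w = d := by
  have e1 : HasDerivAt (fun t : ℝ => x + t • w) w 0 := by
    simpa using ((hasDerivAt_id (0 : ℝ)).smul_const w).const_add x
  have e2 : HasDerivAt (fun t : ℝ => S (x + t • w)) (fderiv ℝ S x w) 0 := by
    have h0 : x + (0 : ℝ) • w = x := by simp
    exact HasFDerivAt.comp_hasDerivAt (0 : ℝ) (by rw [h0]; exact hS.hasFDerivAt) e1
  have e3 : HasDerivAt (fun t : ℝ => S (x + t • w)) d 0 :=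
    (hasDerivAt_pi.2 h1).prodMk (hasDerivAt_pi.2 h2)
  exact e2.unique e3

theorem hasDerivAt_shear (a b c a' b' c' h : ℝ) (hc : 1 + h * c ≠ 0) :
    HasDerivAt (fun t : ℝ => (a + t * a') * (1 + h * (b + t * b')) / (1 + h * (c + t * c')))
      ((a' * (1 + h * b) + a * (h * b')) / (1 + h * c)
        - a * (1 + h * b) * (h * c') / (1 + h * c) ^ 2) 0 := by
  have l : ∀ a a' : ℝ, HasDerivAt (fun t : ℝ => a + t * a') a' 0 := fun a a' => by
    simpa using ((hasDerivAt_id (0 : ℝ)).mul_const a').const_add a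
  have := ((l a a').mul (((l b b').const_mul h).const_add 1)).div
    (((l c c').const_mul h).const_add 1) (by simpa using hc)
  refine HasDerivAt.congr_deriv this ?_
  simp only [Pi.mul_apply, zero_mul, add_zero]
  field_simp

theorem fderiv_shearU {h : ℝ} {x : Phase N} (hx : ∀ k, 1 + h * x.2 k ≠ 0) (w : Phase N) :
    fderiv ℝ (shearU h) x w = (fun k => (w.1 k * (1 + h * x.2 k) + x.1 k * (h * w.2 k))
        / (1 + h * x.2 (k - 1)) - x.1 k * (1 + h * x.2 k) * (h * w.2 (k - 1))
        / (1 + h * x.2 (k - 1)) ^ 2, w.2) := by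
  refine fderiv_apply_eq_of_line ((contDiffAt_shearU hx).differentiableAt (by simp))
    (fun k => hasDerivAt_shear _ _ _ _ _ _ h (hx _)) fun k => ?_
  simpa [shearU] using ((hasDerivAt_id (0 : ℝ)).mul_const (w.2 k)).const_add (x.2 k)

theorem fderiv_shearV {h : ℝ} {x : Phase N} (hx : ∀ k, 1 + h * x.1 k ≠ 0) (w : Phase N) :
    fderiv ℝ (shearV h) x w = (w.1, fun k => (w.2 k * (1 + h * x.1 (k + 1))
        + x.2 k * (h * w.1 (k + 1))) / (1 + h * x.1 k)
        - x.2 k * (1 + h * x.1 (k + 1)) * (h * w.1 k) / (1 + h * x.1 k) ^ 2) := by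
  refine fderiv_apply_eq_of_line ((contDiffAt_shearV hx).differentiableAt (by simp))
    (fun k => ?_) fun k => hasDerivAt_shear _ _ _ _ _ _ h (hx _)
  simpa [shearV] using ((hasDerivAt_id (0 : ℝ)).mul_const (w.1 k)).const_add (x.1 k)

/-- Under pullback the u_k∂_{u_k} are unchanged, while v_k∂_{v_k} acquires a multiple γ_k of the
difference of u∂_u at k + 1 and at k. The bracket pairs v_k∂_{v_k} with exactly this difference, so
the additional terms cancel by antisymmetry. -/
theorem quadBr_comp_shearU {h : ℝ} {x : Phase N} (hx : ∀ k, 1 + h * x.2 k ≠ 0)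
    {φ ψ : Phase N → ℝ} (hφ : DifferentiableAt ℝ φ (shearU h x))
    (hψ : DifferentiableAt ℝ ψ (shearU h x)) :
    quadBr (φ ∘ shearU h) (ψ ∘ shearU h) x = quadBr φ ψ (shearU h x) := by
  have hd := (contDiffAt_shearU hx).differentiableAt (by simp)
  set γ : Fin N → ℝ := fun k => h * x.2 k / (1 + h * x.2 k) with hγ
  have eu : ∀ {φ : Phase N → ℝ}, DifferentiableAt ℝ φ (shearU h x) → ∀ k,
      eulerDeriv (Sum.inl k) (φ ∘ shearU h) x = eulerDeriv (Sum.inl k) φ (shearU h x) := by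
    intro φ hφ k
    rw [eulerDeriv_comp hd hφ, fderiv_shearU hx, eulerDeriv, ← smul_eq_mul, ← map_smul]
    congr 1
    refine Prod.ext (funext fun j => ?_) ?_
    · by_cases hj : j = k
      · subst hj
        simp [phaseDir, phaseCoord_inl, shearU, stepU]
        ring
      · simp [phaseDir, hj]
    · simp [phaseDir]
  have ev : ∀ {φ : Phase N → ℝ}, DifferentiableAt ℝ φ (shearU h x) → ∀ k,
      eulerDeriv (Sum.inr k) (φ ∘ shearU h) x = eulerDeriv (Sum.inr k) φ (shearU h x)
        - γ k * (eulerDeriv (Sum.inl (k + 1)) φ (shearU h x)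
          - eulerDeriv (Sum.inl k) φ (shearU h x)) := by
    intro φ hφ k
    rw [eulerDeriv_comp hd hφ, fderiv_shearU hx]
    simp only [eulerDeriv, ← smul_eq_mul, ← map_smul, ← map_sub]
    congr 1
    refine Prod.ext (funext fun j => ?_) ?_
    · have h1 := hx j
      have h2 := hx (j - 1)
      have h3 := hx k
      have h4 := h3
      rw [mul_comm] at h4
      have hj1 : j - 1 = k ↔ j = k + 1 := sub_eq_iff_eq_add
      by_cases hj : j = k <;> by_cases hj' : j = k + 1
      -- Both equalities hold together only if 1 = 0 in `Fin N`, that is for N = 1; then numerator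
      -- and denominator of the shear cancel.
      · have hk : j - 1 = j := by rw [hj1.2 hj', hj]
        subst hj
        simp [phaseDir, phaseCoord_inl, phaseCoord_inr, shearU, stepU, ← hj', hk, hγ]
        field_simp
        simp
      · subst hj
        have hk : j - 1 ≠ j := fun h => hj' (hj1.1 h)
        simp [phaseDir, phaseCoord_inl, phaseCoord_inr, shearU, stepU, hj', hk, hγ]
        field_simp
      · have hk : j - 1 = k := hj1.2 hj'
        subst hj'
        simp at hk
        simp [phaseDir, phaseCoord_inl, phaseCoord_inr, shearU, stepU, hj, hγ]
        field_simp
      · have hk : j - 1 ≠ k := fun h => hj' (hj1.1 h)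
        simp [phaseDir, hj, hj', hk]
    · simp [phaseDir, phaseCoord_inr, shearU]
  rw [quadBr_eq_euler, quadBr_eq_euler]
  refine Finset.sum_congr rfl fun k _ => ?_
  rw [eu hφ, eu hφ, ev hφ, eu hψ, eu hψ, ev hψ]
  ring

/-- Shifting the index pairs each u_k∂_{u_k} with a difference of the v∂_v, as the second shear
requires. -/
theorem quadBr_eq_euler' (φ ψ : Phase N → ℝ) (x : Phase N) :
    quadBr φ ψ x = ∑ k, (eulerDeriv (Sum.inl k) φ x *
        (eulerDeriv (Sum.inr (k - 1)) ψ x - eulerDeriv (Sum.inr k) ψ x)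
        - (eulerDeriv (Sum.inr (k - 1)) φ x - eulerDeriv (Sum.inr k) φ x)
        * eulerDeriv (Sum.inl k) ψ x) := by
  have e : ∀ φ ψ : Phase N → ℝ, ∑ k, eulerDeriv (Sum.inl (k + 1)) φ x * eulerDeriv (Sum.inr k) ψ x
      = ∑ k, eulerDeriv (Sum.inl k) φ x * eulerDeriv (Sum.inr (k - 1)) ψ x := fun φ ψ => by
    rw [← Equiv.sum_comp (Equiv.addRight (1 : Fin N))
      (fun k => eulerDeriv (Sum.inl k) φ x * eulerDeriv (Sum.inr (k - 1)) ψ x)]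
    simp
  have h1 := e φ ψ
  have h2 := e ψ φ
  rw [quadBr_eq_euler]
  simp only [mul_sub, sub_mul, Finset.sum_sub_distrib] at h1 h2 ⊢
  simp only [mul_comm (eulerDeriv (Sum.inr _) φ x)]
  rw [h1, h2]

theorem quadBr_comp_shearV {h : ℝ} {x : Phase N} (hx : ∀ k, 1 + h * x.1 k ≠ 0)
    {φ ψ : Phase N → ℝ} (hφ : DifferentiableAt ℝ φ (shearV h x))
    (hψ : DifferentiableAt ℝ ψ (shearV h x)) :
    quadBr (φ ∘ shearV h) (ψ ∘ shearV h) x = quadBr φ ψ (shearV h x) := by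
  have hd := (contDiffAt_shearV hx).differentiableAt (by simp)
  set γ : Fin N → ℝ := fun k => h * x.1 k / (1 + h * x.1 k) with hγ
  have ev : ∀ {φ : Phase N → ℝ}, DifferentiableAt ℝ φ (shearV h x) → ∀ k,
      eulerDeriv (Sum.inr k) (φ ∘ shearV h) x = eulerDeriv (Sum.inr k) φ (shearV h x) := by
    intro φ hφ k
    rw [eulerDeriv_comp hd hφ, fderiv_shearV hx, eulerDeriv, ← smul_eq_mul, ← map_smul]
    congr 1
    refine Prod.ext ?_ (funext fun j => ?_)
    · simp [phaseDir]
    · by_cases hj : j = k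
      · subst hj
        simp [phaseDir, phaseCoord_inr, shearV]
        ring
      · simp [phaseDir, hj]
  have eu : ∀ {φ : Phase N → ℝ}, DifferentiableAt ℝ φ (shearV h x) → ∀ k,
      eulerDeriv (Sum.inl k) (φ ∘ shearV h) x = eulerDeriv (Sum.inl k) φ (shearV h x)
        + γ k * (eulerDeriv (Sum.inr (k - 1)) φ (shearV h x)
          - eulerDeriv (Sum.inr k) φ (shearV h x)) := by
    intro φ hφ k
    rw [eulerDeriv_comp hd hφ, fderiv_shearV hx]
    simp only [eulerDeriv, ← smul_eq_mul, ← map_smul, ← map_sub, ← map_add]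
    congr 1
    refine Prod.ext ?_ (funext fun j => ?_)
    · simp [phaseDir, phaseCoord_inl, shearV]
    · have h1 := hx j
      have h2 := hx (j + 1)
      have h3 := hx k
      have h4 := h3
      rw [mul_comm] at h4
      have hj1 : j + 1 = k ↔ j = k - 1 := eq_sub_iff_add_eq.symm
      by_cases hj : j = k <;> by_cases hj' : j = k - 1
      · have hk : j + 1 = j := by rw [hj1.2 hj', hj]
        subst hj
        simp [phaseDir, phaseCoord_inl, phaseCoord_inr, shearV, ← hj', hk, hγ]
        field_simp
        simp
      · subst hj
        have hk : j + 1 ≠ j := fun h => hj' (hj1.1 h)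
        simp [phaseDir, phaseCoord_inl, phaseCoord_inr, shearV, hj', hk, hγ]
        field_simp
      · have hk : j + 1 = k := hj1.2 hj'
        subst hj'
        simp at hk
        simp [phaseDir, phaseCoord_inl, phaseCoord_inr, shearV, hj, hγ]
        field_simp
      · have hk : j + 1 ≠ k := fun h => hj' (hj1.1 h)
        simp [phaseDir, hj, hj', hk]
  rw [quadBr_eq_euler', quadBr_eq_euler']
  refine Finset.sum_congr rfl fun k _ => ?_
  rw [ev hφ, ev hφ, eu hφ, ev hψ, ev hψ, eu hψ]
  ring

theorem isOpen_stepDomain (h : ℝ) : IsOpen (stepDomain N h) := by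
  rw [isOpen_iff_mem_nhds]
  intro x hx
  have h1 : ∀ᶠ y : Phase N in 𝓝 x, ∀ k, 1 + h * y.2 k ≠ 0 := Filter.eventually_all.2 fun k =>
    ContinuousAt.eventually_ne (g := fun y : Phase N => 1 + h * y.2 k)
      (by fun_prop) (hx.1 k)
  have h2 : ∀ᶠ y : Phase N in 𝓝 x, ∀ k, 1 + h * stepU h y k ≠ 0 :=
    Filter.eventually_all.2 fun k => by
      refine ContinuousAt.eventually_ne (g := fun y : Phase N => 1 + h * stepU h y k) ?_ (hx.2 k)
      have hc : ContinuousAt (shearU h) x := (contDiffAt_shearU hx.1).continuousAt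
      have : ContinuousAt (fun y : Phase N => (shearU h y).1 k) x :=
        (phaseCoord (Sum.inl k)).continuous.continuousAt.comp hc
      exact continuousAt_const.add (continuousAt_const.mul this)
  filter_upwards [h1, h2] with y a b using ⟨a, b⟩

theorem isDiscreteStep_iff {h : ℝ} {x : Phase N} (hx : x ∈ stepDomain N h) (y : Phase N) :
    IsDiscreteStep h x y ↔ y = stepMap h x := by
  have e1 : (∀ k, y.1 k * (1 + h * x.2 (k - 1)) = x.1 k * (1 + h * x.2 k)) ↔ y.1 = stepU h x := by
    rw [funext_iff]
    exact forall_congr' fun k => (eq_div_iff (hx.1 (k - 1))).symm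
  constructor
  · rintro ⟨h1, h2⟩
    have h1' := e1.1 h1
    refine Prod.ext h1' (funext fun k => ?_)
    have := h2 k
    rw [h1'] at this
    exact (eq_div_iff (hx.2 k)).2 this
  · rintro rfl
    refine ⟨e1.2 rfl, fun k => ?_⟩
    exact div_mul_cancel₀ _ (hx.2 k)

theorem contDiffAt_stepMap {h : ℝ} {x : Phase N} (hx : x ∈ stepDomain N h) :
    ContDiffAt ℝ ∞ (stepMap h) x := by
  rw [stepMap_eq_comp]
  exact ContDiffAt.comp x (contDiffAt_shearV hx.2) (contDiffAt_shearU hx.1)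

theorem quadBr_comp_stepMap {h : ℝ} {x : Phase N} (hx : x ∈ stepDomain N h)
    {φ ψ : Phase N → ℝ} (hφ : SmoothPhase φ) (hψ : SmoothPhase ψ) :
    quadBr (φ ∘ stepMap h) (ψ ∘ stepMap h) x = quadBr φ ψ (stepMap h x) := by
  have d : ∀ {φ : Phase N → ℝ}, SmoothPhase φ → ∀ y, DifferentiableAt ℝ φ y :=
    fun hφ y => ContDiff.differentiable hφ (by simp) y
  have dV : DifferentiableAt ℝ (shearV h) (shearU h x) :=
    (contDiffAt_shearV hx.2).differentiableAt (by simp)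
  rw [stepMap_eq_comp, ← Function.comp_assoc, ← Function.comp_assoc,
    quadBr_comp_shearU hx.1 ((d hφ _).comp _ dV) ((d hψ _).comp _ dV),
    quadBr_comp_shearV hx.2 (d hφ _) (d hψ _)]
  rfl

end Step

/-! ## Lax triads -/

section Triads

variable {N : ℕ} [NeZero N]

/-- The twisting condition for doubly infinite series. -/
def BiTwisted (X : BiSeries N) : Prop :=
  ∀ (p : ℤ) (i j : Fin N), ¬ ((i : ℕ) : ℤ) - ((j : ℕ) : ℤ) ≡ p [ZMOD (N : ℤ)] → X p i j = 0

theorem biTwisted_toBi (L : Loop N) : BiTwisted (toBi L) := fun p i j h => coefMat_twisted L p i j h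

/-- `I + w ℰ⁻¹`. -/
def onePlus (w : Fin N → ℝ) : Loop N := 1 + diagShift (-1) w

theorem coefMat_onePlus_zero (w : Fin N → ℝ) : coefMat 0 (onePlus w) = 1 := by
  rw [onePlus, coefMat_add, coefMat_one, if_pos rfl, coefMat_diagShift_of_ne (by lia), add_zero]

theorem coefMat_onePlus_neg_one (w : Fin N → ℝ) (i j : Fin N) :
    coefMat (-1) (onePlus w) i j = if i + 1 = j then w i else 0 := by
  rw [onePlus, coefMat_add, coefMat_one, if_neg (by lia), zero_add, coefMat_diagShift, if_pos rfl]
  simp only [sub_modEq_neg_one_iff]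

theorem coefMat_onePlus_of_ne (w : Fin N → ℝ) {p : ℤ} (h : p ≠ 0) (h' : p ≠ -1) :
    coefMat p (onePlus w) = 0 := by
  rw [onePlus, coefMat_add, coefMat_one, if_neg h, coefMat_diagShift_of_ne h', zero_add]

theorem coefMat_matU_zero (x : Phase N) : coefMat 0 (matU x) = Matrix.diagonal x.1 := by
  rw [matU, coefMat_add, coefMat_diagShift_of_ne (by lia), zero_add, coefMat_diagShift_zero]

theorem coefMat_matU_one (x : Phase N) (i j : Fin N) :
    coefMat 1 (matU x) i j = if i = j + 1 then 1 else 0 := by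
  rw [matU, coefMat_add, coefMat_diagShift_of_ne (q := 1) (by lia) x.1, add_zero, coefMat_diagShift,
    if_pos rfl]
  simp only [sub_modEq_one_iff]

theorem coefMat_matU_of_ne (x : Phase N) {p : ℤ} (h : p ≠ 0) (h' : p ≠ 1) :
    coefMat p (matU x) = 0 := by
  rw [matU, coefMat_add, coefMat_diagShift_of_ne h', coefMat_diagShift_of_ne h, zero_add]

theorem matV_eq (x : Phase N) : matV x = onePlus x.2 := rfl

theorem matC_eq (h : ℝ) (x : Phase N) : matC h x = onePlus fun k => -(h * (x.1 k * x.2 k)) := by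
  refine coefMat_ext fun p => ?_
  ext i j
  simp only [matC, onePlus, coefMat_sub, coefMat_add, coefMat_smul, Matrix.sub_apply,
    Matrix.add_apply, Matrix.smul_apply, coefMat_diagShift, smul_eq_mul]
  split_ifs <;> ring

theorem lmulBi_onePlus (w : Fin N → ℝ) (X : BiSeries N) (p : ℤ) (i j : Fin N) :
    lmulBi (onePlus w) X p i j = X p i j + w i * X (p + 1) (i + 1) j := by
  rw [lmulBi, finsum_eq_sum_of_support_subset (s := {0, -1}), Finset.sum_pair (by lia)]
  · rw [coefMat_onePlus_zero, one_mul, sub_zero, sub_neg_eq_add, Matrix.add_apply, Matrix.mul_apply,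
      Finset.sum_eq_single (i + 1)]
    · rw [coefMat_onePlus_neg_one, if_pos rfl]
    · intro k _ hk
      rw [coefMat_onePlus_neg_one, if_neg (Ne.symm hk), zero_mul]
    · simp
  · intro q hq
    by_contra h
    simp only [Finset.coe_insert, Finset.coe_singleton, Set.mem_insert_iff, Set.mem_singleton_iff,
      not_or] at h
    exact hq (by simp only [coefMat_onePlus_of_ne w h.1 h.2, Matrix.zero_mul])

theorem rmulBi_onePlus (w : Fin N → ℝ) (X : BiSeries N) (p : ℤ) (i j : Fin N) :
    rmulBi X (onePlus w) p i j = X p i j + X (p + 1) i (j - 1) * w (j - 1) := by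
  rw [rmulBi, finsum_eq_sum_of_support_subset (s := {0, -1}), Finset.sum_pair (by lia)]
  · rw [coefMat_onePlus_zero, mul_one, sub_zero, sub_neg_eq_add, Matrix.add_apply, Matrix.mul_apply,
      Finset.sum_eq_single (j - 1)]
    · rw [coefMat_onePlus_neg_one, if_pos (sub_add_cancel j 1)]
    · intro k _ hk
      rw [coefMat_onePlus_neg_one, if_neg (fun h => hk (eq_sub_of_add_eq h)), mul_zero]
    · simp
  · intro q hq
    by_contra h
    simp only [Finset.coe_insert, Finset.coe_singleton, Set.mem_insert_iff, Set.mem_singleton_iff,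
      not_or] at h
    exact hq (by simp only [coefMat_onePlus_of_ne w h.1 h.2, Matrix.mul_zero])

theorem lmulBi_matU (x : Phase N) (X : BiSeries N) (p : ℤ) (i j : Fin N) :
    lmulBi (matU x) X p i j = x.1 i * X p i j + X (p - 1) (i - 1) j := by
  rw [lmulBi, finsum_eq_sum_of_support_subset (s := {0, 1}), Finset.sum_pair (by lia)]
  · rw [coefMat_matU_zero, sub_zero, Matrix.add_apply, Matrix.diagonal_mul, Matrix.mul_apply,
      Finset.sum_eq_single (i - 1)]
    · rw [coefMat_matU_one, if_pos (sub_add_cancel i 1).symm, one_mul]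
    · intro k _ hk
      rw [coefMat_matU_one, if_neg (fun h => hk (eq_sub_of_add_eq h.symm)), zero_mul]
    · simp
  · intro q hq
    by_contra h
    simp only [Finset.coe_insert, Finset.coe_singleton, Set.mem_insert_iff, Set.mem_singleton_iff,
      not_or] at h
    exact hq (by simp only [coefMat_matU_of_ne x h.1 h.2, Matrix.zero_mul])

theorem rmulBi_matU (x : Phase N) (X : BiSeries N) (p : ℤ) (i j : Fin N) :
    rmulBi X (matU x) p i j = X p i j * x.1 j + X (p - 1) i (j + 1) := by
  rw [rmulBi, finsum_eq_sum_of_support_subset (s := {0, 1}), Finset.sum_pair (by lia)]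
  · rw [coefMat_matU_zero, sub_zero, Matrix.add_apply, Matrix.mul_diagonal, Matrix.mul_apply,
      Finset.sum_eq_single (j + 1)]
    · rw [coefMat_matU_one, if_pos rfl, mul_one]
    · intro k _ hk
      rw [coefMat_matU_one, if_neg hk, mul_zero]
    · simp
  · intro q hq
    by_contra h
    simp only [Finset.coe_insert, Finset.coe_singleton, Set.mem_insert_iff, Set.mem_singleton_iff,
      not_or] at h
    exact hq (by simp only [coefMat_matU_of_ne x h.1 h.2, Matrix.mul_zero])

/-- The two admissible choices of the projection in the Lax triads. -/
def IsTriadProj (P : BiSeries N → BiSeries N) : Prop := P = biPlus ∨ P = fun X => -biMinus X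

theorem BiTwisted.zero_apply_of_ne {X : BiSeries N} (hX : BiTwisted X) {i j : Fin N} (h : i ≠ j) :
    X 0 i j = 0 := hX 0 i j (by rwa [sub_modEq_zero_iff])

/-- With A = I + wℰ⁻¹ and A G = F A, the expression formed with π₊ has degrees at least −1 and is
minus the one formed with π₋, which has degrees at most −1. Only degree −1 survives, and it involves
only the free terms of F and G, which are diagonal by the twist. -/
theorem triad_rhs_onePlus {P : BiSeries N → BiSeries N} (hP : IsTriadProj P) {w : Fin N → ℝ}
    {F G : BiSeries N} (hF : BiTwisted F) (hG : BiTwisted G)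
    (h : lmulBi (onePlus w) G = rmulBi F (onePlus w)) (p : ℤ) (i j : Fin N) :
    (lmulBi (onePlus w) (P G) - rmulBi (P F) (onePlus w)) p i j
      = if p = -1 ∧ i + 1 = j then w i * (G 0 (i + 1) (i + 1) - F 0 i i) else 0 := by
  have hh := congrFun (congrFun (congrFun h p) i) j
  rw [lmulBi_onePlus, rmulBi_onePlus] at hh
  have h0 : p = -1 → (w i * G (p + 1) (i + 1) j - F (p + 1) i (j - 1) * w (j - 1)
      = if i + 1 = j then w i * (G 0 (i + 1) (i + 1) - F 0 i i) else 0) := by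
    rintro rfl
    by_cases hij : i + 1 = j
    · subst hij
      simp; ring
    · have h1 : i ≠ j - 1 := fun h' => hij (by rw [h', sub_add_cancel])
      simp [hij, hG.zero_apply_of_ne hij, hF.zero_apply_of_ne h1]
  change lmulBi (onePlus w) (P G) p i j - rmulBi (P F) (onePlus w) p i j = _
  rw [lmulBi_onePlus, rmulBi_onePlus]
  rcases hP with rfl | rfl
  · simp only [biPlus]
    rcases lt_trichotomy p (-1) with hp | hp | hp
    · rw [if_neg (by lia), if_neg (by lia), if_neg (by lia), if_neg (by lia), if_neg (by lia)]
      simp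
    · rw [if_neg (by lia), if_pos (by lia), if_neg (by lia), if_pos (by lia)]
      simp only [hp, true_and] at h0 ⊢
      simp [← h0]
    · rw [if_pos (by lia), if_pos (by lia), if_pos (by lia), if_pos (by lia), if_neg (by lia)]
      linarith
  · simp only [biMinus, Pi.neg_apply, Matrix.neg_apply]
    rcases lt_trichotomy p (-1) with hp | hp | hp
    · rw [if_pos (by lia), if_pos (by lia), if_pos (by lia), if_pos (by lia), if_neg (by lia)]
      linarith
    · rw [if_pos (by lia), if_neg (by lia), if_pos (by lia), if_neg (by lia)]
      simp only [hp, true_and] at h0 hh ⊢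
      rw [← h0 trivial]
      simp only [Matrix.zero_apply, neg_zero, mul_zero, zero_mul, add_zero]
      linarith
    · rw [if_neg (by lia), if_neg (by lia), if_neg (by lia), if_neg (by lia), if_neg (by lia)]
      simp

/-- The same argument for U, whose degrees are 1 and 0: the two projections now bound the degree by
0 from below and from above. -/
theorem triad_rhs_matU {P : BiSeries N → BiSeries N} (hP : IsTriadProj P) {x : Phase N}
    {F G : BiSeries N} (hF : BiTwisted F) (hG : BiTwisted G)
    (h : lmulBi (matU x) G = rmulBi F (matU x)) (p : ℤ) (i j : Fin N) :
    (lmulBi (matU x) (P G) - rmulBi (P F) (matU x)) p i j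
      = if p = 0 ∧ i = j then x.1 i * (G 0 i i - F 0 i i) else 0 := by
  have hh := congrFun (congrFun (congrFun h p) i) j
  rw [lmulBi_matU, rmulBi_matU] at hh
  have h0 : p = 0 → (x.1 i * G p i j - F p i j * x.1 j
      = if i = j then x.1 i * (G 0 i i - F 0 i i) else 0) := by
    rintro rfl
    by_cases hij : i = j
    · subst hij
      simp; ring
    · simp [hij, hG.zero_apply_of_ne hij, hF.zero_apply_of_ne hij]
  change lmulBi (matU x) (P G) p i j - rmulBi (P F) (matU x) p i j = _
  rw [lmulBi_matU, rmulBi_matU]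
  rcases hP with rfl | rfl
  · simp only [biPlus]
    rcases lt_trichotomy p 0 with hp | hp | hp
    · rw [if_neg (by lia), if_neg (by lia), if_neg (by lia), if_neg (by lia), if_neg (by lia)]
      simp
    · rw [if_pos (by lia), if_neg (by lia), if_pos (by lia), if_neg (by lia)]
      simp only [hp, true_and] at h0 ⊢
      simp [← h0]
    · rw [if_pos (by lia), if_pos (by lia), if_pos (by lia), if_pos (by lia), if_neg (by lia)]
      linarith
  · simp only [biMinus, Pi.neg_apply, Matrix.neg_apply]
    rcases lt_trichotomy p 0 with hp | hp | hp
    · rw [if_pos (by lia), if_pos (by lia), if_pos (by lia), if_pos (by lia), if_neg (by lia)]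
      linarith
    · rw [if_neg (by lia), if_pos (by lia), if_neg (by lia), if_pos (by lia)]
      simp only [hp, true_and] at h0 hh ⊢
      rw [← h0 trivial]
      simp only [Matrix.zero_apply, neg_zero, mul_zero, zero_mul, zero_add]
      linarith
    · rw [if_neg (by lia), if_neg (by lia), if_neg (by lia), if_neg (by lia), if_neg (by lia)]
      simp

theorem hasCoefDeriv_matU_iff {c : ℝ → Phase N} {t : ℝ} {D : BiSeries N} {d : Fin N → ℝ}
    (hD : ∀ p i j, D p i j = if p = 0 ∧ i = j then d i else 0) :
    HasCoefDeriv (fun s => matU (c s)) D t ↔ ∀ k, HasDerivAt (fun s => (c s).1 k) (d k) t := by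
  constructor
  · intro h k
    have := h 0 k k
    simpa [hD, coefMat_matU_zero] using this
  · intro h p i j
    rw [hD]
    by_cases hp : p = 0
    · subst hp
      simp only [coefMat_matU_zero, Matrix.diagonal_apply, true_and]
      split_ifs
      · exact h i
      · exact hasDerivAt_const t 0
    · rw [if_neg (fun h => hp h.1)]
      by_cases hp1 : p = 1
      · subst hp1
        simp only [coefMat_matU_one]
        exact hasDerivAt_const t _
      · simp only [coefMat_matU_of_ne _ hp hp1]
        exact hasDerivAt_const t _

theorem hasCoefDeriv_onePlus_iff {w : ℝ → Fin N → ℝ} {t : ℝ} {D : BiSeries N} {d : Fin N → ℝ}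
    (hD : ∀ p i j, D p i j = if p = -1 ∧ i + 1 = j then d i else 0) :
    HasCoefDeriv (fun s => onePlus (w s)) D t ↔ ∀ k, HasDerivAt (fun s => w s k) (d k) t := by
  constructor
  · intro h k
    have := h (-1) k (k + 1)
    simpa [hD, coefMat_onePlus_neg_one] using this
  · intro h p i j
    rw [hD]
    by_cases hp : p = -1
    · subst hp
      simp only [coefMat_onePlus_neg_one, true_and]
      split_ifs
      · exact h i
      · exact hasDerivAt_const t 0
    · rw [if_neg (fun h => hp h.1)]
      by_cases hp1 : p = 0
      · subst hp1
        simp only [coefMat_onePlus_zero]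
        exact hasDerivAt_const t _
      · simp only [coefMat_onePlus_of_ne _ hp1 hp]
        exact hasDerivAt_const t _

/-- The relations `U F₃ = F₁ U`, `C F₂ = F₁ C`, `V F₂ = F₃ V` between twisted series. -/
structure Intertwined (h : ℝ) (x : Phase N) (F1 F2 F3 : BiSeries N) : Prop where
  tw1 : BiTwisted F1
  tw2 : BiTwisted F2
  tw3 : BiTwisted F3
  relU : lmulBi (matU x) F3 = rmulBi F1 (matU x)
  relC : lmulBi (matC h x) F2 = rmulBi F1 (matC h x)
  relV : lmulBi (matV x) F2 = rmulBi F3 (matV x)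

/-- The vector field described by the Lax triads. -/
def triadField (F1 F2 F3 : BiSeries N) (x : Phase N) : Phase N :=
  (fun k => x.1 k * (F3 0 k k - F1 0 k k), fun k => x.2 k * (F2 0 (k + 1) (k + 1) - F3 0 k k))

theorem hasDerivAt_phase_iff {c : ℝ → Phase N} {d : Phase N} {t : ℝ} : HasDerivAt c d t ↔
    (∀ k, HasDerivAt (fun s => (c s).1 k) (d.1 k) t) ∧
      ∀ k, HasDerivAt (fun s => (c s).2 k) (d.2 k) t := by
  rw [← hasDerivAt_pi, ← hasDerivAt_pi]
  constructor
  · exact fun h => ⟨h.fst, h.snd⟩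
  · exact fun h => h.1.prodMk h.2

/-- Both projections produce the same diagonals, so the triads amount to one system of scalar
equations. The equations for U and V already determine the velocity. -/
theorem laxTriads_iff {P : BiSeries N → BiSeries N} (hP : IsTriadProj P) {h : ℝ}
    {F1 F2 F3 : Phase N → BiSeries N} {c : ℝ → Phase N} {t : ℝ}
    (hF : Intertwined h (c t) (F1 (c t)) (F2 (c t)) (F3 (c t))) :
    LaxTriads P h F1 F2 F3 c t ↔
      HasDerivAt c (triadField (F1 (c t)) (F2 (c t)) (F3 (c t)) (c t)) t := by
  have eU := hasCoefDeriv_matU_iff (c := c) (t := t) (triad_rhs_matU hP hF.tw1 hF.tw3 hF.relU)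
  have eV := hasCoefDeriv_onePlus_iff (w := fun s => (c s).2) (t := t)
    (triad_rhs_onePlus hP hF.tw3 hF.tw2 hF.relV)
  have relC := hF.relC
  rw [matC_eq] at relC
  have eC := hasCoefDeriv_onePlus_iff (w := fun s k => -(h * ((c s).1 k * (c s).2 k))) (t := t)
    (triad_rhs_onePlus hP hF.tw1 hF.tw2 relC)
  simp only [← matC_eq] at eC
  simp only [← matV_eq] at eV
  rw [hasDerivAt_phase_iff]
  constructor
  · rintro ⟨hU, -, hV⟩
    exact ⟨eU.1 hU, eV.1 hV⟩
  · rintro ⟨hU, hV⟩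
    -- The equation for C is the product rule for u_k v_k: the logarithmic rates F₃ − F₁ and F₂ − F₃
    -- add up to F₂ − F₁.
    refine ⟨eU.2 hU, eC.2 fun k => ?_, eV.2 hV⟩
    refine (((hU k).mul (hV k)).const_mul h).neg.congr_deriv ?_
    simp only [triadField]
    ring

end Triads

/-! ### Covariant functions, the Lax equation and the first flow -/

section CovariantTriads

variable {N : ℕ} [NeZero N]

theorem lmulBi_toBi (A L : Loop N) : lmulBi A (toBi L) = toBi (A * L) :=
  funext fun p => (coefMat_mul_eq_finsum A L p).symm

theorem rmulBi_toBi (A L : Loop N) : rmulBi (toBi L) A = toBi (L * A) := by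
  funext p
  change _ = coefMat p (L * A)
  rw [coefMat_mul_eq_finsum, ← finsum_comp_equiv (Equiv.subLeft p)]
  simp only [Equiv.subLeft_apply, sub_sub_cancel]
  rfl

theorem toBi_injective : Function.Injective (toBi (N := N)) :=
  fun _ _ h => coefMat_ext fun p => congrFun h p

/-! ### Units -/

theorem degLE_uvC (h : ℝ) (x : Phase N) :
    DegLE (-1) (h • diagShift (-1) (fun k => x.1 k * x.2 k) : Loop N) :=
  (degLE_diagShift _ _).smul h

/-- `C` as a unit. -/
def unitC (h : ℝ) (x : Phase N) : (Loop N)ˣ := oneSubUnit _ (degLE_uvC h x)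

theorem coe_unitC (h : ℝ) (x : Phase N) : (unitC h x : Loop N) = matC h x := rfl

theorem coe_inv_unitC (h : ℝ) (x : Phase N) : (↑(unitC h x)⁻¹ : Loop N) = matCinv h x := by
  rw [matCinv, ← coe_unitC, Ring.inverse_unit]

theorem matCinv_eq_geom (h : ℝ) (x : Phase N) : matCinv h x = geom _ (degLE_uvC h x) :=
  (coe_inv_unitC h x).symm

theorem matC_mul_matCinv (h : ℝ) (x : Phase N) : matC h x * matCinv h x = 1 := by
  rw [← coe_unitC, ← coe_inv_unitC, Units.mul_inv]

theorem matCinv_mul_matC (h : ℝ) (x : Phase N) : matCinv h x * matC h x = 1 := by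
  rw [← coe_unitC, ← coe_inv_unitC, Units.inv_mul]

theorem degLE_onePlus (w : Fin N → ℝ) : DegLE 0 (onePlus w) :=
  degLE_one.add ((degLE_diagShift _ _).mono (by lia))

/-- `I + w ℰ⁻¹` as a unit. -/
def unitOnePlus (w : Fin N → ℝ) : (Loop N)ˣ :=
  oneSubUnit (-diagShift (-1) w) fun p hp => by
    rw [coefMat_neg, degLE_diagShift (-1) w p hp, neg_zero]

theorem coe_unitOnePlus (w : Fin N → ℝ) : (unitOnePlus w : Loop N) = onePlus w :=
  sub_neg_eq_add _ _

theorem coefMat_onePlus_mul (w : Fin N → ℝ) (L : Loop N) (p : ℤ) (i j : Fin N) :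
    coefMat p (onePlus w * L) i j = coefMat p L i j + w i * coefMat (p + 1) L (i + 1) j := by
  have := lmulBi_onePlus w (toBi L) p i j
  rwa [lmulBi_toBi] at this

theorem coefMat_mul_onePlus (w : Fin N → ℝ) (L : Loop N) (p : ℤ) (i j : Fin N) :
    coefMat p (L * onePlus w) i j
      = coefMat p L i j + coefMat (p + 1) L i (j - 1) * w (j - 1) := by
  have := rmulBi_onePlus w (toBi L) p i j
  rwa [rmulBi_toBi] at this

theorem coefMat_matU_mul (x : Phase N) (L : Loop N) (p : ℤ) (i j : Fin N) :
    coefMat p (matU x * L) i j = x.1 i * coefMat p L i j + coefMat (p - 1) L (i - 1) j := by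
  have := lmulBi_matU x (toBi L) p i j
  rwa [lmulBi_toBi] at this

theorem coefMat_mul_matU (x : Phase N) (L : Loop N) (p : ℤ) (i j : Fin N) :
    coefMat p (L * matU x) i j = coefMat p L i j * x.1 j + coefMat (p - 1) L i (j + 1) := by
  have := rmulBi_matU x (toBi L) p i j
  rwa [rmulBi_toBi] at this

theorem matU_zero : matU (0 : Phase N) = diagShift 1 (fun _ => 1) := by
  refine coefMat_ext fun p => ?_
  ext i j
  rw [matU, coefMat_add, Matrix.add_apply, coefMat_diagShift 0]
  simp

theorem coefMat_diagShift_neg_one (p : ℤ) (w : Fin N → ℝ) (i j : Fin N) :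
    coefMat p (diagShift (-1) w) i j = if p = -1 ∧ i + 1 = j then w i else 0 := by
  rw [coefMat_diagShift, ite_and]
  simp only [sub_modEq_neg_one_iff]

theorem coefMat_diagShift_one (p : ℤ) (w : Fin N → ℝ) (i j : Fin N) :
    coefMat p (diagShift 1 w) i j = if p = 1 ∧ i = j + 1 then w i else 0 := by
  rw [coefMat_diagShift, ite_and]
  simp only [sub_modEq_one_iff]

/-- `ℰ` as a unit. -/
def unitE (N : ℕ) [NeZero N] : (Loop N)ˣ where
  val := diagShift 1 (fun _ => 1)
  inv := diagShift (-1) (fun _ => 1)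
  val_inv := by
    refine coefMat_ext fun p => ?_
    ext i j
    rw [← matU_zero, coefMat_matU_mul, coefMat_diagShift_neg_one, coefMat_diagShift_neg_one,
      coefMat_one]
    by_cases hp : p = 0
    · subst hp; simp [Matrix.one_apply]
    · rw [if_neg hp, if_neg (c := p - 1 = -1 ∧ _) (by lia)]; simp
  inv_val := by
    refine coefMat_ext fun p => ?_
    ext i j
    rw [← matU_zero, coefMat_mul_matU, coefMat_diagShift_neg_one, coefMat_diagShift_neg_one,
      coefMat_one]
    by_cases hp : p = 0
    · subst hp; simp [Matrix.one_apply]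
    · rw [if_neg hp, if_neg (c := p - 1 = -1 ∧ _) (by lia)]; simp

/-- U = ℰ(I + ℰ⁻¹u), where ℰ⁻¹u has negative degree. So U is invertible even where some u_k vanish,
and conjugation by U is always available. -/
theorem exists_unitU (x : Phase N) : ∃ a : (Loop N)ˣ, (a : Loop N) = matU x := by
  have hd : DegLE (-1) (-(↑(unitE N)⁻¹ * diagShift 0 x.1) : Loop N) := by
    have h : DegLE (-1 + 0) (↑(unitE N)⁻¹ * diagShift 0 x.1 : Loop N) :=
      (degLE_diagShift (-1) _).mul (degLE_diagShift 0 _)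
    intro p hp
    rw [coefMat_neg, h p hp, neg_zero]
  refine ⟨unitE N * oneSubUnit _ hd, ?_⟩
  change (unitE N : Loop N) * (1 - -(↑(unitE N)⁻¹ * diagShift 0 x.1)) = _
  rw [sub_neg_eq_add, mul_add, mul_one, Units.mul_inv_cancel_left]
  rfl

/-! ### The triads for a covariant function -/

/-- UVC⁻¹ is the conjugate of VC⁻¹U by U, and covariance passes this on to f. The next two
statements use conjugation by C and by V in the same way. -/
theorem matU_mul_covariant {f : Loop N → Loop N} (hf : ConjCovariant f) (h : ℝ) (x : Phase N) :
    matU x * f (monVCU h x) = f (monUVC h x) * matU x := by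
  obtain ⟨a, ha⟩ := exists_unitU x
  have := hf a (monVCU h x)
  rw [monVCU, ← ha, ← mul_assoc, Units.mul_inv_cancel_right, ha, ← mul_assoc] at this
  rw [monUVC, this, monVCU, ← ha, Units.inv_mul_cancel_right]

theorem matC_mul_covariant {f : Loop N → Loop N} (hf : ConjCovariant f) (h : ℝ) (x : Phase N) :
    matC h x * f (monCUV h x) = f (monUVC h x) * matC h x := by
  have := hf (unitC h x) (monCUV h x)
  rw [monCUV, ← coe_inv_unitC, mul_assoc (↑(unitC h x)⁻¹ : Loop N), Units.mul_inv_cancel_left]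
    at this
  rw [monUVC, monCUV, ← coe_inv_unitC, this, ← coe_unitC, Units.inv_mul_cancel_right,
    mul_assoc (↑(unitC h x)⁻¹ : Loop N)]

theorem matV_mul_covariant {f : Loop N → Loop N} (hf : ConjCovariant f) (h : ℝ) (x : Phase N) :
    matV x * f (monCUV h x) = f (monVCU h x) * matV x := by
  have hv : (unitOnePlus x.2 : Loop N) = matV x := coe_unitOnePlus x.2
  have := hf (unitOnePlus x.2) (monCUV h x)
  rw [monCUV, ← hv, ← mul_assoc, Units.mul_inv_cancel_right, hv, ← mul_assoc] at this
  rw [monVCU, this, monCUV, ← hv, Units.inv_mul_cancel_right]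

theorem intertwined_of_covariant {f : Loop N → Loop N} (hf : ConjCovariant f) (h : ℝ)
    (x : Phase N) :
    Intertwined h x (toBi (f (monUVC h x))) (toBi (f (monCUV h x))) (toBi (f (monVCU h x))) where
  tw1 := biTwisted_toBi _
  tw2 := biTwisted_toBi _
  tw3 := biTwisted_toBi _
  relU := by rw [lmulBi_toBi, rmulBi_toBi, matU_mul_covariant hf]
  relC := by rw [lmulBi_toBi, rmulBi_toBi, matC_mul_covariant hf]
  relV := by rw [lmulBi_toBi, rmulBi_toBi, matV_mul_covariant hf]

/-- The vector field of the hierarchy belonging to `f`. -/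
def hierField (h : ℝ) (f : Loop N → Loop N) (x : Phase N) : Phase N :=
  triadField (toBi (f (monUVC h x))) (toBi (f (monCUV h x))) (toBi (f (monVCU h x))) x

theorem laxTriadsPlus_iff {f : Loop N → Loop N} (hf : ConjCovariant f) (h : ℝ) (c : ℝ → Phase N)
    (t : ℝ) : LaxTriadsPlus h f c t ↔ HasDerivAt c (hierField h f (c t)) t :=
  laxTriads_iff (Or.inl rfl) (intertwined_of_covariant hf h (c t))

theorem laxTriadsMinus_iff {f : Loop N → Loop N} (hf : ConjCovariant f) (h : ℝ) (c : ℝ → Phase N)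
    (t : ℝ) : LaxTriadsMinus h f c t ↔ HasDerivAt c (hierField h f (c t)) t :=
  laxTriads_iff (Or.inr rfl) (intertwined_of_covariant hf h (c t))

/-! ### Smoothness of the Lax matrices -/

theorem contDiff_fst_apply (k : Fin N) : ContDiff ℝ ∞ fun x : Phase N => x.1 k :=
  (contDiff_apply ℝ ℝ k).comp contDiff_fst

theorem contDiff_snd_apply (k : Fin N) : ContDiff ℝ ∞ fun x : Phase N => x.2 k :=
  (contDiff_apply ℝ ℝ k).comp contDiff_snd

theorem smoothLoop_matU : SmoothLoop (matU : Phase N → Loop N) :=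
  (SmoothLoop.const _).add (smoothLoop_diagShift 0 contDiff_fst_apply)

theorem smoothLoop_matV : SmoothLoop (matV : Phase N → Loop N) :=
  (SmoothLoop.const _).add (smoothLoop_diagShift (-1) contDiff_snd_apply)

theorem smoothLoop_huv (h : ℝ) :
    SmoothLoop fun x : Phase N => (h • diagShift (-1) (fun k => x.1 k * x.2 k) : Loop N) :=
  (smoothLoop_diagShift (-1) fun k =>
    (contDiff_fst_apply k).mul (contDiff_snd_apply k)).const_smul h

theorem smoothLoop_matC (h : ℝ) : SmoothLoop (matC h : Phase N → Loop N) :=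
  (SmoothLoop.const _).sub (smoothLoop_huv h)

theorem smoothLoop_matCinv (h : ℝ) : SmoothLoop (matCinv h : Phase N → Loop N) := by
  have e : (matCinv h : Phase N → Loop N) = fun x => geom _ (degLE_uvC h x) :=
    funext (matCinv_eq_geom h)
  rw [e]
  exact (smoothLoop_huv h).geom (degLE_uvC h)

theorem smoothLoop_monUVC (h : ℝ) : SmoothLoop (monUVC h : Phase N → Loop N) :=
  (smoothLoop_matU.mul smoothLoop_matV).mul (smoothLoop_matCinv h)

theorem hasLoopDeriv_matCinv {h : ℝ} {x w : Phase N} {δ : Loop N}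
    (hC : HasLoopDeriv (matC h) x w δ) :
    HasLoopDeriv (matCinv h) x w (-(matCinv h x * δ * matCinv h x)) := by
  obtain ⟨ε, -, hε⟩ := (smoothLoop_matCinv (N := N) h).exists_deriv w
  have h1 := hC.mul (smoothLoop_matC h) (smoothLoop_matCinv h) (hε x)
  simp only [matC_mul_matCinv] at h1
  have h2 := h1.unique (hasLoopDeriv_const 1 x w)
  have h3 : ε x = -(matCinv h x * δ * matCinv h x) := by
    have h4 := congrArg (fun L => matCinv h x * L) h2
    simp only [mul_add, ← mul_assoc, matCinv_mul_matC, one_mul, mul_zero] at h4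
    exact eq_neg_of_add_eq_zero_right h4
  rw [← h3]
  exact hε x

theorem Loop.HasLoopDeriv.hasCoefDeriv {γ : Phase N → Loop N} (hγ : SmoothLoop γ) {c : ℝ → Phase N}
    {t : ℝ} {w : Phase N} {δ : Loop N} (hc : HasDerivAt c w t) (h : HasLoopDeriv γ (c t) w δ) :
    HasCoefDeriv (fun s => γ (c s)) (toBi δ) t := by
  intro p i j
  refine ((hγ.differentiable p i j (c t)).hasFDerivAt.comp_hasDerivAt t hc).congr_deriv ?_
  exact (h p i j).symm

theorem HasCoefDeriv.hasLoopDeriv {γ : Phase N → Loop N} (hγ : SmoothLoop γ) {c : ℝ → Phase N}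
    {t : ℝ} {w : Phase N} {δ : Loop N} (hc : HasDerivAt c w t)
    (h : HasCoefDeriv (fun s => γ (c s)) (toBi δ) t) : HasLoopDeriv γ (c t) w δ := by
  intro p i j
  exact (h p i j).unique ((hγ.differentiable p i j (c t)).hasFDerivAt.comp_hasDerivAt t hc)

theorem lmulBi_sub_rmulBi_biPlus (A F G : Loop N) :
    lmulBi A (biPlus (toBi G)) - rmulBi (biPlus (toBi F)) A
      = toBi (A * piPlus N G - piPlus N F * A) := by
  have e : ∀ L : Loop N, biPlus (toBi L) = toBi (piPlus N L) := fun L =>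
    funext fun p => (coefMat_piPlus L p).symm
  rw [e, e, lmulBi_toBi, rmulBi_toBi]
  funext p
  exact (coefMat_sub p _ _).symm

/-- Carrying f once around the cycle C⁻¹, V, U shows that f(L) commutes with L. Therefore π₊(f(L))
and −π₋(f(L)) have the same commutator with L. -/
theorem monUVC_mul_covariant {f : Loop N → Loop N} (hf : ConjCovariant f) (h : ℝ) (x : Phase N) :
    monUVC h x * f (monUVC h x) = f (monUVC h x) * monUVC h x := by
  have h1 : matCinv h x * f (monUVC h x) = f (monCUV h x) * matCinv h x := by
    have := congrArg (fun L => matCinv h x * L * matCinv h x) (matC_mul_covariant hf h x)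
    simp only [← mul_assoc, matCinv_mul_matC, one_mul] at this
    rw [this, mul_assoc _ (matC h x), matC_mul_matCinv, mul_one]
  calc monUVC h x * f (monUVC h x)
      = matU x * (matV x * (matCinv h x * f (monUVC h x))) := by simp only [monUVC, mul_assoc]
    _ = matU x * (matV x * f (monCUV h x)) * matCinv h x := by rw [h1]; simp only [mul_assoc]
    _ = matU x * f (monVCU h x) * matV x * matCinv h x := by
        rw [matV_mul_covariant hf]; simp only [mul_assoc]
    _ = f (monUVC h x) * (matU x * matV x * matCinv h x) := by
        rw [matU_mul_covariant hf]; simp only [mul_assoc]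

/-- In the product rule for UVC⁻¹ the auxiliary matrices between neighbouring factors cancel, and
only the outer one remains. -/
theorem LaxTriadsPlus.hasCoefDeriv_monUVC {f : Loop N → Loop N} (hf : ConjCovariant f) {h : ℝ}
    {c : ℝ → Phase N} {t : ℝ} (H : LaxTriadsPlus h f c t) :
    HasCoefDeriv (fun s => monUVC h (c s))
      (toBi (monUVC h (c t) * piPlus N (f (monUVC h (c t)))
        - piPlus N (f (monUVC h (c t))) * monUVC h (c t))) t := by
  have hc := (laxTriadsPlus_iff hf h c t).1 H
  have hU := H.eqU
  have hC := H.eqC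
  have hV := H.eqV
  rw [lmulBi_sub_rmulBi_biPlus] at hU hC hV
  have dU := hU.hasLoopDeriv smoothLoop_matU hc
  have dV := hV.hasLoopDeriv smoothLoop_matV hc
  have dC := hasLoopDeriv_matCinv (hC.hasLoopDeriv (smoothLoop_matC h) hc)
  have dL := (dU.mul smoothLoop_matU smoothLoop_matV dV).mul
    (smoothLoop_matU.mul smoothLoop_matV) (smoothLoop_matCinv h) dC
  have key := dL.hasCoefDeriv (smoothLoop_monUVC h) hc
  convert key using 2
  set P1 := piPlus N (f (monUVC h (c t)))
  set P2 := piPlus N (f (monCUV h (c t)))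
  set P3 := piPlus N (f (monVCU h (c t)))
  have e : matCinv h (c t) * (matC h (c t) * P2 - P1 * matC h (c t)) * matCinv h (c t)
      = P2 * matCinv h (c t) - matCinv h (c t) * P1 := by
    rw [mul_sub, sub_mul, ← mul_assoc, matCinv_mul_matC, one_mul, mul_assoc _ _ (matCinv h (c t)),
      mul_assoc P1, matC_mul_matCinv, mul_one]
  rw [e, monUVC]
  noncomm_ring

theorem LaxTriadsPlus.hasCoefDeriv_monUVC' {f : Loop N → Loop N} (hf : ConjCovariant f) {h : ℝ}
    {c : ℝ → Phase N} {t : ℝ} (H : LaxTriadsPlus h f c t) :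
    HasCoefDeriv (fun s => monUVC h (c s))
      (toBi (-(monUVC h (c t) * piMinus N (f (monUVC h (c t)))
        - piMinus N (f (monUVC h (c t))) * monUVC h (c t)))) t := by
  convert H.hasCoefDeriv_monUVC hf using 2
  change -(monUVC h (c t) * (f (monUVC h (c t)) - piPlus N (f (monUVC h (c t))))
    - (f (monUVC h (c t)) - piPlus N (f (monUVC h (c t)))) * monUVC h (c t)) = _
  rw [mul_sub, sub_mul, monUVC_mul_covariant hf]
  abel

/-! ### The relativistic Volterra lattice -/

theorem coefMat_matC_mul (h : ℝ) (x : Phase N) (L : Loop N) (p : ℤ) (i j : Fin N) :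
    coefMat p (matC h x * L) i j
      = coefMat p L i j - h * (x.1 i * x.2 i) * coefMat (p + 1) L (i + 1) j := by
  rw [matC_eq, coefMat_onePlus_mul]; ring

theorem coefMat_mul_matC (h : ℝ) (x : Phase N) (L : Loop N) (p : ℤ) (i j : Fin N) :
    coefMat p (L * matC h x) i j = coefMat p L i j
      - coefMat (p + 1) L i (j - 1) * (h * (x.1 (j - 1) * x.2 (j - 1))) := by
  rw [matC_eq, coefMat_mul_onePlus]; ring

theorem coefMat_mul_matV (x : Phase N) (L : Loop N) (p : ℤ) (i j : Fin N) :
    coefMat p (L * matV x) i j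
      = coefMat p L i j + coefMat (p + 1) L i (j - 1) * x.2 (j - 1) := coefMat_mul_onePlus _ _ _ _ _

theorem coefMat_matV_mul (x : Phase N) (L : Loop N) (p : ℤ) (i j : Fin N) :
    coefMat p (matV x * L) i j
      = coefMat p L i j + x.2 i * coefMat (p + 1) L (i + 1) j := coefMat_onePlus_mul _ _ _ _ _

theorem degLE_matU (x : Phase N) : DegLE 1 (matU x) :=
  (degLE_diagShift 1 _).add ((degLE_diagShift 0 _).mono (by lia))

theorem degLE_matCinv (h : ℝ) (x : Phase N) : DegLE 0 (matCinv h x) := by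
  rw [matCinv_eq_geom]
  intro p hp
  rw [coefMat_geom]
  exact Finset.sum_eq_zero fun n _ => (degLE_uvC h x).pow n p (by lia)

theorem piPlus_eq_of_coef {L : Loop N} {d : Fin N → ℝ} (hL : DegLE 1 L)
    (h1 : ∀ i j, coefMat 1 L i j = if i = j + 1 then 1 else 0)
    (h0 : ∀ i, coefMat 0 L i i = d i) :
    piPlus N L = diagShift 0 d + diagShift 1 (fun _ => 1) := by
  refine coefMat_ext fun p => ?_
  rw [coefMat_piPlus, coefMat_add]
  by_cases hp : 0 ≤ p
  · rw [if_pos hp]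
    by_cases hp0 : p = 0
    · subst hp0
      rw [coefMat_diagShift_zero, coefMat_diagShift_of_ne (by lia), add_zero,
        coefMat_zero_eq_diagonal]
      congr 1
      funext i
      exact h0 i
    · rw [coefMat_diagShift_of_ne hp0, zero_add]
      by_cases hp1 : p = 1
      · subst hp1
        ext i j
        rw [h1, coefMat_diagShift_one]
        simp
      · rw [hL p (by lia), coefMat_diagShift_of_ne hp1]
  · rw [if_neg hp, coefMat_diagShift_of_ne (by lia), coefMat_diagShift_of_ne (by lia), add_zero]

theorem coefMat_one_apply (p : ℤ) (i j : Fin N) :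
    coefMat p (1 : Loop N) i j = if p = 0 ∧ i = j then 1 else 0 := by
  rw [coefMat_one, ite_and]
  split_ifs with _ h2
  · rw [h2, Matrix.one_apply_eq]
  · rw [Matrix.one_apply_ne h2]
  · rfl

/-- Since U and V have degrees 1 and 0, the nonnegative part of a monodromy matrix involves only the
two leading coefficients of C⁻¹. Both are read off from C C⁻¹ = I. -/
theorem coefMat_matCinv_zero (h : ℝ) (x : Phase N) (i j : Fin N) :
    coefMat 0 (matCinv h x) i j = if i = j then 1 else 0 := by
  have h1 := coefMat_matC_mul h x (matCinv h x) 0 i j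
  rw [matC_mul_matCinv, zero_add, degLE_matCinv h x 1 (by lia), coefMat_one_apply] at h1
  simpa using h1.symm

theorem coefMat_matCinv_neg_one (h : ℝ) (x : Phase N) (i j : Fin N) :
    coefMat (-1) (matCinv h x) i j = if i + 1 = j then h * (x.1 i * x.2 i) else 0 := by
  have h1 := coefMat_matC_mul h x (matCinv h x) (-1) i j
  rw [matC_mul_matCinv, neg_add_cancel, coefMat_matCinv_zero, coefMat_one_apply,
    if_neg (by lia)] at h1
  split_ifs at h1 ⊢ <;> linarith

theorem coefMat_monUVC_zero (h : ℝ) (x : Phase N) (k : Fin N) : coefMat 0 (monUVC h x) k k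
    = x.1 k + x.2 (k - 1) + h * x.1 (k - 1) * x.2 (k - 1) := by
  rw [monUVC, mul_assoc, coefMat_matU_mul, coefMat_matV_mul, coefMat_matV_mul, zero_add, zero_sub,
    neg_add_cancel, degLE_matCinv h x 1 (by lia), coefMat_matCinv_zero, coefMat_matCinv_zero,
    coefMat_matCinv_neg_one]
  simp
  ring

theorem coefMat_monVCU_zero (h : ℝ) (x : Phase N) (k : Fin N) : coefMat 0 (monVCU h x) k k
    = x.1 k + x.2 k + h * x.1 k * x.2 k := by
  rw [monVCU, coefMat_mul_matU, coefMat_matV_mul, coefMat_matV_mul, zero_add, zero_sub,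
    neg_add_cancel, degLE_matCinv h x 1 (by lia), coefMat_matCinv_zero, coefMat_matCinv_zero,
    coefMat_matCinv_neg_one]
  simp
  ring

theorem coefMat_monCUV_zero (h : ℝ) (x : Phase N) (k : Fin N) : coefMat 0 (monCUV h x) k k
    = x.1 k + x.2 (k - 1) + h * x.1 k * x.2 k := by
  rw [monCUV, coefMat_mul_matV, coefMat_mul_matU, coefMat_mul_matU, zero_add, zero_sub,
    sub_self, degLE_matCinv h x 1 (by lia), coefMat_matCinv_zero, coefMat_matCinv_zero,
    coefMat_matCinv_neg_one]
  simp
  ring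

theorem degLE_matV (x : Phase N) : DegLE 0 (matV x) := degLE_onePlus _

theorem degLE_monUVC (h : ℝ) (x : Phase N) : DegLE 1 (monUVC h x) :=
  ((degLE_matU x).mul (degLE_matV x)).mul (degLE_matCinv h x)

theorem degLE_monVCU (h : ℝ) (x : Phase N) : DegLE 1 (monVCU h x) :=
  ((degLE_matV x).mul (degLE_matCinv h x)).mul (degLE_matU x)

theorem degLE_monCUV (h : ℝ) (x : Phase N) : DegLE 1 (monCUV h x) :=
  ((degLE_matCinv h x).mul (degLE_matU x)).mul (degLE_matV x)

theorem piPlus_monUVC (h : ℝ) (x : Phase N) : piPlus N (monUVC h x)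
    = diagShift 0 (fun k => x.1 k + x.2 (k - 1) + h * x.1 (k - 1) * x.2 (k - 1))
      + diagShift 1 (fun _ => 1) := by
  refine piPlus_eq_of_coef (degLE_monUVC h x) (fun i j => ?_) (coefMat_monUVC_zero h x)
  rw [monUVC, mul_assoc, coefMat_matU_mul, coefMat_matV_mul, coefMat_matV_mul, sub_self, zero_add,
    degLE_matCinv h x 1 (by lia), degLE_matCinv h x (1 + 1) (by lia), coefMat_matCinv_zero]
  simp [sub_eq_iff_eq_add]

theorem piPlus_monCUV (h : ℝ) (x : Phase N) : piPlus N (monCUV h x)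
    = diagShift 0 (fun k => x.1 k + x.2 (k - 1) + h * x.1 k * x.2 k)
      + diagShift 1 (fun _ => 1) := by
  refine piPlus_eq_of_coef (degLE_monCUV h x) (fun i j => ?_) (coefMat_monCUV_zero h x)
  rw [monCUV, coefMat_mul_matV, coefMat_mul_matU, coefMat_mul_matU, sub_self, add_sub_cancel_right,
    degLE_matCinv h x 1 (by lia), degLE_matCinv h x (1 + 1) (by lia), coefMat_matCinv_zero]
  simp

theorem piPlus_monVCU (h : ℝ) (x : Phase N) : piPlus N (monVCU h x)
    = diagShift 0 (fun k => x.1 k + x.2 k + h * x.1 k * x.2 k)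
      + diagShift 1 (fun _ => 1) := by
  refine piPlus_eq_of_coef (degLE_monVCU h x) (fun i j => ?_) (coefMat_monVCU_zero h x)
  rw [monVCU, coefMat_mul_matU, coefMat_matV_mul, coefMat_matV_mul, sub_self, zero_add,
    degLE_matCinv h x 1 (by lia), degLE_matCinv h x (1 + 1) (by lia), coefMat_matCinv_zero]
  simp

theorem conjCovariant_id : ConjCovariant (id : Loop N → Loop N) := fun _ _ => rfl

theorem hierField_id (h : ℝ) (x : Phase N) : hierField h id x = rvlField h x := by
  refine Prod.ext (funext fun k => ?_) (funext fun k => ?_)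
  · change x.1 k * (coefMat 0 (monVCU h x) k k - coefMat 0 (monUVC h x) k k) = _
    rw [coefMat_monVCU_zero, coefMat_monUVC_zero]
    simp only [rvlField]
    ring
  · change x.2 k * (coefMat 0 (monCUV h x) (k + 1) (k + 1) - coefMat 0 (monVCU h x) k k) = _
    rw [coefMat_monVCU_zero, coefMat_monCUV_zero, add_sub_cancel_right]
    simp only [rvlField]
    ring

end CovariantTriads

/-! ## The Lax matrix maps are Poisson -/

section LaxMaps

variable {N : ℕ} [NeZero N]

/-! ### Hamiltonian vector fields on the phase space -/

theorem fderiv_phase_eq_sum (φ : Phase N → ℝ) (x w : Phase N) :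
    fderiv ℝ φ x w = ∑ k, w.1 k * dU k φ x + ∑ k, w.2 k * dV k φ x := by
  have hw : w = ∑ k, w.1 k • ((Pi.single k 1, 0) : Phase N)
      + ∑ k, w.2 k • ((0, Pi.single k 1) : Phase N) := by
    refine Prod.ext (funext fun i => ?_) (funext fun i => ?_)
    · simp [Prod.fst_sum, Finset.sum_apply, Pi.single_apply]
    · simp [Prod.snd_sum, Finset.sum_apply, Pi.single_apply]
  conv_lhs => rw [hw]
  simp only [map_add, map_sum, map_smul, smul_eq_mul]
  rfl

theorem quadBr_eq_fderiv_aux (φ ψ : Phase N → ℝ) (x : Phase N) :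
    quadBr φ ψ x = fderiv ℝ ψ x
      (fun k => x.1 k * (x.2 k * dV k φ x - x.2 (k - 1) * dV (k - 1) φ x),
        fun k => x.2 k * (x.1 (k + 1) * dU (k + 1) φ x - x.1 k * dU k φ x)) := by
  rw [fderiv_phase_eq_sum]
  have e : ∑ k, x.1 k * (x.2 (k - 1) * dV (k - 1) φ x) * dU k ψ x
      = ∑ k, x.1 (k + 1) * (x.2 k * dV k φ x) * dU (k + 1) ψ x := by
    rw [← Equiv.sum_comp (Equiv.addRight (1 : Fin N))]
    simp
  simp only [mul_sub, sub_mul, Finset.sum_sub_distrib, quadBr, neg_mul, mul_sub, Finset.sum_neg_distrib] at e ⊢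
  rw [e]
  simp only [← Finset.sum_sub_distrib, ← Finset.sum_add_distrib, ← Finset.sum_neg_distrib]
  refine Finset.sum_congr rfl fun k _ => ?_
  ring

theorem hamField_eq (φ : Phase N → ℝ) (x : Phase N) : hamField φ x =
    (fun k => x.1 k * (x.2 k * dV k φ x - x.2 (k - 1) * dV (k - 1) φ x),
      fun k => x.2 k * (x.1 (k + 1) * dU (k + 1) φ x - x.1 k * dU k φ x)) := by
  have h1 : ∀ k : Fin N, (fun y : Phase N => y.1 k) = phaseCoord (Sum.inl k) := fun _ => rfl
  have h2 : ∀ k : Fin N, (fun y : Phase N => y.2 k) = phaseCoord (Sum.inr k) := fun _ => rfl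
  refine Prod.ext (funext fun k => ?_) (funext fun k => ?_)
  · simp only [hamField]
    rw [quadBr_eq_fderiv_aux, h1, ContinuousLinearMap.fderiv, phaseCoord_inl]
  · simp only [hamField]
    rw [quadBr_eq_fderiv_aux, h2, ContinuousLinearMap.fderiv, phaseCoord_inr]

theorem quadBr_eq_fderiv (φ ψ : Phase N → ℝ) (x : Phase N) :
    quadBr φ ψ x = fderiv ℝ ψ x (hamField φ x) := by
  rw [hamField_eq, quadBr_eq_fderiv_aux]

/-! ### Brackets of `U`, `C` and `V` with truncations -/

theorem opR0_eq (L : Loop N) :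
    opR0 N L = (2 : ℝ) • piPlus N L - L - diagLin N (freeDiag N L) := by
  change piPlus N L - (L - piPlus N L) - diagLin N (freeDiag N L) = _
  rw [two_smul]; abel

theorem matU_mul_diagLin_sub (x : Phase N) (d e : Fin N → ℝ) :
    matU x * diagLin N d - diagLin N e * matU x
      = diagLin N (fun k => x.1 k * (d k - e k)) + diagShift 1 (fun k => d (k - 1) - e k) := by
  refine coefMat_ext fun p => ?_
  ext i j
  rw [coefMat_sub, coefMat_add, Matrix.sub_apply, Matrix.add_apply, coefMat_matU_mul,
    coefMat_mul_matU, coefMat_diagShift_one]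
  simp only [coefMat_diagLin]
  by_cases h0 : p = 0
  · subst h0
    by_cases hij : i = j
    · subst hij; simp; ring
    · simp [hij]
  · by_cases h1 : p = 1
    · subst h1
      by_cases hij : i = j + 1
      · subst hij; simp
      · simp [hij, sub_eq_iff_eq_add]
    · have : p - 1 ≠ 0 := by lia
      simp [h0, h1, this]

theorem onePlus_mul_diagLin_sub (w d e : Fin N → ℝ) :
    onePlus w * diagLin N d - diagLin N e * onePlus w
      = diagLin N (fun k => d k - e k) + diagShift (-1) (fun k => w k * (d (k + 1) - e k)) := by
  refine coefMat_ext fun p => ?_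
  ext i j
  rw [coefMat_sub, coefMat_add, Matrix.sub_apply, Matrix.add_apply, coefMat_onePlus_mul,
    coefMat_mul_onePlus, coefMat_diagShift_neg_one]
  simp only [coefMat_diagLin]
  by_cases h0 : p = 0
  · subst h0
    by_cases hij : i = j
    · subst hij; simp
    · simp [hij]
  · by_cases h1 : p = -1
    · subst h1
      by_cases hij : i + 1 = j
      · subst hij; simp; ring
      · have : i ≠ j - 1 := fun h => hij (by rw [h, sub_add_cancel])
        simp [hij, this]
    · have : p + 1 ≠ 0 := by lia
      simp [h0, h1, this]

theorem matU_mul_piPlus_sub {x : Phase N} {G F : Loop N} (h : matU x * G = F * matU x) :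
    matU x * piPlus N G - piPlus N F * matU x
      = diagLin N (fun k => x.1 k * (freeDiag N G k - freeDiag N F k)) := by
  refine toBi_injective ?_
  rw [← lmulBi_sub_rmulBi_biPlus]
  funext p
  ext i j
  rw [triad_rhs_matU (Or.inl rfl) (biTwisted_toBi F) (biTwisted_toBi G)
    (by rw [lmulBi_toBi, rmulBi_toBi, h])]
  change _ = coefMat p _ i j
  rw [coefMat_diagLin, ite_and]
  split_ifs with _ h2
  · subst h2; rw [Matrix.diagonal_apply_eq]; rfl
  · rw [Matrix.diagonal_apply_ne _ h2]
  · rfl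

theorem onePlus_mul_piPlus_sub {w : Fin N → ℝ} {G F : Loop N}
    (h : onePlus w * G = F * onePlus w) :
    onePlus w * piPlus N G - piPlus N F * onePlus w
      = diagShift (-1) (fun k => w k * (freeDiag N G (k + 1) - freeDiag N F k)) := by
  refine toBi_injective ?_
  rw [← lmulBi_sub_rmulBi_biPlus]
  funext p
  ext i j
  rw [triad_rhs_onePlus (Or.inl rfl) (biTwisted_toBi F) (biTwisted_toBi G)
    (by rw [lmulBi_toBi, rmulBi_toBi, h])]
  change _ = coefMat p _ i j
  rw [coefMat_diagShift_neg_one]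
  rfl

/-- R₀ = 2π₊ − 1 − P₀, and the identity part drops out because A G = F A. What remains is a triad
term, already computed, and an explicit commutator with diagonals. -/
theorem mul_opR0_sub {A G F : Loop N} (h : A * G = F * A) (d e : Fin N → ℝ) :
    A * (opR0 N G + diagLin N d) - (opR0 N F + diagLin N e) * A
      = (2 : ℝ) • (A * piPlus N G - piPlus N F * A)
        + (A * diagLin N (d - freeDiag N G) - diagLin N (e - freeDiag N F) * A) := by
  rw [opR0_eq, opR0_eq, map_sub, map_sub]
  simp only [mul_add, mul_sub, add_mul, sub_mul, mul_smul', smul_mul', smul_sub]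
  rw [h]
  abel

theorem matU_mul_opR0_sub {x : Phase N} {G F : Loop N} (h : matU x * G = F * matU x)
    (d e : Fin N → ℝ) :
    matU x * (opR0 N G + diagLin N d) - (opR0 N F + diagLin N e) * matU x
      = diagLin N (fun k => x.1 k * (d k - e k + freeDiag N G k - freeDiag N F k))
        + diagShift 1 (fun k => d (k - 1) - freeDiag N G (k - 1) - (e k - freeDiag N F k)) := by
  rw [mul_opR0_sub h, matU_mul_piPlus_sub h, matU_mul_diagLin_sub, ← add_assoc, ← map_smul,
    ← map_add]
  congr 2
  funext k
  simp only [Pi.smul_apply, Pi.add_apply, Pi.sub_apply, smul_eq_mul]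
  ring

theorem diagShift_add (p : ℤ) (d e : Fin N → ℝ) :
    diagShift p d + diagShift p e = diagShift p (d + e) := by
  refine coefMat_ext fun q => ?_
  ext i j
  rw [coefMat_add, Matrix.add_apply, coefMat_diagShift, coefMat_diagShift, coefMat_diagShift]
  split_ifs <;> simp

theorem smul_diagShift (p : ℤ) (r : ℝ) (d : Fin N → ℝ) :
    r • diagShift p d = diagShift p (r • d) := by
  refine coefMat_ext fun q => ?_
  ext i j
  rw [coefMat_smul, Matrix.smul_apply, coefMat_diagShift, coefMat_diagShift]
  split_ifs <;> simp

theorem onePlus_mul_opR0_sub {w : Fin N → ℝ} {G F : Loop N} (h : onePlus w * G = F * onePlus w)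
    (d e : Fin N → ℝ) :
    onePlus w * (opR0 N G + diagLin N d) - (opR0 N F + diagLin N e) * onePlus w
      = diagLin N (fun k => d k - freeDiag N G k - (e k - freeDiag N F k))
        + diagShift (-1) (fun k => w k * (d (k + 1) - e k
            + freeDiag N G (k + 1) - freeDiag N F k)) := by
  rw [mul_opR0_sub h, onePlus_mul_piPlus_sub h, onePlus_mul_diagLin_sub, smul_diagShift,
    add_left_comm, diagShift_add]
  congr 2
  funext k
  simp only [Pi.smul_apply, Pi.add_apply, Pi.sub_apply, smul_eq_mul]
  ring

/-! ### The operator `W` and the cyclic shift -/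

/-- The kernel of W is a step function, so its difference at neighbouring sites is local. Closing
the cycle between the last and the first site costs twice the total sum, which cancels later between
∇L and L∇. -/
theorem diagW_apply_sub (d : Fin N → ℝ) (k : Fin N) :
    diagW N d k - diagW N d (k + 1)
      = d k + d (k + 1) - (if k + 1 = 0 then 2 * ∑ j, d j else 0) := by
  have hk := k.isLt
  have e1 : d k = ∑ j, d j * (if j = k then 1 else 0) := by simp
  have e2 : d (k + 1) = ∑ j, d j * (if j = k + 1 then 1 else 0) := by simp
  simp only [diagW, LinearMap.coe_mk, AddHom.coe_mk]
  rw [e1, e2, ← Finset.sum_sub_distrib, ← Finset.sum_add_distrib]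
  have hval : ((k + 1 : Fin N) : ℕ) = ((k : ℕ) + 1) % N := by
    rw [Fin.val_add, Fin.val_one', Nat.add_mod_mod]
  by_cases h : k + 1 = 0
  · rw [if_pos h, h, Finset.mul_sum, ← Finset.sum_sub_distrib]
    have h0 : ((k : ℕ) + 1) = N := by
      rw [h, Fin.val_zero] at hval
      have := Nat.le_of_dvd (by lia) (Nat.dvd_of_mod_eq_zero hval.symm)
      lia
    refine Finset.sum_congr rfl fun j _ => ?_
    have hj := j.isLt
    have a1 : ¬ k < j := by rw [Fin.lt_def]; lia
    have a2 : ¬ j < 0 := by rw [Fin.lt_def, Fin.val_zero]; lia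
    have a3 : j < k ↔ j ≠ k := by rw [Fin.lt_def, Ne, Fin.ext_iff]; lia
    have a4 : 0 < j ↔ j ≠ 0 := by rw [Fin.lt_def, Ne, Fin.ext_iff, Fin.val_zero]; lia
    simp only [a1, a2, a3, a4, if_false]
    split_ifs <;> simp_all <;> ring
  · rw [if_neg h, sub_zero]
    have h0 : ((k + 1 : Fin N) : ℕ) = (k : ℕ) + 1 := by
      rw [hval]
      refine Nat.mod_eq_of_lt (lt_of_le_of_ne (by lia) fun h' => h ?_)
      rw [Fin.ext_iff, hval, h', Nat.mod_self, Fin.val_zero]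
    refine Finset.sum_congr rfl fun j _ => ?_
    rw [← mul_sub, ← mul_add]
    congr 1
    simp only [Fin.lt_def, Fin.ext_iff, h0]
    split_ifs <;> first | lia | norm_num

/-- Cyclicity of the trace is what removes the wrap-around terms of `diagW_apply_sub`. -/
theorem sum_freeDiag_mul_comm (L M : Loop N) :
    ∑ k, freeDiag N (L * M) k = ∑ k, freeDiag N (M * L) k := by
  have := loopPair_comm L M
  rw [loopPair_eq_trace, loopPair_eq_trace] at this
  exact this

end LaxMaps

/-! ### Hamiltonian vectors at the points (U, C⁻¹, V) -/

section LaxTriple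

variable {N : ℕ} [NeZero N]

theorem opA1_apply (L : Loop N) :
    opA1 N L = opR0 N L + diagLin N (diagW N (freeDiag N L)) := rfl
theorem opA2_apply (L : Loop N) :
    opA2 N L = opR0 N L - diagLin N (diagW N (freeDiag N L)) := rfl
theorem opS_apply (L : Loop N) :
    opS N L = diagLin N (freeDiag N L) - diagLin N (diagW N (freeDiag N L)) := rfl
theorem opSadj_apply (L : Loop N) :
    opSadj N L = diagLin N (freeDiag N L) + diagLin N (diagW N (freeDiag N L)) := rfl

/-- The tangent vector at `x` which is half the Hamiltonian vector field on `g ⊗ g ⊗ g` of a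
function with gradient `f`. -/
def laxDir (x : Phase N) (a b : Fin 3 → Fin N → ℝ) : Phase N :=
  (fun k => x.1 k * (b 1 k - a 1 k + b 2 k - a 2 k),
    fun k => x.2 k * (b 0 (k + 1) - a 0 k + b 1 (k + 1) - a 1 (k + 1)))

section
variable (A B : Fin 3 → Loop N)

/-- This and the next five formulas bring the components of `hamX` and `hamY` to the form R₀ plus a
diagonal, to which `matU_mul_opR0_sub` and `onePlus_mul_opR0_sub` apply. -/
theorem bigX_zero : bigA1 N A 0 + bigS N B 0 = opR0 N (A 0) + diagLin N
    (diagW N (freeDiag N (A 0)) + (freeDiag N (B 0) + freeDiag N (B 1) + freeDiag N (B 2)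
        - freeDiag N (A 1) - freeDiag N (A 2))
      - diagW N (freeDiag N (B 0) + freeDiag N (B 1) + freeDiag N (B 2)
        - freeDiag N (A 1) - freeDiag N (A 2))) := by
  simp [bigA1, bigS, blockOp_apply, Fin.sum_univ_three, opA1_apply, opS_apply]
  abel

theorem bigY_zero : bigA2 N B 0 + bigSadj N A 0 = opR0 N (B 0) + diagLin N
    (-diagW N (freeDiag N (B 0)) + (freeDiag N (A 0) + freeDiag N (A 1) + freeDiag N (A 2)
        - freeDiag N (B 1) - freeDiag N (B 2))
      + diagW N (freeDiag N (A 0) + freeDiag N (A 1) + freeDiag N (A 2)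
        - freeDiag N (B 1) - freeDiag N (B 2))) := by
  simp [bigA2, bigSadj, blockOp_apply, Fin.sum_univ_three, opA2_apply, opSadj_apply]
  abel

theorem bigX_one : bigA1 N A 1 + bigS N B 1 = opR0 N (A 1) + diagLin N
    (diagW N (freeDiag N (A 1)) + (freeDiag N (A 0) + freeDiag N (A 2) - freeDiag N (B 1)
        - freeDiag N (B 2)) + diagW N (freeDiag N (A 0) + freeDiag N (A 2) - freeDiag N (B 1)
        - freeDiag N (B 2)) + freeDiag N (B 0) - diagW N (freeDiag N (B 0))) := by
  simp [bigA1, bigS, blockOp_apply, Fin.sum_univ_three, opA1_apply, opS_apply, opSadj_apply]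
  abel

theorem bigY_one : bigA2 N B 1 + bigSadj N A 1 = opR0 N (B 1) + diagLin N
    (-diagW N (freeDiag N (B 1)) + (freeDiag N (A 0) + freeDiag N (A 2)
        - freeDiag N (B 2)) + diagW N (freeDiag N (A 0) + freeDiag N (A 2)
        - freeDiag N (B 2)) + (freeDiag N (B 0) - freeDiag N (A 1))
      - diagW N (freeDiag N (B 0) - freeDiag N (A 1))) := by
  simp [bigA2, bigSadj, blockOp_apply, Fin.sum_univ_three, opA2_apply, opS_apply, opSadj_apply]
  abel

theorem bigX_two : bigA1 N A 2 + bigS N B 2 = opR0 N (A 2) + diagLin N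
    (diagW N (freeDiag N (A 2)) + (freeDiag N (A 0) - freeDiag N (B 2))
      + diagW N (freeDiag N (A 0) - freeDiag N (B 2))
      + (freeDiag N (B 0) + freeDiag N (B 1) - freeDiag N (A 1))
      - diagW N (freeDiag N (B 0) + freeDiag N (B 1) - freeDiag N (A 1))) := by
  simp [bigA1, bigS, blockOp_apply, Fin.sum_univ_three, opA1_apply, opS_apply, opSadj_apply]
  abel

theorem bigY_two : bigA2 N B 2 + bigSadj N A 2 = opR0 N (B 2) + diagLin N
    (-diagW N (freeDiag N (B 2)) + freeDiag N (A 0) + diagW N (freeDiag N (A 0))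
      + (freeDiag N (B 0) + freeDiag N (B 1) - freeDiag N (A 1) - freeDiag N (A 2))
      - diagW N (freeDiag N (B 0) + freeDiag N (B 1) - freeDiag N (A 1) - freeDiag N (A 2))) := by
  simp [bigA2, bigSadj, blockOp_apply, Fin.sum_univ_three, opA2_apply, opS_apply, opSadj_apply]
  abel

end

theorem diagShift_eq_zero (p : ℤ) {d : Fin N → ℝ} (h : ∀ k, d k = 0) :
    diagShift p d = 0 := by
  refine coefMat_ext fun q => ?_
  ext i j
  rw [coefMat_diagShift, h]
  simp [coefMat_zero]

section
variable (h : ℝ) (x : Phase N) (f : Fin 3 → Loop N)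

/-- The leading coefficient of U is constant, so tangency requires the term with ℰ to vanish. This
is the purpose of W: differences of W at neighbouring sites offset the shifted diagonals, and the
wrap-around sums cancel by the trace. -/
theorem hamVec_laxTriple_zero :
    hamVec (bigA1 N) (bigA2 N) (bigS N) (bigSadj N) (laxTriple h x) f 0
      = (2 : ℝ) • diagLin N (laxDir x (fun i => freeDiag N (f i * laxTriple h x i))
          (fun i => freeDiag N (laxTriple h x i * f i))).1 := by
  change matU x * (bigA1 N (f * laxTriple h x) 0 + bigS N (laxTriple h x * f) 0)
    - (bigA2 N (laxTriple h x * f) 0 + bigSadj N (f * laxTriple h x) 0) * matU x = _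
  have hs : ∀ i, ∑ k, freeDiag N ((laxTriple h x * f) i) k = ∑ k, freeDiag N ((f * laxTriple h x) i) k :=
    fun i => sum_freeDiag_mul_comm _ _
  rw [bigX_zero, bigY_zero]
  -- The two arguments of R₀ are ∇U and U∇; associativity alone says that U intertwines them.
  have key : matU x * (f * laxTriple h x) 0 = (laxTriple h x * f) 0 * matU x :=
    (mul_assoc (matU x) (f 0) (matU x)).symm
  rw [matU_mul_opR0_sub key, diagShift_eq_zero 1, add_zero, ← map_smul]
  · congr 1
    funext k
    simp only [laxDir, map_add, map_sub, Pi.add_apply, Pi.sub_apply, Pi.neg_apply, Pi.smul_apply,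
      smul_eq_mul, Pi.mul_apply]
    ring
  · intro k
    obtain ⟨l, rfl⟩ : ∃ l, l + 1 = k := ⟨k - 1, sub_add_cancel k 1⟩
    have e := fun i => diagW_apply_sub (freeDiag N ((f * laxTriple h x) i)) l
    have e' := fun i => diagW_apply_sub (freeDiag N ((laxTriple h x * f) i)) l
    simp only [hs] at e'
    simp only [add_sub_cancel_right, map_add, map_sub, Pi.add_apply, Pi.sub_apply, Pi.neg_apply]
    by_cases hl : l + 1 = 0
    · simp only [if_pos hl] at e e'
      linear_combination -(e' 0) - e' 1 - e' 2 + e 0 + e 1 + e 2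
    · simp only [if_neg hl] at e e'
      linear_combination -(e' 0) - e' 1 - e' 2 + e 0 + e 1 + e 2

/-- Here the term of degree zero, which must vanish as V has the constant free term I, cancels
identically; the identity for W is used in degree −1. -/
theorem hamVec_laxTriple_two :
    hamVec (bigA1 N) (bigA2 N) (bigS N) (bigSadj N) (laxTriple h x) f 2
      = (2 : ℝ) • diagShift (-1) (laxDir x (fun i => freeDiag N (f i * laxTriple h x i))
          (fun i => freeDiag N (laxTriple h x i * f i))).2 := by
  change onePlus x.2 * (bigA1 N (f * laxTriple h x) 2 + bigS N (laxTriple h x * f) 2)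
    - (bigA2 N (laxTriple h x * f) 2 + bigSadj N (f * laxTriple h x) 2) * onePlus x.2 = _
  have hs : ∀ i, ∑ k, freeDiag N ((laxTriple h x * f) i) k = ∑ k, freeDiag N ((f * laxTriple h x) i) k :=
    fun i => sum_freeDiag_mul_comm _ _
  rw [bigX_two, bigY_two]
  have key : onePlus x.2 * (f * laxTriple h x) 2 = (laxTriple h x * f) 2 * onePlus x.2 :=
    (mul_assoc (matV x) (f 2) (matV x)).symm
  rw [onePlus_mul_opR0_sub key]
  change diagShift 0 _ + _ = _
  rw [diagShift_eq_zero 0, zero_add, smul_diagShift]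
  · congr 1
    funext k
    have e := fun i => diagW_apply_sub (freeDiag N ((f * laxTriple h x) i)) k
    have e' := fun i => diagW_apply_sub (freeDiag N ((laxTriple h x * f) i)) k
    simp only [hs] at e'
    simp only [laxDir, map_add, map_sub, Pi.add_apply, Pi.sub_apply, Pi.neg_apply, Pi.smul_apply,
      smul_eq_mul, Pi.mul_apply] at e e' ⊢
    by_cases hl : k + 1 = 0
    · simp only [if_pos hl] at e e'
      linear_combination x.2 k * (e' 0 + e' 1 + e' 2 - e 0 - e 1 - e 2)
    · simp only [if_neg hl] at e e'
      linear_combination x.2 k * (e' 0 + e' 1 + e' 2 - e 0 - e 1 - e 2)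
  · intro k
    simp only [map_add, map_sub, Pi.add_apply, Pi.sub_apply, Pi.neg_apply]
    ring

/-- C⁻¹X − YC⁻¹ = −C⁻¹(CY − XC)C⁻¹ reduces the inverse factor to the Laurent polynomial C, for which
the formula with I + wℰ⁻¹ is available. -/
theorem hamVec_laxTriple_one :
    hamVec (bigA1 N) (bigA2 N) (bigS N) (bigSadj N) (laxTriple h x) f 1
      = (2 : ℝ) • (matCinv h x * (h • diagShift (-1) (fun k =>
          (laxDir x (fun i => freeDiag N (f i * laxTriple h x i))
            (fun i => freeDiag N (laxTriple h x i * f i))).1 k * x.2 k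
          + x.1 k * (laxDir x (fun i => freeDiag N (f i * laxTriple h x i))
            (fun i => freeDiag N (laxTriple h x i * f i))).2 k)) * matCinv h x) := by
  set X := bigA1 N (f * laxTriple h x) 1 + bigS N (laxTriple h x * f) 1 with hX
  set Y := bigA2 N (laxTriple h x * f) 1 + bigSadj N (f * laxTriple h x) 1 with hY
  change matCinv h x * X - Y * matCinv h x = _
  have e1 : matCinv h x * X - Y * matCinv h x
      = matCinv h x * (-(matC h x * Y - X * matC h x)) * matCinv h x := by
    rw [neg_sub, mul_sub, sub_mul, ← mul_assoc _ (matC h x) Y, matCinv_mul_matC, one_mul,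
      ← mul_assoc _ X, mul_assoc _ (matC h x), matC_mul_matCinv, mul_one]
  have hs : ∀ i, ∑ k, freeDiag N ((laxTriple h x * f) i) k = ∑ k, freeDiag N ((f * laxTriple h x) i) k :=
    fun i => sum_freeDiag_mul_comm _ _
  rw [e1, ← smul_mul', ← mul_smul', hX, hY, bigX_one, bigY_one]
  have key : matC h x * (laxTriple h x * f) 1 = (f * laxTriple h x) 1 * matC h x := by
    change matC h x * (matCinv h x * f 1) = f 1 * matCinv h x * matC h x
    rw [← mul_assoc, matC_mul_matCinv, one_mul, mul_assoc, matCinv_mul_matC, mul_one]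
  rw [matC_eq] at key ⊢
  rw [onePlus_mul_opR0_sub key]
  congr 2
  change -(diagShift 0 _ + _) = _
  rw [diagShift_eq_zero 0, zero_add, smul_diagShift, smul_diagShift, ← neg_one_smul ℝ, smul_diagShift]
  · congr 1
    funext k
    have e := fun i => diagW_apply_sub (freeDiag N ((f * laxTriple h x) i)) k
    have e' := fun i => diagW_apply_sub (freeDiag N ((laxTriple h x * f) i)) k
    simp only [hs] at e'
    simp only [laxDir, map_add, map_sub, Pi.add_apply, Pi.sub_apply, Pi.neg_apply, Pi.smul_apply,
      smul_eq_mul, Pi.mul_apply] at e e' ⊢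
    by_cases hl : k + 1 = 0
    · simp only [if_pos hl] at e e'
      linear_combination h * (x.1 k * x.2 k) * (e' 0 + e' 1 + e' 2 - e 0 - e 1 - e 2)
    · simp only [if_neg hl] at e e'
      linear_combination h * (x.1 k * x.2 k) * (e' 0 + e' 1 + e' 2 - e 0 - e 1 - e 2)
  · intro k
    simp only [map_add, map_sub, Pi.add_apply, Pi.sub_apply, Pi.neg_apply]
    ring

end

end LaxTriple

/-! ### The map (U, C⁻¹, V) is Poisson -/

section LaxTriplePoisson

variable {N : ℕ} [NeZero N]

theorem hasLoopDeriv_diagShift (p : ℤ) (d : Phase N → Fin N → ℝ) (x w : Phase N) :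
    HasLoopDeriv (fun y => diagShift p (d y)) x w
      (diagShift p fun k => fderiv ℝ (fun y => d y k) x w) := by
  intro q i j
  simp only [coefMat_diagShift]
  split_ifs <;> simp

theorem fderiv_fst_apply (x w : Phase N) (k : Fin N) :
    fderiv ℝ (fun y : Phase N => y.1 k) x w = w.1 k := by
  change fderiv ℝ (phaseCoord (Sum.inl k) : Phase N → ℝ) x w = _
  rw [ContinuousLinearMap.fderiv, phaseCoord_inl]

theorem fderiv_snd_apply (x w : Phase N) (k : Fin N) :
    fderiv ℝ (fun y : Phase N => y.2 k) x w = w.2 k := by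
  change fderiv ℝ (phaseCoord (Sum.inr k) : Phase N → ℝ) x w = _
  rw [ContinuousLinearMap.fderiv, phaseCoord_inr]

theorem hasLoopDeriv_matU (x w : Phase N) : HasLoopDeriv matU x w (diagShift 0 w.1) := by
  have h := (hasLoopDeriv_const (diagShift 1 fun _ : Fin N => (1 : ℝ)) x w).add (SmoothLoop.const _)
    (smoothLoop_diagShift 0 contDiff_fst_apply) (hasLoopDeriv_diagShift 0 (fun y => y.1) x w)
  simp only [fderiv_fst_apply, zero_add] at h
  exact h

theorem hasLoopDeriv_matV (x w : Phase N) : HasLoopDeriv matV x w (diagShift (-1) w.2) := by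
  have h := (hasLoopDeriv_const (1 : Loop N) x w).add (SmoothLoop.const _)
    (smoothLoop_diagShift (-1) contDiff_snd_apply) (hasLoopDeriv_diagShift (-1) (fun y => y.2) x w)
  simp only [fderiv_snd_apply, zero_add] at h
  exact h

theorem hasLoopDeriv_matC (h : ℝ) (x w : Phase N) : HasLoopDeriv (matC h) x w
    (-(h • diagShift (-1) fun k => w.1 k * x.2 k + x.1 k * w.2 k)) := by
  have hsm : SmoothLoop fun y : Phase N => diagShift (-1) fun k => y.1 k * y.2 k :=
    smoothLoop_diagShift (-1) fun k => (contDiff_fst_apply k).mul (contDiff_snd_apply k)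
  have h1 := (hasLoopDeriv_const (1 : Loop N) x w).sub (SmoothLoop.const _) (smoothLoop_huv h)
    ((hasLoopDeriv_diagShift (-1) (fun y k => y.1 k * y.2 k) x w).const_smul h hsm)
  have h2 : ∀ k : Fin N, fderiv ℝ (fun y : Phase N => y.1 k * y.2 k) x w
      = w.1 k * x.2 k + x.1 k * w.2 k := by
    intro k
    rw [fderiv_fun_mul ((contDiff_fst_apply k).differentiable (by simp) x)
      ((contDiff_snd_apply k).differentiable (by simp) x), _root_.add_apply, _root_.smul_apply,
      _root_.smul_apply, fderiv_fst_apply, fderiv_snd_apply, smul_eq_mul, smul_eq_mul]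
    ring
  simp only [h2, zero_sub] at h1
  exact h1

/-- The derivative of `(U, C⁻¹, V)`. -/
def laxDeriv (h : ℝ) (x w : Phase N) : Fin 3 → Loop N :=
  ![diagShift 0 w.1, matCinv h x * (h • diagShift (-1) fun k => w.1 k * x.2 k + x.1 k * w.2 k)
    * matCinv h x, diagShift (-1) w.2]

theorem hasFamDeriv_laxTriple (h : ℝ) (x w : Phase N) :
    HasFamDeriv (laxTriple h) x w (laxDeriv h x w) := by
  intro i
  fin_cases i
  · exact hasLoopDeriv_matU x w
  · have := hasLoopDeriv_matCinv (hasLoopDeriv_matC h x w)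
    rw [mul_neg, neg_mul, neg_neg] at this
    exact this
  · exact hasLoopDeriv_matV x w

theorem isSmoothFamily_laxTriple (h : ℝ) : IsSmoothFamily (laxTriple h : Phase N → _) := by
  rw [isSmoothFamily_iff]
  intro i
  fin_cases i
  · exact smoothLoop_matU
  · exact smoothLoop_matCinv h
  · exact smoothLoop_matV

/-- Every Hamiltonian vector at (U, C⁻¹, V) is tangent to the image of the phase space, with an
explicit preimage `laxDir`. The Poisson property reduces to recognizing `laxDir` as a Hamiltonian
field. -/
theorem hamVec_laxTriple (h : ℝ) (x : Phase N) (f : Fin 3 → Loop N) :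
    hamVec (bigA1 N) (bigA2 N) (bigS N) (bigSadj N) (laxTriple h x) f
      = (2 : ℝ) • laxDeriv h x (laxDir x (fun i => freeDiag N (f i * laxTriple h x i))
          (fun i => freeDiag N (laxTriple h x i * f i))) := by
  funext i
  fin_cases i
  · exact hamVec_laxTriple_zero h x f
  · exact hamVec_laxTriple_one h x f
  · exact hamVec_laxTriple_two h x f

/-! ### Pullback along `(U, C⁻¹, V)` -/

theorem loopPair_diagShift_zero (f : Loop N) (d : Fin N → ℝ) :
    loopPair f (diagShift 0 d) = ∑ k, d k * coefMat 0 f k k := by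
  rw [loopPair_comm]; exact loopPair_diagLin_left d f

theorem loopPair_diagShift_neg_one (f : Loop N) (d : Fin N → ℝ) :
    loopPair f (diagShift (-1) d) = ∑ k, d k * coefMat 1 f (k + 1) k := by
  have e : diagShift (-1) d = onePlus d - 1 := by rw [onePlus]; abel
  rw [e, loopPair_eq_trace, mul_sub, mul_one, coefMat_sub, Matrix.trace_sub]
  simp only [Matrix.trace, Matrix.diag, coefMat_mul_onePlus, Finset.sum_add_distrib,
    add_sub_cancel_left]
  rw [← Equiv.sum_comp (Equiv.addRight (1 : Fin N))]
  simp [mul_comm]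

theorem bigPair_laxDeriv (h : ℝ) (x w : Phase N) (f : Fin 3 → Loop N) :
    bigPair f (laxDeriv h x w) = ∑ k, (w.1 k * coefMat 0 (f 0) k k
      + h * (w.1 k * x.2 k + x.1 k * w.2 k)
        * coefMat 1 (matCinv h x * f 1 * matCinv h x) (k + 1) k
      + w.2 k * coefMat 1 (f 2) (k + 1) k) := by
  rw [bigPair, Fin.sum_univ_three]
  change loopPair (f 0) (diagShift 0 w.1) + loopPair (f 1) (matCinv h x * _ * matCinv h x)
    + loopPair (f 2) (diagShift (-1) w.2) = _
  have e : loopPair (f 1) (matCinv h x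
        * (h • diagShift (-1) fun k => w.1 k * x.2 k + x.1 k * w.2 k) * matCinv h x)
      = h * loopPair (matCinv h x * f 1 * matCinv h x)
        (diagShift (-1) fun k => w.1 k * x.2 k + x.1 k * w.2 k) := by
    rw [loopPair_mul_right, ← loopPair_mul_left, loopPair_smul_right]
  rw [e, loopPair_diagShift_zero, loopPair_diagShift_neg_one, loopPair_diagShift_neg_one,
    Finset.mul_sum, ← Finset.sum_add_distrib, ← Finset.sum_add_distrib]
  refine Finset.sum_congr rfl fun k _ => ?_
  ring

theorem freeDiag_matU_mul (x : Phase N) (L : Loop N) (k : Fin N) :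
    freeDiag N (matU x * L) (k + 1) = x.1 (k + 1) * coefMat 0 L (k + 1) (k + 1)
      + coefMat (-1) L k (k + 1) := by
  change coefMat 0 _ _ _ = _
  rw [coefMat_matU_mul, add_sub_cancel_right, zero_sub]

theorem freeDiag_mul_matU (x : Phase N) (L : Loop N) (k : Fin N) :
    freeDiag N (L * matU x) k = coefMat 0 L k k * x.1 k + coefMat (-1) L k (k + 1) := by
  change coefMat 0 _ _ _ = _
  rw [coefMat_mul_matU, zero_sub]

theorem freeDiag_matV_mul (x : Phase N) (L : Loop N) (k : Fin N) :
    freeDiag N (matV x * L) k = coefMat 0 L k k + x.2 k * coefMat 1 L (k + 1) k := by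
  change coefMat 0 _ _ _ = _
  rw [coefMat_matV_mul, zero_add]

theorem freeDiag_mul_matV (x : Phase N) (L : Loop N) (k : Fin N) :
    freeDiag N (L * matV x) (k + 1)
      = coefMat 0 L (k + 1) (k + 1) + coefMat 1 L (k + 1) k * x.2 k := by
  change coefMat 0 _ _ _ = _
  rw [coefMat_mul_matV, zero_add, add_sub_cancel_right]

theorem freeDiag_matC_mul (h : ℝ) (x : Phase N) (L : Loop N) (k : Fin N) :
    freeDiag N (matC h x * L) k
      = coefMat 0 L k k - h * (x.1 k * x.2 k) * coefMat 1 L (k + 1) k := by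
  change coefMat 0 _ _ _ = _
  rw [coefMat_matC_mul, zero_add]

theorem freeDiag_mul_matC (h : ℝ) (x : Phase N) (L : Loop N) (k : Fin N) :
    freeDiag N (L * matC h x) (k + 1)
      = coefMat 0 L (k + 1) (k + 1) - coefMat 1 L (k + 1) k * (h * (x.1 k * x.2 k)) := by
  change coefMat 0 _ _ _ = _
  rw [coefMat_mul_matC, zero_add, add_sub_cancel_right]

/-- The Hamiltonian vector field of a function whose differential at `x` is the pullback of `f`. -/
theorem hamField_eq_laxDir (h : ℝ) {x : Phase N} {f : Fin 3 → Loop N} {φ : Phase N → ℝ}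
    (hφ : ∀ w, fderiv ℝ φ x w = bigPair f (laxDeriv h x w)) :
    hamField φ x = laxDir x (fun i => freeDiag N (f i * laxTriple h x i))
          (fun i => freeDiag N (laxTriple h x i * f i)) := by
  set c := matCinv h x * f 1 * matCinv h x with hc
  have eU : ∀ k, dU k φ x = coefMat 0 (f 0) k k + h * x.2 k * coefMat 1 c (k + 1) k := by
    intro k
    rw [dU, hφ, bigPair_laxDeriv, Finset.sum_eq_single k]
    · simp [hc]
    · intro l _ hl; simp [Pi.single_eq_of_ne hl]
    · simp
  have eV : ∀ k, dV k φ x = coefMat 1 (f 2) (k + 1) k + h * x.1 k * coefMat 1 c (k + 1) k := by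
    intro k
    rw [dV, hφ, bigPair_laxDeriv, Finset.sum_eq_single k]
    · simp [hc]; ring
    · intro l _ hl; simp [Pi.single_eq_of_ne hl]
    · simp
  -- With c = C⁻¹ ∇ C⁻¹ the two products with C⁻¹ become C c and c C, so their free terms need no
  -- coefficients of C⁻¹.
  have e1 : f 1 * laxTriple h x 1 = matC h x * c := by
    rw [hc, ← mul_assoc, ← mul_assoc, matC_mul_matCinv, one_mul]; rfl
  have e2 : laxTriple h x 1 * f 1 = c * matC h x := by
    rw [hc, mul_assoc, matCinv_mul_matC, mul_one]; rfl
  have e3 : ∀ k, freeDiag N (f 0 * laxTriple h x 0) k = _ := freeDiag_mul_matU x (f 0)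
  have e4 : ∀ k, freeDiag N (laxTriple h x 0 * f 0) (k + 1) = _ := freeDiag_matU_mul x (f 0)
  have e5 : ∀ k, freeDiag N (f 2 * laxTriple h x 2) (k + 1) = _ := freeDiag_mul_matV x (f 2)
  have e6 : ∀ k, freeDiag N (laxTriple h x 2 * f 2) k = _ := freeDiag_matV_mul x (f 2)
  rw [hamField_eq]
  refine Prod.ext (funext fun k => ?_) (funext fun k => ?_)
  · obtain ⟨l, rfl⟩ : ∃ l, l + 1 = k := ⟨k - 1, sub_add_cancel k 1⟩
    simp only [laxDir, e1, e2, e5, e6, freeDiag_matC_mul, freeDiag_mul_matC, eV,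
      add_sub_cancel_right]
    ring
  · simp only [laxDir, e1, e2, e3, e4, freeDiag_matC_mul, freeDiag_mul_matC, eU]
    ring

theorem hamField_comp_laxTriple (h : ℝ) {φ : (Fin 3 → Loop N) → ℝ} (hφ : IsSmoothFun φ)
    (x : Phase N) : hamField (φ ∘ laxTriple h) x
      = laxDir x (fun i => freeDiag N (grad φ (laxTriple h x) i * laxTriple h x i))
          (fun i => freeDiag N (laxTriple h x i * grad φ (laxTriple h x) i)) :=
  hamField_eq_laxDir h fun w => hφ.hasSmoothGradient.fderiv_eq (isSmoothFamily_laxTriple h)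
    (hasFamDeriv_laxTriple h x w)

/-- Both brackets are derivatives of ψ along the same tangent vector; the factor 1/2 in
`PB2_eq_hamVec` meets the factor 2 in `hamVec_laxTriple`. -/
theorem isPoissonMap_laxTriple (h : ℝ) :
    IsPoissonMap SmoothPhase quadBr IsSmoothFun (PB2 (bigA1 N) (bigA2 N) (bigS N))
      (laxTriple h) := by
  intro φ ψ hφ hψ
  refine ⟨(hφ.hasSmoothGradient _ _ (isSmoothFamily_laxTriple h)).1,
    (hψ.hasSmoothGradient _ _ (isSmoothFamily_laxTriple h)).1, funext fun x => ?_⟩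
  have e := hψ.hasSmoothGradient.fderiv_eq (isSmoothFamily_laxTriple h)
    (hasFamDeriv_laxTriple h x (hamField (φ ∘ laxTriple h) x))
  change quadBr (φ ∘ laxTriple h) (ψ ∘ laxTriple h) x = PB2 _ _ _ φ ψ (laxTriple h x)
  rw [PB2_eq_hamVec isRMatrix_big, hamVec_laxTriple, bigPair_smul_left, quadBr_eq_fderiv,
    ← hamField_comp_laxTriple h hφ, bigPair_comm, ← e, ← mul_assoc]
  norm_num
  rfl

end LaxTriplePoisson

/-! ### Products of the three factors -/

section ProductMaps

variable {N : ℕ}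

/-- The monodromy `T_a T_b T_c`, as an element of `g ^ 1`. -/
def tripleProd (a b c : Fin 3) (T : Fin 3 → Loop N) : Fin 1 → Loop N := fun _ => T a * T b * T c

/-- The gradient of `T ↦ φ (T_a T_b T_c)`, where `f` is the gradient of `φ`. -/
def tripleGrad (a b c : Fin 3) (f : Loop N) (T : Fin 3 → Loop N) : Fin 3 → Loop N := fun i =>
  if i = a then T b * T c * f else if i = b then T c * f * T a else f * T a * T b

/-- The three cyclic orders `U V C⁻¹`, `V C⁻¹ U`, `C⁻¹ U V`. -/
inductive IsMonOrder : Fin 3 → Fin 3 → Fin 3 → Prop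
  | uvc : IsMonOrder 0 2 1
  | vcu : IsMonOrder 2 1 0
  | cuv : IsMonOrder 1 0 2

theorem bigPair_tripleGrad {a b c : Fin 3} (habc : IsMonOrder a b c) (f : Loop N)
    (T δ : Fin 3 → Loop N) : bigPair (tripleGrad a b c f T) δ
      = loopPair f ((δ a * T b + T a * δ b) * T c + T a * T b * δ c) := by
  have e1 : ∀ x y z : Loop N, loopPair (y * z * f) x = loopPair f (x * y * z) := by
    intro x y z
    rw [loopPair_comm, ← loopPair_mul_left, loopPair_comm, mul_assoc]
  have e2 : ∀ x y z : Loop N, loopPair (z * f * x) y = loopPair f (x * y * z) := by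
    intro x y z
    rw [loopPair_mul_right, ← loopPair_mul_left]
  have e3 : ∀ x y z : Loop N, loopPair (f * x * y) z = loopPair f (x * y * z) := by
    intro x y z
    rw [loopPair_mul_left, loopPair_mul_left, mul_assoc]
  cases habc <;>
  · simp only [bigPair, Fin.sum_univ_three, tripleGrad, add_mul, loopPair_add_right]
    simp only [Fin.isValue, ite_true, ite_false, Fin.reduceEq, e1, e2, e3]
    ring

theorem hasSmoothGradient_comp_tripleProd {a b c : Fin 3} (habc : IsMonOrder a b c)
    {φ : (Fin 1 → Loop N) → ℝ} (hφ : IsSmoothFun φ) :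
    HasSmoothGradient (φ ∘ tripleProd a b c)
      (fun T => tripleGrad a b c (grad φ (tripleProd a b c T) 0) T) := by
  intro E _ _ _ γ hγ
  have hi := isSmoothFamily_iff.1 hγ
  have hp : IsSmoothFamily fun y => tripleProd a b c (γ y) :=
    isSmoothFamily_iff.2 fun _ => ((hi a).mul (hi b)).mul (hi c)
  obtain ⟨h1, h2, h3⟩ := hφ.hasSmoothGradient E _ hp
  have hf := isSmoothFamily_iff.1 h2 0
  refine ⟨h1, isSmoothFamily_iff.2 fun i => ?_, fun x w δ hδ => ?_⟩
  · simp only [tripleGrad]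
    split_ifs
    · exact ((hi b).mul (hi c)).mul hf
    · exact ((hi c).mul hf).mul (hi a)
    · exact (hf.mul (hi a)).mul (hi b)
  · have hd : ∀ i, HasLoopDeriv (fun y => γ y i) x w (δ i) := fun i => hδ i
    have hm := ((hd a).mul (hi a) (hi b) (hd b)).mul ((hi a).mul (hi b)) (hi c) (hd c)
    have := h3 x w (fun _ => (δ a * γ x b + γ x a * δ b) * γ x c + γ x a * γ x b * δ c)
      (fun _ p j k => hm p j k)
    rw [bigPair, Fin.sum_univ_one] at this
    rw [bigPair_tripleGrad habc, ← this]
    rfl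

/-- For a product abc and a gradient f, the derivatives with respect to the factors involve only the
words abcf, bcfa, cfab and fabc. The inner words bcfa and cfab occur both as a left and as a right
derivative, and the blocks are such that their contributions cancel. The outer words give the
bracket on g. -/
theorem PB2_comp_tripleProd {a b c : Fin 3} (habc : IsMonOrder a b c)
    {φ ψ : (Fin 1 → Loop N) → ℝ} (hφ : IsSmoothFun φ) (hψ : IsSmoothFun ψ)
    (T : Fin 3 → Loop N) :
    PB2 (bigA1 N) (bigA2 N) (bigS N) (φ ∘ tripleProd a b c) (ψ ∘ tripleProd a b c) T
      = PB2 (blockOp !![opA1 N]) (blockOp !![opA2 N]) (blockOp !![opS N]) φ ψ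
          (tripleProd a b c T) := by
  rw [PB2, PB2, (hasSmoothGradient_comp_tripleProd habc hφ).grad_eq,
    (hasSmoothGradient_comp_tripleProd habc hψ).grad_eq]
  -- Moving P₀ and W always into the first argument of the pairing gives a normal form, so that
  -- `ring` can match the terms.
  have p' : ∀ x y : Loop N, loopPair x (opP0 N y) = loopPair (opP0 N x) y :=
    fun x y => (loopPair_opP0 x y).symm
  have w' : ∀ x y : Loop N, loopPair x (opW N y) = -loopPair (opW N x) y :=
    fun x y => by rw [loopPair_opW, neg_neg]
  set f := grad φ (tripleProd a b c T) 0 with hf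
  set g := grad ψ (tripleProd a b c T) 0 with hg
  cases habc <;>
  · simp only [bigPair, Fin.sum_univ_three, Fin.sum_univ_one, bigA1, bigA2, bigS, blockOp_apply,
      opA1, opA2, opS, opSadj, Pi.mul_apply, tripleGrad, tripleProd]
    simp only [Fin.isValue, ite_true, ite_false, Fin.reduceEq, Matrix.of_apply,
      Matrix.cons_val', Matrix.cons_val_zero, Matrix.cons_val_one, Matrix.cons_val,
      LinearMap.add_apply, LinearMap.sub_apply, LinearMap.neg_apply, ← mul_assoc,
      loopPair_add_left, loopPair_add_right, loopPair_sub_left, loopPair_sub_right,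
      loopPair_neg_left, loopPair_neg_right, p', w'] at hf hg ⊢
    rw [← hf, ← hg]
    ring

theorem isPoissonMap_tripleProd_laxTriple [NeZero N] {a b c : Fin 3} (habc : IsMonOrder a b c)
    (h : ℝ) : IsPoissonMap SmoothPhase quadBr IsSmoothFun
      (PB2 (blockOp !![opA1 N]) (blockOp !![opA2 N]) (blockOp !![opS N]))
      (fun x => tripleProd a b c (laxTriple h x)) := by
  intro φ ψ hφ hψ
  obtain ⟨h1, h2, h3⟩ := isPoissonMap_laxTriple (N := N) h _ _
    ⟨_, hasSmoothGradient_comp_tripleProd habc hφ⟩ ⟨_, hasSmoothGradient_comp_tripleProd habc hψ⟩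
  refine ⟨h1, h2, h3.trans (funext fun x => ?_)⟩
  exact PB2_comp_tripleProd habc hφ hψ _

theorem isPoissonMap_monodromy [NeZero N] (h : ℝ) :
    ∀ T ∈ [monUVC (N := N) h, monVCU h, monCUV h],
      IsPoissonMap SmoothPhase quadBr IsSmoothFun
        (PB2 (blockOp !![opA1 N]) (blockOp !![opA2 N]) (blockOp !![opS N]))
        (fun x => (fun _ : Fin 1 => T x)) := by
  intro T hT
  simp only [List.mem_cons, List.not_mem_nil, or_false] at hT
  rcases hT with rfl | rfl | rfl
  · exact isPoissonMap_tripleProd_laxTriple .uvc h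
  · exact isPoissonMap_tripleProd_laxTriple .vcu h
  · exact isPoissonMap_tripleProd_laxTriple .cuv h

end ProductMaps

/-! ## Invariant functions -/

section Invariant

variable {N : ℕ}

/-- The right-hand side, conjugated back, is also a gradient of φ because φ is invariant; gradients
are unique. -/
theorem grad_conj {φ : (Fin 1 → Loop N) → ℝ} (hφ : IsSmoothFun φ) (hinv : ConjInvariant φ)
    (a : (Loop N)ˣ) (L : Loop N) :
    grad φ (fun _ => a * L * ↑a⁻¹) 0 = a * grad φ (fun _ => L) 0 * ↑a⁻¹ := by
  have key : HasSmoothGradient φ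
      (fun T _ => ↑a⁻¹ * grad φ (fun _ => a * T 0 * ↑a⁻¹) 0 * a) := by
    intro E _ _ _ γ hγ
    have hc : IsSmoothFamily fun y => (fun _ : Fin 1 => (a : Loop N) * γ y 0 * (↑a⁻¹ : Loop N)) :=
      isSmoothFamily_iff.2 fun _ =>
        ((SmoothLoop.const _).mul (isSmoothFamily_iff.1 hγ 0)).mul (SmoothLoop.const _)
    obtain ⟨h1, h2, h3⟩ := hφ.hasSmoothGradient E _ hc
    have e : ∀ y, φ (fun _ => (a : Loop N) * γ y 0 * (↑a⁻¹ : Loop N)) = φ (γ y) := by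
      intro y
      rw [hinv a (γ y 0)]
      congr 1
      funext i
      rw [Subsingleton.elim i 0]
    simp only [e] at h1 h3
    refine ⟨h1, isSmoothFamily_iff.2 fun _ => ((SmoothLoop.const _).mul
      (isSmoothFamily_iff.1 h2 0)).mul (SmoothLoop.const _), fun x w δ hδ => ?_⟩
    have hd : HasLoopDeriv (fun y => γ y 0) x w (δ 0) := hδ 0
    have hs := isSmoothFamily_iff.1 hγ 0
    have hm := ((hasLoopDeriv_const (a : Loop N) x w).mul (SmoothLoop.const _) hs hd).mul
      ((SmoothLoop.const _).mul hs) (SmoothLoop.const (↑a⁻¹ : Loop N)) (hasLoopDeriv_const _ x w)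
    simp only [zero_mul, zero_add, mul_zero, add_zero] at hm
    have h4 := h3 x w (fun _ => a * δ 0 * (↑a⁻¹ : Loop N)) (fun _ p j k => hm p j k)
    rw [bigPair, Fin.sum_univ_one, loopPair_mul_right, ← loopPair_mul_left] at h4
    refine h4.trans ?_
    rw [bigPair, Fin.sum_univ_one]
  have h := congrFun (congrFun key.grad_eq (fun _ => L)) 0
  rw [h]
  simp only [← mul_assoc, Units.mul_inv, one_mul]
  rw [mul_assoc _ (a : Loop N), Units.mul_inv, mul_one]

theorem conjCovariant_dLeft {φ : (Fin 1 → Loop N) → ℝ} (hφ : IsSmoothFun φ)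
    (hinv : ConjInvariant φ) : ConjCovariant (dLeft φ) := by
  intro a L
  rw [dLeft, grad_conj hφ hinv, dLeft]
  simp only [mul_assoc, Units.inv_mul_cancel_left]

/-- If a² = 0, then 1 + sa is a unit with inverse 1 − sa, so L can be moved within its conjugacy
class along a polynomial curve with derivative [a, L] at s = 0. No exponential is needed, which
would not exist in g for elements of positive degree. -/
theorem loopPair_comm_grad_of_sq_zero {φ : (Fin 1 → Loop N) → ℝ} (hφ : IsSmoothFun φ)
    (hinv : ConjInvariant φ) (L : Loop N) {a : Loop N} (ha : a * a = 0) :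
    loopPair (L * grad φ (fun _ => L) 0 - grad φ (fun _ => L) 0 * L) a = 0 := by
  have hs : SmoothLoop fun s : ℝ => s • a := (SmoothLoop.const a).smul contDiff_id
  have hm : SmoothLoop fun s : ℝ => (1 + s • a) * L * (1 - s • a) :=
    (((SmoothLoop.const 1).add hs).mul (SmoothLoop.const L)).mul ((SmoothLoop.const 1).sub hs)
  have hγ : IsSmoothFamily fun s : ℝ => (fun _ : Fin 1 => (1 + s • a) * L * (1 - s • a)) :=
    isSmoothFamily_iff.2 fun _ => hm
  have hd : HasLoopDeriv (fun s : ℝ => s • a) 0 1 a := by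
    have := (hasLoopDeriv_const a (0 : ℝ) (1 : ℝ)).smul contDiff_id (SmoothLoop.const a)
    simpa using this
  have h1 := ((hasLoopDeriv_const (1 : Loop N) (0 : ℝ) (1 : ℝ)).add (SmoothLoop.const 1) hs hd)
  have h2 := ((hasLoopDeriv_const (1 : Loop N) (0 : ℝ) (1 : ℝ)).sub (SmoothLoop.const 1) hs hd)
  have h3 := (h1.mul ((SmoothLoop.const 1).add hs) (SmoothLoop.const L)
    (hasLoopDeriv_const L _ _)).mul (((SmoothLoop.const 1).add hs).mul (SmoothLoop.const L))
    ((SmoothLoop.const 1).sub hs) h2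
  simp only [zero_add, zero_smul, add_zero, mul_zero, sub_zero, mul_one, zero_sub, one_mul,
    mul_neg] at h3
  have h4 := hφ.hasSmoothGradient.fderiv_eq (x := (0 : ℝ)) (w := 1) hγ
    (δ := fun _ => a * L + -(L * a)) (fun _ => h3)
  have e : (φ ∘ fun s : ℝ => (fun _ : Fin 1 => (1 + s • a) * L * (1 - s • a)))
      = fun _ => φ (fun _ => L) := by
    funext s
    have hsq : (s • a) * (s • a) = 0 := by rw [smul_mul', mul_smul', ha, smul_zero, smul_zero]
    exact hinv ⟨1 + s • a, 1 - s • a, by rw [add_mul, mul_sub, one_mul, mul_sub, hsq]; simp,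
      by rw [sub_mul, mul_add, one_mul, mul_add, hsq]; simp⟩ L
  have h5 : fderiv ℝ (fun _ : ℝ => φ (fun _ => L)) 0 1 = 0 := by simp
  rw [← e] at h5
  have h6 := h4.symm.trans h5
  simp only [zero_smul, add_zero, sub_zero, one_mul, mul_one, bigPair, Fin.sum_univ_one,
    ← sub_eq_add_neg] at h6
  rw [loopPair_sub_right, loopPair_mul_right, ← loopPair_mul_left] at h6
  rw [loopPair_sub_left, h6]

theorem matUnit_mul_matUnit {p q : ℤ} {i j k : Fin N} (h1 : ((i : ℕ) : ℤ) - ((j : ℕ) : ℤ) ≡ p [ZMOD (N : ℤ)])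
    (h2 : ((j : ℕ) : ℤ) - ((k : ℕ) : ℤ) ≡ q [ZMOD (N : ℤ)])
    (h3 : ((i : ℕ) : ℤ) - ((k : ℕ) : ℤ) ≡ p + q [ZMOD (N : ℤ)]) :
    matUnit p i j h1 * matUnit q j k h2 = matUnit (p + q) i k h3 := by
  refine coefMat_ext fun r => ?_
  rw [coefMat_mul_eq_finsum, finsum_eq_single _ p]
  · simp only [coefMat_matUnit, if_true]
    by_cases h : r = p + q
    · rw [if_pos h, if_pos (by lia), Matrix.single_mul_single_same, one_mul]
    · rw [if_neg h, if_neg (by lia), mul_zero]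
  · intro s hs
    rw [coefMat_matUnit, if_neg hs, zero_mul]

theorem matUnit_mul_matUnit_of_ne {p q : ℤ} {i j k l : Fin N} (h : j ≠ k) (h1) (h2) :
    matUnit p i j h1 * matUnit q k l h2 = 0 := by
  refine coefMat_ext fun r => ?_
  rw [coefMat_mul_eq_finsum, finsum_eq_zero_of_forall_eq_zero, coefMat_zero]
  intro s
  simp only [coefMat_matUnit]
  split_ifs <;> simp [h]

theorem trace_coefMat_mul_comm (L M : Loop N) (p : ℤ) :
    (coefMat p (L * M)).trace = (coefMat p (M * L)).trace := by
  have h : ∀ K : Loop N, (coefMat p K).trace = (Matrix.trace K.mat).coeff (-p) := by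
    intro K
    simp only [Matrix.trace, HahnSeries.coeff_sum, Matrix.diag, coefMat]
  rw [h, h]
  change (Matrix.trace (L.mat * M.mat)).coeff _ = (Matrix.trace (M.mat * L.mat)).coeff _
  rw [Matrix.trace_mul_comm]

/-- The gradient of an invariant function commutes with its argument. -/
theorem grad_commute {φ : (Fin 1 → Loop N) → ℝ} (hN : 2 ≤ N) (hφ : IsSmoothFun φ) (hinv : ConjInvariant φ)
    (L : Loop N) : L * grad φ (fun _ => L) 0 = grad φ (fun _ => L) 0 * L := by
  rw [← sub_eq_zero]
  have hsq := fun a => loopPair_comm_grad_of_sq_zero hφ hinv L (a := a)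
  -- A commutator has vanishing trace in every degree. This settles the one direction that elements
  -- of square zero cannot detect, the common value of the diagonal entries.
  have htr : ∀ p, (coefMat p (L * grad φ (fun _ => L) 0 - grad φ (fun _ => L) 0 * L)).trace = 0 := by
    intro p
    rw [coefMat_sub, Matrix.trace_sub, trace_coefMat_mul_comm, sub_self]
  generalize L * grad φ (fun _ => L) 0 - grad φ (fun _ => L) 0 * L = M at hsq htr
  refine coefMat_ext fun p => ?_
  -- Two diagonal entries are compared through units e = E_{jk} and b = E_{kj} whose degrees add up
  -- to −p, so that eb and be read off the diagonal entries of the coefficient of λᵖ.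
  have hdiag : ∀ j k : Fin N, coefMat p M j j = coefMat p M k k := by
    intro j k
    by_cases hjk : j = k
    · rw [hjk]
    by_cases hp : (0 : ℤ) ≡ p [ZMOD (N : ℤ)]
    · have hp' : (0 : ℤ) ≡ -p [ZMOD (N : ℤ)] := by simpa using hp.neg
      set r : ℤ := ((j : ℕ) : ℤ) - ((k : ℕ) : ℤ) with hr
      have hb : ((k : ℕ) : ℤ) - ((j : ℕ) : ℤ) ≡ -p - r [ZMOD (N : ℤ)] := by
        have := hp'.sub (Int.ModEq.refl (n := (N : ℤ)) r)
        rwa [zero_sub, hr, neg_sub] at this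
      have hz : ∀ i : Fin N, ((i : ℕ) : ℤ) - ((i : ℕ) : ℤ) ≡ -p [ZMOD (N : ℤ)] := by
        intro i; rwa [sub_self]
      set e := matUnit r j k (Int.ModEq.refl _) with he
      set b := matUnit (-p - r) k j hb with hb'
      have hee : e * e = 0 := matUnit_mul_matUnit_of_ne (Ne.symm hjk) _ _
      have hbb : b * b = 0 := matUnit_mul_matUnit_of_ne hjk _ _
      have hbeb : (b * e * b) * (b * e * b) = 0 := by
        have : (b * e * b) * (b * e * b) = b * e * (b * b) * e * b := by noncomm_ring
        rw [this, hbb]; simp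
      -- The conjugate e + be − eb − beb of e by 1 + b has square zero too. As M is orthogonal to e
      -- and to beb, it pairs equally with be and eb.
      have hconj : ((1 + b) * e * (1 - b)) * ((1 + b) * e * (1 - b)) = 0 := by
        have : ((1 + b) * e * (1 - b)) * ((1 + b) * e * (1 - b))
            = (1 + b) * (e * e - e * (b * b) * e) * (1 - b) := by noncomm_ring
        rw [this, hee, hbb]; simp
      have h1 := hsq _ hee
      have h2 := hsq _ hbeb
      have h3 := hsq _ hconj
      have hx : (1 + b) * e * (1 - b) = e + b * e - e * b - b * e * b := by noncomm_ring
      have hbe : loopPair M (b * e) = coefMat p M k k := by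
        have hm : b * e = matUnit (-p - r + r) k k (by rw [sub_add_cancel]; exact hz k) :=
          matUnit_mul_matUnit _ _ _
        rw [hm, loopPair_matUnit, sub_add_cancel, neg_neg]
      have heb : loopPair M (e * b) = coefMat p M j j := by
        have hm : e * b = matUnit (r + (-p - r)) j j (by rw [add_sub_cancel]; exact hz j) :=
          matUnit_mul_matUnit _ _ _
        rw [hm, loopPair_matUnit, add_sub_cancel, neg_neg]
      rw [hx, loopPair_sub_right, loopPair_sub_right, loopPair_add_right, h1, h2, hbe, heb] at h3
      linarith
    · have hz : ∀ i : Fin N, ¬ ((i : ℕ) : ℤ) - ((i : ℕ) : ℤ) ≡ p [ZMOD (N : ℤ)] := by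
        intro i; rwa [sub_self]
      rw [coefMat_twisted M p j j (hz j), coefMat_twisted M p k k (hz k)]
  ext i j
  rw [coefMat_zero, Matrix.zero_apply]
  by_cases hij : i = j
  · subst hij
    have h := htr p
    have h2 : (coefMat p M).trace = ∑ _k : Fin N, coefMat p M i i :=
      Finset.sum_congr rfl fun k _ => hdiag k i
    rw [h2, Finset.sum_const, Finset.card_univ, Fintype.card_fin, nsmul_eq_mul] at h
    have hN' : (N : ℝ) ≠ 0 := by
      have : N ≠ 0 := by lia
      exact_mod_cast this
    exact (mul_eq_zero.1 h).resolve_left hN'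
  · by_cases h : ((i : ℕ) : ℤ) - ((j : ℕ) : ℤ) ≡ p [ZMOD (N : ℤ)]
    · have h' : ((j : ℕ) : ℤ) - ((i : ℕ) : ℤ) ≡ -p [ZMOD (N : ℤ)] := by
        have := h.neg; rwa [neg_sub] at this
      -- An off-diagonal matrix unit has square zero and detects an off-diagonal entry directly.
      have := hsq (matUnit (-p) j i h') (matUnit_mul_matUnit_of_ne hij _ _)
      rwa [loopPair_matUnit, neg_neg] at this
    · exact coefMat_twisted M p i j h

variable [NeZero N]

/-- Since the gradient f commutes with L = UVC⁻¹, the four words around the product reduce to dφ at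
the three monodromy matrices. In `laxDir` the value at C⁻¹UV cancels from the u-equation and the
value at UVC⁻¹ from the v-equation, which leaves the triad field. -/
theorem hamField_monUVC (hN : 2 ≤ N) {φ : (Fin 1 → Loop N) → ℝ} (hφ : IsSmoothFun φ)
    (hinv : ConjInvariant φ) (h : ℝ) (x : Phase N) :
    hamField (fun x => φ (fun _ => monUVC h x)) x = hierField h (dLeft φ) x := by
  have hg := hasSmoothGradient_comp_tripleProd .uvc hφ
  have e := hamField_comp_laxTriple h ⟨_, hg⟩ x
  rw [hg.grad_eq] at e
  refine (Eq.trans rfl e).trans ?_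
  have hcov := conjCovariant_dLeft hφ hinv
  have hcomm := grad_commute hN hφ hinv (monUVC h x)
  set f := grad φ (fun _ => monUVC h x) 0 with hf
  have hf' : grad φ (tripleProd 0 2 1 (laxTriple h x)) 0 = f := rfl
  have hF1 : dLeft φ (monUVC h x) = monUVC h x * f := rfl
  have hF3 : dLeft φ (monVCU h x) = matV x * matCinv h x * f * matU x := by
    obtain ⟨a, ha⟩ := exists_unitU x
    have h1 := matU_mul_covariant hcov h x
    rw [hF1, ← ha] at h1
    rw [← Units.mul_right_inj a]
    rw [h1, monUVC, ← ha]
    simp only [mul_assoc]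
  have hF2 : dLeft φ (monCUV h x) = matCinv h x * f * matU x * matV x := by
    have h1 := congrArg (fun K => matCinv h x * K) (matC_mul_covariant hcov h x)
    simp only [← mul_assoc, matCinv_mul_matC, one_mul] at h1
    rw [h1, hF1, hcomm, monUVC]
    simp only [mul_assoc, matCinv_mul_matC, mul_one]
  have a1 : f * matU x * matV x * matCinv h x = dLeft φ (monUVC h x) := by
    rw [hF1, hcomm, monUVC]; simp only [mul_assoc]
  have b0 : matU x * (matV x * matCinv h x * f) = dLeft φ (monUVC h x) := by
    rw [hF1, monUVC]; simp only [mul_assoc]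
  have b1 : matCinv h x * (f * matU x * matV x) = dLeft φ (monCUV h x) := by
    rw [hF2]; simp only [mul_assoc]
  have b2 : matV x * (matCinv h x * f * matU x) = dLeft φ (monVCU h x) := by
    rw [hF3]; simp only [mul_assoc]
  refine Prod.ext (funext fun k => ?_) (funext fun k => ?_)
  · change x.1 k * (freeDiag N (matCinv h x * (f * matU x * matV x)) k
      - freeDiag N (f * matU x * matV x * matCinv h x) k
      + freeDiag N (matV x * (matCinv h x * f * matU x)) k
      - freeDiag N (matCinv h x * f * matU x * matV x) k)
      = x.1 k * (freeDiag N (dLeft φ (monVCU h x)) k - freeDiag N (dLeft φ (monUVC h x)) k)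
    rw [a1, b1, b2, ← hF2]
    ring
  · change x.2 k * (freeDiag N (matU x * (matV x * matCinv h x * f)) (k + 1)
      - freeDiag N (matV x * matCinv h x * f * matU x) k
      + freeDiag N (matCinv h x * (f * matU x * matV x)) (k + 1)
      - freeDiag N (f * matU x * matV x * matCinv h x) (k + 1))
      = x.2 k * (freeDiag N (dLeft φ (monCUV h x)) (k + 1) - freeDiag N (dLeft φ (monVCU h x)) k)
    rw [b0, b1, a1, ← hF3]
    ring

end Invariant

/-! ## Absolutely summable doubly infinite series -/

section Wiener

variable {A : Type} [NormedRing A] [NormedAlgebra ℝ A] [CompleteSpace A]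

/-- Absolutely summable doubly infinite series with coefficients in `A`. -/
def Wiener (A : Type) [NormedRing A] : Type := lp (fun _ : ℤ => A) 1

namespace Wiener

instance : NormedAddCommGroup (Wiener A) := inferInstanceAs (NormedAddCommGroup (lp (fun _ : ℤ => A) 1))
instance : NormedSpace ℝ (Wiener A) := inferInstanceAs (NormedSpace ℝ (lp (fun _ : ℤ => A) 1))
instance : CompleteSpace (Wiener A) := inferInstanceAs (CompleteSpace (lp (fun _ : ℤ => A) 1))

/-- The coefficients of a series. -/
def coef (f : Wiener A) (p : ℤ) : A := (f : lp (fun _ : ℤ => A) 1).1 p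

theorem ext {f g : Wiener A} (h : ∀ p, f.coef p = g.coef p) : f = g := Subtype.ext (funext h)

theorem memℓp_iff {f : ℤ → A} : Memℓp f 1 ↔ Summable fun p => ‖f p‖ := by
  rw [memℓp_gen_iff (by simp)]
  simp

theorem summable_norm_coef (f : Wiener A) : Summable fun p => ‖f.coef p‖ :=
  memℓp_iff.1 (f : lp (fun _ : ℤ => A) 1).2

theorem norm_eq_tsum (f : Wiener A) : ‖f‖ = ∑' p, ‖f.coef p‖ := by
  have := lp.norm_eq_tsum_rpow (E := fun _ : ℤ => A) (p := 1) (by simp) f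
  simp only [ENNReal.toReal_one, Real.rpow_one, div_one] at this
  exact this

/-- The series with the given summable coefficients. -/
def mk (f : ℤ → A) (hf : Summable fun p => ‖f p‖) : Wiener A :=
  (⟨f, memℓp_iff.2 hf⟩ : lp (fun _ : ℤ => A) 1)

theorem coef_mk (f : ℤ → A) (hf) (p : ℤ) : (mk f hf).coef p = f p := rfl
theorem coef_add (f g : Wiener A) (p : ℤ) : (f + g).coef p = f.coef p + g.coef p := rfl
theorem coef_zero (p : ℤ) : (0 : Wiener A).coef p = 0 := rfl
theorem coef_sub (f g : Wiener A) (p : ℤ) : (f - g).coef p = f.coef p - g.coef p := rfl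
theorem coef_smul (r : ℝ) (f : Wiener A) (p : ℤ) : (r • f).coef p = r • f.coef p := rfl

theorem norm_coef_le (f : Wiener A) (p : ℤ) : ‖f.coef p‖ ≤ ‖f‖ :=
  lp.norm_apply_le_norm (E := fun _ : ℤ => A) one_ne_zero f p

theorem norm_le_of_coef {f g : Wiener A} {C : ℝ} (h : ∀ p, ‖f.coef p‖ ≤ C * ‖g.coef p‖) :
    ‖f‖ ≤ C * ‖g‖ := by
  rw [norm_eq_tsum, norm_eq_tsum, ← tsum_mul_left]
  exact f.summable_norm_coef.tsum_le_tsum h (g.summable_norm_coef.mul_left C)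

/-- A coefficient as a continuous linear map. -/
def coefCLM (p : ℤ) : Wiener A →L[ℝ] A :=
  LinearMap.mkContinuous ⟨⟨fun f => f.coef p, fun _ _ => rfl⟩, fun _ _ => rfl⟩ 1
    fun f => by rw [one_mul]; exact f.norm_coef_le p

theorem coefCLM_apply (p : ℤ) (f : Wiener A) : coefCLM p f = f.coef p := rfl

/-- The monomial with coefficient `a` in degree `q`. -/
def single (q : ℤ) (a : A) : Wiener A := lp.single (E := fun _ : ℤ => A) 1 q a

theorem coef_single (q : ℤ) (a : A) (p : ℤ) : (single q a).coef p = if p = q then a else 0 := by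
  change (lp.single (E := fun _ : ℤ => A) 1 q a : ℤ → A) p = _
  rw [lp.single_apply, Pi.single_apply]

theorem norm_single (q : ℤ) (a : A) : ‖single q a‖ = ‖a‖ :=
  lp.norm_single (E := fun _ : ℤ => A) one_pos q a

theorem hasSum_single (f : Wiener A) : HasSum (fun q => single q (f.coef q)) f :=
  lp.hasSum_single (E := fun _ : ℤ => A) (p := 1) (by simp) f

/-- Monomials sum to every series in norm, so continuous linear identities can be checked on
monomials. -/
theorem clm_ext {F : Type*} [NormedAddCommGroup F] [NormedSpace ℝ F] {S T : Wiener A →L[ℝ] F}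
    (h : ∀ q a, S (single q a) = T (single q a)) : S = T := by
  refine ContinuousLinearMap.ext fun f => ?_
  have h1 := S.hasSum f.hasSum_single
  have h2 := T.hasSum f.hasSum_single
  simp only [h] at h1
  exact h1.unique h2

/-! ### The product -/

theorem summable_shift (f : Wiener A) (q : ℤ) (a : A) :
    Summable fun p => ‖a * f.coef (p - q)‖ :=
  Summable.of_nonneg_of_le (fun _ => norm_nonneg _) (fun _ => norm_mul_le a _)
    (((Equiv.subRight q).summable_iff.2 f.summable_norm_coef).mul_left ‖a‖)

/-- Multiplication by a monomial. -/
def opMonomial (q : ℤ) (a : A) : Wiener A →L[ℝ] Wiener A :=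
  LinearMap.mkContinuous
    ⟨⟨fun f => mk (fun p => a * f.coef (p - q)) (f.summable_shift q a), fun f g =>
      ext fun p => mul_add _ _ _⟩, fun r f => ext fun p => mul_smul_comm _ _ _⟩ ‖a‖ fun f => by
    change ‖mk (fun p => a * f.coef (p - q)) (f.summable_shift q a)‖ ≤ _
    rw [norm_eq_tsum, norm_eq_tsum, ← (Equiv.subRight q).tsum_eq (fun p => ‖f.coef p‖),
      ← tsum_mul_left]
    exact (f.summable_shift q a).tsum_le_tsum (fun p => norm_mul_le _ _)
      (((Equiv.subRight q).summable_iff.2 f.summable_norm_coef).mul_left ‖a‖)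

theorem coef_opMonomial (q : ℤ) (a : A) (f : Wiener A) (p : ℤ) :
    (opMonomial q a f).coef p = a * f.coef (p - q) := rfl

theorem norm_opMonomial_le (q : ℤ) (a : A) : ‖opMonomial q a‖ ≤ ‖a‖ :=
  LinearMap.mkContinuous_norm_le _ (norm_nonneg _) _

theorem summable_opMonomial (f : Wiener A) : Summable fun q => opMonomial q (f.coef q) :=
  Summable.of_norm_bounded f.summable_norm_coef fun q => norm_opMonomial_le q _

/-- Left multiplication, as a bounded bilinear map. -/
def mulL : Wiener A →L[ℝ] Wiener A →L[ℝ] Wiener A :=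
  LinearMap.mkContinuous ⟨⟨fun f => ∑' q, opMonomial q (f.coef q), fun f g => by
      rw [← f.summable_opMonomial.tsum_add g.summable_opMonomial]
      refine tsum_congr fun q => ?_
      refine ContinuousLinearMap.ext fun k => ext fun p => ?_
      exact add_mul _ _ _⟩, fun r f => by
      rw [RingHom.id_apply, ← tsum_const_smul'']
      refine tsum_congr fun q => ?_
      refine ContinuousLinearMap.ext fun k => ext fun p => ?_
      exact smul_mul_assoc _ _ _⟩ 1 fun f => by
    rw [one_mul, norm_eq_tsum]
    exact tsum_of_norm_bounded f.summable_norm_coef.hasSum fun q => norm_opMonomial_le q _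

theorem mulL_apply (f : Wiener A) : mulL f = ∑' q, opMonomial q (f.coef q) := rfl

theorem mulL_single (q : ℤ) (a : A) : mulL (single q a) = opMonomial q a := by
  rw [mulL_apply, tsum_eq_single q]
  · rw [coef_single, if_pos rfl]
  · intro r hr
    rw [coef_single, if_neg hr]
    refine ContinuousLinearMap.ext fun k => ext fun p => ?_
    exact zero_mul _

theorem opMonomial_single (q : ℤ) (a : A) (r : ℤ) (b : A) :
    opMonomial q a (single r b) = single (q + r) (a * b) := by
  refine ext fun p => ?_
  rw [coef_opMonomial, coef_single, coef_single]
  by_cases h : p = q + r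
  · rw [if_pos h, if_pos (by lia)]
  · rw [if_neg h, if_neg (by lia), mul_zero]

theorem opMonomial_comp (q : ℤ) (a : A) (r : ℤ) (b : A) :
    (opMonomial q a).comp (opMonomial r b) = opMonomial (q + r) (a * b) := by
  refine ContinuousLinearMap.ext fun k => ext fun p => ?_
  change a * (b * k.coef (p - q - r)) = a * b * k.coef (p - (q + r))
  rw [mul_assoc, sub_sub]

/-- Associativity of the convolution, written as an identity of bounded operators; it is checked on
monomials, first in one factor and then in the other. -/
theorem mulL_mulL (f g : Wiener A) : mulL (mulL f g) = (mulL f).comp (mulL g) := by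
  have h2 : ∀ q (a : A), mulL.comp (mulL (single q a))
      = (ContinuousLinearMap.compL ℝ (Wiener A) _ _ (mulL (single q a))).comp mulL := by
    intro q a
    refine clm_ext fun r b => ?_
    change mulL (mulL (single q a) (single r b)) = (mulL (single q a)).comp (mulL (single r b))
    rw [mulL_single, opMonomial_single, mulL_single, mulL_single, opMonomial_comp]
  have h3 : mulL.comp (mulL.flip g)
      = ((ContinuousLinearMap.compL ℝ (Wiener A) (Wiener A) (Wiener A)).flip (mulL g)).comp mulL :=
    clm_ext fun q a => congrArg (fun T => T g) (h2 q a)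
  exact congrArg (fun T => T f) h3

instance : Mul (Wiener A) := ⟨fun f g => mulL f g⟩
instance : One (Wiener A) := ⟨single 0 1⟩

theorem mul_def (f g : Wiener A) : f * g = mulL f g := rfl
theorem one_def : (1 : Wiener A) = single 0 1 := rfl

theorem hasSum_coef_mul (f g : Wiener A) (p : ℤ) :
    HasSum (fun q => f.coef q * g.coef (p - q)) ((f * g).coef p) := by
  have h := f.summable_opMonomial.hasSum
  rw [← mulL_apply] at h
  have h1 := (ContinuousLinearMap.apply ℝ (Wiener A) g).hasSum h
  simp only [ContinuousLinearMap.apply_apply, ← mul_def] at h1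
  have h2 := (coefCLM p).hasSum h1
  simp only [coefCLM_apply, coef_opMonomial] at h2
  exact h2

theorem coef_mul (f g : Wiener A) (p : ℤ) :
    (f * g).coef p = ∑' q, f.coef q * g.coef (p - q) := (hasSum_coef_mul f g p).tsum_eq.symm

instance : NormedRing (Wiener A) where
  __ := (inferInstance : NormedAddCommGroup (Wiener A))
  left_distrib f g k := (mulL f).map_add g k
  right_distrib f g k := mulL.map_add₂ f g k
  zero_mul f := mulL.map_zero₂ f
  mul_zero f := (mulL f).map_zero
  mul_assoc f g k := congrArg (fun T => T k) (mulL_mulL f g)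
  one_mul f := ext fun p => by
    rw [one_def, mul_def, mulL_single, coef_opMonomial, one_mul, sub_zero]
  mul_one f := ext fun p => by
    rw [coef_mul, tsum_eq_single p]
    · rw [one_def, coef_single, if_pos (by lia), mul_one]
    · intro q hq
      rw [one_def, coef_single, if_neg (by lia), mul_zero]
  norm_mul_le f g := by
    refine (mulL f).le_of_opNorm_le ?_ g
    rw [mulL_apply, norm_eq_tsum]
    exact tsum_of_norm_bounded f.summable_norm_coef.hasSum fun q => norm_opMonomial_le q _

instance : NormedAlgebra ℝ (Wiener A) where
  __ := Algebra.ofModule (R := ℝ) (A := Wiener A) (fun r f g => mulL.map_smul₂ r f g)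
    (fun r f g => (mulL f).map_smul r g)
  norm_smul_le r f := norm_smul_le r f

theorem coef_one (p : ℤ) : (1 : Wiener A).coef p = if p = 0 then 1 else 0 := by
  rw [one_def, coef_single]

theorem norm_one [NormOneClass A] : ‖(1 : Wiener A)‖ = 1 := by
  rw [one_def, norm_single, NormOneClass.norm_one]

instance [NormOneClass A] : NormOneClass (Wiener A) := ⟨norm_one⟩

/-! ### Truncations -/

open Classical in
/-- Keep the coefficients with degree in `s`. -/
def trunc (s : Set ℤ) : Wiener A →L[ℝ] Wiener A :=
  LinearMap.mkContinuous ⟨⟨fun f => mk (fun p => if p ∈ s then f.coef p else 0)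
      (Summable.of_nonneg_of_le (fun _ => norm_nonneg _)
        (fun p => by split_ifs <;> simp) f.summable_norm_coef), fun f g => ext fun p => by
        rw [coef_add, coef_mk, coef_mk, coef_mk, coef_add]; split_ifs <;> simp⟩,
      fun r f => ext fun p => by
        rw [RingHom.id_apply, coef_smul, coef_mk, coef_mk, coef_smul]; split_ifs <;> simp⟩ 1
    fun f => norm_le_of_coef fun p => by
      rw [one_mul]
      change ‖if p ∈ s then f.coef p else 0‖ ≤ _
      split_ifs <;> simp

open Classical in
theorem coef_trunc (s : Set ℤ) (f : Wiener A) (p : ℤ) :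
    (trunc s f).coef p = if p ∈ s then f.coef p else 0 := rfl

theorem norm_trunc_le (s : Set ℤ) (f : Wiener A) : ‖trunc s f‖ ≤ ‖f‖ := by
  rw [← one_mul ‖f‖]
  refine norm_le_of_coef fun p => ?_
  rw [coef_trunc, one_mul]
  split_ifs <;> simp

/-- All coefficients with degree outside `s` vanish. -/
def SuppIn (s : Set ℤ) (f : Wiener A) : Prop := ∀ p, p ∉ s → f.coef p = 0

theorem trunc_eq_self {s : Set ℤ} {f : Wiener A} (h : SuppIn s f) : trunc s f = f := by
  refine ext fun p => ?_
  rw [coef_trunc]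
  split_ifs with hp
  · rfl
  · exact (h p hp).symm

theorem trunc_eq_zero {s t : Set ℤ} {f : Wiener A} (h : SuppIn t f) (hst : Disjoint s t) :
    trunc s f = 0 := by
  refine ext fun p => ?_
  rw [coef_trunc, coef_zero]
  split_ifs with hp
  · exact h p fun ht => hst.le_bot ⟨hp, ht⟩
  · rfl

theorem suppIn_trunc (s : Set ℤ) (f : Wiener A) : SuppIn s (trunc s f) := fun p hp => by
  rw [coef_trunc, if_neg hp]

theorem SuppIn.mul {s t u : Set ℤ} {f g : Wiener A} (hf : SuppIn s f) (hg : SuppIn t g)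
    (h : ∀ p ∈ s, ∀ q ∈ t, p + q ∈ u) : SuppIn u (f * g) := by
  intro p hp
  rw [coef_mul]
  refine (tsum_congr fun q => ?_).trans tsum_zero
  by_cases h1 : q ∈ s
  · by_cases h2 : p - q ∈ t
    · exact absurd (by simpa using h q h1 _ h2) hp
    · rw [hg _ h2, mul_zero]
  · rw [hf _ h1, zero_mul]

theorem SuppIn.mono {s t : Set ℤ} {f : Wiener A} (hf : SuppIn s f) (h : s ⊆ t) : SuppIn t f :=
  fun p hp => hf p fun hs => hp (h hs)

theorem SuppIn.add {s : Set ℤ} {f g : Wiener A} (hf : SuppIn s f) (hg : SuppIn s g) :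
    SuppIn s (f + g) := fun p hp => by rw [coef_add, hf p hp, hg p hp, add_zero]

theorem SuppIn.sub {s : Set ℤ} {f g : Wiener A} (hf : SuppIn s f) (hg : SuppIn s g) :
    SuppIn s (f - g) := fun p hp => by rw [coef_sub, hf p hp, hg p hp, sub_zero]

theorem suppIn_single {s : Set ℤ} {q : ℤ} (h : q ∈ s) (a : A) : SuppIn s (single q a) :=
  fun p hp => by rw [coef_single, if_neg (by rintro rfl; exact hp h)]

theorem trunc_add_trunc_compl (s : Set ℤ) (f : Wiener A) : trunc s f + trunc sᶜ f = f := by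
  refine ext fun p => ?_
  rw [coef_add, coef_trunc, coef_trunc]
  by_cases hp : p ∈ s
  · rw [if_pos hp, if_neg (by simpa using hp), add_zero]
  · rw [if_neg hp, if_pos (by simpa using hp), zero_add]

end Wiener

end Wiener

/-! ## The logarithm in a Banach algebra -/

section LogOnePlus

variable {B : Type*} [NormedRing B] [NormedAlgebra ℝ B] [CompleteSpace B]

/-- The coefficients of `log (1 + x)`. -/
def logCoeff (n : ℕ) : ℝ := (-1) ^ n / (n + 1)

theorem abs_logCoeff_mul (n : ℕ) : |logCoeff n| * (n + 1) = 1 := by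
  have : (n : ℝ) + 1 ≠ 0 := by positivity
  rw [logCoeff, abs_div, abs_pow, abs_neg, abs_one, one_pow, abs_of_pos (by positivity)]
  field_simp

theorem abs_logCoeff_le (n : ℕ) : |logCoeff n| ≤ 1 := by
  have h := abs_logCoeff_mul n
  have : (0 : ℝ) ≤ n := Nat.cast_nonneg n
  nlinarith [abs_nonneg (logCoeff n)]

/-- `log (1 + x)` as a power series. -/
def logOnePlus (x : B) : B := ∑' n : ℕ, logCoeff n • x ^ (n + 1)

theorem norm_logCoeff_smul_le (x : B) (n : ℕ) : ‖logCoeff n • x ^ (n + 1)‖ ≤ ‖x‖ ^ (n + 1) := by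
  refine (norm_smul_le _ _).trans ?_
  have h := norm_pow_le' x n.succ_pos
  rw [Real.norm_eq_abs]
  calc |logCoeff n| * ‖x ^ (n + 1)‖ ≤ 1 * ‖x‖ ^ (n + 1) :=
        mul_le_mul (abs_logCoeff_le n) h (norm_nonneg _) zero_le_one
    _ = _ := one_mul _

theorem hasSum_pow_succ {r : ℝ} (h0 : 0 ≤ r) (h1 : r < 1) :
    HasSum (fun n : ℕ => r ^ (n + 1)) (r * (1 - r)⁻¹) := by
  simp only [pow_succ']
  exact (hasSum_geometric_of_lt_one h0 h1).mul_left r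

theorem summable_logOnePlus {x : B} (hx : ‖x‖ < 1) :
    Summable fun n : ℕ => logCoeff n • x ^ (n + 1) :=
  Summable.of_norm_bounded (hasSum_pow_succ (norm_nonneg x) hx).summable
    (norm_logCoeff_smul_le x)

theorem norm_logOnePlus_le {x : B} (hx : ‖x‖ ≤ 1 / 2) : ‖logOnePlus x‖ ≤ 2 * ‖x‖ := by
  have h := tsum_of_norm_bounded (hasSum_pow_succ (norm_nonneg x) (by linarith))
    (norm_logCoeff_smul_le x)
  refine h.trans ?_
  have h2 : (1 - ‖x‖)⁻¹ ≤ 2 := by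
    rw [inv_le_comm₀ (by linarith) (by norm_num)]; linarith
  nlinarith [norm_nonneg x]

/-- Intertwining passes to powers and then term by term through the convergent sum. -/
theorem mul_logOnePlus {a x y : B} (hx : ‖x‖ < 1) (hy : ‖y‖ < 1) (h : a * x = y * a) :
    a * logOnePlus x = logOnePlus y * a := by
  rw [logOnePlus, logOnePlus, ← (summable_logOnePlus hx).tsum_mul_left,
    ← (summable_logOnePlus hy).tsum_mul_right]
  refine tsum_congr fun n => ?_
  have hs : SemiconjBy a x y := h
  rw [mul_smul_comm, smul_mul_assoc, (hs.pow_right (n + 1)).eq]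

theorem norm_pow_sub_pow_le {x y : B} {r : ℝ} (hx : ‖x‖ ≤ r) (hy : ‖y‖ ≤ r) (n : ℕ) :
    ‖x ^ (n + 1) - y ^ (n + 1)‖ ≤ (n + 1) * r ^ n * ‖x - y‖ := by
  have hr : 0 ≤ r := (norm_nonneg x).trans hx
  induction n with
  | zero => simp
  | succ n ih =>
    have e : x ^ (n + 1 + 1) - y ^ (n + 1 + 1)
        = x * (x ^ (n + 1) - y ^ (n + 1)) + (x - y) * y ^ (n + 1) := by
      rw [pow_succ' x, pow_succ' y, mul_sub, sub_mul]; abel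
    have hy' : ‖y ^ (n + 1)‖ ≤ r ^ (n + 1) :=
      (norm_pow_le' y n.succ_pos).trans (pow_le_pow_left₀ (norm_nonneg _) hy _)
    rw [e]
    calc _ ≤ ‖x‖ * ‖x ^ (n + 1) - y ^ (n + 1)‖ + ‖x - y‖ * ‖y ^ (n + 1)‖ :=
          (norm_add_le _ _).trans (add_le_add (norm_mul_le _ _) (norm_mul_le _ _))
      _ ≤ r * ((n + 1) * r ^ n * ‖x - y‖) + ‖x - y‖ * r ^ (n + 1) := by gcongr
      _ = _ := by push_cast; ring

/-- The factor n + 1 from the difference of powers cancels the denominator of the logarithm's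
coefficient, leaving a geometric majorant. -/
theorem norm_logCoeff_smul_sub_le {x y : B} (hx : ‖x‖ ≤ 1 / 2) (hy : ‖y‖ ≤ 1 / 2) (n : ℕ) :
    ‖logCoeff n • x ^ (n + 1) - logCoeff n • y ^ (n + 1)‖ ≤ (1 / 2 : ℝ) ^ n * ‖x - y‖ := by
  rw [← smul_sub]
  refine (norm_smul_le _ _).trans ?_
  rw [Real.norm_eq_abs]
  calc |logCoeff n| * ‖x ^ (n + 1) - y ^ (n + 1)‖
      ≤ |logCoeff n| * ((n + 1) * (1 / 2) ^ n * ‖x - y‖) :=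
        mul_le_mul_of_nonneg_left (norm_pow_sub_pow_le hx hy n) (abs_nonneg _)
    _ = (|logCoeff n| * (n + 1)) * ((1 / 2) ^ n * ‖x - y‖) := by ring
    _ = _ := by rw [abs_logCoeff_mul, one_mul]

theorem norm_logOnePlus_sub_le {x y : B} (hx : ‖x‖ ≤ 1 / 2) (hy : ‖y‖ ≤ 1 / 2) :
    ‖logOnePlus x - logOnePlus y‖ ≤ 2 * ‖x - y‖ := by
  have h1 : Summable fun n : ℕ => logCoeff n • x ^ (n + 1) := summable_logOnePlus (by linarith)
  have h2 : Summable fun n : ℕ => logCoeff n • y ^ (n + 1) := summable_logOnePlus (by linarith)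
  have h3 := (h1.hasSum.sub h2.hasSum).norm_le_of_bounded
    ((hasSum_geometric_of_lt_one (by norm_num) (by norm_num : (1 / 2 : ℝ) < 1)).mul_right ‖x - y‖)
    (norm_logCoeff_smul_sub_le hx hy)
  refine h3.trans (le_of_eq ?_)
  norm_num

open NormedSpace

/-- Commutation allows splitting off exp(g(t)), after which only the derivative of exp at 0 is
needed. -/
theorem hasDerivAt_exp_comp_of_commute {g : ℝ → B} {g' : B} {t : ℝ} (hg : HasDerivAt g g' t)
    (hc : ∀ s, Commute (g t) (g s)) :
    HasDerivAt (fun s => exp (g s)) (exp (g t) * g') t := by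
  let _ : NormedAlgebra ℚ B := NormedAlgebra.restrictScalars ℚ ℝ B
  have e : (fun s => exp (g s)) = fun s => exp (g t) * exp (g s - g t) := by
    funext s
    rw [← exp_add_of_commute ((hc s).sub_right (Commute.refl _)), add_sub_cancel]
  rw [e]
  refine HasDerivAt.const_mul _ ?_
  have h0 : HasFDerivAt exp (1 : B →L[ℝ] B) (g t - g t) := by
    rw [sub_self]; exact hasFDerivAt_exp_zero
  exact h0.comp_hasDerivAt t (hg.sub_const _)

/-- For |t| < 3/2 and ‖x‖ ≤ 1/2 the terms of the derivative are dominated by powers of 3/4. The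
interval exceeds [0, 1], so t = 1 is an interior point. -/
theorem hasDerivAt_logOnePlus_smul {x : B} (hx : ‖x‖ ≤ 1 / 2) {t : ℝ} (ht : |t| < 3 / 2) :
    HasDerivAt (fun s : ℝ => logOnePlus (s • x)) (∑' n : ℕ, (-(t • x)) ^ n * x) t := by
  have hd : ∀ (n : ℕ) (s : ℝ), HasDerivAt (fun s : ℝ => logCoeff n • (s • x) ^ (n + 1))
      ((-(s • x)) ^ n * x) s := by
    intro n s
    simp only [smul_pow]
    have h1 : HasDerivAt (fun s : ℝ => s ^ (n + 1)) (((n + 1 : ℕ) : ℝ) * s ^ n) s := by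
      simpa using hasDerivAt_pow (n + 1) s
    refine ((h1.smul_const (x ^ (n + 1))).const_smul (logCoeff n)).congr_deriv ?_
    rw [← neg_smul, smul_pow, smul_smul, smul_mul_assoc, ← pow_succ]
    congr 1
    have : (n : ℝ) + 1 ≠ 0 := by positivity
    rw [logCoeff, neg_pow s]
    push_cast
    field_simp
  have hb : ∀ (n : ℕ) (s : ℝ), s ∈ Set.Ioo (-(3 / 2) : ℝ) (3 / 2) →
      ‖(-(s • x)) ^ n * x‖ ≤ (3 / 4 : ℝ) ^ n * ‖x‖ := by
    intro n s hs
    have hs' : |s| ≤ 3 / 2 := (abs_lt.2 hs).le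
    have h1 : ‖-(s • x)‖ ≤ 3 / 4 := by
      rw [norm_neg]
      refine (norm_smul_le _ _).trans ?_
      rw [Real.norm_eq_abs]
      nlinarith [norm_nonneg x, abs_nonneg s]
    rcases Nat.eq_zero_or_pos n with rfl | hn
    · simp
    · refine (norm_mul_le _ _).trans ?_
      gcongr
      exact (norm_pow_le' _ hn).trans (pow_le_pow_left₀ (norm_nonneg _) h1 n)
  refine hasDerivAt_tsum_of_isPreconnected
    ((summable_geometric_of_lt_one (by norm_num) (by norm_num : (3 / 4 : ℝ) < 1)).mul_right ‖x‖)
    isOpen_Ioo isPreconnected_Ioo (fun n s _ => hd n s) hb (y₀ := 0) (by norm_num) ?_ (abs_lt.1 ht)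
  simp

/-- The product exp(−log(1 + sx))(1 + sx) has zero derivative in s on [0, 1] and equals 1 at s = 0.
All elements involved are limits of polynomials in x, hence commute. -/
theorem exp_logOnePlus {x : B} (hx : ‖x‖ ≤ 1 / 2) : exp (logOnePlus x) = 1 + x := by
  let _ : NormedAlgebra ℚ B := NormedAlgebra.restrictScalars ℚ ℝ B
  have hlt : ∀ t : ℝ, |t| < 3 / 2 → ‖t • x‖ < 1 := by
    intro t ht
    refine (norm_smul_le _ _).trans_lt ?_
    rw [Real.norm_eq_abs]
    nlinarith [norm_nonneg x, abs_nonneg t]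
  have hcx : ∀ t : ℝ, Commute x (logOnePlus (t • x)) := by
    intro t
    by_cases hs : Summable fun n : ℕ => logCoeff n • (t • x) ^ (n + 1)
    · refine Commute.symm ?_
      change logOnePlus (t • x) * x = x * logOnePlus (t • x)
      rw [logOnePlus, ← hs.tsum_mul_left, ← hs.tsum_mul_right]
      refine tsum_congr fun n => ?_
      exact ((((Commute.refl x).smul_left t).pow_left (n + 1)).smul_left (logCoeff n)).eq
    · rw [logOnePlus, tsum_eq_zero_of_not_summable hs]
      exact Commute.zero_right x
  have hc : ∀ s t : ℝ, Commute (logOnePlus (s • x)) (logOnePlus (t • x)) := by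
    intro s t
    by_cases hs : Summable fun n : ℕ => logCoeff n • (s • x) ^ (n + 1)
    · change logOnePlus (s • x) * logOnePlus (t • x) = logOnePlus (t • x) * logOnePlus (s • x)
      rw [logOnePlus, ← hs.tsum_mul_left, ← hs.tsum_mul_right]
      refine tsum_congr fun n => ?_
      exact ((((hcx t).smul_left s).pow_left (n + 1)).smul_left (logCoeff n)).eq
    · rw [logOnePlus, tsum_eq_zero_of_not_summable hs]
      exact Commute.zero_left _
  have hderiv : ∀ t ∈ Set.Ico (0 : ℝ) 1, HasDerivWithinAt
      (fun s : ℝ => exp (-logOnePlus (s • x)) * (1 + s • x)) 0 (Set.Ici t) t := by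
    intro t ht
    have ht' : |t| < 3 / 2 := by rw [abs_of_nonneg ht.1]; linarith [ht.2]
    have h1 := hasDerivAt_exp_comp_of_commute (hasDerivAt_logOnePlus_smul hx ht').neg
      fun s => ((hc t s).neg_left.neg_right)
    have h2 : HasDerivAt (fun s : ℝ => 1 + s • x) x t := by
      simpa using ((hasDerivAt_id t).smul_const x).const_add 1
    refine ((h1.mul h2).congr_deriv ?_).hasDerivWithinAt
    have hg : (∑' n : ℕ, (-(t • x)) ^ n * x) * (1 + t • x) = x := by
      have hn : ‖-(t • x)‖ < 1 := by rw [norm_neg]; exact hlt t ht'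
      rw [(summable_geometric_of_norm_lt_one hn).tsum_mul_right, mul_assoc]
      have hcom : x * (1 + t • x) = (1 - -(t • x)) * x := by
        rw [sub_neg_eq_add, mul_add, add_mul, mul_one, one_mul, mul_smul_comm, smul_mul_assoc]
      rw [hcom, ← mul_assoc, geom_series_mul_neg _ hn, one_mul]
    rw [mul_neg, neg_mul, mul_assoc, hg]
    exact neg_add_cancel _
  have hcont : ContinuousOn (fun s : ℝ => exp (-logOnePlus (s • x)) * (1 + s • x))
      (Set.Icc 0 1) := by
    intro t ht
    have ht' : |t| < 3 / 2 := by rw [abs_of_nonneg ht.1]; linarith [ht.2]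
    have h1 := hasDerivAt_exp_comp_of_commute (hasDerivAt_logOnePlus_smul hx ht').neg
      fun s => ((hc t s).neg_left.neg_right)
    have h2 : HasDerivAt (fun s : ℝ => 1 + s • x) x t := by
      simpa using ((hasDerivAt_id t).smul_const x).const_add 1
    exact (h1.mul h2).continuousAt.continuousWithinAt
  have h := constant_of_has_deriv_right_zero hcont hderiv 1 (by norm_num)
  have h0 : logOnePlus (0 : B) = 0 := by
    simp [logOnePlus]
  simp only [one_smul, zero_smul, h0, neg_zero, exp_zero, add_zero, mul_one] at h
  have h3 : exp (logOnePlus x) * exp (-logOnePlus x) = 1 := by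
    rw [← exp_add_of_commute ((Commute.refl _).neg_right), add_neg_cancel, exp_zero]
  calc exp (logOnePlus x) = exp (logOnePlus x) * (exp (-logOnePlus x) * (1 + x)) := by
        rw [h, mul_one]
    _ = 1 + x := by rw [← mul_assoc, h3, one_mul]

end LogOnePlus

/-! ## Weighted Wiener algebra of twisted loops -/

namespace Wiener

section Loops

attribute [local instance] Matrix.linftyOpNormedRing Matrix.linftyOpNormedAlgebra

variable {N : ℕ} [NeZero N]

/-- Absolutely convergent matrix series. -/
abbrev MatSeries (N : ℕ) : Type := Wiener (Matrix (Fin N) (Fin N) ℝ)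

theorem completeSpace_matrix : CompleteSpace (Matrix (Fin N) (Fin N) ℝ) :=
  FiniteDimensional.complete ℝ _

attribute [local instance] completeSpace_matrix

theorem abs_apply_le_norm (M : Matrix (Fin N) (Fin N) ℝ) (i j : Fin N) : |M i j| ≤ ‖M‖ := by
  have h : ‖M i j‖₊ ≤ ‖M‖₊ := by
    rw [Matrix.linfty_opNNNorm_def]
    exact (Finset.single_le_sum (f := fun j => ‖M i j‖₊) (fun _ _ => zero_le)
      (Finset.mem_univ j)).trans
      (Finset.le_sup (f := fun i => ∑ j, ‖M i j‖₊) (Finset.mem_univ i))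
  exact_mod_cast h

/-- A matrix entry as a continuous linear map. -/
def entryCLM (i j : Fin N) : Matrix (Fin N) (Fin N) ℝ →L[ℝ] ℝ :=
  LinearMap.mkContinuous ⟨⟨fun M => M i j, fun _ _ => rfl⟩, fun _ _ => rfl⟩ 1
    fun M => by rw [one_mul]; exact abs_apply_le_norm M i j

/-- A row of diag(d)ℰᵖ has at most one nonzero entry, since the column is fixed modulo N; hence the
maximal row sum is at most the supremum of |d|. -/
theorem norm_coefMat_diagShift_le (p q : ℤ) (d : Fin N → ℝ) :
    ‖coefMat q (diagShift p d)‖ ≤ ‖d‖ := by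
  have h : ‖coefMat q (diagShift p d)‖₊ ≤ ‖d‖₊ := by
    rw [Matrix.linfty_opNNNorm_def]
    refine Finset.sup_le fun i _ => ?_
    by_cases he : ∃ j, coefMat q (diagShift p d) i j ≠ 0
    · obtain ⟨j, hj⟩ := he
      have hm : ∀ j, coefMat q (diagShift p d) i j ≠ 0 → q = p ∧
          ((i : ℕ) : ℤ) - ((j : ℕ) : ℤ) ≡ p [ZMOD (N : ℤ)] := by
        intro j hj
        rw [coefMat_diagShift] at hj
        by_contra hc
        rw [not_and] at hc
        apply hj
        split_ifs with h1 h2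
        · exact absurd h2 (hc h1)
        · rfl
        · rfl
      rw [Finset.sum_eq_single j]
      · rw [coefMat_diagShift, if_pos (hm j hj).1, if_pos (hm j hj).2]
        exact nnnorm_le_pi_nnnorm d i
      · intro k _ hk
        rw [nnnorm_eq_zero]
        by_contra hne
        have h1 := (hm j hj).2.sub (hm k hne).2
        apply hk
        rw [← sub_modEq_zero_iff]
        have e : ((k : ℕ) : ℤ) - ((j : ℕ) : ℤ) = ((i : ℕ) : ℤ) - ((j : ℕ) : ℤ) -
          (((i : ℕ) : ℤ) - ((k : ℕ) : ℤ)) := by ring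
        rw [e, ← sub_self p]
        exact h1
      · intro hj; exact absurd (Finset.mem_univ j) hj
    · push Not at he
      rw [Finset.sum_eq_zero fun j _ => by rw [he j, nnnorm_zero]]
      exact zero_le
  exact_mod_cast h

/-- The series `w` represents `L`, after the substitution `λ ↦ ρ λ`. -/
def Represents (ρ : ℝ) (w : MatSeries N) (L : Loop N) : Prop :=
  ∀ p, w.coef p = ρ ^ p • coefMat p L

/-- The doubly infinite series of `f` after the substitution `λ ↦ ρ⁻¹ λ`. -/
def unweight (ρ : ℝ) (f : MatSeries N) : BiSeries N := fun p => (ρ ^ p)⁻¹ • f.coef p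

section
variable {ρ : ℝ}

theorem Represents.add {v w : MatSeries N} {L M : Loop N} (hv : Represents ρ v L)
    (hw : Represents ρ w M) : Represents ρ (v + w) (L + M) := fun p => by
  rw [coef_add, hv, hw, coefMat_add, smul_add]

theorem Represents.sub {v w : MatSeries N} {L M : Loop N} (hv : Represents ρ v L)
    (hw : Represents ρ w M) : Represents ρ (v - w) (L - M) := fun p => by
  rw [coef_sub, hv, hw, coefMat_sub, smul_sub]

theorem Represents.smul (r : ℝ) {v : MatSeries N} {L : Loop N} (hv : Represents ρ v L) :
    Represents ρ (r • v) (r • L) := fun p => by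
  rw [coef_smul, hv, coefMat_smul, smul_comm]

theorem represents_one : Represents ρ (1 : MatSeries N) 1 := fun p => by
  rw [coef_one, coefMat_one]
  split_ifs with h
  · rw [h, zpow_zero, one_smul]
  · rw [smul_zero]

theorem Represents.mul (hρ : ρ ≠ 0) {v w : MatSeries N} {L M : Loop N} (hv : Represents ρ v L)
    (hw : Represents ρ w M) : Represents ρ (v * w) (L * M) := fun p => by
  obtain ⟨P, hP⟩ := exists_degLE L
  obtain ⟨Q, hQ⟩ := exists_degLE M
  rw [coef_mul, coefMat_mul hP hQ, Finset.smul_sum, tsum_eq_sum (s := Finset.Icc (p - Q) P)]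
  · refine Finset.sum_congr rfl fun q _ => ?_
    rw [hv, hw, smul_mul_assoc, mul_smul_comm, smul_smul, ← zpow_add₀ hρ, add_sub_cancel]
  · intro q hq
    rw [Finset.mem_Icc, not_and_or, not_le, not_le] at hq
    rcases hq with hq | hq
    · rw [hw, hQ _ (by lia), smul_zero, mul_zero]
    · rw [hv, hP _ hq, smul_zero, zero_mul]

theorem Represents.pow (hρ : ρ ≠ 0) {v : MatSeries N} {L : Loop N} (hv : Represents ρ v L) :
    ∀ n : ℕ, Represents ρ (v ^ n) (L ^ n)
  | 0 => by simpa using represents_one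
  | n + 1 => by
    rw [pow_succ, pow_succ]
    exact (hv.pow hρ n).mul hρ hv

theorem Represents.unweight_eq (hρ : ρ ≠ 0) {v : MatSeries N} {L : Loop N}
    (hv : Represents ρ v L) : unweight ρ v = toBi L := by
  funext p
  rw [unweight, hv, smul_smul, inv_mul_cancel₀ (zpow_ne_zero p hρ), one_smul, toBi]

theorem Represents.unique (hρ : ρ ≠ 0) {v : MatSeries N} {L M : Loop N} (hL : Represents ρ v L)
    (hM : Represents ρ v M) : L = M :=
  toBi_injective ((hL.unweight_eq hρ).symm.trans (hM.unweight_eq hρ))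

theorem unweight_injective (hρ : ρ ≠ 0) {f g : MatSeries N} (h : unweight ρ f = unweight ρ g) :
    f = g := ext fun p => by
  have h1 := congrArg (fun X => ρ ^ p • X) (congrFun h p)
  simpa only [unweight, smul_smul, mul_inv_cancel₀ (zpow_ne_zero p hρ), one_smul] using h1

theorem lmulBi_unweight (hρ : ρ ≠ 0) {v : MatSeries N} {L : Loop N} (hv : Represents ρ v L)
    {s : Finset ℤ} (hs : ∀ q ∉ s, coefMat q L = 0) (X : MatSeries N) :
    lmulBi L (unweight ρ X) = unweight ρ (v * X) := by
  funext p
  rw [lmulBi, unweight, coef_mul, finsum_eq_sum_of_support_subset (s := s),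
    tsum_eq_sum (s := s), Finset.smul_sum]
  · refine Finset.sum_congr rfl fun q _ => ?_
    rw [unweight, hv, smul_mul_assoc, mul_smul_comm, smul_smul]
    congr 1
    rw [zpow_sub₀ hρ, inv_div, div_eq_inv_mul]
  · intro q hq
    rw [hv, hs q hq, smul_zero, zero_mul]
  · intro q hq
    by_contra h
    exact hq (mul_eq_zero_of_left (hs q h) _)

theorem rmulBi_unweight (hρ : ρ ≠ 0) {v : MatSeries N} {L : Loop N} (hv : Represents ρ v L)
    {s : Finset ℤ} (hs : ∀ q ∉ s, coefMat q L = 0) (X : MatSeries N) :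
    rmulBi (unweight ρ X) L = unweight ρ (X * v) := by
  funext p
  have h1 : (X * v).coef p = ∑' q, X.coef (p - q) * v.coef q := by
    rw [coef_mul, ← (Equiv.subLeft p).tsum_eq]
    refine tsum_congr fun q => ?_
    rw [Equiv.subLeft_apply, sub_sub_cancel]
  rw [rmulBi, unweight, h1, finsum_eq_sum_of_support_subset (s := s),
    tsum_eq_sum (s := s), Finset.smul_sum]
  · refine Finset.sum_congr rfl fun q _ => ?_
    rw [unweight, hv, mul_smul_comm, smul_mul_assoc, smul_smul]
    congr 1
    rw [zpow_sub₀ hρ, inv_div, div_eq_inv_mul]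
  · intro q hq
    rw [hv, hs q hq, smul_zero, mul_zero]
  · intro q hq
    by_contra h
    exact hq (mul_eq_zero_of_right _ (hs q h))

theorem biPlus_unweight (X : MatSeries N) :
    biPlus (unweight ρ X) = unweight ρ (trunc (Set.Ici 0) X) := by
  funext p
  rw [biPlus, unweight, unweight, coef_trunc]
  simp only [Set.mem_Ici]
  split_ifs
  · rfl
  · rw [smul_zero]

theorem unweight_sub (X Y : MatSeries N) :
    unweight ρ (X - Y) = unweight ρ X - unweight ρ Y := by
  funext p
  rw [Pi.sub_apply, unweight, coef_sub, smul_sub]; rfl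

/-- A coefficientwise derivative does not imply one in norm. If the norm derivative is known to
exist, however, its coefficients must be the given ones, and so a Lax equation becomes an equation
in the Banach algebra. -/
theorem hasCoefDeriv_unweight (hρ : ρ ≠ 0) {w : ℝ → MatSeries N} {L : ℝ → Loop N}
    (hw : ∀ s, Represents ρ (w s) (L s)) {t : ℝ} {w' Z : MatSeries N} (hd : HasDerivAt w w' t)
    (hL : HasCoefDeriv L (unweight ρ Z) t) : w' = Z := by
  refine unweight_injective hρ ?_
  funext p
  ext i j
  have h1 := ((entryCLM i j).comp (coefCLM p)).hasFDerivAt.comp_hasDerivAt t hd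
  have h2 := (h1.const_mul (ρ ^ p)⁻¹)
  refine HasDerivAt.unique (h2.congr_deriv rfl) ((hL p i j).congr_of_eventuallyEq ?_)
  refine Filter.Eventually.of_forall fun s => ?_
  have := congrFun (congrFun (congrFun ((hw s).unweight_eq hρ) p) i) j
  exact this

/-- The monomial `diag(d) ℰ ^ p` after the substitution `λ ↦ ρ λ`. -/
def monomial (ρ : ℝ) (p : ℤ) : (Fin N → ℝ) →ₗ[ℝ] MatSeries N where
  toFun d := single p (ρ ^ p • coefMat p (diagShift p d))
  map_add' d e := ext fun q => by
    rw [coef_add, coef_single, coef_single, coef_single, ← diagShift_add, coefMat_add, smul_add]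
    split_ifs <;> simp
  map_smul' r d := ext fun q => by
    rw [RingHom.id_apply, coef_smul, coef_single, coef_single, ← smul_diagShift, coefMat_smul,
      smul_comm]
    split_ifs <;> simp

theorem represents_monomial (p : ℤ) (d : Fin N → ℝ) :
    Represents ρ (monomial ρ p d) (diagShift p d) := fun q => by
  change (single p _).coef q = _
  rw [coef_single]
  split_ifs with h
  · rw [h]
  · rw [coefMat_diagShift_of_ne h, smul_zero]

theorem suppIn_monomial {s : Set ℤ} {p : ℤ} (h : p ∈ s) (d : Fin N → ℝ) :
    SuppIn s (monomial ρ p d) := suppIn_single h _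

theorem norm_monomial_le (hρ : 0 < ρ) (p : ℤ) (d : Fin N → ℝ) :
    ‖monomial ρ p d‖ ≤ ρ ^ p * ‖d‖ := by
  change ‖single p _‖ ≤ _
  rw [norm_single]
  refine (norm_smul_le _ _).trans ?_
  rw [Real.norm_eq_abs, abs_of_pos (zpow_pos hρ p)]
  exact mul_le_mul_of_nonneg_left (norm_coefMat_diagShift_le p p d) (zpow_pos hρ p).le

theorem contDiff_monomial (p : ℤ) : ContDiff ℝ ∞ (monomial (N := N) ρ p) :=
  (LinearMap.toContinuousLinearMap (monomial (N := N) ρ p)).contDiff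

theorem hasSum_entry {ι : Type*} {f : ι → MatSeries N} {g : MatSeries N} (h : HasSum f g) (p : ℤ)
    (i j : Fin N) : HasSum (fun n => (f n).coef p i j) (g.coef p i j) := by
  have h1 := ((entryCLM i j).comp (coefCLM p)).hasSum h
  exact h1

/-- Entries of coefficients are continuous functionals on the Wiener algebra, so norm convergence of
the logarithm yields coefficientwise convergence of the formal one. -/
theorem hasSum_logTerm (hρ : ρ ≠ 0) {h : ℝ} {w : MatSeries N} {L : Loop N} (hw : Represents ρ w L)
    (hn : ‖h • w‖ < 1) (p : ℤ) (i j : Fin N) :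
    HasSum (logTerm h L p i j) ((ρ ^ p)⁻¹ * (logOnePlus (h • w)).coef p i j) := by
  have h1 := (hasSum_entry (summable_logOnePlus hn).hasSum p i j).mul_left (ρ ^ p)⁻¹
  refine h1.congr_fun fun n => ?_
  rw [coef_smul, (hw.smul h).pow hρ (n + 1) p, Matrix.smul_apply, Matrix.smul_apply, smul_eq_mul,
    smul_eq_mul, mul_left_comm, inv_mul_cancel_left₀ (zpow_ne_zero p hρ)]
  rfl

theorem logConverges_of_represents (hρ : ρ ≠ 0) {h : ℝ} {w : MatSeries N} {L : Loop N}
    (hw : Represents ρ w L) (hn : ‖h • w‖ < 1) : LogConverges h L :=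
  fun p i j => (hasSum_logTerm hρ hw hn p i j).summable

theorem logFun_eq_unweight (hρ : ρ ≠ 0) {h : ℝ} {w : MatSeries N} {L : Loop N}
    (hw : Represents ρ w L) (hn : ‖h • w‖ < 1) :
    logFun h L = unweight ρ (h⁻¹ • logOnePlus (h • w)) := by
  funext p
  ext i j
  change h⁻¹ * ∑' n, logTerm h L p i j n = _
  rw [(hasSum_logTerm hρ hw hn p i j).tsum_eq]
  change _ = (ρ ^ p)⁻¹ * (h⁻¹ * (logOnePlus (h • w)).coef p i j)
  ring

theorem biTwisted_logFun (h : ℝ) (L : Loop N) : BiTwisted (logFun h L) := by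
  intro p i j hp
  change h⁻¹ * ∑' n, logTerm h L p i j n = 0
  have : logTerm h L p i j = 0 := by
    funext n
    rw [logTerm, coefMat_twisted _ p i j hp, mul_zero]; rfl
  rw [this]
  simp

/-- The Neumann series converges in norm, and the formal geometric series is finite in each degree.
The same finitely many powers contribute to each coefficient. -/
theorem Represents.inverse (hρ : ρ ≠ 0) {w : MatSeries N} {A : Loop N} (hA : DegLE (-1) A)
    (hw : Represents ρ w A) (hn : ‖w‖ < 1) :
    Represents ρ (Ring.inverse (1 - w)) (geom A hA) := fun p => by
  have e : Ring.inverse (1 - w) = ∑' n : ℕ, w ^ n := by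
    rw [NormedRing.inverse_one_sub w hn]; rfl
  have h1 := (coefCLM p).hasSum (summable_geometric_of_norm_lt_one hn).hasSum
  simp only [coefCLM_apply] at h1
  rw [e, ← h1.tsum_eq, coefMat_geom, tsum_eq_sum (s := Finset.range ((-p).toNat + 1)),
    Finset.smul_sum]
  · exact Finset.sum_congr rfl fun n _ => hw.pow hρ n p
  · intro n hn'
    rw [Finset.mem_range, not_lt] at hn'
    rw [hw.pow hρ n p, hA.pow n p (by lia), smul_zero]

end

end Loops

end Wiener

/-! ## Linear differential equations and factorization -/

section LinearODE

theorem eq_zero_of_hasDerivWithinAt {E : Type*} [NormedAddCommGroup E] [NormedSpace ℝ E]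
    {f f' : ℝ → E} {K : ℝ}
    (hf : ∀ t ∈ Set.Icc (0 : ℝ) 1, HasDerivWithinAt f (f' t) (Set.Icc 0 1) t) (h0 : f 0 = 0)
    (hb : ∀ t ∈ Set.Icc (0 : ℝ) 1, ‖f' t‖ ≤ K * ‖f t‖) : ∀ t ∈ Set.Icc (0 : ℝ) 1, f t = 0 :=
  eq_zero_of_abs_deriv_le_mul_abs_self_of_eq_zero_right (fun t ht => (hf t ht).continuousWithinAt)
    (fun t ht => (hf t (Set.Ico_subset_Icc_self ht)).mono_of_mem_nhdsWithin
      (Icc_mem_nhdsGE_of_mem ht)) h0 fun t ht => hb t (Set.Ico_subset_Icc_self ht)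

/-- In the unit ball around 1 one has ‖g‖ ≤ 2, so the velocity g b is at most 1 in norm and the
solution stays in the ball over the whole unit interval. -/
theorem exists_fundamental {B : Type*} [NormedRing B] [NormedAlgebra ℝ B] [CompleteSpace B]
    [NormOneClass B] {b : ℝ → B} (hc : ContinuousOn b (Set.Icc 0 1))
    (hb : ∀ t ∈ Set.Icc (0 : ℝ) 1, ‖b t‖ ≤ 1 / 2) :
    ∃ G : ℝ → B, G 0 = 1 ∧
      ∀ t ∈ Set.Icc (0 : ℝ) 1, HasDerivWithinAt G (G t * b t) (Set.Icc 0 1) t := by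
  have hP : IsPicardLindelof (fun t (g : B) => g * b t)
      (⟨0, by norm_num⟩ : Set.Icc (0 : ℝ) 1) (1 : B) 1 0 1 1 := by
    refine ⟨fun t ht => ?_, fun g _ => continuousOn_const.mul hc, fun t ht g hg => ?_, ?_⟩
    · refine LipschitzOnWith.of_dist_le_mul fun g _ g' _ => ?_
      rw [dist_eq_norm, dist_eq_norm, ← sub_mul, NNReal.coe_one, one_mul]
      refine (norm_mul_le _ _).trans ?_
      nlinarith [hb t ht, norm_nonneg (g - g')]
    · rw [mem_closedBall_iff_norm, NNReal.coe_one] at hg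
      have h2 : ‖g‖ ≤ 2 := by
        have := norm_add_le (g - 1) 1
        rw [sub_add_cancel, norm_one] at this
        linarith
      refine (norm_mul_le _ _).trans ?_
      rw [NNReal.coe_one]
      nlinarith [hb t ht, norm_nonneg g, norm_nonneg (b t)]
    · norm_num
  exact hP.exists_eq_forall_mem_Icc_hasDerivWithinAt₀

/-- The equation is solved on [−1, 2], whose end points are at distance at most 2 from 0; this
explains the bound on 2L and gives two-sided derivatives at 0 and 1. The Picard fixed point is used
directly, because it stays in the ball for every real t. -/
theorem exists_solution_mem_closedBall {E : Type*} [NormedAddCommGroup E] [NormedSpace ℝ E]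
    [CompleteSpace E] {f : E → E} {x : E} {a L K : NNReal}
    (hb : ∀ y ∈ Metric.closedBall x a, ‖f y‖ ≤ L)
    (hl : LipschitzOnWith K f (Metric.closedBall x a)) (hm : L * 2 ≤ (a : ℝ)) :
    ∃ c : ℝ → E, c 0 = x ∧ (∀ t, c t ∈ Metric.closedBall x a) ∧
      ∀ t ∈ Set.Icc (0 : ℝ) 1, HasDerivAt c (f (c t)) t := by
  have m0 : (0 : ℝ) ∈ Set.Icc (-1 : ℝ) 2 := by norm_num
  have hP : IsPicardLindelof (fun _ => f) (⟨0, m0⟩ : Set.Icc (-1 : ℝ) 2) x a 0 L K :=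
    IsPicardLindelof.of_time_independent hb hl (by
      rw [max_eq_left (by norm_num)]
      simpa using hm)
  have hx0 : x ∈ Metric.closedBall x ((0 : NNReal) : ℝ) := Metric.mem_closedBall_self le_rfl
  obtain ⟨α, hα⟩ := ODE.FunSpace.exists_isFixedPt_next hP hx0
  have hd : ∀ t ∈ Set.Icc (-1 : ℝ) 2, HasDerivWithinAt α.compProj (f (α.compProj t))
      (Set.Icc (-1 : ℝ) 2) t := by
    intro t ht
    refine (ODE.hasDerivWithinAt_picard_Icc m0
      hP.continuousOn_uncurry α.continuous_compProj.continuousOn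
      (fun _ _ => α.compProj_mem_closedBall hP.mul_max_le) x ht).congr_of_mem (fun t' ht' => ?_) ht
    nth_rw 1 [← hα]
    rw [ODE.FunSpace.compProj_of_mem ht', ODE.FunSpace.next_apply]
  refine ⟨α.compProj, ?_, fun t => α.compProj_mem_closedBall hP.mul_max_le, fun t ht =>
    (hd t ⟨by linarith [ht.1], by linarith [ht.2]⟩).hasDerivAt
      (Icc_mem_nhds (by linarith [ht.1]) (by linarith [ht.2]))⟩
  rw [ODE.FunSpace.compProj_of_mem m0, ← hα, ODE.FunSpace.next_apply₀]

end LinearODE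

namespace Wiener

section Factorization

variable {A : Type} [NormedRing A] [NormedAlgebra ℝ A] [CompleteSpace A]

theorem suppIn_sub_trunc (s : Set ℤ) (f : Wiener A) : SuppIn sᶜ (f - trunc s f) := by
  have h := suppIn_trunc sᶜ f
  rwa [eq_sub_of_add_eq' (trunc_add_trunc_compl s f)] at h

theorem trunc_mul_eq {s t u : Set ℤ} {f g : Wiener A} (hg : SuppIn t g)
    (h : ∀ p ∈ sᶜ, ∀ q ∈ t, p + q ∈ uᶜ) : trunc u (f * g) = trunc u (trunc s f * g) := by
  rw [← sub_eq_zero, ← map_sub, ← sub_mul]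
  exact trunc_eq_zero ((suppIn_sub_trunc s f).mul hg h) disjoint_compl_right

theorem suppIn_one {s : Set ℤ} (h : (0 : ℤ) ∈ s) : SuppIn s (1 : Wiener A) := suppIn_single h 1

/-- Uniqueness for linear equations gives the intertwining of two fundamental solutions. -/
theorem fundamental_intertwine {G H a b b' : ℝ → Wiener A}
    (hG0 : G 0 = 1) (hH0 : H 0 = 1)
    (hG : ∀ t ∈ Set.Icc (0 : ℝ) 1, HasDerivWithinAt G (G t * b t) (Set.Icc 0 1) t)
    (hH : ∀ t ∈ Set.Icc (0 : ℝ) 1, HasDerivWithinAt H (H t * b' t) (Set.Icc 0 1) t)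
    (ha : ∀ t ∈ Set.Icc (0 : ℝ) 1, HasDerivWithinAt a (a t * b' t - b t * a t) (Set.Icc 0 1) t)
    (hb : ∀ t ∈ Set.Icc (0 : ℝ) 1, ‖b' t‖ ≤ 1 / 2) {t : ℝ} (ht : t ∈ Set.Icc (0 : ℝ) 1) :
    G t * a t = a 0 * H t := by
  rw [← sub_eq_zero]
  refine eq_zero_of_hasDerivWithinAt (f := fun t => G t * a t - a 0 * H t)
    (f' := fun t => (G t * a t - a 0 * H t) * b' t) (K := 1) (fun s hs => ?_) ?_ (fun s hs => ?_)
    t ht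
  · refine (((hG s hs).mul (ha s hs)).sub ((hH s hs).const_mul (a 0))).congr_deriv ?_
    noncomm_ring
  · simp only [hG0, hH0, one_mul, mul_one, sub_self]
  · refine (norm_mul_le _ _).trans ?_
    nlinarith [hb s hs, norm_nonneg (G s * a s - a 0 * H s)]

/-- Multiplication by nonnegative powers cannot produce a negative power from nonnegative ones. The
negative part of G thus solves a closed homogeneous linear equation with initial value 0. -/
theorem suppIn_fundamental [NormOneClass A] {G b : ℝ → Wiener A} (hG0 : G 0 = 1)
    (hG : ∀ t ∈ Set.Icc (0 : ℝ) 1, HasDerivWithinAt G (G t * trunc (Set.Ici 0) (b t))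
      (Set.Icc 0 1) t)
    (hb : ∀ t ∈ Set.Icc (0 : ℝ) 1, ‖b t‖ ≤ 1 / 2) {t : ℝ} (ht : t ∈ Set.Icc (0 : ℝ) 1) :
    SuppIn (Set.Ici 0) (G t) := by
  have h : trunc (Set.Iio 0) (G t) = 0 := by
    refine eq_zero_of_hasDerivWithinAt (f := fun t => trunc (Set.Iio 0) (G t))
      (f' := fun t => trunc (Set.Iio 0) (trunc (Set.Iio 0) (G t) * trunc (Set.Ici 0) (b t)))
      (K := 1) (fun s hs => ?_) ?_ (fun s hs => ?_) t ht
    · refine ((trunc (Set.Iio 0)).hasFDerivAt.comp_hasDerivWithinAt s (hG s hs)).congr_deriv ?_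
      refine trunc_mul_eq (suppIn_trunc _ _) fun p hp q hq => ?_
      simp only [Set.mem_compl_iff, Set.mem_Iio, Set.mem_Ici] at *
      lia
    · simp only [hG0]
      exact trunc_eq_zero (suppIn_one (Set.mem_Ici.2 le_rfl)) (Set.Iio_disjoint_Ici le_rfl)
    · refine (norm_trunc_le _ _).trans ((norm_mul_le _ _).trans ?_)
      have := (norm_trunc_le (Set.Ici 0) (b s)).trans (hb s hs)
      nlinarith [norm_nonneg (trunc (Set.Iio 0) (G s))]
  have h2 := suppIn_sub_trunc (Set.Iio 0) (G t)
  rwa [h, sub_zero, Set.compl_Iio] at h2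

/-- Let G_i solve Ġ_i = G_i π₊(b_i) with G_i(0) = 1. Uniqueness for linear equations gives G₁U =
U(0)G₃ and its analogues for C and V, hence G₁L = L(0)G₁. The series G₁ has no negative powers,
while K = exp(−t b₁(0)) G₁ is 1 plus negative powers. At t = 1 this factors exp(b₁(0)) = 1 + hL(0)
and exhibits L(1) as conjugated by the factor G₁. -/
theorem exists_factorization [NormOneClass A] {h : ℝ} {U V C D b1 b2 b3 : ℝ → Wiener A}
    (hU : ∀ t ∈ Set.Icc (0 : ℝ) 1, HasDerivWithinAt U
      (U t * trunc (Set.Ici 0) (b3 t) - trunc (Set.Ici 0) (b1 t) * U t) (Set.Icc 0 1) t)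
    (hC : ∀ t ∈ Set.Icc (0 : ℝ) 1, HasDerivWithinAt C
      (C t * trunc (Set.Ici 0) (b2 t) - trunc (Set.Ici 0) (b1 t) * C t) (Set.Icc 0 1) t)
    (hV : ∀ t ∈ Set.Icc (0 : ℝ) 1, HasDerivWithinAt V
      (V t * trunc (Set.Ici 0) (b2 t) - trunc (Set.Ici 0) (b3 t) * V t) (Set.Icc 0 1) t)
    (hCD : ∀ t ∈ Set.Icc (0 : ℝ) 1, C t * D t = 1) (hDC : ∀ t ∈ Set.Icc (0 : ℝ) 1, D t * C t = 1)
    (hb1 : ∀ t ∈ Set.Icc (0 : ℝ) 1, b1 t = logOnePlus (h • (U t * V t * D t)))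
    (hL : ∀ t ∈ Set.Icc (0 : ℝ) 1, ‖h • (U t * V t * D t)‖ ≤ 1 / 4)
    (hc1 : ContinuousOn b1 (Set.Icc 0 1)) (hc2 : ContinuousOn b2 (Set.Icc 0 1))
    (hc3 : ContinuousOn b3 (Set.Icc 0 1))
    (hn2 : ∀ t ∈ Set.Icc (0 : ℝ) 1, ‖b2 t‖ ≤ 1 / 2) (hn3 : ∀ t ∈ Set.Icc (0 : ℝ) 1, ‖b3 t‖ ≤ 1 / 2) :
    ∃ G1 G3 K : Wiener A, SuppIn (Set.Ici 0) G1 ∧ SuppIn (Set.Ici 0) G3 ∧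
      SuppIn (Set.Iio 0) (K - 1) ∧ G1 = (1 + h • (U 0 * V 0 * D 0)) * K ∧
      G1 * U 1 = U 0 * G3 ∧ G1 * (U 1 * V 1 * D 1) = (U 0 * V 0 * D 0) * G1 := by
  have hn1 : ∀ t ∈ Set.Icc (0 : ℝ) 1, ‖b1 t‖ ≤ 1 / 2 := fun t ht => by
    rw [hb1 t ht]
    exact (norm_logOnePlus_le ((hL t ht).trans (by norm_num))).trans (by linarith [hL t ht])
  have hp : ∀ {b : ℝ → Wiener A}, (∀ t ∈ Set.Icc (0 : ℝ) 1, ‖b t‖ ≤ 1 / 2) →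
      ∀ t ∈ Set.Icc (0 : ℝ) 1, ‖trunc (Set.Ici 0) (b t)‖ ≤ 1 / 2 :=
    fun hb t ht => (norm_trunc_le _ _).trans (hb t ht)
  obtain ⟨G1, hG10, hG1⟩ := exists_fundamental
    ((trunc (A := A) (Set.Ici 0)).continuous.comp_continuousOn hc1) (hp hn1)
  obtain ⟨G2, hG20, hG2⟩ := exists_fundamental
    ((trunc (A := A) (Set.Ici 0)).continuous.comp_continuousOn hc2) (hp hn2)
  obtain ⟨G3, hG30, hG3⟩ := exists_fundamental
    ((trunc (A := A) (Set.Ici 0)).continuous.comp_continuousOn hc3) (hp hn3)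
  have iU : ∀ t ∈ Set.Icc (0 : ℝ) 1, G1 t * U t = U 0 * G3 t := fun t ht =>
    fundamental_intertwine hG10 hG30 hG1 hG3 hU (hp hn3) ht
  have iC : ∀ t ∈ Set.Icc (0 : ℝ) 1, G1 t * C t = C 0 * G2 t := fun t ht =>
    fundamental_intertwine hG10 hG20 hG1 hG2 hC (hp hn2) ht
  have iV : ∀ t ∈ Set.Icc (0 : ℝ) 1, G3 t * V t = V 0 * G2 t := fun t ht =>
    fundamental_intertwine hG30 hG20 hG3 hG2 hV (hp hn2) ht
  have m0 : (0 : ℝ) ∈ Set.Icc (0 : ℝ) 1 := by norm_num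
  have m1 : (1 : ℝ) ∈ Set.Icc (0 : ℝ) 1 := by norm_num
  have iL : ∀ t ∈ Set.Icc (0 : ℝ) 1,
      G1 t * (U t * V t * D t) = (U 0 * V 0 * D 0) * G1 t := by
    intro t ht
    have e2 : G2 t * D t = D 0 * G1 t := by
      calc G2 t * D t = D 0 * C 0 * G2 t * D t := by rw [hDC 0 m0, one_mul]
        _ = D 0 * (C 0 * G2 t) * D t := by noncomm_ring
        _ = D 0 * G1 t * (C t * D t) := by rw [← iC t ht]; noncomm_ring
        _ = _ := by rw [hCD t ht, mul_one]
    calc G1 t * (U t * V t * D t) = G1 t * U t * V t * D t := by noncomm_ring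
      _ = U 0 * (G3 t * V t) * D t := by rw [iU t ht]; noncomm_ring
      _ = U 0 * V 0 * (G2 t * D t) := by rw [iV t ht]; noncomm_ring
      _ = _ := by rw [e2]; noncomm_ring
  have hlt : ∀ t ∈ Set.Icc (0 : ℝ) 1, ‖h • (U t * V t * D t)‖ < 1 := fun t ht => by
    linarith [hL t ht]
  -- b₁ is a power series in hL, so the relation G₁L = L(0)G₁ carries over to it.
  have ib : ∀ t ∈ Set.Icc (0 : ℝ) 1, G1 t * b1 t = b1 0 * G1 t := by
    intro t ht
    rw [hb1 t ht, hb1 0 m0]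
    refine mul_logOnePlus (hlt t ht) (hlt 0 m0) ?_
    rw [mul_smul_comm, smul_mul_assoc, iL t ht]
  -- By the last relation exp(−t b₁(0)) contributes −G₁b₁ to the derivative, which changes π₊(b₁)
  -- into −π₋(b₁).
  let K : ℝ → Wiener A := fun t => NormedSpace.exp (t • (-b1 0)) * G1 t
  have hK : ∀ t ∈ Set.Icc (0 : ℝ) 1, HasDerivWithinAt K (-(K t * trunc (Set.Iio 0) (b1 t)))
      (Set.Icc 0 1) t := by
    intro t ht
    refine ((hasDerivAt_exp_smul_const (-b1 0) t).hasDerivWithinAt.mul (hG1 t ht)).congr_deriv ?_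
    have e := trunc_add_trunc_compl (Set.Ici 0) (b1 t)
    rw [Set.compl_Ici] at e
    have e' : trunc (Set.Ici 0) (b1 t) = b1 t - trunc (Set.Iio 0) (b1 t) := eq_sub_of_add_eq e
    have e3 : NormedSpace.exp (t • -b1 0) * -b1 0 * G1 t
        = -(NormedSpace.exp (t • -b1 0) * (G1 t * b1 t)) := by
      rw [ib t ht]; noncomm_ring
    change NormedSpace.exp (t • -b1 0) * -b1 0 * G1 t
      + NormedSpace.exp (t • -b1 0) * (G1 t * trunc (Set.Ici 0) (b1 t))
      = -(NormedSpace.exp (t • -b1 0) * G1 t * trunc (Set.Iio 0) (b1 t))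
    rw [e', e3]
    noncomm_ring
  have hK0 : K 0 = 1 := by
    change NormedSpace.exp ((0 : ℝ) • (-b1 0)) * G1 0 = 1
    rw [zero_smul, NormedSpace.exp_zero, hG10, one_mul]
  have hK1 : trunc (Set.Ici 0) (K 1 - 1) = 0 := by
    refine eq_zero_of_hasDerivWithinAt (f := fun t => trunc (Set.Ici 0) (K t - 1))
      (f' := fun t => -trunc (Set.Ici 0) (trunc (Set.Ici 0) (K t - 1) * trunc (Set.Iio 0) (b1 t)))
      (K := 1) (fun s hs => ?_) ?_ (fun s hs => ?_) 1 m1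
    · refine ((trunc (Set.Ici 0)).hasFDerivAt.comp_hasDerivWithinAt s
        ((hK s hs).sub_const 1)).congr_deriv ?_
      rw [map_neg, ← trunc_mul_eq (suppIn_trunc _ _), sub_mul, one_mul, map_sub,
        trunc_eq_zero (suppIn_trunc _ _) (Set.Iio_disjoint_Ici le_rfl).symm, sub_zero]
      intro p hp q hq
      simp only [Set.mem_compl_iff, Set.mem_Iio, Set.mem_Ici] at *
      lia
    · simp only [hK0, sub_self, map_zero]
    · rw [norm_neg]
      refine (norm_trunc_le _ _).trans ((norm_mul_le _ _).trans ?_)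
      have := (norm_trunc_le (Set.Iio 0) (b1 s)).trans (hn1 s hs)
      nlinarith [norm_nonneg (trunc (Set.Ici 0) (K s - 1))]
  refine ⟨G1 1, G3 1, K 1, suppIn_fundamental hG10 hG1 hn1 m1, suppIn_fundamental hG30 hG3 hn3 m1,
    ?_, ?_, iU 1 m1, iL 1 m1⟩
  · have h2 := suppIn_sub_trunc (Set.Ici 0) (K 1 - 1)
    rwa [hK1, sub_zero, Set.compl_Ici] at h2
  · let _ : NormedAlgebra ℚ (Wiener A) := NormedAlgebra.restrictScalars ℚ ℝ (Wiener A)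
    rw [← exp_logOnePlus ((hL 0 m0).trans (by norm_num)), ← hb1 0 m0]
    change _ = NormedSpace.exp (b1 0) * (NormedSpace.exp ((1 : ℝ) • -b1 0) * G1 1)
    rw [one_smul, ← mul_assoc, ← NormedSpace.exp_add_of_commute ((Commute.refl _).neg_right),
      add_neg_cancel, NormedSpace.exp_zero, one_mul]

theorem eq_zero_of_trunc_mul {s : Set ℤ} {g n : Wiener A} (hg : ‖g‖ < 1)
    (h : n = -trunc s (g * n)) : n = 0 := by
  have e2 : ‖n‖ ≤ ‖g‖ * ‖n‖ := by
    calc ‖n‖ = ‖trunc s (g * n)‖ := by conv_lhs => rw [h, norm_neg]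
      _ ≤ _ := (norm_trunc_le _ _).trans (norm_mul_le _ _)
  rw [← norm_eq_zero]
  nlinarith [norm_nonneg n]

/-- The factorization of an element `1 + nonnegative part` close to `1` is unique. -/
theorem eq_zero_of_mul_suppIn {g n : Wiener A} (hg : ‖g‖ < 1) (hn : SuppIn (Set.Iio 0) n)
    (h : SuppIn (Set.Ici 0) ((1 + g) * n)) : n = 0 := by
  have e1 : trunc (Set.Iio 0) ((1 + g) * n) = 0 :=
    trunc_eq_zero h (Set.Iio_disjoint_Ici le_rfl)
  rw [add_mul, one_mul, map_add, trunc_eq_self hn] at e1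
  exact eq_zero_of_trunc_mul hg (eq_neg_of_add_eq_zero_left e1)

end Factorization

end Wiener

/-! ## The Lax matrices as convergent series -/

namespace Wiener

section LaxSeries

attribute [local instance] Matrix.linftyOpNormedRing Matrix.linftyOpNormedAlgebra
attribute [local instance] completeSpace_matrix

variable {N : ℕ} [NeZero N]

/-- The series of `U`. -/
def serU (ρ : ℝ) (x : Phase N) : MatSeries N := monomial ρ 1 (fun _ => 1) + monomial ρ 0 x.1

/-- The series of `V`. -/
def serV (ρ : ℝ) (x : Phase N) : MatSeries N := 1 + monomial ρ (-1) x.2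

/-- The series of `h u v ℰ⁻¹ = 1 - C`. -/
def serUV (ρ h : ℝ) (x : Phase N) : MatSeries N :=
  h • monomial ρ (-1) (fun k => x.1 k * x.2 k)

/-- The series of `C`. -/
def serC (ρ h : ℝ) (x : Phase N) : MatSeries N := 1 - serUV ρ h x

/-- The series of `C⁻¹`. -/
def serD (ρ h : ℝ) (x : Phase N) : MatSeries N := Ring.inverse (serC ρ h x)

/-- The series of `U V C⁻¹`. -/
def serUVD (ρ h : ℝ) (x : Phase N) : MatSeries N := serU ρ x * serV ρ x * serD ρ h x

/-- The series of `C⁻¹ U V`. -/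
def serDUV (ρ h : ℝ) (x : Phase N) : MatSeries N := serD ρ h x * serU ρ x * serV ρ x

/-- The series of `V C⁻¹ U`. -/
def serVDU (ρ h : ℝ) (x : Phase N) : MatSeries N := serV ρ x * serD ρ h x * serU ρ x

variable {ρ h : ℝ} {x : Phase N}

theorem represents_serU (x : Phase N) : Represents ρ (serU ρ x) (matU x) :=
  (represents_monomial _ _).add (represents_monomial _ _)

theorem represents_serV (x : Phase N) : Represents ρ (serV ρ x) (matV x) :=
  represents_one.add (represents_monomial _ _)

theorem represents_serUV (h : ℝ) (x : Phase N) :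
    Represents ρ (serUV ρ h x) (h • diagShift (-1) fun k => x.1 k * x.2 k) :=
  (represents_monomial _ _).smul h

theorem represents_serC (h : ℝ) (x : Phase N) : Represents ρ (serC ρ h x) (matC h x) :=
  represents_one.sub (represents_serUV h x)

/-- The range of parameters in which the series converge. -/
structure Admissible (ρ h : ℝ) (x : Phase N) : Prop where
  pos : 0 < ρ
  small : |h| * ρ ≤ 1 / 72
  bdd : ‖x‖ ≤ ρ / 2

theorem norm_const_one : ‖(fun _ => 1 : Fin N → ℝ)‖ = 1 := by
  rw [pi_norm_const]; exact NormOneClass.norm_one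

theorem norm_serU_le (H : Admissible ρ h x) : ‖serU ρ x‖ ≤ 3 / 2 * ρ := by
  have h1 := norm_monomial_le H.pos 1 (fun _ : Fin N => (1 : ℝ))
  have h2 := norm_monomial_le H.pos 0 x.1
  have h3 := (norm_fst_le x).trans H.bdd
  rw [norm_const_one, zpow_one] at h1
  rw [zpow_zero] at h2
  refine (norm_add_le _ _).trans ?_
  linarith

theorem norm_serV_le (H : Admissible ρ h x) : ‖serV ρ x‖ ≤ 3 / 2 := by
  have h2 := norm_monomial_le H.pos (-1) x.2
  have h3 := (norm_snd_le x).trans H.bdd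
  have h4 : ρ ^ (-1 : ℤ) * ‖x.2‖ ≤ 1 / 2 := by
    rw [zpow_neg_one, inv_mul_le_iff₀ H.pos]
    linarith
  refine (norm_add_le _ _).trans ?_
  rw [NormOneClass.norm_one]
  linarith

theorem norm_serUV_le (H : Admissible ρ h x) : ‖serUV ρ h x‖ ≤ 1 / 288 := by
  have h2 := norm_monomial_le H.pos (-1) (fun k => x.1 k * x.2 k)
  have h3 : ‖fun k => x.1 k * x.2 k‖ ≤ ρ / 2 * (ρ / 2) := by
    have hp := H.pos
    refine (pi_norm_le_iff_of_nonneg (by positivity)).2 fun k => ?_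
    rw [norm_mul]
    exact mul_le_mul (((norm_le_pi_norm _ k).trans (norm_fst_le x)).trans H.bdd)
      (((norm_le_pi_norm _ k).trans (norm_snd_le x)).trans H.bdd) (norm_nonneg _) (by positivity)
  have h4 : ρ ^ (-1 : ℤ) * ‖fun k => x.1 k * x.2 k‖ ≤ ρ / 4 := by
    rw [zpow_neg_one, inv_mul_le_iff₀ H.pos]
    linarith
  refine (norm_smul_le _ _).trans ?_
  rw [Real.norm_eq_abs]
  nlinarith [H.small, abs_nonneg h]

theorem norm_serUV_lt_one (H : Admissible ρ h x) : ‖serUV ρ h x‖ < 1 :=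
  (norm_serUV_le H).trans_lt (by norm_num)

theorem represents_serD (H : Admissible ρ h x) : Represents ρ (serD ρ h x) (matCinv h x) := by
  rw [matCinv_eq_geom]
  exact (represents_serUV h x).inverse H.pos.ne' _ (norm_serUV_lt_one H)

theorem isUnit_serC (H : Admissible ρ h x) : IsUnit (serC ρ h x) :=
  isUnit_one_sub_of_norm_lt_one (norm_serUV_lt_one H)

theorem serC_mul_serD (H : Admissible ρ h x) : serC ρ h x * serD ρ h x = 1 :=
  Ring.mul_inverse_cancel _ (isUnit_serC H)

theorem serD_mul_serC (H : Admissible ρ h x) : serD ρ h x * serC ρ h x = 1 :=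
  Ring.inverse_mul_cancel _ (isUnit_serC H)

theorem norm_serD_le (H : Admissible ρ h x) : ‖serD ρ h x‖ ≤ 2 := by
  have e : serD ρ h x = 1 + serUV ρ h x * serD ρ h x := by
    have := serC_mul_serD H
    rw [serC, sub_mul, one_mul] at this
    rw [← this]; abel
  have h1 : ‖serD ρ h x‖ ≤ 1 + ‖serUV ρ h x‖ * ‖serD ρ h x‖ := by
    conv_lhs => rw [e]
    refine (norm_add_le _ _).trans ?_
    rw [NormOneClass.norm_one]
    exact add_le_add le_rfl (norm_mul_le _ _)
  nlinarith [norm_serUV_le H, norm_nonneg (serD ρ h x)]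

/-- The factors U, V, C⁻¹ have norms at most 3ρ/2, 3/2 and 2, with product 9ρ/2; |h|ρ ≤ 1/72 then
gives 1/16. -/
theorem norm_smul_le_of_factors (H : Admissible ρ h x) {a b c : MatSeries N} {α β γ : ℝ}
    (ha : ‖a‖ ≤ α) (hb : ‖b‖ ≤ β) (hc : ‖c‖ ≤ γ) (e : α * β * γ = 9 / 2 * ρ) :
    ‖h • (a * b * c)‖ ≤ 1 / 16 := by
  have hα := (norm_nonneg a).trans ha
  have hβ := (norm_nonneg b).trans hb
  have h1 : ‖a * b * c‖ ≤ α * β * γ :=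
    (norm_mul_le _ _).trans (mul_le_mul ((norm_mul_le _ _).trans
      (mul_le_mul ha hb (norm_nonneg _) hα)) hc (norm_nonneg _) (mul_nonneg hα hβ))
  refine (norm_smul_le _ _).trans ?_
  rw [Real.norm_eq_abs]
  rw [e] at h1
  nlinarith [H.small, abs_nonneg h]

theorem norm_serUVD_le (H : Admissible ρ h x) : ‖h • serUVD ρ h x‖ ≤ 1 / 16 :=
  norm_smul_le_of_factors H (norm_serU_le H) (norm_serV_le H) (norm_serD_le H) (by ring)

theorem norm_serDUV_le (H : Admissible ρ h x) : ‖h • serDUV ρ h x‖ ≤ 1 / 16 :=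
  norm_smul_le_of_factors H (norm_serD_le H) (norm_serU_le H) (norm_serV_le H) (by ring)

theorem norm_serVDU_le (H : Admissible ρ h x) : ‖h • serVDU ρ h x‖ ≤ 1 / 16 :=
  norm_smul_le_of_factors H (norm_serV_le H) (norm_serD_le H) (norm_serU_le H) (by ring)

theorem represents_serUVD (H : Admissible ρ h x) : Represents ρ (serUVD ρ h x) (monUVC h x) :=
  ((represents_serU x).mul H.pos.ne' (represents_serV x)).mul H.pos.ne' (represents_serD H)

theorem represents_serDUV (H : Admissible ρ h x) : Represents ρ (serDUV ρ h x) (monCUV h x) :=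
  ((represents_serD H).mul H.pos.ne' (represents_serU x)).mul H.pos.ne' (represents_serV x)

theorem represents_serVDU (H : Admissible ρ h x) : Represents ρ (serVDU ρ h x) (monVCU h x) :=
  ((represents_serV x).mul H.pos.ne' (represents_serD H)).mul H.pos.ne' (represents_serU x)

/-- The logarithms of `1 + h L` for the three monodromy matrices. -/
def logUVD (ρ h : ℝ) (x : Phase N) : MatSeries N := logOnePlus (h • serUVD ρ h x)

def logDUV (ρ h : ℝ) (x : Phase N) : MatSeries N := logOnePlus (h • serDUV ρ h x)

def logVDU (ρ h : ℝ) (x : Phase N) : MatSeries N := logOnePlus (h • serVDU ρ h x)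

theorem norm_logOnePlus_le_eighth {w : MatSeries N} (hw : ‖w‖ ≤ 1 / 16) :
    ‖logOnePlus w‖ ≤ 1 / 8 :=
  (norm_logOnePlus_le (hw.trans (by norm_num))).trans (by linarith)

theorem logConverges_all (H : Admissible ρ h x) :
    LogConverges h (monUVC h x) ∧ LogConverges h (monCUV h x) ∧ LogConverges h (monVCU h x) :=
  ⟨logConverges_of_represents H.pos.ne' (represents_serUVD H)
    ((norm_serUVD_le H).trans_lt (by norm_num)),
  logConverges_of_represents H.pos.ne' (represents_serDUV H)
    ((norm_serDUV_le H).trans_lt (by norm_num)),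
  logConverges_of_represents H.pos.ne' (represents_serVDU H)
    ((norm_serVDU_le H).trans_lt (by norm_num))⟩

theorem logFun_monUVC (H : Admissible ρ h x) :
    logFun h (monUVC h x) = unweight ρ (h⁻¹ • logUVD ρ h x) :=
  logFun_eq_unweight H.pos.ne' (represents_serUVD H) ((norm_serUVD_le H).trans_lt (by norm_num))

theorem logFun_monCUV (H : Admissible ρ h x) :
    logFun h (monCUV h x) = unweight ρ (h⁻¹ • logDUV ρ h x) :=
  logFun_eq_unweight H.pos.ne' (represents_serDUV H) ((norm_serDUV_le H).trans_lt (by norm_num))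

theorem logFun_monVCU (H : Admissible ρ h x) :
    logFun h (monVCU h x) = unweight ρ (h⁻¹ • logVDU ρ h x) :=
  logFun_eq_unweight H.pos.ne' (represents_serVDU H) ((norm_serVDU_le H).trans_lt (by norm_num))

theorem coefMat_matU_eq_zero (x : Phase N) : ∀ q ∉ ({0, 1} : Finset ℤ), coefMat q (matU x) = 0 := by
  intro q hq
  simp only [Finset.mem_insert, Finset.mem_singleton, not_or] at hq
  exact coefMat_matU_of_ne x hq.1 hq.2

theorem coefMat_onePlus_eq_zero (w : Fin N → ℝ) :
    ∀ q ∉ ({0, -1} : Finset ℤ), coefMat q (onePlus w) = 0 := by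
  intro q hq
  simp only [Finset.mem_insert, Finset.mem_singleton, not_or] at hq
  exact coefMat_onePlus_of_ne w hq.1 hq.2

theorem coefMat_matC_eq_zero (h : ℝ) (x : Phase N) :
    ∀ q ∉ ({0, -1} : Finset ℤ), coefMat q (matC h x) = 0 := by
  rw [matC_eq]; exact coefMat_onePlus_eq_zero _

theorem coefMat_matV_eq_zero (x : Phase N) :
    ∀ q ∉ ({0, -1} : Finset ℤ), coefMat q (matV x) = 0 := coefMat_onePlus_eq_zero _

theorem serU_mul_serVDU (ρ h : ℝ) (x : Phase N) :
    serU ρ x * serVDU ρ h x = serUVD ρ h x * serU ρ x := by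
  simp only [serVDU, serUVD, mul_assoc]

theorem serV_mul_serDUV (ρ h : ℝ) (x : Phase N) :
    serV ρ x * serDUV ρ h x = serVDU ρ h x * serV ρ x := by
  simp only [serVDU, serDUV, mul_assoc]

theorem serC_mul_serDUV (H : Admissible ρ h x) :
    serC ρ h x * serDUV ρ h x = serUVD ρ h x * serC ρ h x := by
  rw [serDUV, serUVD, mul_assoc _ (serD ρ h x), serD_mul_serC H, mul_one, mul_assoc (serD ρ h x),
    ← mul_assoc, serC_mul_serD H, one_mul]

theorem mul_logOnePlus_smul {a v w : MatSeries N} (hv : ‖h • v‖ ≤ 1 / 16) (hw : ‖h • w‖ ≤ 1 / 16)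
    (e : a * v = w * a) : a * logOnePlus (h • v) = logOnePlus (h • w) * a :=
  mul_logOnePlus (hv.trans_lt (by norm_num)) (hw.trans_lt (by norm_num)) (by
    rw [mul_smul_comm, smul_mul_assoc, e])

/-- `logFun` is not a function from g to g, so covariance is not available. The relations hold in
the Wiener algebra and are transported to doubly infinite series; U, C and V are Laurent
polynomials, so the products remain finite sums. -/
theorem intertwined_logFun (H : Admissible ρ h x) :
    Intertwined h x (logFun h (monUVC h x)) (logFun h (monCUV h x)) (logFun h (monVCU h x)) where
  tw1 := biTwisted_logFun _ _
  tw2 := biTwisted_logFun _ _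
  tw3 := biTwisted_logFun _ _
  relU := by
    rw [logFun_monUVC H, logFun_monVCU H,
      lmulBi_unweight H.pos.ne' (represents_serU x) (coefMat_matU_eq_zero x),
      rmulBi_unweight H.pos.ne' (represents_serU x) (coefMat_matU_eq_zero x), mul_smul_comm,
      smul_mul_assoc, logVDU, logUVD,
      mul_logOnePlus_smul (norm_serVDU_le H) (norm_serUVD_le H) (serU_mul_serVDU ρ h x)]
  relC := by
    rw [logFun_monUVC H, logFun_monCUV H,
      lmulBi_unweight H.pos.ne' (represents_serC h x) (coefMat_matC_eq_zero h x),
      rmulBi_unweight H.pos.ne' (represents_serC h x) (coefMat_matC_eq_zero h x), mul_smul_comm,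
      smul_mul_assoc, logDUV, logUVD,
      mul_logOnePlus_smul (norm_serDUV_le H) (norm_serUVD_le H) (serC_mul_serDUV H)]
  relV := by
    rw [logFun_monCUV H, logFun_monVCU H,
      lmulBi_unweight H.pos.ne' (represents_serV x) (coefMat_matV_eq_zero x),
      rmulBi_unweight H.pos.ne' (represents_serV x) (coefMat_matV_eq_zero x), mul_smul_comm,
      smul_mul_assoc, logVDU, logDUV,
      mul_logOnePlus_smul (norm_serDUV_le H) (norm_serVDU_le H) (serV_mul_serDUV ρ h x)]

/-! ### Smoothness -/

theorem contDiff_serU : ContDiff ℝ ∞ (serU (N := N) ρ) :=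
  contDiff_const.add ((contDiff_monomial 0).comp contDiff_fst)

theorem contDiff_serV : ContDiff ℝ ∞ (serV (N := N) ρ) :=
  contDiff_const.add ((contDiff_monomial (-1)).comp contDiff_snd)

theorem contDiff_serUV : ContDiff ℝ ∞ (serUV (N := N) ρ h) := by
  refine ((contDiff_monomial (-1)).comp (contDiff_pi.2 fun k => ?_)).const_smul h
  exact (contDiff_fst_apply k).mul (contDiff_snd_apply k)

theorem contDiff_serC : ContDiff ℝ ∞ (serC (N := N) ρ h) := contDiff_const.sub contDiff_serUV

theorem contDiffAt_serD (H : Admissible ρ h x) : ContDiffAt ℝ ∞ (serD (N := N) ρ h) x := by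
  have h1 := contDiffAt_ringInverse ℝ (n := ∞) (isUnit_serC H).unit
  exact ContDiffAt.comp x h1 contDiff_serC.contDiffAt

/-- A smooth map is Lipschitz on the compact convex ball of radius ρ/2, and `logOnePlus` has
Lipschitz constant 2 on the ball of radius 1/2. -/
theorem exists_lipschitz {f : Phase N → MatSeries N} (hs : |h| * ρ ≤ 1 / 72) (hρ : 0 < ρ)
    (hf : ∀ x, Admissible ρ h x → ContDiffAt ℝ ∞ f x)
    (hb : ∀ x, Admissible ρ h x → ‖h • f x‖ ≤ 1 / 16) :
    ∃ K : ℝ, 0 ≤ K ∧ ∀ x y, Admissible ρ h x → Admissible ρ h y →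
      ‖logOnePlus (h • f x) - logOnePlus (h • f y)‖ ≤ K * ‖x - y‖ := by
  have hA : ∀ x ∈ Metric.closedBall (0 : Phase N) (ρ / 2), Admissible ρ h x := fun x hx =>
    ⟨hρ, hs, mem_closedBall_zero_iff.1 hx⟩
  obtain ⟨K, hK⟩ := ContDiffOn.exists_lipschitzOnWith (n := ∞)
    (f := fun x => h • f x) (s := Metric.closedBall (0 : Phase N) (ρ / 2))
    (fun x hx => ((hf x (hA x hx)).const_smul h).contDiffWithinAt) (by simp)
    (convex_closedBall _ _) (isCompact_closedBall _ _)
  refine ⟨2 * K, by positivity, fun x y hx hy => ?_⟩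
  have h1 := hK.dist_le_mul x (mem_closedBall_zero_iff.2 hx.bdd) y
    (mem_closedBall_zero_iff.2 hy.bdd)
  rw [dist_eq_norm, dist_eq_norm] at h1
  have h2 := norm_logOnePlus_sub_le ((hb x hx).trans (by norm_num))
    ((hb y hy).trans (by norm_num : (1 / 16 : ℝ) ≤ 1 / 2))
  linarith

theorem contDiffAt_serUVD (H : Admissible ρ h x) : ContDiffAt ℝ ∞ (serUVD (N := N) ρ h) x :=
  (contDiff_serU.contDiffAt.mul contDiff_serV.contDiffAt).mul (contDiffAt_serD H)

theorem contDiffAt_serDUV (H : Admissible ρ h x) : ContDiffAt ℝ ∞ (serDUV (N := N) ρ h) x :=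
  ((contDiffAt_serD H).mul contDiff_serU.contDiffAt).mul contDiff_serV.contDiffAt

theorem contDiffAt_serVDU (H : Admissible ρ h x) : ContDiffAt ℝ ∞ (serVDU (N := N) ρ h) x :=
  (contDiff_serV.contDiffAt.mul (contDiffAt_serD H)).mul contDiff_serU.contDiffAt

end LaxSeries

end Wiener

/-! ## Trajectories of the logarithmic flow -/

namespace Wiener

section LogFlow

attribute [local instance] Matrix.linftyOpNormedRing Matrix.linftyOpNormedAlgebra
attribute [local instance] completeSpace_matrix

variable {N : ℕ} [NeZero N] {ρ h : ℝ} {x : Phase N}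

/-- The vector field of the flow with `f(L) = h⁻¹ log (1 + h L)`. -/
def logField (h : ℝ) (x : Phase N) : Phase N :=
  triadField (logFun h (monUVC h x)) (logFun h (monCUV h x)) (logFun h (monVCU h x)) x

/-- The diagonal entries of the free term. -/
def freeEntry (f : MatSeries N) (k : Fin N) : ℝ := f.coef 0 k k

theorem abs_freeEntry_le (f : MatSeries N) (k : Fin N) : |freeEntry f k| ≤ ‖f‖ :=
  (abs_apply_le_norm _ k k).trans (f.norm_coef_le 0)

/-- Rescaling time by h turns the interval into [0, 1] and cancels the factor h⁻¹, so that the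
bounds on the logarithms apply directly. -/
theorem smul_logField (hh : h ≠ 0) (H : Admissible ρ h x) : h • logField h x =
    (fun k => x.1 k * freeEntry (logVDU ρ h x - logUVD ρ h x) k,
      fun k => x.2 k * (freeEntry (logDUV ρ h x) (k + 1) - freeEntry (logVDU ρ h x) k)) := by
  have e : ∀ (w : MatSeries N) (k : Fin N),
      unweight ρ (h⁻¹ • w) 0 k k = h⁻¹ * freeEntry w k := by
    intro w k
    change (ρ ^ (0 : ℤ))⁻¹ * (h⁻¹ * freeEntry w k) = _
    rw [zpow_zero, inv_one, one_mul]
  rw [logField, logFun_monUVC H, logFun_monCUV H, logFun_monVCU H]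
  refine Prod.ext (funext fun k => ?_) (funext fun k => ?_)
  · change h * (x.1 k * (_ - _)) = _
    change _ = x.1 k * (freeEntry (logVDU ρ h x) k - freeEntry (logUVD ρ h x) k)
    rw [e, e]
    field_simp
  · change h * (x.2 k * (_ - _)) = _
    rw [e, e]
    field_simp

theorem norm_phase_le {x : Phase N} {M : ℝ} (hM : 0 ≤ M) (h1 : ∀ k, |x.1 k| ≤ M)
    (h2 : ∀ k, |x.2 k| ≤ M) : ‖x‖ ≤ M :=
  norm_prod_le_iff.2 ⟨(pi_norm_le_iff_of_nonneg hM).2 h1, (pi_norm_le_iff_of_nonneg hM).2 h2⟩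

theorem abs_fst_le (x : Phase N) (k : Fin N) : |x.1 k| ≤ ‖x‖ :=
  (norm_le_pi_norm x.1 k).trans (norm_fst_le x)

theorem abs_snd_le (x : Phase N) (k : Fin N) : |x.2 k| ≤ ‖x‖ :=
  (norm_le_pi_norm x.2 k).trans (norm_snd_le x)

theorem norm_smul_logField_le (hh : h ≠ 0) (H : Admissible ρ h x) :
    ‖h • logField h x‖ ≤ ρ / 8 := by
  have h1 := norm_logOnePlus_le_eighth (norm_serUVD_le H)
  have h2 := norm_logOnePlus_le_eighth (norm_serDUV_le H)
  have h3 := norm_logOnePlus_le_eighth (norm_serVDU_le H)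
  have hρ := H.pos
  have key : ∀ a b c : ℝ, |a| ≤ ρ / 2 → |b| ≤ 1 / 8 → |c| ≤ 1 / 8 → |a * (b - c)| ≤ ρ / 8 := by
    intro a b c ha hb hc
    have hbc : |b - c| ≤ 1 / 4 := (abs_sub b c).trans (by linarith)
    rw [abs_mul]
    nlinarith [abs_nonneg a, abs_nonneg (b - c)]
  rw [smul_logField hh H]
  refine norm_phase_le (by linarith) (fun k => ?_) fun k => ?_
  · exact key _ _ _ ((abs_fst_le x k).trans H.bdd) ((abs_freeEntry_le _ k).trans h3)
      ((abs_freeEntry_le _ k).trans h1)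
  · exact key _ _ _ ((abs_snd_le x k).trans H.bdd) ((abs_freeEntry_le _ _).trans h2)
      ((abs_freeEntry_le _ k).trans h3)

theorem lipschitz_smul_logField (hh : h ≠ 0) (hs : |h| * ρ ≤ 1 / 72) (hρ : 0 < ρ) :
    ∃ K : NNReal, ∀ x y : Phase N, Admissible ρ h x → Admissible ρ h y →
      ‖h • logField h x - h • logField h y‖ ≤ K * ‖x - y‖ := by
  obtain ⟨K1, hK1, l1⟩ := exists_lipschitz (N := N) (f := serUVD ρ h) hs hρ
    (fun x hx => contDiffAt_serUVD hx) fun x hx => norm_serUVD_le hx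
  obtain ⟨K2, hK2, l2⟩ := exists_lipschitz (N := N) (f := serDUV ρ h) hs hρ
    (fun x hx => contDiffAt_serDUV hx) fun x hx => norm_serDUV_le hx
  obtain ⟨K3, hK3, l3⟩ := exists_lipschitz (N := N) (f := serVDU ρ h) hs hρ
    (fun x hx => contDiffAt_serVDU hx) fun x hx => norm_serVDU_le hx
  refine ⟨⟨1 + ρ / 2 * (K1 + K2 + K3), by positivity⟩, fun x y hx hy => ?_⟩
  have b1 := norm_logOnePlus_le_eighth (norm_serUVD_le hx)
  have b2 := norm_logOnePlus_le_eighth (norm_serDUV_le hx)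
  have b3 := norm_logOnePlus_le_eighth (norm_serVDU_le hx)
  have key : ∀ a b c a' b' c' K K' : ℝ, 0 ≤ K → 0 ≤ K' → K + K' ≤ K1 + K2 + K3 →
      |a - a'| ≤ ‖x - y‖ → |a'| ≤ ρ / 2 → |b| ≤ 1 / 8 →
      |c| ≤ 1 / 8 → |b - b'| ≤ K * ‖x - y‖ → |c - c'| ≤ K' * ‖x - y‖ →
      |a * (b - c) - a' * (b' - c')| ≤ (1 + ρ / 2 * (K1 + K2 + K3)) * ‖x - y‖ := by
    intro a b c a' b' c' K K' hK hK' hKK ha ha' hb hc hbb hcc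
    have e : a * (b - c) - a' * (b' - c') = (a - a') * (b - c) + a' * ((b - b') - (c - c')) := by
      ring
    have hbc : |b - c| ≤ 1 := (abs_sub b c).trans (by linarith)
    have hd : |(b - b') - (c - c')| ≤ (K1 + K2 + K3) * ‖x - y‖ :=
      (abs_sub _ _).trans (by nlinarith [norm_nonneg (x - y)])
    rw [e]
    refine (abs_add_le _ _).trans ?_
    rw [abs_mul, abs_mul]
    have p1 : |a - a'| * |b - c| ≤ ‖x - y‖ * 1 :=
      mul_le_mul ha hbc (abs_nonneg _) (norm_nonneg _)
    have p2 : |a'| * |(b - b') - (c - c')| ≤ ρ / 2 * ((K1 + K2 + K3) * ‖x - y‖) :=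
      mul_le_mul ha' hd (abs_nonneg _) (by positivity)
    linarith
  rw [smul_logField hh hx, smul_logField hh hy]
  refine norm_phase_le (mul_nonneg (NNReal.coe_nonneg _) (norm_nonneg _)) (fun k => ?_)
    fun k => ?_
  · exact key (x.1 k) (freeEntry (logVDU ρ h x) k) (freeEntry (logUVD ρ h x) k) (y.1 k)
      (freeEntry (logVDU ρ h y) k) (freeEntry (logUVD ρ h y) k) K3 K1 hK3 hK1 (by linarith)
      (abs_fst_le (x - y) k) ((abs_fst_le y k).trans hy.bdd) ((abs_freeEntry_le _ k).trans b3)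
      ((abs_freeEntry_le _ k).trans b1) ((abs_freeEntry_le (_ - _) k).trans (l3 x y hx hy))
      ((abs_freeEntry_le (_ - _) k).trans (l1 x y hx hy))
  · exact key (x.2 k) (freeEntry (logDUV ρ h x) (k + 1)) (freeEntry (logVDU ρ h x) k) (y.2 k)
      (freeEntry (logDUV ρ h y) (k + 1)) (freeEntry (logVDU ρ h y) k) K2 K3 hK2 hK3 (by linarith)
      (abs_snd_le (x - y) k) ((abs_snd_le y k).trans hy.bdd) ((abs_freeEntry_le _ _).trans b2)
      ((abs_freeEntry_le _ k).trans b3) ((abs_freeEntry_le (_ - _) (k + 1)).trans (l2 x y hx hy))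
      ((abs_freeEntry_le (_ - _) k).trans (l3 x y hx hy))

/-- The speed is at most ρ/2 · (1/8 + 1/8) = ρ/8. A ball of radius ρ/4 about x therefore suffices
for the interval of the Picard argument, and it lies in the ball of radius ρ/2 about 0. -/
theorem exists_trajectory (hh : h ≠ 0) (hs : |h| * ρ ≤ 1 / 72) (hρ : 0 < ρ) (hx : ‖x‖ ≤ ρ / 4) :
    ∃ c : ℝ → Phase N, c 0 = x ∧ (∀ t, ‖c t‖ ≤ ρ / 2) ∧
      ∀ t ∈ Set.Icc (0 : ℝ) 1, HasDerivAt c (h • logField h (c t)) t := by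
  obtain ⟨K, hK⟩ := lipschitz_smul_logField (N := N) hh hs hρ
  have hA : ∀ y ∈ Metric.closedBall x (ρ / 4), Admissible ρ h y := fun y hy => ⟨hρ, hs, by
    rw [mem_closedBall_iff_norm] at hy
    have := norm_add_le (y - x) x
    rw [sub_add_cancel] at this
    linarith⟩
  obtain ⟨c, h0, hc, hd⟩ := exists_solution_mem_closedBall (f := fun y => h • logField h y) (x := x)
    (a := (⟨ρ / 4, by positivity⟩ : NNReal)) (L := (⟨ρ / 8, by positivity⟩ : NNReal)) (K := K)
    (fun y hy => norm_smul_logField_le hh (hA y hy))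
    (LipschitzOnWith.of_dist_le_mul fun y hy z hz => by
      rw [dist_eq_norm, dist_eq_norm]; exact hK y z (hA y hy) (hA z hz))
    (by change ρ / 8 * 2 ≤ ρ / 4; linarith)
  exact ⟨c, h0, fun t => (hA _ (hc t)).bdd, hd⟩

theorem div_mem_Icc_of_mem_uIcc (hh : h ≠ 0) {t : ℝ} (ht : t ∈ Set.uIcc 0 h) :
    t / h ∈ Set.Icc (0 : ℝ) 1 := by
  rcases lt_or_gt_of_ne hh with h0 | h0
  · rw [Set.uIcc_of_ge h0.le] at ht
    exact ⟨div_nonneg_of_nonpos ht.2 h0.le, (div_le_one_of_neg h0).2 ht.1⟩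
  · rw [Set.uIcc_of_le h0.le] at ht
    exact ⟨div_nonneg ht.1 h0.le, (div_le_one h0).2 ht.2⟩

theorem mul_mem_uIcc {t : ℝ} (ht : t ∈ Set.Icc (0 : ℝ) 1) : h * t ∈ Set.uIcc 0 h := by
  rcases le_total h 0 with h0 | h0
  · rw [Set.uIcc_of_ge h0]
    exact ⟨by nlinarith [ht.2], by nlinarith [ht.1]⟩
  · rw [Set.uIcc_of_le h0]
    exact ⟨mul_nonneg h0 ht.1, by nlinarith [ht.2]⟩

theorem exists_isLogTrajectory (hh : h ≠ 0) (hs : |h| * ρ ≤ 1 / 72) (hρ : 0 < ρ)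
    (hx : ‖x‖ ≤ ρ / 4) : ∃ c : ℝ → Phase N, IsLogTrajectory h (ρ / 2) x c := by
  obtain ⟨c, h0, hb, hd⟩ := exists_trajectory hh hs hρ hx
  have hd' : ∀ t ∈ Set.uIcc 0 h, HasDerivAt (fun s => c (s / h)) (logField h (c (t / h))) t := by
    intro t ht
    refine ((hd _ (div_mem_Icc_of_mem_uIcc hh ht)).scomp t
      ((hasDerivAt_id t).div_const h)).congr_deriv ?_
    rw [smul_smul, one_div, inv_mul_cancel₀ hh, one_smul]
  refine ⟨fun t => c (t / h), ⟨by simpa using h0, fun t _ => hb _, fun t ht => ?_, fun t ht => ?_⟩⟩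
  · exact (laxTriads_iff (Or.inl rfl) (F1 := fun y => logFun h (monUVC h y))
      (F2 := fun y => logFun h (monCUV h y)) (F3 := fun y => logFun h (monVCU h y))
      (c := fun s => c (s / h)) (intertwined_logFun ⟨hρ, hs, hb _⟩)).2 (hd' t ht)
  · exact (laxTriads_iff (Or.inr rfl) (F1 := fun y => logFun h (monUVC h y))
      (F2 := fun y => logFun h (monCUV h y)) (F3 := fun y => logFun h (monVCU h y))
      (c := fun s => c (s / h)) (intertwined_logFun ⟨hρ, hs, hb _⟩)).2 (hd' t ht)

/-! ### The Lax equations for the rescaled trajectory -/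

theorem triad_unweight (hρ : ρ ≠ 0) {a b c : MatSeries N} {L : Loop N} (ha : Represents ρ a L)
    {s : Finset ℤ} (hs : ∀ q ∉ s, coefMat q L = 0) :
    lmulBi L (biPlus (unweight ρ b)) - rmulBi (biPlus (unweight ρ c)) L
      = unweight ρ (a * trunc (Set.Ici 0) b - trunc (Set.Ici 0) c * a) := by
  rw [biPlus_unweight, biPlus_unweight, lmulBi_unweight hρ ha hs, rmulBi_unweight hρ ha hs,
    unweight_sub]

/-- Differentiability in norm comes from the smooth dependence of the series on the phase point; the
Lax equation only identifies the derivative. -/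
theorem hasDerivWithinAt_rescaled (hh : h ≠ 0) (hρ : ρ ≠ 0) {c : ℝ → Phase N}
    {a : Phase N → MatSeries N} {L : Phase N → Loop N} (haL : ∀ x, Represents ρ (a x) (L x))
    (hda : ContDiff ℝ ∞ a) {s : Finset ℤ} (hs : ∀ x, ∀ q ∉ s, coefMat q (L x) = 0) {t : ℝ}
    {c' : Phase N} (hc : HasDerivAt c c' (h * t)) {b b' : MatSeries N}
    (hL : HasCoefDeriv (fun τ => L (c τ)) (lmulBi (L (c (h * t))) (biPlus (unweight ρ (h⁻¹ • b)))
      - rmulBi (biPlus (unweight ρ (h⁻¹ • b'))) (L (c (h * t)))) (h * t)) :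
    HasDerivWithinAt (fun τ => a (c (h * τ))) (a (c (h * t)) * trunc (Set.Ici 0) b
      - trunc (Set.Ici 0) b' * a (c (h * t))) (Set.Icc 0 1) t := by
  rw [triad_unweight hρ (haL _) (hs _)] at hL
  have h1 := ((hda.differentiable (by simp)) (c (h * t))).hasFDerivAt.comp_hasDerivAt (h * t) hc
  have e := hasCoefDeriv_unweight hρ (fun τ => haL (c τ)) h1 hL
  have h2 := h1.congr_deriv e
  have h3 : HasDerivAt (fun τ : ℝ => h * τ) h t := by simpa using (hasDerivAt_id t).const_mul h
  refine ((h2.scomp t h3).congr_deriv ?_).hasDerivWithinAt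
  rw [map_smul, map_smul, mul_smul_comm, smul_mul_assoc, ← smul_sub, smul_smul,
    mul_inv_cancel₀ hh, one_smul]

theorem continuousOn_logOnePlus {f : Phase N → MatSeries N} (hs : |h| * ρ ≤ 1 / 72) (hρ : 0 < ρ)
    (hf : ∀ x, Admissible ρ h x → ContDiffAt ℝ ∞ f x)
    (hb : ∀ x, Admissible ρ h x → ‖h • f x‖ ≤ 1 / 16) :
    ContinuousOn (fun x => logOnePlus (h • f x)) {x | Admissible ρ h x} := by
  obtain ⟨K, hK, hl⟩ := exists_lipschitz hs hρ hf hb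
  exact (LipschitzOnWith.of_dist_le_mul (K := ⟨K, hK⟩) fun x hx y hy => by
    rw [dist_eq_norm, dist_eq_norm]; exact hl x y hx hy).continuousOn

theorem exists_factorization_of_isLogTrajectory (hh : h ≠ 0) (hs : |h| * ρ ≤ 1 / 72) (hρ : 0 < ρ)
    {c : ℝ → Phase N} (hc : IsLogTrajectory h (ρ / 2) x c) :
    ∃ G1 G3 K : MatSeries N, SuppIn (Set.Ici 0) G1 ∧ SuppIn (Set.Ici 0) G3 ∧
      SuppIn (Set.Iio 0) (K - 1) ∧ G1 = (1 + h • serUVD ρ h x) * K ∧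
      G1 * serU ρ (c h) = serU ρ x * G3 ∧ G1 * serUVD ρ h (c h) = serUVD ρ h x * G1 := by
  have hA : ∀ t ∈ Set.Icc (0 : ℝ) 1, Admissible ρ h (c (h * t)) := fun t ht =>
    ⟨hρ, hs, hc.bdd _ (mul_mem_uIcc ht)⟩
  -- An arbitrary trajectory is assumed only to satisfy the Lax triads; their equivalence with the
  -- vector field makes the curve itself differentiable.
  have hd : ∀ t ∈ Set.Icc (0 : ℝ) 1, HasDerivAt c (logField h (c (h * t))) (h * t) :=
    fun t ht => (laxTriads_iff (Or.inl rfl) (F1 := fun y => logFun h (monUVC h y))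
      (F2 := fun y => logFun h (monCUV h y)) (F3 := fun y => logFun h (monVCU h y))
      (intertwined_logFun (hA t ht))).1 (hc.plus _ (mul_mem_uIcc ht))
  have hcc : ContinuousOn (fun t : ℝ => c (h * t)) (Set.Icc 0 1) := fun t ht =>
    (ContinuousAt.comp (f := fun t : ℝ => h * t) (hd t ht).continuousAt
      (continuous_const.mul continuous_id).continuousAt).continuousWithinAt
  have tri : ∀ t ∈ Set.Icc (0 : ℝ) 1, _ := fun t ht => hc.plus (h * t) (mul_mem_uIcc ht)
  have h0 : c (h * 0) = x := by rw [mul_zero, hc.init]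
  have h1 : c (h * 1) = c h := by rw [mul_one]
  have key := Wiener.exists_factorization (h := h) (U := fun t => serU ρ (c (h * t)))
    (V := fun t => serV ρ (c (h * t))) (C := fun t => serC ρ h (c (h * t)))
    (D := fun t => serD ρ h (c (h * t))) (b1 := fun t => logUVD ρ h (c (h * t)))
    (b2 := fun t => logDUV ρ h (c (h * t))) (b3 := fun t => logVDU ρ h (c (h * t)))
    (fun t ht => ?_) (fun t ht => ?_) (fun t ht => ?_) (fun t ht => serC_mul_serD (hA t ht))
    (fun t ht => serD_mul_serC (hA t ht)) (fun t ht => rfl)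
    (fun t ht => (norm_serUVD_le (hA t ht)).trans (by norm_num))
    ((continuousOn_logOnePlus hs hρ (fun x hx => contDiffAt_serUVD hx)
      fun x hx => norm_serUVD_le hx).comp hcc hA)
    ((continuousOn_logOnePlus hs hρ (fun x hx => contDiffAt_serDUV hx)
      fun x hx => norm_serDUV_le hx).comp hcc hA)
    ((continuousOn_logOnePlus hs hρ (fun x hx => contDiffAt_serVDU hx)
      fun x hx => norm_serVDU_le hx).comp hcc hA)
    (fun t ht => (norm_logOnePlus_le_eighth (norm_serDUV_le (hA t ht))).trans (by norm_num))
    (fun t ht => (norm_logOnePlus_le_eighth (norm_serVDU_le (hA t ht))).trans (by norm_num))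
  · simp only [h0, h1] at key
    exact key
  · have := (tri t ht).eqU
    simp only [logFun_monUVC (hA t ht), logFun_monVCU (hA t ht)] at this
    exact hasDerivWithinAt_rescaled hh hρ.ne' represents_serU contDiff_serU coefMat_matU_eq_zero
      (hd t ht) this
  · have := (tri t ht).eqC
    simp only [logFun_monUVC (hA t ht), logFun_monCUV (hA t ht)] at this
    exact hasDerivWithinAt_rescaled hh hρ.ne' (represents_serC h) contDiff_serC
      (coefMat_matC_eq_zero h) (hd t ht) this
  · have := (tri t ht).eqV
    simp only [logFun_monVCU (hA t ht), logFun_monCUV (hA t ht)] at this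
    exact hasDerivWithinAt_rescaled hh hρ.ne' represents_serV contDiff_serV coefMat_matV_eq_zero
      (hd t ht) this

end LogFlow

end Wiener

/-! ## The time-`h` map of the logarithmic flow -/

namespace Wiener

section TimeMap

attribute [local instance] Matrix.linftyOpNormedRing Matrix.linftyOpNormedAlgebra
attribute [local instance] completeSpace_matrix

variable {N : ℕ} [NeZero N] {ρ h : ℝ} {x : Phase N}

theorem coefMat_diagShift_zero_apply (p : ℤ) (d : Fin N → ℝ) (i j : Fin N) :
    coefMat p (diagShift 0 d) i j = if p = 0 ∧ i = j then d i else 0 := by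
  rw [coefMat_diagShift, ite_and]
  simp only [sub_modEq_zero_iff]

/-- `I + h (ℰ + diag(u_k + v_{k-1}))`, the nonnegative factor of `I + h U V C⁻¹`. -/
def stepFactor (h : ℝ) (x : Phase N) : Loop N :=
  1 + (h • diagShift 1 (fun _ => 1) + h • diagShift 0 fun k => x.1 k + x.2 (k - 1))

theorem coefMat_stepFactor (h : ℝ) (x : Phase N) (p : ℤ) (i j : Fin N) :
    coefMat p (stepFactor h x) i j = (if p = 0 ∧ i = j then 1 else 0)
      + (h * (if p = 1 ∧ i = j + 1 then 1 else 0)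
        + h * (if p = 0 ∧ i = j then x.1 i + x.2 (i - 1) else 0)) := by
  rw [stepFactor, coefMat_add, coefMat_add, coefMat_smul, coefMat_smul, Matrix.add_apply,
    Matrix.add_apply, Matrix.smul_apply, Matrix.smul_apply, coefMat_one_apply,
    coefMat_diagShift_one, coefMat_diagShift_zero_apply, smul_eq_mul, smul_eq_mul]

/-- UV contains uvℰ⁻¹, and C was chosen so that this term cancels. Hence I + hUVC⁻¹ = (C + hUV)C⁻¹
is explicitly factored, with a nonnegative factor of degree 1; this is why the discretization is
explicit. -/
theorem matC_add_smul (h : ℝ) (x : Phase N) :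
    matC h x + h • (matU x * matV x) = stepFactor h x := by
  refine coefMat_ext fun p => ?_
  ext i j
  rw [coefMat_stepFactor, matC, coefMat_add, coefMat_sub, coefMat_smul, coefMat_smul,
    Matrix.add_apply, Matrix.sub_apply, Matrix.smul_apply, Matrix.smul_apply, coefMat_mul_matV,
    matU, coefMat_add, coefMat_add, Matrix.add_apply, Matrix.add_apply, coefMat_one_apply,
    coefMat_diagShift_neg_one, coefMat_diagShift_one, coefMat_diagShift_one,
    coefMat_diagShift_zero_apply, coefMat_diagShift_zero_apply, sub_add_cancel, smul_eq_mul,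
    smul_eq_mul]
  have e1 : (p + 1 = 1 ∧ i = j) = (p = 0 ∧ i = j) := by
    rw [add_eq_right]
  have e2 : (p + 1 = 0 ∧ i = j - 1) = (p = -1 ∧ i + 1 = j) := by
    rw [eq_neg_iff_add_eq_zero, eq_sub_iff_add_eq]
  simp only [e1, e2]
  by_cases h1 : p = -1 ∧ i + 1 = j
  · obtain ⟨rfl, rfl⟩ := h1
    simp
  · rw [if_neg h1, if_neg h1]
    by_cases h2 : p = 0 ∧ i = j
    · obtain ⟨rfl, rfl⟩ := h2
      simp only [if_true, and_self]
      ring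
    · simp only [if_neg h2]
      ring

/-- The part of `stepFactor` multiplied by `h`, as a series. -/
def stepShift (ρ h : ℝ) (x : Phase N) : MatSeries N :=
  h • monomial ρ 1 (fun _ => 1) + h • monomial ρ 0 fun k => x.1 k + x.2 (k - 1)

theorem represents_stepFactor (h : ℝ) (x : Phase N) :
    Represents ρ (1 + stepShift ρ h x) (stepFactor h x) :=
  represents_one.add (((represents_monomial _ _).smul h).add ((represents_monomial _ _).smul h))

theorem Represents.eq {v w : MatSeries N} {L : Loop N} (hv : Represents ρ v L)
    (hw : Represents ρ w L) : v = w := ext fun p => (hv p).trans (hw p).symm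

theorem serC_add_smul (hρ : ρ ≠ 0) (h : ℝ) (x : Phase N) :
    serC ρ h x + h • (serU ρ x * serV ρ x) = 1 + stepShift ρ h x := by
  have h1 := (represents_serC (ρ := ρ) h x).add
    (((represents_serU x).mul hρ (represents_serV x)).smul h)
  rw [matC_add_smul] at h1
  exact h1.eq (represents_stepFactor h x)

theorem one_add_smul_serUVD (H : Admissible ρ h x) :
    1 + h • serUVD ρ h x = (1 + stepShift ρ h x) * serD ρ h x := by
  rw [← serC_add_smul H.pos.ne', add_mul, serC_mul_serD H, smul_mul_assoc, serUVD]

theorem norm_stepShift_lt_one (H : Admissible ρ h x) : ‖stepShift ρ h x‖ < 1 := by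
  have h1 := norm_monomial_le H.pos 1 (fun _ : Fin N => (1 : ℝ))
  have h2 := norm_monomial_le H.pos 0 (fun k => x.1 k + x.2 (k - 1))
  have h3 : ‖fun k => x.1 k + x.2 (k - 1)‖ ≤ ρ := by
    refine (pi_norm_le_iff_of_nonneg H.pos.le).2 fun k => (abs_add_le _ _).trans ?_
    linarith [abs_fst_le x k, abs_snd_le x (k - 1), H.bdd]
  rw [norm_const_one, zpow_one, mul_one] at h1
  rw [zpow_zero, one_mul] at h2
  rw [stepShift, ← smul_add]
  refine (norm_smul_le _ _).trans_lt ?_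
  rw [Real.norm_eq_abs]
  have h4 : ‖monomial ρ 1 (fun _ : Fin N => (1 : ℝ)) + monomial ρ 0 fun k => x.1 k + x.2 (k - 1)‖
      ≤ 2 * ρ := (norm_add_le _ _).trans (by linarith)
  nlinarith [H.small, abs_nonneg h]

theorem SuppIn.smul {A : Type} [NormedRing A] [NormedAlgebra ℝ A] [CompleteSpace A] {s : Set ℤ}
    {f : Wiener A} (r : ℝ) (hf : SuppIn s f) : SuppIn s (r • f) := fun p hp => by
  rw [coef_smul, hf p hp, smul_zero]

theorem suppIn_one_add_stepShift (h : ℝ) (x : Phase N) :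
    SuppIn (Set.Icc 0 1) (1 + stepShift ρ h x) :=
  (suppIn_one (by simp)).add (((suppIn_monomial (by simp) _).smul h).add
    ((suppIn_monomial (by simp) _).smul h))

theorem suppIn_serU (x : Phase N) : SuppIn (Set.Icc 0 1) (serU ρ x) :=
  (suppIn_monomial (by simp) _).add (suppIn_monomial (by simp) _)

theorem suppIn_serD (H : Admissible ρ h x) : SuppIn (Set.Iic 0) (serD ρ h x) := fun p hp => by
  rw [represents_serD H, degLE_matCinv h x p (by simpa using hp), smul_zero]

theorem suppIn_serD_sub_one (H : Admissible ρ h x) : SuppIn (Set.Iio 0) (serD ρ h x - 1) := by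
  have e : serD ρ h x - 1 = serUV ρ h x * serD ρ h x := by
    have := serC_mul_serD H
    rw [serC, sub_mul, one_mul] at this
    rw [← this]; abel
  rw [e]
  refine SuppIn.mul (s := {-1}) ((suppIn_monomial (by simp) _).smul h) (suppIn_serD H) ?_
  intro p hp q hq
  simp only [Set.mem_singleton_iff, Set.mem_Iic, Set.mem_Iio] at *
  lia

/-- Both G and C + hUV are nonnegative factors of the same element, the complementary factors being
1 plus negative powers. Such a factorization is unique because the nonnegative factor is close to 1.
-/
theorem eq_stepSeries (H : Admissible ρ h x) {G K : MatSeries N} (hG : SuppIn (Set.Ici 0) G)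
    (hK : SuppIn (Set.Iio 0) (K - 1)) (e : G = (1 + h • serUVD ρ h x) * K) :
    G = 1 + stepShift ρ h x := by
  rw [one_add_smul_serUVD H, mul_assoc] at e
  have hn : SuppIn (Set.Iio 0) (serD ρ h x * K - 1) := by
    have e2 : serD ρ h x * K - 1 = (serD ρ h x - 1) + serD ρ h x * (K - 1) := by
      rw [mul_sub, mul_one]; abel
    rw [e2]
    refine (suppIn_serD_sub_one H).add ((suppIn_serD H).mul hK fun p hp q hq => ?_)
    simp only [Set.mem_Iic, Set.mem_Iio] at *
    lia
  have h0 := eq_zero_of_mul_suppIn (norm_stepShift_lt_one H) hn (by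
    rw [mul_sub, ← e, mul_one]
    exact hG.sub ((suppIn_one_add_stepShift h x).mono Set.Icc_subset_Ici_self))
  rw [e, sub_eq_zero.1 h0, mul_one]

theorem diagShift_mul_matU (x : Phase N) :
    diagShift (-1) (fun _ => 1) * matU x = 1 + diagShift (-1) fun k => x.1 (k + 1) := by
  refine coefMat_ext fun p => ?_
  ext i j
  rw [coefMat_mul_matU, coefMat_add, Matrix.add_apply, coefMat_diagShift_neg_one,
    coefMat_diagShift_neg_one, coefMat_diagShift_neg_one, coefMat_one_apply]
  have e1 : (p - 1 = -1 ∧ i + 1 = j + 1) = (p = 0 ∧ i = j) := by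
    rw [sub_eq_neg_self, add_left_inj]
  simp only [e1]
  by_cases h1 : p = -1 ∧ i + 1 = j
  · obtain ⟨rfl, rfl⟩ := h1
    simp
  · simp [h1]

/-- ℰ⁻¹U = 1 + m with m small and of degree −1. If UG has degree at most 2, the part of G of degree
at least 2 satisfies a contracting homogeneous equation and vanishes. This excludes an infinite
positive tail of G. -/
theorem trunc_eq_zero_of_serU_mul (hρ : 0 < ρ) (hx : ‖x‖ ≤ ρ / 4) {G F : MatSeries N}
    (e : F = serU ρ x * G) (hF : SuppIn (Set.Iic 2) F) : trunc (Set.Ici 2) G = 0 := by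
  let m : MatSeries N := monomial ρ (-1) fun k => x.1 (k + 1)
  have em : monomial ρ (-1) (fun _ => 1) * serU ρ x = 1 + m := by
    have h1 := (represents_monomial (ρ := ρ) (-1) (fun _ : Fin N => (1 : ℝ))).mul hρ.ne'
      (represents_serU x)
    rw [diagShift_mul_matU] at h1
    exact h1.eq (represents_one.add (represents_monomial _ _))
  have hm : ‖m‖ < 1 := by
    have h1 := norm_monomial_le hρ (-1) fun k => x.1 (k + 1)
    have h2 : ‖fun k => x.1 (k + 1)‖ ≤ ρ / 4 :=
      (pi_norm_le_iff_of_nonneg (by positivity)).2 fun k => (abs_fst_le x (k + 1)).trans hx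
    refine h1.trans_lt ?_
    rw [zpow_neg_one, inv_mul_lt_iff₀ hρ]
    linarith
  have e1 : monomial ρ (-1) (fun _ => 1) * F = G + m * G := by
    rw [e, ← mul_assoc, em, add_mul, one_mul]
  have e2 : trunc (Set.Ici 2) (monomial ρ (-1) (fun _ => 1) * F) = 0 := by
    refine trunc_eq_zero (t := Set.Iio 2) (SuppIn.mul (s := {-1}) (suppIn_monomial (by simp) _)
      hF fun p hp q hq => ?_) (Set.Iio_disjoint_Ici le_rfl).symm
    simp only [Set.mem_singleton_iff, Set.mem_Iic, Set.mem_Iio] at *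
    lia
  have e3 : trunc (Set.Ici 2) (m * G) = trunc (Set.Ici 2) (m * trunc (Set.Ici 2) G) := by
    rw [← sub_eq_zero, ← map_sub, ← mul_sub]
    refine trunc_eq_zero (t := Set.Iio 2) (SuppIn.mul (s := {-1}) (suppIn_monomial (by simp) _)
      (suppIn_sub_trunc (Set.Ici 2) G) fun p hp q hq => ?_) (Set.Iio_disjoint_Ici le_rfl).symm
    simp only [Set.mem_singleton_iff, Set.mem_compl_iff, Set.mem_Ici, Set.mem_Iio] at *
    lia
  refine eq_zero_of_trunc_mul hm (s := Set.Ici 2) ?_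
  rw [e1, map_add, e3] at e2
  exact eq_neg_of_add_eq_zero_left e2

/-- G₁Ũ = UG₃ is a relation between polynomials of degree at most 1 in ℰ. The two highest
coefficients determine G₃, and the free term is then the equation for ũ. -/
theorem stepU_relation {y : Phase N} (hρ : 0 < ρ) (hx : ‖x‖ ≤ ρ / 4) {G : MatSeries N}
    (hG : SuppIn (Set.Ici 0) G) (e : (1 + stepShift ρ h x) * serU ρ y = serU ρ x * G)
    (k : Fin N) : y.1 k * (1 + h * x.2 (k - 1)) = x.1 k * (1 + h * x.2 k) := by
  have hF : SuppIn (Set.Iic 2) ((1 + stepShift ρ h x) * serU ρ y) :=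
    (suppIn_one_add_stepShift h x).mul (suppIn_serU y) fun p hp q hq => by
      simp only [Set.mem_Icc, Set.mem_Iic] at *
      lia
  have hT := trunc_eq_zero_of_serU_mul hρ hx e hF
  let X : BiSeries N := unweight ρ G
  have X2 : X 2 = 0 := by
    have := congrArg (fun f => f.coef 2) hT
    rw [show (trunc (Set.Ici 2) G).coef 2 = G.coef 2 by rw [coef_trunc, if_pos (by simp)]] at this
    change (ρ ^ (2 : ℤ))⁻¹ • G.coef 2 = 0
    rw [this, coef_zero, smul_zero]
  have Xn : X (-1) = 0 := by
    change (ρ ^ (-1 : ℤ))⁻¹ • G.coef (-1) = 0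
    rw [hG (-1) (by simp), smul_zero]
  have rel : ∀ (p : ℤ) (i j : Fin N), x.1 i * X p i j + X (p - 1) (i - 1) j
      = coefMat p (stepFactor h x) i j * y.1 j + coefMat (p - 1) (stepFactor h x) i (j + 1) := by
    intro p i j
    rw [← lmulBi_matU, ← coefMat_mul_matU,
      lmulBi_unweight hρ.ne' (represents_serU x) (coefMat_matU_eq_zero x), ← e,
      ((represents_stepFactor h x).mul hρ.ne' (represents_serU y)).unweight_eq hρ.ne']
    rfl
  -- Degree 2 gives the coefficient h of ℰ in G₃, degree 1 its diagonal 1 + h(ũ_k + v_k), and degree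
  -- 0 the relation itself.
  have r2 := rel 2 (k + 1 + 1) k
  have r1 := rel 1 (k + 1) k
  have r0 := rel 0 k k
  rw [X2] at r2
  norm_num [coefMat_stepFactor] at r2 r1
  rw [show (0 : ℤ) - 1 = -1 by norm_num, Xn] at r0
  norm_num [coefMat_stepFactor] at r0
  rw [r2] at r1
  have r3 : X 0 k k = 1 + h * (y.1 k + x.2 k) := by linarith
  rw [r3] at r0
  linarith

/-- Conjugation of I + hL = G₁C⁻¹ by G₁ interchanges the factors, so I + hL̃ = C⁻¹G₁. The same
factorization at the new point gives C G̃₁ = G₁ C̃. The free term of this identity, simplified by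
the equation for ũ and divided by h, is the equation for ṽ. -/
theorem stepV_relation {y : Phase N} (Hx : Admissible ρ h x) (Hy : Admissible ρ h y) (hh : h ≠ 0)
    (e : (1 + stepShift ρ h x) * serUVD ρ h y = serUVD ρ h x * (1 + stepShift ρ h x))
    (hu : ∀ k, y.1 k * (1 + h * x.2 (k - 1)) = x.1 k * (1 + h * x.2 k)) (k : Fin N) :
    y.2 k * (1 + h * y.1 k) = x.2 k * (1 + h * y.1 (k + 1)) := by
  have e1 : (1 + stepShift ρ h x) * (1 + h • serUVD ρ h y)
      = (1 + h • serUVD ρ h x) * (1 + stepShift ρ h x) := by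
    rw [mul_add, mul_one, mul_smul_comm, e, add_mul (1 : MatSeries N) (h • _), one_mul,
      smul_mul_assoc]
  rw [one_add_smul_serUVD Hx, one_add_smul_serUVD Hy, mul_assoc] at e1
  have hu1 : IsUnit (1 + stepShift ρ h x) := by
    have h1 := isUnit_one_sub_of_norm_lt_one (x := -stepShift ρ h x) (by
      rw [norm_neg]; exact norm_stepShift_lt_one Hx)
    rwa [sub_neg_eq_add] at h1
  have e2 := hu1.mul_left_cancel e1
  have e3 : serC ρ h x * (1 + stepShift ρ h y) = (1 + stepShift ρ h x) * serC ρ h y := by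
    calc serC ρ h x * (1 + stepShift ρ h y)
        = serC ρ h x * ((1 + stepShift ρ h y) * serD ρ h y) * serC ρ h y := by
          rw [mul_assoc, mul_assoc (1 + stepShift ρ h y), serD_mul_serC Hy, mul_one]
      _ = (serC ρ h x * serD ρ h x) * (1 + stepShift ρ h x) * serC ρ h y := by
          rw [e2, ← mul_assoc]
      _ = _ := by rw [serC_mul_serD Hx, one_mul]
  have hρ := Hx.pos.ne'
  have e4 := (represents_serC (ρ := ρ) h x).mul hρ (represents_stepFactor h y)
  rw [e3] at e4
  have e5 := e4.unique hρ ((represents_stepFactor h x).mul hρ (represents_serC h y))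
  have e6 := congrFun (congrFun (congrArg (coefMat 0) e5) (k + 1)) (k + 1)
  rw [coefMat_matC_mul, coefMat_mul_matC] at e6
  norm_num [coefMat_stepFactor] at e6
  have hk := hu (k + 1)
  rw [add_sub_cancel_right] at hk
  refine mul_left_cancel₀ hh ?_
  linear_combination e6 - h * hk

/-- All hu_k and hv_k are at most 1/288 in absolute value. If hũ_k were −1, its defining equation
would equate a number near −1 with one near 0. -/
theorem mem_stepDomain (hs : |h| * ρ ≤ 1 / 72) (hx : ‖x‖ ≤ ρ / 4) :
    x ∈ stepDomain N h := by
  have hv : ∀ k, |h * x.2 k| ≤ 1 / 288 := fun k => by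
    rw [abs_mul]
    nlinarith [(abs_snd_le x k).trans hx, abs_nonneg h]
  have hu : ∀ k, |h * x.1 k| ≤ 1 / 288 := fun k => by
    rw [abs_mul]
    nlinarith [(abs_fst_le x k).trans hx, abs_nonneg h]
  have hp : ∀ k, 0 < 1 + h * x.2 k := fun k => by linarith [(abs_le.1 (hv k)).1]
  refine ⟨fun k => (hp k).ne', fun k h0 => ?_⟩
  have e : h * stepU h x k * (1 + h * x.2 (k - 1)) = h * x.1 k * (1 + h * x.2 k) := by
    rw [stepU]
    have := (hp (k - 1)).ne'
    field_simp
  have e1 : h * stepU h x k = -1 := by linarith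
  rw [e1] at e
  have h1 := abs_le.1 (hv k)
  have h2 := abs_le.1 (hv (k - 1))
  have h3 := abs_le.1 (hu k)
  nlinarith

theorem eq_stepMap_of_isLogTrajectory (hh : h ≠ 0) (hs : |h| * ρ ≤ 1 / 72) (hρ : 0 < ρ)
    (hx : ‖x‖ ≤ ρ / 4) {c : ℝ → Phase N} (hc : IsLogTrajectory h (ρ / 2) x c) :
    c h = stepMap h x := by
  have Hx : Admissible ρ h x := ⟨hρ, hs, by linarith⟩
  have Hy : Admissible ρ h (c h) := ⟨hρ, hs, hc.bdd h Set.right_mem_uIcc⟩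
  obtain ⟨G1, G3, K, hG1, hG3, hK, e1, e2, e3⟩ :=
    exists_factorization_of_isLogTrajectory hh hs hρ hc
  rw [eq_stepSeries Hx hG1 hK e1] at e2 e3
  have hu := stepU_relation hρ hx hG3 e2
  exact (isDiscreteStep_iff (mem_stepDomain hs hx) _).1 ⟨hu, stepV_relation Hx Hy hh e3 hu⟩

end TimeMap

end Wiener

end

/-! ### Assembly of the theorem -/

theorem mainTheorem1 (N : ℕ) [NeZero N] (hN : 2 ≤ N) :
    -- the brackets are Poisson brackets
    (IsPoissonBracket (SmoothPhase (N := N)) quadBr ∧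
      IsPoissonBracket IsSmoothFun (PB2 (bigA1 N) (bigA2 N) (bigS N)) ∧
      IsPoissonBracket IsSmoothFun
        (PB2 (blockOp !![opA1 N]) (blockOp !![opA2 N]) (blockOp !![opS N]))) ∧
    (∀ h : ℝ,
      -- `C` is invertible, and the Lax matrix maps are Poisson
      (∀ x : Phase N, IsUnit (matC h x)) ∧
      IsPoissonMap SmoothPhase quadBr IsSmoothFun (PB2 (bigA1 N) (bigA2 N) (bigS N))
        (laxTriple h) ∧
      (∀ T ∈ [monUVC (N := N) h, monVCU h, monCUV h],
        IsPoissonMap SmoothPhase quadBr IsSmoothFun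
          (PB2 (blockOp !![opA1 N]) (blockOp !![opA2 N]) (blockOp !![opS N]))
          (fun x => (fun _ : Fin 1 => T x))) ∧
      -- the hierarchy is described by the Lax triads
      (∀ f : Loop N → Loop N, ConjCovariant f →
        (∃ X : Phase N → Phase N, ∀ (c : ℝ → Phase N) (t : ℝ),
          (LaxTriadsPlus h f c t ↔ HasDerivAt c (X (c t)) t) ∧
          (LaxTriadsMinus h f c t ↔ HasDerivAt c (X (c t)) t)) ∧
        ∀ (c : ℝ → Phase N) (t : ℝ), LaxTriadsPlus h f c t →
          HasCoefDeriv (fun s => monUVC h (c s))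
            (toBi (monUVC h (c t) * piPlus N (f (monUVC h (c t)))
              - piPlus N (f (monUVC h (c t))) * monUVC h (c t))) t ∧
          HasCoefDeriv (fun s => monUVC h (c s))
            (toBi (-(monUVC h (c t) * piMinus N (f (monUVC h (c t)))
              - piMinus N (f (monUVC h (c t))) * monUVC h (c t)))) t) ∧
      (∀ φ : (Fin 1 → Loop N) → ℝ, IsSmoothFun φ → ConjInvariant φ →
        ConjCovariant (dLeft φ) ∧
        ∀ (c : ℝ → Phase N) (t : ℝ),
          (HasDerivAt c (hamField (fun x => φ (fun _ => monUVC h x)) (c t)) t ↔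
            LaxTriadsPlus h (dLeft φ) c t) ∧
          (HasDerivAt c (hamField (fun x => φ (fun _ => monUVC h x)) (c t)) t ↔
            LaxTriadsMinus h (dLeft φ) c t)) ∧
      -- the first flow
      (∀ (c : ℝ → Phase N) (t : ℝ),
        (LaxTriadsPlus h id c t ↔ HasDerivAt c (rvlField h (c t)) t) ∧
        (LaxTriadsMinus h id c t ↔ HasDerivAt c (rvlField h (c t)) t)) ∧
      (∀ x : Phase N,
        piPlus N (monUVC h x) =
          diagShift 0 (fun k => x.1 k + x.2 (k - 1) + h * x.1 (k - 1) * x.2 (k - 1))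
            + diagShift 1 (fun _ => 1) ∧
        piPlus N (monCUV h x) =
          diagShift 0 (fun k => x.1 k + x.2 (k - 1) + h * x.1 k * x.2 k)
            + diagShift 1 (fun _ => 1) ∧
        piPlus N (monVCU h x) =
          diagShift 0 (fun k => x.1 k + x.2 k + h * x.1 k * x.2 k)
            + diagShift 1 (fun _ => 1)) ∧
      -- the explicit discretization is a Poisson map
      IsOpen (stepDomain N h) ∧
      (∀ x ∈ stepDomain N h,
        (∀ y, IsDiscreteStep h x y ↔ y = stepMap h x) ∧
        ContDiffAt ℝ ∞ (stepMap h) x ∧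
        ∀ φ ψ : Phase N → ℝ, SmoothPhase φ → SmoothPhase ψ →
          quadBr (φ ∘ stepMap h) (ψ ∘ stepMap h) x = quadBr φ ψ (stepMap h x))) ∧
    -- the explicit discretization is the time-`h` map of the flow `f(L) = h⁻¹ log (I + h L)`
    (∀ r : ℝ, 0 < r → ∃ h₀ : ℝ, 0 < h₀ ∧ ∀ h : ℝ, h ≠ 0 → |h| < h₀ →
      (∀ y : Phase N, ‖y‖ ≤ 2 * r →
        LogConverges h (monUVC h y) ∧ LogConverges h (monCUV h y) ∧
          LogConverges h (monVCU h y)) ∧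
      ∀ x : Phase N, ‖x‖ ≤ r →
        x ∈ stepDomain N h ∧
        (∃ c : ℝ → Phase N, IsLogTrajectory h (2 * r) x c) ∧
        ∀ c : ℝ → Phase N, IsLogTrajectory h (2 * r) x c → c h = stepMap h x) := by
  refine ⟨⟨isPoissonBracket_quadBr, isPoissonBracket_PB2 isRMatrix_big,
    isPoissonBracket_PB2 isRMatrix_small⟩, fun h => ⟨fun x => (unitC h x).isUnit,
    isPoissonMap_laxTriple h, isPoissonMap_monodromy h, fun f hf => ⟨⟨hierField h f, fun c t =>
      ⟨laxTriadsPlus_iff hf h c t, laxTriadsMinus_iff hf h c t⟩⟩, fun c t H =>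
      ⟨H.hasCoefDeriv_monUVC hf, H.hasCoefDeriv_monUVC' hf⟩⟩, fun φ hφ hinv => ?_, fun c t => ?_,
    fun x => ⟨piPlus_monUVC h x, piPlus_monCUV h x, piPlus_monVCU h x⟩, isOpen_stepDomain h,
    fun x hx => ⟨fun y => isDiscreteStep_iff hx y, contDiffAt_stepMap hx,
      fun φ ψ hφ hψ => quadBr_comp_stepMap hx hφ hψ⟩⟩, fun r hr => ?_⟩
  · have hf := conjCovariant_dLeft hφ hinv
    refine ⟨hf, fun c t => ?_⟩
    rw [hamField_monUVC hN hφ hinv, laxTriadsPlus_iff hf, laxTriadsMinus_iff hf]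
    exact ⟨Iff.rfl, Iff.rfl⟩
  · rw [← hierField_id]
    exact ⟨laxTriadsPlus_iff conjCovariant_id h c t, laxTriadsMinus_iff conjCovariant_id h c t⟩
  -- The scale is ρ = 4r, which makes the balls of radius ρ/4 and ρ/2 those of radius r and 2r; |h|ρ
  -- ≤ 1/72 then reads |h| ≤ 1/(288r).
  · refine ⟨1 / (288 * r), by positivity, fun h hh hr' => ?_⟩
    have hρ : 0 < 4 * r := by positivity
    have hs : |h| * (4 * r) ≤ 1 / 72 := by
      rw [lt_div_iff₀ (by positivity)] at hr'
      linarith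
    have e : 2 * r = 4 * r / 2 := by ring
    refine ⟨fun y hy => Wiener.logConverges_all (ρ := 4 * r) ⟨hρ, hs, e ▸ hy⟩, fun x hx => ?_⟩
    have hx' : ‖x‖ ≤ 4 * r / 4 := by linarith
    rw [e]
    exact ⟨Wiener.mem_stepDomain hs hx', Wiener.exists_isLogTrajectory hh hs hρ hx',
      fun c hc => Wiener.eq_stepMap_of_isLogTrajectory hh hs hρ hx' hc⟩
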